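/- **Setting.** Let $\Sigma$ be a totally ordered alphabet and let $S$ be a non-empty string over $\Sigma$, of length $n$, with run-length encoding $RLE_S=(a_1,e_1),\dots,(a_m,e_m)$ (so $a_j\in\Sigma$, $e_j\ge 1$, $a_j\ne a_{j+1}$ and $S=a_1^{e_1}\cdots a_m^{e_m}$). Let $\Sigma_{RLE}$ be the set of the distinct pairs $(a_j,e_j)$, and $\sigma_{RLE}=|\Sigma_{RLE}|$. Pairs $(a,e)$, also written $a^e$, are ordered lexicographically: $(a,e)<(a',e')$ iff $a<a'$, or $a=a'$ and $e<e'$. Let $P=S[i..i']$ be an occurrence of a non-empty palindrome. It is *RLE-bounded* if $i$ is the first position of a run of $S$ and $i'$ is the last position of a run of $S$; it is *maximal* if $i=1$, or $i'=n$, or $S[i-1]\neq S[i'+1]$; it is *run-centered* if its center $\frac{i+i'}2$ equals the center of some run of $S$. The *RLE-eertree* of $S$ is the following rooted tree with labeled edges. Its nodes are the empty string $\varepsilon$ (the root) and the distinct non-empty palindromes that have a run-centered occurrence in $S$ which is RLE-bounded or maximal. There is an edge with label $a^e$ from $\varepsilon$ to $v$ if $v=a^e$ is a single run, and from a node $u\ne\varepsilon$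 to a node $v$ if $RLE_v=(a,e)\,RLE_u\,(a,e)$. **Lemma.** Given $RLE_S$ of size $m$, the RLE-eertree of $S$ can be constructed in $O(m\log\sigma_{RLE})$ time and $O(m)$ space, where the out-going edges of each node are sorted according to the total order of their labels. Moreover, in the resulting tree each non-root node $u$ stores the number of occurrences of $u$ in $S$ which are RLE-bounded or maximal. Precisely: there are a program (which does not depend on $\Sigma$ or $S$) and a constant $C$ such that for all $\Sigma$ and $S$ as above, the program, started with $m$ and $RLE_S$ in the memory of a random access machine, halts after at most $C\,m\max(1,\log_2\sigma_{RLE})$ steps with this data structure in memory. It uses only memory cells with addresses below $Cm$ (and finitely many registers), and every number in a register or cell stays below $Cn$. A register or cell holds one such number or one letter of $\Sigma$. The operations, which cost one step each, are: loading a constant, copying, addition and (truncated) subtraction of numbers, loading from and storing to a memory cell whose address is in a register, and tests whether two registers are equal or in increasing order. In particular, letters are only copied and compared. The data structure is an array of node records, the root first, where the record of a node consists of its number of occurrences (with no requirement at the root), its number of out-going edges, and the address of the sorted array of these edges; each edge is stored as its letter, its exponent and the index of its target node. -/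

import Mathlib

universe u

namespace RLEString

section Strings

variable {α : Type u}

/-! ### Strings and run-length encodings

Strings are lists.  Positions are counted from `0`, and the occurrence of a string `P` that
starts at position `i` occupies the half-open interval `[i, i + |P|)`. -/

/-- The run-length encoding `(a₁, e₁), …, (aₘ, eₘ)` of a string. -/
def rle [DecidableEq α] : List α → List (α × ℕ)
  | [] => []
  | a :: S =>
    match rle S with
    | [] => [(a, 1)]
    | (b, e) :: R => if a = b then (b, e + 1) :: R else (a, 1) :: (b, e) :: R

/-- The set `Σ_RLE` of the distinct runs of `S`. -/
def rleAlphabet [DecidableEq α] (S : List α) : Finset (α × ℕ) :=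
  (rle S).toFinset

/-- The position at which run number `k` (counted from `0`) of `S` begins. -/
def runBegin [DecidableEq α] (S : List α) (k : ℕ) : ℕ :=
  (((rle S).take k).map Prod.snd).sum

/-- The position just after the end of run number `k` of `S`. -/
def runEnd [DecidableEq α] (S : List α) (k : ℕ) : ℕ :=
  (((rle S).take (k + 1)).map Prod.snd).sum

/-- `P` occurs in `S` at position `i`. -/
def OccursAt (S P : List α) (i : ℕ) : Prop :=
  P <+: S.drop i

/-- Both ends of the interval `[i, j)` touch boundaries of runs: it is the union of the runs
`k, k + 1, …, k'` for some `k ≤ k'`. -/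
def RLEBounded [DecidableEq α] (S : List α) (i j : ℕ) : Prop :=
  ∃ k k', k ≤ k' ∧ k' < (rle S).length ∧ i = runBegin S k ∧ j = runEnd S k'

/-- The interval `[i, j)` has the same center as one of the runs of `S`. -/
def RunCentered [DecidableEq α] (S : List α) (i j : ℕ) : Prop :=
  ∃ k, k < (rle S).length ∧ i + j = runBegin S k + runEnd S k

/-- A palindromic occurrence `[i, j)` is maximal: it touches an end of `S`, or the two letters
next to it differ. -/
def MaximalAt (S : List α) (i j : ℕ) : Prop :=
  i = 0 ∨ j = S.length ∨ S[i - 1]? ≠ S[j]?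

/-- The number of occurrences of `P` in `S` that are RLE-bounded or maximal. -/
noncomputable def occCount [DecidableEq α] (S P : List α) : ℕ :=
  {i : ℕ | OccursAt S P i ∧
    (RLEBounded S i (i + P.length) ∨ MaximalAt S i (i + P.length))}.ncard

/-! ### The RLE-eertree -/

/-- The strings represented by the nodes of the RLE-eertree of `S`: the empty string (the root),
and the nonempty palindromes with a run-centered occurrence in `S` that is RLE-bounded or
maximal. -/
def eertreeNodes [DecidableEq α] (S : List α) : Set (List α) :=
  {P | P = [] ∨ (P ≠ [] ∧ P.reverse = P ∧
    ∃ i, OccursAt S P i ∧ RunCentered S i (i + P.length) ∧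
      (RLEBounded S i (i + P.length) ∨ MaximalAt S i (i + P.length)))}

/-- The labeled edges `(u, a^e, v)` of the RLE-eertree of `S`.  From the root there is an edge
labeled `a^e` to the node `a^e`; from a node `u` that is not the root there is one to the node
`a^e u a^e`, where `u` and `v` are read as strings over the alphabet of runs. -/
def EertreeEdge [DecidableEq α] (S u : List α) (l : α × ℕ) (v : List α) : Prop :=
  u ∈ eertreeNodes S ∧ v ∈ eertreeNodes S ∧
    ((u = [] ∧ rle v = [l]) ∨ (u ≠ [] ∧ rle v = l :: (rle u ++ [l])))

/-- The total order of runs: `(a, e) < (a', e')` iff `a < a'`, or `a = a'` and `e < e'`. -/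
def RunLT [LinearOrder α] (x y : α × ℕ) : Prop :=
  x.1 < y.1 ∨ (x.1 = y.1 ∧ x.2 < y.2)

end Strings

/-! ### The machine model

A random access machine.  A word holds a natural number or a letter of the alphabet; letters can
be copied and compared, nothing else.  Every instruction and every test takes one step.  The
machine has `B` memory cells (with addresses `0, …, B - 1`), its numbers are smaller than `W`,
and it gets stuck if an instruction violates one of these limits.  A program names its finitely
many registers explicitly and does not depend on the alphabet. -/

/-- The contents of a register or of a memory cell. -/
inductive Word (α : Type u) : Type u
  | num (n : ℕ)
  | sym (a : α)

/-- The tests of the machine. -/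
inductive Test : Type
  | eq (x y : ℕ)
  | lt (x y : ℕ)

/-- Programs: instructions, composition, branching and loops. -/
inductive Prog : Type
  | const (r c : ℕ)
  | move (r x : ℕ)
  | add (r x y : ℕ)
  | sub (r x y : ℕ)
  | load (r x : ℕ)
  | store (x y : ℕ)
  | seq (p q : Prog)
  | ite (t : Test) (p q : Prog)
  | loop (t : Test) (p : Prog)

/-- A configuration: the contents of the registers and of the memory. -/
structure State (α : Type u) : Type u where
  reg : ℕ → Word α
  mem : ℕ → Word α

section Machine

variable {α : Type u}

/-- Overwrite register `r`. -/
def State.setReg (s : State α) (r : ℕ) (w : Word α) : State α :=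
  { s with reg := Function.update s.reg r w }

/-- Overwrite memory cell `a`. -/
def State.setMem (s : State α) (a : ℕ) (w : Word α) : State α :=
  { s with mem := Function.update s.mem a w }

/-- The order of words: numbers among numbers, letters among letters. -/
def Word.LT [LinearOrder α] : Word α → Word α → Prop
  | .num m, .num n => m < n
  | .sym a, .sym b => a < b
  | _, _ => False

/-- The outcome of a test, applied to the contents of two registers. -/
def Test.Holds [LinearOrder α] (s : State α) : Test → Prop
  | .eq x y => s.reg x = s.reg y
  | .lt x y => (s.reg x).LT (s.reg y)

/-- `Exec B W p s t s'`: on a machine with `B` memory cells and with numbers smaller than `W`,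
the program `p` started in `s` halts after exactly `t` steps in `s'`. -/
inductive Exec [LinearOrder α] (B W : ℕ) : Prog → State α → ℕ → State α → Prop
  | const {s : State α} {r c : ℕ} : c < W →
      Exec B W (.const r c) s 1 (s.setReg r (.num c))
  | move {s : State α} {r x : ℕ} :
      Exec B W (.move r x) s 1 (s.setReg r (s.reg x))
  | add {s : State α} {r x y a b : ℕ} : s.reg x = .num a → s.reg y = .num b → a + b < W →
      Exec B W (.add r x y) s 1 (s.setReg r (.num (a + b)))
  | sub {s : State α} {r x y a b : ℕ} : s.reg x = .num a → s.reg y = .num b →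
      Exec B W (.sub r x y) s 1 (s.setReg r (.num (a - b)))
  | load {s : State α} {r x a : ℕ} : s.reg x = .num a → a < B →
      Exec B W (.load r x) s 1 (s.setReg r (s.mem a))
  | store {s : State α} {x y a : ℕ} : s.reg x = .num a → a < B →
      Exec B W (.store x y) s 1 (s.setMem a (s.reg y))
  | seq {s s₁ s₂ : State α} {p q : Prog} {k l : ℕ} : Exec B W p s k s₁ → Exec B W q s₁ l s₂ →
      Exec B W (.seq p q) s (k + l) s₂
  | iteTrue {s s' : State α} {t : Test} {p q : Prog} {k : ℕ} : t.Holds s → Exec B W p s k s' →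
      Exec B W (.ite t p q) s (k + 1) s'
  | iteFalse {s s' : State α} {t : Test} {p q : Prog} {k : ℕ} : ¬ t.Holds s → Exec B W q s k s' →
      Exec B W (.ite t p q) s (k + 1) s'
  | loopDone {s : State α} {t : Test} {p : Prog} : ¬ t.Holds s →
      Exec B W (.loop t p) s 1 s
  | loopStep {s s₁ s₂ : State α} {t : Test} {p : Prog} {k l : ℕ} : t.Holds s →
      Exec B W p s k s₁ → Exec B W (.loop t p) s₁ l s₂ →
      Exec B W (.loop t p) s (k + l + 1) s₂

/-- The initial configuration for a sequence `R` of runs: register `0` holds the number of runs,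
the memory cells `2 k` and `2 k + 1` hold the letter and the exponent of run number `k`, and
everything else is `0`. -/
def initState (R : List (α × ℕ)) : State α where
  reg r := if r = 0 then .num R.length else .num 0
  mem a :=
    match R[a / 2]? with
    | none => .num 0
    | some (c, e) => if a % 2 = 0 then .sym c else .num e

/-- The array at address `a` of the memory consists of the listed edges; an edge with label
`(c, e)` to node number `j` takes three consecutive cells, which hold `c`, `e` and `j`. -/
def StoresEdges (s : State α) (a : ℕ) (E : List ((α × ℕ) × ℕ)) : Prop :=
  ∀ (k : ℕ) (c : α) (e j : ℕ), E[k]? = some ((c, e), j) →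
    s.mem (a + 3 * k) = .sym c ∧ s.mem (a + 3 * k + 1) = .num e ∧
      s.mem (a + 3 * k + 2) = .num j

/-- The first `B` memory cells of `s` contain the RLE-eertree of `S`.  Register `0` holds the
number `N` of nodes and register `1` the address of an array of `N` node records.  The record of
a node consists of three cells: the number of occurrences of the node in `S` that are RLE-bounded
or maximal (no requirement at the root, which is node number `0`), the address of the array of
its out-going edges, and the number of these edges.  The edges of each node are in increasing
order of their labels. -/
def StoresEertree [LinearOrder α] (B : ℕ) (S : List α) (s : State α) : Prop :=
  ∃ (N base : ℕ) (node : ℕ → List α),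
    s.reg 0 = .num N ∧ s.reg 1 = .num base ∧ base + 3 * N ≤ B ∧
    Set.BijOn node (Set.Iio N) (eertreeNodes S) ∧ node 0 = [] ∧
    ∀ i < N, ∃ (first : ℕ) (E : List ((α × ℕ) × ℕ)),
      (i ≠ 0 → s.mem (base + 3 * i) = .num (occCount S (node i))) ∧
      s.mem (base + 3 * i + 1) = .num first ∧
      s.mem (base + 3 * i + 2) = .num E.length ∧
      first + 3 * E.length ≤ B ∧
      StoresEdges s first E ∧
      E.Pairwise (fun x y => RunLT x.1 y.1) ∧
      ∀ (l : α × ℕ) (j : ℕ), (l, j) ∈ E ↔ j < N ∧ EertreeEdge S (node i) l (node j)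

end Machine

end RLEString

set_option linter.unusedSimpArgs false

namespace RLEString

/-! ### A small imperative language with arrays, compiled to the machine -/

/-! Combinatorics. Adjacent runs have different letters, so the run-length encoding of a nonempty
palindrome has odd length (`exists_mirror`). The palindrome is therefore determined by its arm: the
runs read outwards from the central run. An edge of the RLE-eertree appends one run to the arm, so
the tree is a trie of arms. Consider an occurrence with at least three runs. It is RLE-bounded or
maximal exactly if one of its ends is an end of a run (`HasRuns.bounded_or_maximal_iff`). Then its
inner runs are complete runs of `S`, its center is the center of a run, and its outermost run is the
common part of the two runs of `S` at its ends (`HasRuns.occurs_mirror_iff`).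

Replace each run by its rank among the distinct runs. This gives a word `X` of length `m` with
letters below `σ`. From a center `c` read outwards as long as both sides agree; at the first
mismatch append the common part of the two next runs, if these have the same letter. Ranks of runs
with the same letter grow with the exponent, so this common part has the smaller of the two ranks.
Call the result the path of `c` (`pathOf`). The nodes are exactly the prefixes of the `m` paths
(`Result.cen_iff`, `Result.bijOn`), and the number of occurrences of a node with an arm of length at
least two is the number of paths that begin with this arm. A single run `a ^ e` occurs in addition
at both ends of every longer run of `a` (`HasRuns.occCount_single`, `Result.occCount_nodeOf`).

Algorithm. The runs are ranked by a merge sort that discards duplicates when it meets them. No list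
is then longer than `σ`, and a potential argument gives time of order `m log σ` (`sortPot_add`,
`sortStep_spec`). The palindromes of `X` are found from left to right with suffix links. Each
position creates at most one node, and the walks along links are paid for by the number of
palindromic suffixes, which grows by at most one per position. A suffix that is left behind is a
maximal palindrome, and the maximal palindromes at the centers inside it are copied by reflection
(`chainLoop_spec`, `extend_spec`). Each center then adds at most one more node for its path
(`partialLoop_spec`), so there are at most `3 m + 1` nodes. Children are found in digital search
trees over the binary digits of the ranks, at a cost of order `log σ` for each of the linearly many
lookups (`Dst.lt_of_ne`, `lookup_spec`). Numbers of occurrences are summed from the leaves to the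
root (`Trie.count_eq`), and all edges are sorted at once by buckets (`childLoop_spec`).

Machine. The algorithm is written in a small language with numeric arrays whose semantics counts
machine steps exactly. Correctness and time are proved there by a rule for loops with a potential
(`tr_loop`, `mainCm_spec`), and `Run.exec` transfers both to the machine. Only the final replacement
of run numbers by letters is written in machine instructions (`relabel_exec`). -/

/-- Expressions: constants, variables, sums, differences, array entries, exponents of runs, and
the addresses of arrays. -/
inductive Ex : Type
  | c (n : ℕ)
  | v (r : ℕ)
  | add (a b : Ex)
  | sub (a b : Ex)
  | get (f : ℕ) (i : Ex)
  | ex (i : Ex)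
  | base (f : ℕ)

/-- Conditions: comparisons of numbers, and comparisons of the letters of two runs. -/
inductive Bx : Type
  | eq (a b : Ex)
  | lt (a b : Ex)
  | ne (a b : Ex)
  | leq (a b : Ex)
  | llt (a b : Ex)

/-- Commands. -/
inductive Cm : Type
  | set (r : ℕ) (e : Ex)
  | put (f : ℕ) (i e : Ex)
  | skip
  | seq (p q : Cm)
  | ite (b : Bx) (p q : Cm)
  | loop (b : Bx) (p : Cm)

infixr:60 " ;; " => Cm.seq
infixl:65 " +ₑ " => Ex.add
infixl:65 " -ₑ " => Ex.sub

/-- The values of the variables and the contents of the arrays. -/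
structure St where
  v : ℕ → ℕ
  A : ℕ → ℕ → ℕ

/-- Overwrite a variable. -/
def St.setV (s : St) (r n : ℕ) : St := { s with v := Function.update s.v r n }

/-- Overwrite an array entry. -/
def St.setA (s : St) (f i n : ℕ) : St :=
  { s with A := Function.update s.A f (Function.update (s.A f) i n) }

theorem St.setV_v (s : St) (r n r' : ℕ) :
    (s.setV r n).v r' = if r' = r then n else s.v r' := by
  simp [St.setV, Function.update_apply]

theorem St.setV_A (s : St) (r n : ℕ) : (s.setV r n).A = s.A := rfl

theorem St.setA_v (s : St) (f i n : ℕ) : (s.setA f i n).v = s.v := rfl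

theorem St.setA_A (s : St) (f i n f' : ℕ) :
    (s.setA f i n).A f' = if f' = f then Function.update (s.A f) i n else s.A f' := by
  simp [St.setA, Function.update_apply]

/-- The data that a computation depends on: the number of runs, the length of the arrays, the
bound on numbers, the letters and the exponents of the runs. -/
structure Env (α : Type u) where
  m : ℕ
  L : ℕ
  W : ℕ
  ltr : ℕ → α
  ex : ℕ → ℕ

/-! ### Semantics with exact running times, and rules for total correctness. -/

section Semantics

variable {α : Type u} (E : Env α)

/-- The input occupies the first `2 * E.m` cells and the arrays follow it one after another, which
explains the value of `base`. Letters are not values of this language; they enter only through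
conditions, addressed by the number of a run. -/
def Ex.eval (s : St) : Ex → ℕ
  | .c n => n
  | .v r => s.v r
  | .add a b => a.eval s + b.eval s
  | .sub a b => a.eval s - b.eval s
  | .get f i => s.A f (i.eval s)
  | .ex i => E.ex (i.eval s)
  | .base f => 2 * E.m + f * E.L

/-- These conditions keep the compiled code within the limits of the machine. Truncated subtraction
needs none, because it never produces a larger number. -/
def Ex.Safe (s : St) : Ex → Prop
  | .c n => n < E.W
  | .v _ => True
  | .add a b => a.Safe s ∧ b.Safe s ∧ a.eval E s + b.eval E s < E.W
  | .sub a b => a.Safe s ∧ b.Safe s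
  | .get f i => i.Safe s ∧ f < 32 ∧ i.eval E s < E.L
  | .ex i => i.Safe s ∧ i.eval E s < E.m
  | .base f => f < 32

/-- The exact number of steps of the compiled code. An array entry takes an addition of the base and
a load; an exponent takes a doubling, a constant, an addition and a load. -/
def Ex.cost : Ex → ℕ
  | .c _ => 1
  | .v _ => 1
  | .add a b => a.cost + b.cost + 1
  | .sub a b => a.cost + b.cost + 1
  | .get _ i => i.cost + 2
  | .ex i => i.cost + 4
  | .base _ => 1

def Bx.Safe (s : St) : Bx → Prop
  | .eq a b => a.Safe E s ∧ b.Safe E s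
  | .lt a b => a.Safe E s ∧ b.Safe E s
  | .ne a b => a.Safe E s ∧ b.Safe E s
  | .leq a b => a.Safe E s ∧ b.Safe E s ∧ a.eval E s < E.m ∧ b.eval E s < E.m
  | .llt a b => a.Safe E s ∧ b.Safe E s ∧ a.eval E s < E.m ∧ b.eval E s < E.m

def Bx.cost : Bx → ℕ
  | .eq a b => a.cost + b.cost
  | .lt a b => a.cost + b.cost
  | .ne a b => a.cost + b.cost + 3
  | .leq a b => a.cost + b.cost + 4
  | .llt a b => a.cost + b.cost + 4

variable [LinearOrder α]

def Bx.Holds (s : St) : Bx → Prop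
  | .eq a b => a.eval E s = b.eval E s
  | .lt a b => a.eval E s < b.eval E s
  | .ne a b => a.eval E s ≠ b.eval E s
  | .leq a b => E.ltr (a.eval E s) = E.ltr (b.eval E s)
  | .llt a b => E.ltr (a.eval E s) < E.ltr (b.eval E s)

/-- `Run E c s t s'`: the command `c` started in `s` halts after `t` steps in `s'`. -/
inductive Run : Cm → St → ℕ → St → Prop
  | set {s : St} {r : ℕ} {e : Ex} : e.Safe E s →
      Run (.set r e) s (e.cost + 1) (s.setV r (e.eval E s))
  | put {s : St} {f : ℕ} {i e : Ex} : i.Safe E s → e.Safe E s → f < 32 → i.eval E s < E.L →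
      Run (.put f i e) s (i.cost + e.cost + 2) (s.setA f (i.eval E s) (e.eval E s))
  | skip {s : St} : Run .skip s 1 s
  | seq {s s₁ s₂ : St} {p q : Cm} {k l : ℕ} : Run p s k s₁ → Run q s₁ l s₂ →
      Run (.seq p q) s (k + l) s₂
  | iteTrue {s s' : St} {b : Bx} {p q : Cm} {k : ℕ} : b.Safe E s → b.Holds E s → Run p s k s' →
      Run (.ite b p q) s (b.cost + (k + 1)) s'
  | iteFalse {s s' : St} {b : Bx} {p q : Cm} {k : ℕ} : b.Safe E s → ¬ b.Holds E s →
      Run q s k s' → Run (.ite b p q) s (b.cost + (k + 1)) s'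
  | loopDone {s : St} {b : Bx} {p : Cm} : b.Safe E s → ¬ b.Holds E s →
      Run (.loop b p) s (b.cost + 1) s
  | loopStep {s s₁ s₂ : St} {b : Bx} {p : Cm} {k l : ℕ} : b.Safe E s → b.Holds E s →
      Run p s k s₁ → Run (.loop b p) s₁ l s₂ → Run (.loop b p) s (b.cost + (k + l + 1)) s₂

/-- Total correctness: `c` halts, and the final state and the number of steps satisfy `Q`. -/
def Tr (c : Cm) (Q : St → ℕ → Prop) (s : St) : Prop := ∃ t s', Run E c s t s' ∧ Q s' t

variable {E}

theorem Tr.mono {c : Cm} {Q Q' : St → ℕ → Prop} {s : St} (h : Tr E c Q s)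
    (hQ : ∀ s' t, Q s' t → Q' s' t) : Tr E c Q' s := by
  obtain ⟨t, s', h1, h2⟩ := h
  exact ⟨t, s', h1, hQ _ _ h2⟩

/-- This rule and the following ones are equivalences, so that `simp only` executes straight-line
commands symbolically. The postcondition receives the time as an argument, and times add up on the
way. -/
theorem tr_set {r : ℕ} {e : Ex} {Q : St → ℕ → Prop} {s : St} :
    Tr E (.set r e) Q s ↔ e.Safe E s ∧ Q (s.setV r (e.eval E s)) (e.cost + 1) := by
  constructor
  · rintro ⟨t, s', h, hQ⟩
    cases h
    exact ⟨by assumption, hQ⟩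
  · rintro ⟨h, hQ⟩
    exact ⟨_, _, .set h, hQ⟩

theorem tr_put {f : ℕ} {i e : Ex} {Q : St → ℕ → Prop} {s : St} :
    Tr E (.put f i e) Q s ↔ (i.Safe E s ∧ e.Safe E s ∧ f < 32 ∧ i.eval E s < E.L) ∧
      Q (s.setA f (i.eval E s) (e.eval E s)) (i.cost + e.cost + 2) := by
  constructor
  · rintro ⟨t, s', h, hQ⟩
    cases h
    exact ⟨⟨by assumption, by assumption, by assumption, by assumption⟩, hQ⟩
  · rintro ⟨⟨h, h1, h2, h3⟩, hQ⟩
    exact ⟨_, _, .put h h1 h2 h3, hQ⟩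

theorem tr_skip {Q : St → ℕ → Prop} {s : St} : Tr E .skip Q s ↔ Q s 1 := by
  constructor
  · rintro ⟨t, s', h, hQ⟩
    cases h
    exact hQ
  · intro hQ
    exact ⟨_, _, .skip, hQ⟩

theorem tr_seq {p q : Cm} {Q : St → ℕ → Prop} {s : St} :
    Tr E (.seq p q) Q s ↔ Tr E p (fun s₁ k => Tr E q (fun s₂ l => Q s₂ (k + l)) s₁) s := by
  constructor
  · rintro ⟨t, s', h, hQ⟩
    cases h with
    | seq h1 h2 => exact ⟨_, _, h1, _, _, h2, hQ⟩
  · rintro ⟨k, s₁, h1, l, s₂, h2, hQ⟩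
    exact ⟨_, _, .seq h1 h2, hQ⟩

theorem tr_ite {b : Bx} {p q : Cm} {Q : St → ℕ → Prop} {s : St} :
    Tr E (.ite b p q) Q s ↔ b.Safe E s ∧
      (b.Holds E s → Tr E p (fun s' k => Q s' (b.cost + (k + 1))) s) ∧
      (¬ b.Holds E s → Tr E q (fun s' k => Q s' (b.cost + (k + 1))) s) := by
  constructor
  · rintro ⟨t, s', h, hQ⟩
    cases h with
    | iteTrue h1 h2 h3 => exact ⟨h1, fun _ => ⟨_, _, h3, hQ⟩, fun h => absurd h2 h⟩
    | iteFalse h1 h2 h3 => exact ⟨h1, fun h => absurd h h2, fun _ => ⟨_, _, h3, hQ⟩⟩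
  · rintro ⟨h, h1, h2⟩
    by_cases hb : b.Holds E s
    · obtain ⟨k, s', h3, hQ⟩ := h1 hb
      exact ⟨_, _, .iteTrue h hb h3, hQ⟩
    · obtain ⟨k, s', h3, hQ⟩ := h2 hb
      exact ⟨_, _, .iteFalse h hb h3, hQ⟩

/-- The rule for loops, with an invariant that carries a potential for the running time. -/
theorem tr_loop {b : Bx} {p : Cm} (I : ℕ → St → Prop)
    (h : ∀ n s, I n s → b.Safe E s ∧ (b.Holds E s →
      Tr E p (fun s' t => ∃ n', I n' s' ∧ t + b.cost + 1 + n' ≤ n) s))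
    {n : ℕ} {s : St} (hs : I n s) :
    Tr E (.loop b p) (fun s' t => ∃ n', I n' s' ∧ ¬ b.Holds E s' ∧ t + n' ≤ n + b.cost + 1) s := by
  -- The summand `1` for the test makes the potential strictly smaller in every round, so the
  -- potential also proves termination.
  induction n using Nat.strong_induction_on generalizing s with
  | _ n ih =>
    obtain ⟨h1, h2⟩ := h n s hs
    by_cases hb : b.Holds E s
    · obtain ⟨k, s₁, h3, n', h4, h5⟩ := h2 hb
      obtain ⟨l, s₂, h6, n'', h7, h8, h9⟩ := ih n' (by omega) h4
      exact ⟨_, _, .loopStep h1 hb h3 h6, n'', h7, h8, by omega⟩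
    · exact ⟨_, _, .loopDone h1 hb, n, hs, hb, by omega⟩

/-- The variables that a command may overwrite. -/
def Cm.wV : Cm → List ℕ
  | .set r _ => [r]
  | .put _ _ _ => []
  | .skip => []
  | .seq p q => p.wV ++ q.wV
  | .ite _ p q => p.wV ++ q.wV
  | .loop _ p => p.wV

/-- The arrays that a command may overwrite. -/
def Cm.wA : Cm → List ℕ
  | .set _ _ => []
  | .put f _ _ => [f]
  | .skip => []
  | .seq p q => p.wA ++ q.wA
  | .ite _ p q => p.wA ++ q.wA
  | .loop _ p => p.wA

/-- A command changes only what it names syntactically. This spares the specification of a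
subroutine a list of what stays unchanged. -/
theorem Run.frame {c : Cm} {s s' : St} {t : ℕ} (h : Run E c s t s') :
    (∀ r, r ∉ c.wV → s'.v r = s.v r) ∧ (∀ f, f ∉ c.wA → s'.A f = s.A f) := by
  induction h with
  | set _ => exact ⟨fun r hr => by simp_all [St.setV_v, Cm.wV], fun f _ => rfl⟩
  | put _ _ _ _ => exact ⟨fun r hr => rfl, fun f hf => by simp_all [St.setA_A, Cm.wA]⟩
  | skip => exact ⟨fun _ _ => rfl, fun _ _ => rfl⟩
  | seq _ _ h1 h2 =>
    simp only [Cm.wV, Cm.wA, List.mem_append, not_or]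
    exact ⟨fun r hr => by rw [h2.1 r hr.2, h1.1 r hr.1],
      fun r hr => by rw [h2.2 r hr.2, h1.2 r hr.1]⟩
  | iteTrue _ _ _ h1 =>
    simp only [Cm.wV, Cm.wA, List.mem_append, not_or]
    exact ⟨fun r hr => h1.1 r hr.1, fun r hr => h1.2 r hr.1⟩
  | iteFalse _ _ _ h1 =>
    simp only [Cm.wV, Cm.wA, List.mem_append, not_or]
    exact ⟨fun r hr => h1.1 r hr.2, fun r hr => h1.2 r hr.2⟩
  | loopDone _ _ => exact ⟨fun _ _ => rfl, fun _ _ => rfl⟩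
  | loopStep _ _ _ _ h1 h2 =>
    simp only [Cm.wV, Cm.wA] at h1 h2 ⊢
    exact ⟨fun r hr => by rw [h2.1 r hr, h1.1 r hr],
      fun r hr => by rw [h2.2 r hr, h1.2 r hr]⟩

theorem Tr.frame {c : Cm} {Q : St → ℕ → Prop} {s : St} (h : Tr E c Q s) :
    Tr E c (fun s' t => Q s' t ∧ (∀ r, r ∉ c.wV → s'.v r = s.v r) ∧
      (∀ f, f ∉ c.wA → s'.A f = s.A f)) s := by
  obtain ⟨t, s', h1, h2⟩ := h
  exact ⟨t, s', h1, h2, h1.frame⟩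

end Semantics

/-! ### Compilation

Variable `r` lives in register `3 r`, the address of array `f` in register `3 f + 1`, and the
registers `3 t + 2` hold intermediate results. -/

/-- The argument `t` is the height of an evaluation stack: the value is left in register `3 t + 2`,
and no intermediate register below it is touched. Hence a left operand survives the evaluation of
the right one. -/
def Ex.comp : Ex → ℕ → Prog
  | .c n, t => .const (3 * t + 2) n
  | .v r, t => .move (3 * t + 2) (3 * r)
  | .add a b, t => .seq (.seq (a.comp t) (b.comp (t + 1)))
      (.add (3 * t + 2) (3 * t + 2) (3 * (t + 1) + 2))
  | .sub a b, t => .seq (.seq (a.comp t) (b.comp (t + 1)))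
      (.sub (3 * t + 2) (3 * t + 2) (3 * (t + 1) + 2))
  | .get f i, t => .seq (i.comp t) (.seq (.add (3 * t + 2) (3 * t + 2) (3 * f + 1))
      (.load (3 * t + 2) (3 * t + 2)))
  | .ex i, t => .seq (i.comp t) (.seq (.add (3 * t + 2) (3 * t + 2) (3 * t + 2))
      (.seq (.const (3 * (t + 1) + 2) 1) (.seq (.add (3 * t + 2) (3 * t + 2) (3 * (t + 1) + 2))
      (.load (3 * t + 2) (3 * t + 2)))))
  | .base f, t => .move (3 * t + 2) (3 * f + 1)

/-- Load the letters of the runs whose numbers are in the first two intermediate registers. -/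
def loadLetters : Prog :=
  .seq (.seq (.add 2 2 2) (.load 2 2)) (.seq (.add 5 5 5) (.load 5 5))

/-- Turn equality of the first two intermediate registers into an inequality. -/
def flipEq : Prog :=
  .ite (.eq 2 5) (.seq (.const 2 0) (.const 5 0)) (.seq (.const 2 0) (.const 5 1))

/-- Afterwards registers `2` and `5` are such that a single machine test decides the condition. The
machine does not test inequality, so this is turned into `0 < 1` or `0 < 0`. -/
def Bx.prep : Bx → Prog
  | .eq a b => .seq (a.comp 0) (b.comp 1)
  | .lt a b => .seq (a.comp 0) (b.comp 1)
  | .ne a b => .seq (.seq (a.comp 0) (b.comp 1)) flipEq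
  | .leq a b => .seq (.seq (a.comp 0) (b.comp 1)) loadLetters
  | .llt a b => .seq (.seq (a.comp 0) (b.comp 1)) loadLetters

def Bx.test : Bx → Test
  | .eq _ _ => .eq 2 5
  | .lt _ _ => .lt 2 5
  | .ne _ _ => .lt 2 5
  | .leq _ _ => .eq 2 5
  | .llt _ _ => .lt 2 5

/-- A machine loop only tests two registers, so the condition is prepared before the loop and again
at the end of every round. Moving a register to itself serves as the empty instruction. -/
def Cm.comp : Cm → Prog
  | .set r e => .seq (e.comp 0) (.move (3 * r) 2)
  | .put f i e => .seq (.seq (i.comp 0) (e.comp 1)) (.seq (.add 2 2 (3 * f + 1)) (.store 2 5))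
  | .skip => .move 2 2
  | .seq p q => .seq p.comp q.comp
  | .ite b p q => .seq b.prep (.ite b.test p.comp q.comp)
  | .loop b p => .seq b.prep (.loop b.test (.seq p.comp b.prep))

section Compilation

variable {α : Type u}

/-- The configuration `σ` of the machine represents the state `s`. -/
structure Sim (E : Env α) (s : St) (σ : State α) : Prop where
  var : ∀ r, σ.reg (3 * r) = .num (s.v r)
  base : ∀ f < 32, σ.reg (3 * f + 1) = .num (2 * E.m + f * E.L)
  arr : ∀ f < 32, ∀ i < E.L, σ.mem (2 * E.m + f * E.L + i) = .num (s.A f i)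
  ltr : ∀ k < E.m, σ.mem (2 * k) = .sym (E.ltr k)
  ex : ∀ k < E.m, σ.mem (2 * k + 1) = .num (E.ex k)

/-- The machine is large enough. -/
structure Env.Fits (E : Env α) (B : ℕ) : Prop where
  mem : 2 * E.m + 32 * E.L ≤ B
  num : B ≤ E.W
  two : 2 ≤ E.W

theorem Env.Fits.addr_lt {E : Env α} {B : ℕ} (hE : E.Fits B) {f i : ℕ} (hf : f < 32)
    (hi : i < E.L) : 2 * E.m + f * E.L + i < B := by
  have h := hE.mem
  have : (f + 1) * E.L ≤ 32 * E.L := Nat.mul_le_mul_right _ (by omega)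
  have : (f + 1) * E.L = f * E.L + E.L := by ring
  omega

theorem Sim.congr {E : Env α} {s : St} {σ σ' : State α} (h : Sim E s σ)
    (hr : ∀ r, (∀ t, r ≠ 3 * t + 2) → σ'.reg r = σ.reg r) (hm : σ'.mem = σ.mem) : Sim E s σ' where
  var r := by rw [hr _ (fun t => by omega), h.var]
  base f hf := by rw [hr _ (fun t => by omega), h.base f hf]
  arr f hf i hi := by rw [hm, h.arr f hf i hi]
  ltr k hk := by rw [hm, h.ltr k hk]
  ex k hk := by rw [hm, h.ex k hk]

theorem State.setReg_reg (s : State α) (r : ℕ) (w : Word α) (r' : ℕ) :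
    (s.setReg r w).reg r' = if r' = r then w else s.reg r' := by
  simp [State.setReg, Function.update_apply]

theorem State.setReg_mem (s : State α) (r : ℕ) (w : Word α) : (s.setReg r w).mem = s.mem := rfl

theorem State.setMem_mem (s : State α) (a : ℕ) (w : Word α) (a' : ℕ) :
    (s.setMem a w).mem a' = if a' = a then w else s.mem a' := by
  simp [State.setMem, Function.update_apply]

theorem State.setMem_reg (s : State α) (a : ℕ) (w : Word α) : (s.setMem a w).reg = s.reg := rfl

theorem Sim.setTemp {E : Env α} {s : St} {σ : State α} (h : Sim E s σ) (t : ℕ) (w : Word α) :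
    Sim E s (σ.setReg (3 * t + 2) w) :=
  h.congr (fun r hr => by simp [State.setReg_reg, hr t]) rfl

theorem Sim.setV {E : Env α} {s : St} {σ : State α} (h : Sim E s σ) (r n : ℕ) :
    Sim E (s.setV r n) (σ.setReg (3 * r) (.num n)) where
  var r' := by
    by_cases hr : r' = r
    · simp [State.setReg_reg, St.setV_v, hr]
    · simp [State.setReg_reg, St.setV_v, hr, h.var]
  base f hf := by
    rw [State.setReg_reg, if_neg (by omega), h.base f hf]
  arr := h.arr
  ltr := h.ltr
  ex := h.ex

theorem Sim.setA {E : Env α} {s : St} {σ : State α} (h : Sim E s σ) {f i : ℕ} (n : ℕ)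
    (hf : f < 32) (hi : i < E.L) :
    Sim E (s.setA f i n) (σ.setMem (2 * E.m + f * E.L + i) (.num n)) where
  var := h.var
  base := h.base
  arr f' hf' i' hi' := by
    rw [State.setMem_mem, St.setA_A]
    by_cases hff : f' = f
    · subst hff
      by_cases hii : i' = i
      · simp [hii]
      · rw [if_neg (by omega), h.arr f' hf' i' hi']
        simp [hii]
    · have : 2 * E.m + f' * E.L + i' ≠ 2 * E.m + f * E.L + i := by
        intro heq
        rcases lt_or_gt_of_ne hff with hlt | hlt
        · have : (f' + 1) * E.L ≤ f * E.L := Nat.mul_le_mul_right _ hlt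
          have : (f' + 1) * E.L = f' * E.L + E.L := by ring
          omega
        · have : (f + 1) * E.L ≤ f' * E.L := Nat.mul_le_mul_right _ hlt
          have : (f + 1) * E.L = f * E.L + E.L := by ring
          omega
      rw [if_neg this, if_neg hff, h.arr f' hf' i' hi']
  ltr k hk := by
    rw [State.setMem_mem, if_neg (by omega), h.ltr k hk]
  ex k hk := by
    rw [State.setMem_mem, if_neg (by omega), h.ex k hk]

variable [LinearOrder α]

theorem Ex.comp_exec {E : Env α} {B : ℕ} (hE : E.Fits B) {s : St} (e : Ex) :
    ∀ {σ : State α} (t : ℕ), Sim E s σ → e.Safe E s →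
    ∃ σ', Exec B E.W (e.comp t) σ e.cost σ' ∧ σ'.reg (3 * t + 2) = .num (e.eval E s) ∧
      (∀ r, (∀ t' ≥ t, r ≠ 3 * t' + 2) → σ'.reg r = σ.reg r) ∧ σ'.mem = σ.mem := by
  have bin : ∀ (a b : Ex), (∀ {σ : State α} (t : ℕ), Sim E s σ → a.Safe E s →
      ∃ σ', Exec B E.W (a.comp t) σ a.cost σ' ∧ σ'.reg (3 * t + 2) = .num (a.eval E s) ∧
      (∀ r, (∀ t' ≥ t, r ≠ 3 * t' + 2) → σ'.reg r = σ.reg r) ∧ σ'.mem = σ.mem) →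
      (∀ {σ : State α} (t : ℕ), Sim E s σ → b.Safe E s →
      ∃ σ', Exec B E.W (b.comp t) σ b.cost σ' ∧ σ'.reg (3 * t + 2) = .num (b.eval E s) ∧
      (∀ r, (∀ t' ≥ t, r ≠ 3 * t' + 2) → σ'.reg r = σ.reg r) ∧ σ'.mem = σ.mem) →
      ∀ {σ : State α} (t : ℕ), Sim E s σ → a.Safe E s → b.Safe E s →
      ∃ σ', Exec B E.W (.seq (a.comp t) (b.comp (t + 1))) σ (a.cost + b.cost) σ' ∧
      σ'.reg (3 * t + 2) = .num (a.eval E s) ∧ σ'.reg (3 * (t + 1) + 2) = .num (b.eval E s) ∧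
      (∀ r, (∀ t' ≥ t, r ≠ 3 * t' + 2) → σ'.reg r = σ.reg r) ∧ σ'.mem = σ.mem := by
    intro a b iha ihb σ t hs ha hb
    obtain ⟨σ₁, h1, h2, h3, h4⟩ := iha t hs ha
    obtain ⟨σ₂, k1, k2, k3, k4⟩ := ihb (t + 1)
      (hs.congr (fun r hr => h3 r (fun t' _ => hr t')) h4) hb
    refine ⟨σ₂, .seq h1 k1, ?_, k2, ?_, by rw [k4, h4]⟩
    · rw [k3 _ (fun t' ht' => by omega), h2]
    · intro r hr
      rw [k3 r (fun t' ht' => hr t' (by omega)), h3 r hr]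
  induction e with
  | c n =>
    intro σ t hs h
    refine ⟨_, .const h, by simp [State.setReg_reg, Ex.eval], ?_, rfl⟩
    intro r hr
    simp [State.setReg_reg, hr t le_rfl]
  | v r =>
    intro σ t hs h
    refine ⟨_, .move, by simp [State.setReg_reg, Ex.eval, hs.var], ?_, rfl⟩
    intro r hr
    simp [State.setReg_reg, hr t le_rfl]
  | add a b iha ihb =>
    intro σ t hs h
    obtain ⟨ha, hb, hab⟩ := h
    obtain ⟨σ₁, h1, h2, h3, h4, h5⟩ := bin a b iha ihb t hs ha hb
    refine ⟨_, .seq h1 (.add h2 h3 hab), by simp [State.setReg_reg, Ex.eval], ?_, by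
      rw [State.setReg_mem, h5]⟩
    intro r hr
    simp [State.setReg_reg, hr t le_rfl, h4 r hr]
  | sub a b iha ihb =>
    intro σ t hs h
    obtain ⟨ha, hb⟩ := h
    obtain ⟨σ₁, h1, h2, h3, h4, h5⟩ := bin a b iha ihb t hs ha hb
    refine ⟨_, .seq h1 (.sub h2 h3), by simp [State.setReg_reg, Ex.eval], ?_, by
      rw [State.setReg_mem, h5]⟩
    intro r hr
    simp [State.setReg_reg, hr t le_rfl, h4 r hr]
  | get f i ih =>
    intro σ t hs h
    obtain ⟨hi, hf, hl⟩ := h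
    obtain ⟨σ₁, h1, h2, h3, h4⟩ := ih t hs hi
    have hlt := hE.addr_lt hf hl
    have hadd : Exec B E.W (.add (3 * t + 2) (3 * t + 2) (3 * f + 1)) σ₁ 1
        (σ₁.setReg (3 * t + 2) (.num (i.eval E s + (2 * E.m + f * E.L)))) :=
      .add h2 (by rw [h3 _ (fun t' _ => by omega), hs.base f hf])
        (by have := hE.num; omega)
    refine ⟨_, .seq h1 (.seq hadd (.load (a := i.eval E s + (2 * E.m + f * E.L))
      (by simp [State.setReg_reg]) (by omega))), ?_, ?_, ?_⟩
    · simp only [State.setReg_reg, if_true, State.setReg_mem, h4, Ex.eval]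
      rw [add_comm, hs.arr f hf _ hl]
    · intro r hr
      simp [State.setReg_reg, hr t le_rfl, h3 r hr]
    · simp [State.setReg_mem, h4]
  | ex i ih =>
    intro σ t hs h
    obtain ⟨hi, hl⟩ := h
    obtain ⟨σ₁, h1, h2, h3, h4⟩ := ih t hs hi
    have hm := hE.mem
    have hn := hE.num
    have e1 : Exec B E.W (.add (3 * t + 2) (3 * t + 2) (3 * t + 2)) σ₁ 1 _ :=
      .add h2 h2 (by omega)
    have e2 := Exec.const (B := B) (W := E.W)
      (s := σ₁.setReg (3 * t + 2) (.num (i.eval E s + i.eval E s)))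
      (r := 3 * (t + 1) + 2) (c := 1) (by omega)
    have hne : ¬ (3 * t + 2 = 3 * (t + 1) + 2) := by omega
    have e3 := Exec.add (B := B) (W := E.W)
      (s := (σ₁.setReg (3 * t + 2) (.num (i.eval E s + i.eval E s))).setReg
        (3 * (t + 1) + 2) (.num 1))
      (r := 3 * t + 2) (x := 3 * t + 2) (y := 3 * (t + 1) + 2) (a := i.eval E s + i.eval E s)
      (b := 1)
      (by simp only [State.setReg_reg, if_true, if_neg hne]) (by simp only [State.setReg_reg, if_true])
      (by omega)
    refine ⟨_, (Exec.seq h1 (.seq e1 (.seq e2 (.seq e3 (.load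
      (a := i.eval E s + i.eval E s + 1)
      (by simp only [State.setReg_reg, if_true]) (by omega)))))), ?_, ?_, ?_⟩
    · simp only [State.setReg_reg, if_true, State.setReg_mem, h4, Ex.eval]
      rw [← two_mul, hs.ex _ hl]
    · intro r hr
      simp [State.setReg_reg, hr t le_rfl, hr (t + 1) (by omega), h3 r hr]
    · simp [State.setReg_mem, h4]
  | base f =>
    intro σ t hs h
    refine ⟨_, .move, by simp [State.setReg_reg, Ex.eval, hs.base f h], ?_, rfl⟩
    intro r hr
    simp [State.setReg_reg, hr t le_rfl]

theorem Ex.comp_exec_two {E : Env α} {B : ℕ} (hE : E.Fits B) {s : St} (a b : Ex)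
    {σ : State α} (hs : Sim E s σ) (ha : a.Safe E s) (hb : b.Safe E s) :
    ∃ σ', Exec B E.W (.seq (a.comp 0) (b.comp 1)) σ (a.cost + b.cost) σ' ∧ Sim E s σ' ∧
      σ'.reg 2 = .num (a.eval E s) ∧ σ'.reg 5 = .num (b.eval E s) := by
  obtain ⟨σ₁, h1, h2, h3, h4⟩ := a.comp_exec hE 0 hs ha
  have hs1 := hs.congr (fun r hr => h3 r (fun t' _ => hr t')) h4
  obtain ⟨σ₂, k1, k2, k3, k4⟩ := b.comp_exec hE 1 hs1 hb
  refine ⟨σ₂, .seq h1 k1, hs1.congr (fun r hr => k3 r (fun t' _ => hr t')) k4, ?_, k2⟩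
  rw [k3 _ (fun t' ht' => by omega), h2]

theorem loadLetters_exec {E : Env α} {B : ℕ} (hE : E.Fits B) {s : St} {σ : State α}
    (hs : Sim E s σ) {i j : ℕ} (hi : i < E.m) (hj : j < E.m) (h2 : σ.reg 2 = .num i)
    (h5 : σ.reg 5 = .num j) :
    ∃ σ', Exec B E.W loadLetters σ 4 σ' ∧ Sim E s σ' ∧ σ'.reg 2 = .sym (E.ltr i) ∧
      σ'.reg 5 = .sym (E.ltr j) := by
  have hm := hE.mem
  have hn := hE.num
  have e1 : Exec B E.W (.add 2 2 2) σ 1 _ := .add h2 h2 (by omega)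
  have e2 := Exec.load (B := B) (W := E.W) (s := σ.setReg 2 (.num (i + i))) (r := 2) (x := 2)
    (a := i + i) (by simp [State.setReg_reg]) (by omega)
  have hs2 := (hs.setTemp 0 (.num (i + i))).setTemp 0 (σ.mem (i + i))
  have e3 := Exec.add (B := B) (W := E.W)
    (s := (σ.setReg 2 (.num (i + i))).setReg 2 (σ.mem (i + i))) (r := 5) (x := 5) (y := 5)
    (a := j) (b := j) (by simp [State.setReg_reg, h5]) (by simp [State.setReg_reg, h5]) (by omega)
  have e4 := Exec.load (B := B) (W := E.W)
    (s := ((σ.setReg 2 (.num (i + i))).setReg 2 (σ.mem (i + i))).setReg 5 (.num (j + j)))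
    (r := 5) (x := 5) (a := j + j) (by simp [State.setReg_reg]) (by omega)
  refine ⟨_, .seq (.seq e1 e2) (.seq e3 e4), (hs2.setTemp 1 _).setTemp 1 _, ?_, ?_⟩
  · simp [State.setReg_reg, ← two_mul, hs.ltr i hi]
  · simp [State.setReg_reg, State.setReg_mem, ← two_mul, hs.ltr j hj]

theorem flipEq_exec {E : Env α} {B : ℕ} (hE : E.Fits B) {s : St} {σ : State α}
    (hs : Sim E s σ) :
    ∃ σ', Exec B E.W flipEq σ 3 σ' ∧ Sim E s σ' ∧ ((Test.lt 2 5).Holds σ' ↔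
      σ.reg 2 ≠ σ.reg 5) := by
  have h2 := hE.two
  by_cases h : σ.reg 2 = σ.reg 5
  · refine ⟨_, .iteTrue h (.seq (.const (by omega)) (.const (by omega))),
      (hs.setTemp 0 _).setTemp 1 _, ?_⟩
    simp [h, Test.Holds, State.setReg_reg, Word.LT]
  · refine ⟨_, .iteFalse h (.seq (.const (by omega)) (.const (by omega))),
      (hs.setTemp 0 _).setTemp 1 _, ?_⟩
    simp [h, Test.Holds, State.setReg_reg, Word.LT]

theorem Bx.prep_exec {E : Env α} {B : ℕ} (hE : E.Fits B) {s : St} (b : Bx) {σ : State α}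
    (hs : Sim E s σ) (hb : b.Safe E s) :
    ∃ σ', Exec B E.W b.prep σ b.cost σ' ∧ Sim E s σ' ∧ (b.test.Holds σ' ↔ b.Holds E s) := by
  cases b with
  | eq a b =>
    obtain ⟨σ₁, h1, h2, h3, h4⟩ := Ex.comp_exec_two hE a b hs hb.1 hb.2
    exact ⟨σ₁, h1, h2, by simp [Bx.test, Test.Holds, Bx.Holds, h3, h4]⟩
  | lt a b =>
    obtain ⟨σ₁, h1, h2, h3, h4⟩ := Ex.comp_exec_two hE a b hs hb.1 hb.2
    exact ⟨σ₁, h1, h2, by simp [Bx.test, Test.Holds, Bx.Holds, h3, h4, Word.LT]⟩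
  | ne a b =>
    obtain ⟨σ₁, h1, h2, h3, h4⟩ := Ex.comp_exec_two hE a b hs hb.1 hb.2
    obtain ⟨σ₂, k1, k2, k3⟩ := flipEq_exec (s := s) hE h2
    exact ⟨σ₂, .seq h1 k1, k2, by rw [Bx.test, k3]; simp [Bx.Holds, h3, h4]⟩
  | leq a b =>
    obtain ⟨σ₁, h1, h2, h3, h4⟩ := Ex.comp_exec_two hE a b hs hb.1 hb.2.1
    obtain ⟨σ₂, k1, k2, k3, k4⟩ := loadLetters_exec hE h2 hb.2.2.1 hb.2.2.2 h3 h4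
    exact ⟨σ₂, .seq h1 k1, k2, by simp [Bx.test, Test.Holds, Bx.Holds, k3, k4]⟩
  | llt a b =>
    obtain ⟨σ₁, h1, h2, h3, h4⟩ := Ex.comp_exec_two hE a b hs hb.1 hb.2.1
    obtain ⟨σ₂, k1, k2, k3, k4⟩ := loadLetters_exec hE h2 hb.2.2.1 hb.2.2.2 h3 h4
    exact ⟨σ₂, .seq h1 k1, k2, by simp [Bx.test, Test.Holds, Bx.Holds, k3, k4, Word.LT]⟩

/-- Compilation is correct. -/
theorem Run.exec {E : Env α} {B : ℕ} (hE : E.Fits B) {c : Cm} {s s' : St} {t : ℕ}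
    (h : Run E c s t s') :
    ∀ {σ : State α}, Sim E s σ → ∃ σ', Exec B E.W c.comp σ t σ' ∧ Sim E s' σ' := by
  induction h with
  | @set s r e he =>
    intro σ hs
    obtain ⟨σ₁, h1, h2, h3, h4⟩ := e.comp_exec hE 0 hs he
    have hs1 := hs.congr (fun r hr => h3 r (fun t' _ => hr t')) h4
    refine ⟨_, .seq h1 .move, ?_⟩
    rw [show σ₁.reg 2 = _ from h2]
    exact hs1.setV _ _
  | @put s f i e hi he hf hl =>
    intro σ hs
    obtain ⟨σ₁, h1, h2, h3, h4⟩ := Ex.comp_exec_two hE i e hs hi he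
    have hlt := hE.addr_lt hf hl
    have e1 : Exec B E.W (.add 2 2 (3 * f + 1)) σ₁ 1 _ :=
      .add h3 (h2.base f hf) (by have := hE.num; omega)
    refine ⟨_, .seq h1 (.seq e1 (.store (a := i.eval E s + (2 * E.m + f * E.L))
      (by simp [State.setReg_reg]) (by omega))), ?_⟩
    have := (h2.setTemp 0 (.num (i.eval E s + (2 * E.m + f * E.L)))).setA (e.eval E s) hf hl
    simpa [State.setReg_reg, h4, add_comm] using this
  | skip =>
    intro σ hs
    exact ⟨_, .move, hs.setTemp 0 _⟩
  | seq _ _ ih1 ih2 =>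
    intro σ hs
    obtain ⟨σ₁, h1, h2⟩ := ih1 hs
    obtain ⟨σ₂, h3, h4⟩ := ih2 h2
    exact ⟨σ₂, .seq h1 h3, h4⟩
  | iteTrue hb hh _ ih =>
    intro σ hs
    obtain ⟨σ₁, h1, h2, h3⟩ := Bx.prep_exec hE _ hs hb
    obtain ⟨σ₂, h4, h5⟩ := ih h2
    exact ⟨σ₂, .seq h1 (.iteTrue (h3.2 hh) h4), h5⟩
  | iteFalse hb hh _ ih =>
    intro σ hs
    obtain ⟨σ₁, h1, h2, h3⟩ := Bx.prep_exec hE _ hs hb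
    obtain ⟨σ₂, h4, h5⟩ := ih h2
    exact ⟨σ₂, .seq h1 (.iteFalse (mt h3.1 hh) h4), h5⟩
  | loopDone hb hh =>
    intro σ hs
    obtain ⟨σ₁, h1, h2, h3⟩ := Bx.prep_exec hE _ hs hb
    exact ⟨σ₁, .seq h1 (.loopDone (mt h3.1 hh)), h2⟩
  | loopStep hb hh _ _ ih1 ih2 =>
    intro σ hs
    obtain ⟨σ₁, h1, h2, h3⟩ := Bx.prep_exec hE _ hs hb
    obtain ⟨σ₂, h4, h5⟩ := ih1 h2
    obtain ⟨σ₃, h6, h7⟩ := ih2 h5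
    -- The compiled rest of the loop starts with a new preparation of the condition. That part is
    -- split off and becomes the end of the present round.
    cases h6 with
    | seq h8 h9 =>
      refine ⟨σ₃, ?_, h7⟩
      have := Exec.seq h1 (.loopStep (h3.2 hh) (.seq h4 h8) h9)
      simp only [add_assoc] at this ⊢
      exact this

end Compilation

/-! ### The program -/

-- The variables hold: `ρqh`, `ρqt` the ends of the queue of lists; `ρnd` the number of dropped
-- runs; `ρσ`, `ρN` the numbers of ranks and nodes; `ρp`, `ρcur` the position in the text and the
-- current palindromic suffix; `ρk`, `ρcn` centers; `ρu`, `ρy`, `ρq` the parent, the label and the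
-- result of a lookup; `ρsa`, `ρz` the slot address and the remaining digits in a search; `ρe` the
-- number of edges written.
notation "ρm" => (0 : ℕ)
notation "ρqh" => (1 : ℕ)
notation "ρqt" => (2 : ℕ)
notation "ρa" => (3 : ℕ)
notation "ρb" => (4 : ℕ)
notation "ρtl" => (5 : ℕ)
notation "ρnd" => (6 : ℕ)
notation "ρi" => (7 : ℕ)
notation "ρr" => (8 : ℕ)
notation "ρσ" => (9 : ℕ)
notation "ρN" => (10 : ℕ)
notation "ρu" => (11 : ℕ)
notation "ρy" => (12 : ℕ)
notation "ρsa" => (13 : ℕ)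
notation "ρz" => (14 : ℕ)
notation "ρq" => (15 : ℕ)
notation "ρp" => (16 : ℕ)
notation "ρcur" => (17 : ℕ)
notation "ρk" => (18 : ℕ)
notation "ρcn" => (19 : ℕ)
notation "ρn0" => (20 : ℕ)
notation "ρw" => (21 : ℕ)
notation "ρt" => (22 : ℕ)
notation "ρacc" => (23 : ℕ)
notation "ρold" => (24 : ℕ)
notation "ρe" => (25 : ℕ)
notation "ρc0" => (26 : ℕ)
notation "ρx" => (27 : ℕ)

-- The arrays hold: `φrec`, `φed` the output; `φQ`, `φnx` the heads and successors of lists of runs;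
-- `φdr`, `φrd` the dropped runs and the runs they equal; `φrp` a run for each rank; `φX` the text
-- of ranks; `φH`, `φB` halves and parities; `φlab`, `φdep`, `φlink`, `φpar` labels, depths, suffix
-- links and parents; `φsl` the slots of the search trees; `φM` the maximal palindrome at each
-- center; `φcnt` counts; `φhb`, `φnb` buckets of nodes by label; `φhc`, `φnc` lists of children.
notation "φrec" => (0 : ℕ)
notation "φed" => (1 : ℕ)
notation "φQ" => (2 : ℕ)
notation "φnx" => (3 : ℕ)
notation "φdr" => (4 : ℕ)
notation "φrd" => (5 : ℕ)
notation "φrp" => (6 : ℕ)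
notation "φX" => (7 : ℕ)
notation "φH" => (8 : ℕ)
notation "φB" => (9 : ℕ)
notation "φlab" => (10 : ℕ)
notation "φdep" => (11 : ℕ)
notation "φlink" => (12 : ℕ)
notation "φpar" => (13 : ℕ)
notation "φsl" => (14 : ℕ)
notation "φM" => (15 : ℕ)
notation "φcnt" => (16 : ℕ)
notation "φhb" => (17 : ℕ)
notation "φnb" => (18 : ℕ)
notation "φhc" => (19 : ℕ)
notation "φnc" => (20 : ℕ)

open Ex Bx Cm

/-- One list for each run, and the tables of halves and parities. -/
def initLoop : Cm :=
  set ρi (c 0) ;;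
  loop (lt (v ρi) (v ρm))
    (put φQ (v ρi) (v ρi) ;;
     put φnx (v ρi) (v ρm) ;;
     put φB (v ρi +ₑ c 1) (c 1 -ₑ get φB (v ρi)) ;;
     put φH (v ρi +ₑ c 1) (get φH (v ρi) +ₑ get φB (v ρi)) ;;
     set ρi (v ρi +ₑ c 1))

def takeA : Cm :=
  put φnx (v ρtl) (v ρa) ;; set ρtl (v ρa) ;; set ρa (get φnx (v ρa))

def takeB : Cm :=
  put φnx (v ρtl) (v ρb) ;; set ρtl (v ρb) ;; set ρb (get φnx (v ρb))

/-- The equal run `a` remains in its list but may be dropped by a later merge. Therefore the order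
of the drops is recorded too. -/
def dropB : Cm :=
  put φrd (v ρb) (v ρa) ;; put φdr (v ρnd) (v ρb) ;; set ρnd (v ρnd +ₑ c 1) ;;
  set ρb (get φnx (v ρb))

def mergeStep : Cm :=
  ite (llt (v ρa) (v ρb)) takeA
    (ite (llt (v ρb) (v ρa)) takeB
      (ite (lt (ex (v ρa)) (ex (v ρb))) takeA
        (ite (lt (ex (v ρb)) (ex (v ρa))) takeB dropB)))

/-- Merge two sorted lists of runs; a run that is equal to another one is dropped. -/
def mergeLoop : Cm :=
  -- With truncated subtraction `a + (b - a)` is the maximum of `a` and `b`. The end mark `m`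
  -- exceeds all runs, so the loop goes on while neither list has ended.
  loop (lt (v ρa +ₑ (v ρb -ₑ v ρa)) (v ρm)) mergeStep

/-- The two oldest lists are merged behind the auxiliary head `m + 1`, and the result joins the end
of the queue. After the merge one of the two heads is the end mark `m`, so the minimum `a - (a - b)`
is the head of what remains. -/
def sortStep : Cm :=
  set ρa (get φQ (v ρqh)) ;;
  set ρb (get φQ (v ρqh +ₑ c 1)) ;;
  set ρqh (v ρqh +ₑ c 2) ;;
  set ρtl (v ρm +ₑ c 1) ;;
  mergeLoop ;;
  put φnx (v ρtl) (v ρa -ₑ (v ρa -ₑ v ρb)) ;;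
  put φQ (v ρqt) (get φnx (v ρm +ₑ c 1)) ;;
  set ρqt (v ρqt +ₑ c 1)

def sortLoop : Cm :=
  set ρqh (c 0) ;; set ρqt (v ρm) ;; set ρnd (c 0) ;;
  loop (lt (v ρqh +ₑ c 1) (v ρqt)) sortStep

/-- Number the distinct runs, and create a node for each of them. -/
def rankLoop : Cm :=
  set ρa (get φQ (v ρqh)) ;;
  set ρr (c 0) ;;
  loop (lt (v ρa) (v ρm))
    (put φrp (v ρr) (v ρa) ;;
     put φX (v ρa +ₑ c 1) (v ρr) ;;
     put φlab (v ρr +ₑ c 1) (v ρr) ;;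
     put φdep (v ρr +ₑ c 1) (c 1) ;;
     set ρr (v ρr +ₑ c 1) ;;
     set ρa (get φnx (v ρa))) ;;
  set ρσ (v ρr) ;;
  set ρN (v ρr +ₑ c 1)

/-- Dropped runs receive their ranks in the reverse order of the drops: the run to which a dropped
one was found equal then has its rank already. The marks at both ends of the text differ from each
other and from all ranks. -/
def dropLoop : Cm :=
  loop (lt (c 0) (v ρnd))
    (set ρnd (v ρnd -ₑ c 1) ;;
     set ρb (get φdr (v ρnd)) ;;
     put φX (v ρb +ₑ c 1) (get φX (get φrd (v ρb) +ₑ c 1))) ;;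
  put φX (c 0) (v ρm) ;;
  put φX (v ρm +ₑ c 1) (v ρm +ₑ c 1)

/-- An empty slot contains `0`, so writing the wanted label to node `0` lets one comparison detect
both success and failure. The tables of halves and parities replace the division that the machine
does not have. -/
def searchLoop : Cm :=
  put φlab (c 0) (v ρy) ;;
  set ρsa (v ρu +ₑ v ρu +ₑ v ρu) ;;
  set ρz (v ρy) ;;
  set ρq (get φsl (v ρsa)) ;;
  loop (ne (get φlab (v ρq)) (v ρy))
    (set ρsa (v ρq +ₑ v ρq +ₑ v ρq +ₑ c 1 +ₑ get φB (v ρz)) ;;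
     set ρz (get φH (v ρz)) ;;
     set ρq (get φsl (v ρsa)))

def newNode : Cm :=
  set ρq (v ρN) ;;
  set ρN (v ρN +ₑ c 1) ;;
  put φsl (v ρsa) (v ρq) ;;
  put φpar (v ρq) (v ρu) ;;
  put φlab (v ρq) (v ρy) ;;
  put φdep (v ρq) (get φdep (v ρu) +ₑ c 1)

/-- Find or create the child of the node `u` with label `y`. -/
def lookup : Cm :=
  searchLoop ;; ite (eq (v ρq) (c 0)) newNode skip

def copyLoop : Cm :=
  loop (lt (v ρk) (v ρp -ₑ get φdep (v ρcur)))
    (put φM (v ρk) (get φM (v ρcn +ₑ v ρcn -ₑ v ρk)) ;; set ρk (v ρk +ₑ c 1))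

/-- Follow the suffix links of `cur` to a palindrome that extends to position `p`. -/
def chainLoop : Cm :=
  loop (ne (get φX (v ρp -ₑ (get φdep (v ρcur) +ₑ get φdep (v ρcur)))) (get φX (v ρp)))
    (set ρk (v ρp -ₑ get φdep (v ρcur)) ;;
     put φM (v ρk) (v ρcur) ;;
     set ρcn (v ρk) ;;
     set ρcur (get φlink (v ρcur)) ;;
     set ρk (v ρk +ₑ c 1) ;;
     copyLoop)

def linkLoop : Cm :=
  loop (ne (get φX (v ρp -ₑ (get φdep (v ρw) +ₑ get φdep (v ρw)))) (get φX (v ρp)))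
    (set ρw (get φlink (v ρw)))

/-- Compute the suffix link of a new node. -/
def setLink : Cm :=
  set ρw (get φlink (v ρcur)) ;;
  set ρt (v ρq) ;;
  linkLoop ;;
  ite (eq (v ρw) (c 0))
    (set ρq (v ρy +ₑ c 1))
    (set ρu (v ρw) ;; lookup) ;;
  put φlink (v ρt) (v ρq) ;;
  set ρq (v ρt)

/-- The children of the root are the nodes `y + 1` made together with the ranks, so the root needs
no search. A node that `lookup` returns is new exactly if its number is the old number of nodes, and
only then a suffix link is computed. -/
def extend : Cm :=
  set ρy (get φX (v ρp)) ;;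
  ite (eq (v ρcur) (c 0))
    (set ρcur (v ρy +ₑ c 1))
    (set ρu (v ρcur) ;; set ρn0 (v ρN) ;; lookup ;;
     ite (eq (v ρq) (v ρn0)) setLink skip ;;
     set ρcur (v ρq))

/-- The last call of `chainLoop` treats the right mark, which no palindrome reaches. It leads `cur`
down to the root and so settles the remaining centers. -/
def eertreeLoop : Cm :=
  set ρp (c 1) ;; set ρcur (c 0) ;;
  loop (lt (v ρp) (v ρm +ₑ c 1)) (chainLoop ;; extend ;; set ρp (v ρp +ₑ c 1)) ;;
  chainLoop

/-- Find or create the node for everything that is read off outwards from the center `k`. -/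
def partialNode : Cm :=
  set ρu (get φM (v ρk)) ;; set ρq (v ρu) ;; set ρw (get φdep (v ρu)) ;;
  ite (lt (v ρw) (v ρk))
    (ite (lt (v ρk +ₑ v ρw) (v ρm +ₑ c 1))
      (ite (leq (v ρk -ₑ v ρw -ₑ c 1) (v ρk +ₑ v ρw -ₑ c 1))
        -- The truncated difference yields the minimum of the two ranks, that is, the rank of the
        -- shorter of two runs with the same letter. Ranks are stored from position `1` on but runs
        -- are numbered from `0`, hence the shift in the comparison of letters.
        (set ρy (get φX (v ρk -ₑ v ρw) -ₑ
           (get φX (v ρk -ₑ v ρw) -ₑ get φX (v ρk +ₑ v ρw))) ;;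
         lookup)
        skip) skip) skip

def partialLoop : Cm :=
  set ρk (c 1) ;;
  loop (lt (v ρk) (v ρm +ₑ c 1))
    (partialNode ;;
     put φcnt (v ρq) (get φcnt (v ρq) +ₑ c 1) ;;
     set ρk (v ρk +ₑ c 1))

/-- Add up the numbers of occurrences, and sort the nodes by the labels of their edges. -/
def sumLoop : Cm :=
  set ρi (v ρN -ₑ c 1) ;;
  loop (lt (c 0) (v ρi))
    (set ρx (get φpar (v ρi)) ;;
     put φcnt (v ρx) (get φcnt (v ρx) +ₑ get φcnt (v ρi)) ;;
     put φnb (v ρi) (get φhb (get φlab (v ρi))) ;;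
     put φhb (get φlab (v ρi)) (v ρi) ;;
     set ρi (v ρi -ₑ c 1))

/-- Correct the numbers of occurrences of single runs. -/
def singleLoop : Cm :=
  set ρr (v ρσ) ;; set ρacc (c 0) ;; set ρold (c 0) ;;
  loop (lt (c 0) (v ρr))
    (set ρr (v ρr -ₑ c 1) ;;
     -- `acc` is the sum of the counts of the larger ranks with the same letter. `old` keeps the
     -- uncorrected count of rank `r + 1`, which has just been overwritten.
     ite (lt (v ρr +ₑ c 1) (v ρσ))
       (ite (leq (get φrp (v ρr)) (get φrp (v ρr +ₑ c 1)))
         (set ρacc (v ρacc +ₑ v ρold)) (set ρacc (c 0)))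
       skip ;;
     set ρold (get φcnt (v ρr +ₑ c 1)) ;;
     put φcnt (v ρr +ₑ c 1) (v ρold +ₑ v ρacc +ₑ v ρacc))

/-- Sort the children of each node. -/
def childLoop : Cm :=
  set ρr (v ρσ) ;;
  loop (lt (c 0) (v ρr))
    (set ρr (v ρr -ₑ c 1) ;;
     set ρx (get φhb (v ρr)) ;;
     loop (lt (c 0) (v ρx))
       (put φnc (v ρx) (get φhc (get φpar (v ρx))) ;;
        put φhc (get φpar (v ρx)) (v ρx) ;;
        set ρx (get φnb (v ρx))))

/-- Write the tree, with numbers of runs in place of letters. -/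
def outLoop : Cm :=
  set ρe (c 0) ;; set ρi (c 0) ;;
  loop (lt (v ρi) (v ρN))
    (put φrec (v ρi +ₑ v ρi +ₑ v ρi) (get φcnt (v ρi)) ;;
     put φrec (v ρi +ₑ v ρi +ₑ v ρi +ₑ c 1) (base φed +ₑ (v ρe +ₑ v ρe +ₑ v ρe)) ;;
     set ρc0 (v ρe) ;;
     set ρx (get φhc (v ρi)) ;;
     loop (lt (c 0) (v ρx))
       (put φed (v ρe +ₑ v ρe +ₑ v ρe) (get φrp (get φlab (v ρx))) ;;
        put φed (v ρe +ₑ v ρe +ₑ v ρe +ₑ c 1) (ex (get φrp (get φlab (v ρx)))) ;;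
        put φed (v ρe +ₑ v ρe +ₑ v ρe +ₑ c 2) (v ρx) ;;
        set ρe (v ρe +ₑ c 1) ;;
        set ρx (get φnc (v ρx))) ;;
     put φrec (v ρi +ₑ v ρi +ₑ v ρi +ₑ c 2) (v ρe -ₑ v ρc0) ;;
     set ρi (v ρi +ₑ c 1)) ;;
  set ρm (v ρN)

/-- Replace the runs by their ranks. -/
def rankRuns : Cm :=
  initLoop ;; sortLoop ;; rankLoop ;; dropLoop

def mainCm : Cm :=
  rankRuns ;; eertreeLoop ;; partialLoop ;; sumLoop ;; singleLoop ;; childLoop ;; outLoop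

/-! ### Tries whose edges are kept in digital search trees -/

/-- A trie with nodes `0, …, N - 1`; the string of the node `v` is `arm v`, and the nodes
`1, …, σ` are the children of the root. -/
structure Trie (σ N : ℕ) (lab dep par : ℕ → ℕ) (arm : ℕ → List ℕ) : Prop where
  lt : σ < N
  root : arm 0 = []
  par_lt : ∀ v, 1 ≤ v → v < N → par v < v
  lab_lt : ∀ v, 1 ≤ v → v < N → lab v < σ
  arm_eq : ∀ v, 1 ≤ v → v < N → arm v = arm (par v) ++ [lab v]
  dep_eq : ∀ v < N, dep v = (arm v).length
  inj : ∀ v < N, ∀ w < N, arm v = arm w → v = w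
  single : ∀ r < σ, arm (r + 1) = [r]

namespace Trie

variable {σ N : ℕ} {lab dep par : ℕ → ℕ} {arm : ℕ → List ℕ}

theorem arm_ne_nil (h : Trie σ N lab dep par arm) {v : ℕ} (h1 : 1 ≤ v) (h2 : v < N) :
    arm v ≠ [] := by
  rw [h.arm_eq v h1 h2]
  simp

theorem child_iff (h : Trie σ N lab dep par arm) {u v y : ℕ} (hu : u < N) (h1 : 1 ≤ v)
    (h2 : v < N) : arm v = arm u ++ [y] ↔ par v = u ∧ lab v = y := by
  rw [h.arm_eq v h1 h2]
  constructor
  · intro he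
    have := List.append_inj' he rfl
    exact ⟨h.inj _ ((h.par_lt v h1 h2).trans h2) _ hu this.1, by simpa using this.2⟩
  · rintro ⟨rfl, rfl⟩
    rfl

theorem one_le_of_arm (h : Trie σ N lab dep par arm) {u v y : ℕ}
    (he : arm v = arm u ++ [y]) : 1 ≤ v := by
  rcases Nat.eq_zero_or_pos v with rfl | hv
  · rw [h.root] at he
    simp at he
  · exact hv

theorem gt_of_par (h : Trie σ N lab dep par arm) {v : ℕ} (h1 : 1 ≤ v) (h2 : v < N)
    (hp : 1 ≤ par v) : σ < v := by
  by_contra! hv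
  have e1 := h.arm_eq v h1 h2
  have e2 := h.single (v - 1) (by omega)
  rw [Nat.sub_add_cancel h1, e1] at e2
  have : arm (par v) = [] := by
    have := congrArg List.length e2
    simp at this
    exact this
  exact h.arm_ne_nil hp ((h.par_lt v h1 h2).trans h2) this

theorem dep_pos (h : Trie σ N lab dep par arm) {v : ℕ} (h1 : 1 ≤ v) (h2 : v < N) :
    1 ≤ dep v := by
  rw [h.dep_eq v h2]
  exact List.length_pos_iff.2 (h.arm_ne_nil h1 h2)

theorem length_arm_le (h : Trie σ N lab dep par arm) (v : ℕ) (hv : v < N) :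
    (arm v).length ≤ v := by
  induction v using Nat.strong_induction_on with
  | _ v ih =>
    rcases Nat.eq_zero_or_pos v with rfl | h1
    · simp [h.root]
    · have := h.par_lt v h1 hv
      have := ih _ this (by omega)
      rw [h.arm_eq v h1 hv]
      simp
      omega

theorem dep_le (h : Trie σ N lab dep par arm) {v : ℕ} (hv : v < N) : dep v ≤ v := by
  rw [h.dep_eq v hv]
  exact h.length_arm_le v hv

/-- The arrays after the insertion are arbitrary functions with the right values. The label of node
`0` is left free, because searches overwrite it. -/
theorem insert (h : Trie σ N lab dep par arm) {u y : ℕ} (hu : u < N) (hy : y < σ)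
    (hnew : ∀ v < N, arm v ≠ arm u ++ [y]) {lab' dep' par' : ℕ → ℕ}
    (hl : ∀ v, 1 ≤ v → v < N → lab' v = lab v) (hlN : lab' N = y)
    (hd : ∀ v, v < N → dep' v = dep v) (hdN : dep' N = dep u + 1)
    (hp : ∀ v, v < N → par' v = par v) (hpN : par' N = u) :
    Trie σ (N + 1) lab' dep' par' (Function.update arm N (arm u ++ [y])) := by
  have hN := h.lt
  have hold : ∀ v < N, Function.update arm N (arm u ++ [y]) v = arm v := fun v hv =>
    Function.update_of_ne hv.ne _ _
  have cas : ∀ v, v < N + 1 → v < N ∨ v = N := fun v hv => by omega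
  refine ⟨by omega, by rw [hold 0 (by omega), h.root], ?_, ?_, ?_, ?_, ?_, ?_⟩
  · intro v h1 h2
    rcases cas v h2 with hv | rfl
    · rw [hp v hv]
      exact h.par_lt v h1 hv
    · omega
  · intro v h1 h2
    rcases cas v h2 with hv | rfl
    · rw [hl v h1 hv]
      exact h.lab_lt v h1 hv
    · omega
  · intro v h1 h2
    rcases cas v h2 with hv | rfl
    · have := h.par_lt v h1 hv
      rw [hl v h1 hv, hp v hv, hold v hv, hold _ (by omega), h.arm_eq v h1 hv]
    · rw [hlN, hpN, hold u hu]
      simp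
  · intro v h2
    rcases cas v h2 with hv | rfl
    · rw [hd v hv, hold v hv, h.dep_eq v hv]
    · rw [hdN]
      simp [h.dep_eq u hu]
  · intro v h2 w h3 he
    rcases cas v h2 with hv | rfl <;> rcases cas w h3 with hw | rfl
    · rw [hold v hv, hold w hw] at he
      exact h.inj v hv w hw he
    · rw [hold v hv, Function.update_self] at he
      exact absurd he (hnew v hv)
    · rw [hold w hw, Function.update_self] at he
      exact absurd he.symm (hnew w hw)
    · rfl
  · intro r hr
    rw [hold _ (by omega), h.single r hr]

end Trie

/-- The slots that a search for the child of `u` with label `x` visits. -/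
def slot (sl : ℕ → ℕ) (u x : ℕ) : ℕ → ℕ
  | 0 => 3 * u
  | i + 1 => 3 * sl (slot sl u x i) + 1 + x / 2 ^ i % 2

/-- The digital search trees of the children of the nodes of a trie; `δ v` is the depth at which
the node `v` is stored. -/
structure Dst (σ N : ℕ) (lab par sl δ : ℕ → ℕ) : Prop where
  mem : ∀ v, σ < v → v < N → sl (slot sl (par v) (lab v) (δ v)) = v ∧
    ∀ j ≤ δ v, sl (slot sl (par v) (lab v) j) ≠ 0
  top : ∀ w < N, sl (3 * w) ≠ 0 → σ < sl (3 * w) ∧ sl (3 * w) < N ∧ par (sl (3 * w)) = w ∧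
    δ (sl (3 * w)) = 0
  down : ∀ w, 1 ≤ w → w < N → ∀ b < 2, sl (3 * w + 1 + b) ≠ 0 → σ < sl (3 * w + 1 + b) ∧
    sl (3 * w + 1 + b) < N ∧ par (sl (3 * w + 1 + b)) = par w ∧ δ (sl (3 * w + 1 + b)) = δ w + 1 ∧
    lab (sl (3 * w + 1 + b)) % 2 ^ δ w = lab w % 2 ^ δ w ∧
    lab (sl (3 * w + 1 + b)) / 2 ^ δ w % 2 = b
  zero : ∀ a, 3 * N ≤ a → sl a = 0

namespace Dst

variable {σ N : ℕ} {lab par sl δ : ℕ → ℕ}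

/-- Each branching compares one more binary digit, so by induction along the search path the node
met at depth `i` shares the `i` lowest digits with the wanted label. -/
theorem valid (h : Dst σ N lab par sl δ) {u x : ℕ} (hu : u < N) (i : ℕ)
    (hi : ∀ j ≤ i, sl (slot sl u x j) ≠ 0) :
    σ < sl (slot sl u x i) ∧ sl (slot sl u x i) < N ∧ par (sl (slot sl u x i)) = u ∧
      δ (sl (slot sl u x i)) = i ∧ lab (sl (slot sl u x i)) % 2 ^ i = x % 2 ^ i := by
  induction i with
  | zero =>
    obtain ⟨h1, h2, h3, h4⟩ := h.top u hu (hi 0 le_rfl)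
    exact ⟨h1, h2, h3, h4, by simp [Nat.mod_one]⟩
  | succ i ih =>
    obtain ⟨k1, k2, k3, k4, k5⟩ := ih (fun j hj => hi j (by omega))
    obtain ⟨h1, h2, h3, h4, h5, h6⟩ := h.down _ (by omega) k2 (x / 2 ^ i % 2) (Nat.mod_lt _ (by norm_num))
      (hi (i + 1) le_rfl)
    rw [k4] at h5 h6 h4
    refine ⟨h1, h2, h3.trans k3, h4, ?_⟩
    rw [slot, Nat.mod_pow_succ, h5, h6, k5, ← Nat.mod_pow_succ]

theorem slot_lt (h : Dst σ N lab par sl δ) {u x : ℕ} (hu : u < N) (i : ℕ)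
    (hi : ∀ j < i, sl (slot sl u x j) ≠ 0) : slot sl u x i < 3 * N := by
  cases i with
  | zero => simp only [slot]; omega
  | succ i =>
    have := (h.valid hu i (fun j hj => hi j (by omega))).2.1
    have := Nat.mod_lt (x / 2 ^ i) (show 0 < 2 by norm_num)
    simp only [slot]
    omega

/-- Every node below the first `σ + 1` is stored on the search path of its own label. An empty slot
that is reached before the label was met thus shows that there is no such child. -/
theorem not_found (h : Dst σ N lab par sl δ) {u y i : ℕ}
    (hi : ∀ j < i, sl (slot sl u y j) ≠ 0 ∧ lab (sl (slot sl u y j)) ≠ y)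
    (h0 : sl (slot sl u y i) = 0) {v : ℕ} (h1 : σ < v) (h2 : v < N) (hp : par v = u)
    (hl : lab v = y) : False := by
  obtain ⟨k1, k2⟩ := h.mem v h1 h2
  rw [hp, hl] at k1 k2
  rcases lt_or_ge (δ v) i with hd | hd
  · exact (hi _ hd).2 (by rw [k1, hl])
  · exact k2 i hd h0

/-- Labels below `2 ^ l` that share their `l` lowest digits are equal, so a search that must go on
has made fewer than `l` branchings. This is the logarithmic bound for lookups. -/
theorem lt_of_ne (h : Dst σ N lab par sl δ) {u y i l : ℕ} (hu : u < N)
    (hlab : ∀ v, 1 ≤ v → v < N → lab v < σ) (hσ : σ ≤ 2 ^ l) (hy : y < σ)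
    (hi : ∀ j ≤ i, sl (slot sl u y j) ≠ 0) (hne : lab (sl (slot sl u y i)) ≠ y) : i < l := by
  obtain ⟨h1, h2, _, _, h5⟩ := h.valid hu i hi
  by_contra! hl
  have h3 := hlab _ (by omega) h2
  have : 2 ^ l ≤ 2 ^ i := Nat.pow_le_pow_right (by norm_num) hl
  rw [Nat.mod_eq_of_lt (by omega), Nat.mod_eq_of_lt (by omega)] at h5
  exact hne h5

theorem slot_congr {sl sl' : ℕ → ℕ} {u x i : ℕ}
    (h : ∀ j < i, sl' (slot sl u x j) = sl (slot sl u x j)) (j : ℕ) (hj : j ≤ i) :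
    slot sl' u x j = slot sl u x j := by
  induction j with
  | zero => rfl
  | succ j ih => rw [slot, slot, ih (by omega), h j (by omega)]

/-- Only the empty slot at the end of a failed search is filled. The old search paths use nonempty
slots and remain as they were, and the slots of the new node lie beyond `3 * N` and are empty. -/
theorem insert (h : Dst σ N lab par sl δ) (hσ : σ < N) {u y i : ℕ} (hu : u < N)
    (hi : ∀ j < i, sl (slot sl u y j) ≠ 0) (h0 : sl (slot sl u y i) = 0)
    {lab' par' : ℕ → ℕ}
    (hl : ∀ v, 1 ≤ v → v < N → lab' v = lab v) (hlN : lab' N = y)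
    (hp : ∀ v, v < N → par' v = par v) (hpN : par' N = u) :
    Dst σ (N + 1) lab' par' (Function.update sl (slot sl u y i) N)
      (Function.update δ N i) := by
  set a := slot sl u y i with ha
  set sl' := Function.update sl a N with hsl
  have hN : 0 < N := by omega
  have hne : ∀ b, sl b ≠ 0 → sl' b = sl b := fun b hb =>
    Function.update_of_ne (fun hba => hb (by rw [hba, h0])) _ _
  have hδ : ∀ v < N, Function.update δ N i v = δ v := fun v hv => Function.update_of_ne hv.ne _ _
  have hcase : ∀ b, sl' b = sl b ∨ (b = a ∧ sl' b = N) := by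
    intro b
    by_cases hb : b = a
    · right
      exact ⟨hb, by rw [hb]; simp [hsl]⟩
    · left
      exact Function.update_of_ne hb _ _
  have halt : a < 3 * N := h.slot_lt hu i hi
  constructor
  · intro v h1 h2
    rcases Nat.lt_succ_iff_lt_or_eq.1 h2 with hv | rfl
    · obtain ⟨k1, k2⟩ := h.mem v h1 hv
      have hs := slot_congr (sl' := sl') (i := δ v)
        (fun j (hj : j < δ v) => hne _ (k2 j hj.le))
      rw [hl v (by omega) hv, hp v hv, hδ v hv]
      refine ⟨by rw [hs _ le_rfl, hne _ (by rw [k1]; omega), k1], fun j hj => ?_⟩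
      rw [hs j hj, hne _ (k2 j hj)]
      exact k2 j hj
    · have hs := slot_congr (sl' := sl') (i := i)
        (fun j (hj : j < i) => hne _ (hi j hj))
      rw [hlN, hpN, Function.update_self]
      have hlast : sl' (slot sl' u y i) = v := by
        rw [hs i le_rfl]
        simp [hsl, ← ha]
      refine ⟨hlast, fun j hj => ?_⟩
      rcases hj.lt_or_eq with hj | rfl
      · rw [hs j hj.le, hne _ (hi j hj)]
        exact hi j hj
      · rw [hlast]
        omega
  · intro w hw hsw
    rcases hcase (3 * w) with hc | ⟨hc1, hc2⟩
    · rw [hc] at hsw ⊢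
      have hwN : w < N := by
        by_contra hwN
        exact hsw (h.zero _ (by omega))
      obtain ⟨k1, k2, k3, k4⟩ := h.top w hwN hsw
      exact ⟨k1, by omega, by rw [hp _ k2, k3], by rw [hδ _ k2, k4]⟩
    · rw [hc2]
      -- Modulo `3`, the slots for roots of search trees differ from the slots for branches.
      have : i = 0 := by
        cases i with
        | zero => rfl
        | succ i =>
          rw [ha, slot] at hc1
          have := Nat.mod_lt (y / 2 ^ i) (show 0 < 2 by norm_num)
          omega
      subst this
      rw [ha, slot] at hc1
      refine ⟨by omega, by omega, by rw [hpN]; omega, by simp⟩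
  · intro w hw1 hw b hb hsw
    rcases hcase (3 * w + 1 + b) with hc | ⟨hc1, hc2⟩
    · rw [hc] at hsw ⊢
      have hwN : w < N := by
        by_contra hwN
        exact hsw (h.zero _ (by omega))
      obtain ⟨k1, k2, k3, k4, k5, k6⟩ := h.down w hw1 hwN b hb hsw
      rw [hl _ (by omega) k2, hl w hw1 hwN, hδ _ hwN, hδ _ k2, hp _ k2, hp _ hwN]
      exact ⟨k1, by omega, k3, k4, k5, k6⟩
    · rw [hc2]
      cases i with
      | zero => rw [ha, slot] at hc1; omega
      | succ i =>
        rw [ha, slot] at hc1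
        have := Nat.mod_lt (y / 2 ^ i) (show 0 < 2 by norm_num)
        have hwe : w = sl (slot sl u y i) := by omega
        have hbe : b = y / 2 ^ i % 2 := by omega
        obtain ⟨k1, k2, k3, k4, k5⟩ := h.valid hu i (fun j hj => hi j (by omega))
        rw [← hwe] at k1 k2 k3 k4 k5
        rw [hpN, hp w k2, hδ w k2, hlN, hl w (by omega) k2, k3, k4, k5, Function.update_self]
        exact ⟨hσ, by omega, rfl, rfl, rfl, hbe.symm⟩
  · intro b hb
    have : b ≠ a := by omega
    rw [hsl, Function.update_of_ne this, h.zero b (by omega)]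

end Dst

/-- The arrays are long enough, and numbers may be large enough. -/
structure Env.Big {α : Type u} (E : Env α) : Prop where
  pos : 1 ≤ E.m
  len : E.L = 16 * E.m
  num : 600 * E.m ≤ E.W

/-! ### Finding or creating a child in logarithmic time. -/

section Lookup

variable {α : Type u}

/-- The memory contains a trie, with digital search trees, and the tables of halves and
parities. -/
structure TrieInv (E : Env α) (σ l : ℕ) (arm : ℕ → List ℕ) (s : St) : Prop where
  hm : s.v ρm = E.m
  trie : Trie σ (s.v ρN) (s.A φlab) (s.A φdep) (s.A φpar) arm
  dst : ∃ δ, Dst σ (s.v ρN) (s.A φlab) (s.A φpar) (s.A φsl) δ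
  half : ∀ j ≤ E.m, s.A φH j = j / 2
  bit : ∀ j ≤ E.m, s.A φB j = j % 2
  le_m : σ ≤ E.m
  le_pow : σ ≤ 2 ^ l

theorem TrieInv.congr {E : Env α} {σ l : ℕ} {arm : ℕ → List ℕ} {s s' : St}
    (h : TrieInv E σ l arm s) (h0 : s'.v ρm = s.v ρm) (hN : s'.v ρN = s.v ρN)
    (hA : ∀ f ∈ [φlab, φdep, φpar, φsl, φH, φB], s'.A f = s.A f) : TrieInv E σ l arm s' := by
  have e : ∀ f, f ∈ [φlab, φdep, φpar, φsl, φH, φB] → s'.A f = s.A f := hA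
  constructor
  · rw [h0, h.hm]
  · rw [hN, e φlab (by simp), e φdep (by simp), e φpar (by simp)]
    exact h.trie
  · rw [hN, e φlab (by simp), e φsl (by simp), e φpar (by simp)]
    exact h.dst
  · rw [e φH (by simp)]
    exact h.half
  · rw [e φB (by simp)]
    exact h.bit
  · exact h.le_m
  · exact h.le_pow

variable [LinearOrder α]

theorem searchLoop_spec {E : Env α} (hE : E.Big) {s : St} {σ l : ℕ} {arm : ℕ → List ℕ}
    (h : TrieInv E σ l arm s) (hN : s.v ρN ≤ 5 * E.m) (hu : 1 ≤ s.v ρu)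
    (huN : s.v ρu < s.v ρN) (hy : s.v ρy < σ) :
    Tr E searchLoop (fun s' t => (∃ i, s'.v ρsa = slot (s.A φsl) (s.v ρu) (s.v ρy) i ∧
      s'.v ρq = s.A φsl (s'.v ρsa) ∧
      (∀ j < i, s.A φsl (slot (s.A φsl) (s.v ρu) (s.v ρy) j) ≠ 0 ∧
        s.A φlab (s.A φsl (slot (s.A φsl) (s.v ρu) (s.v ρy) j)) ≠ s.v ρy) ∧
      (s'.v ρq = 0 ∨ s.A φlab (s'.v ρq) = s.v ρy)) ∧
      (∀ v, 1 ≤ v → s'.A φlab v = s.A φlab v) ∧ t ≤ 40 * l + 40) s := by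
  obtain ⟨δ, hd⟩ := h.dst
  have hp := hE.pos
  have hL := hE.len
  have hW := hE.num
  have hm := h.le_m
  have htr := h.trie
  simp only [searchLoop, tr_seq, tr_set, tr_put, Ex.Safe, Ex.eval, Ex.cost, St.setV_v, St.setV_A,
    St.setA_v, St.setA_A]
  norm_num only [if_true, if_false, and_assoc, true_and, and_true]
  repeat refine And.intro (by omega) ?_
  -- Here `i` is the number of branchings made. By `Dst.lt_of_ne` another round is possible only for
  -- `i < l`, so the potential `30 * (l - i)` pays for it.
  refine Tr.mono (tr_loop (fun n s' => ∃ i, i ≤ l + 1 ∧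
    s'.v ρsa = slot (s.A φsl) (s.v ρu) (s.v ρy) i ∧
      s'.v ρq = s.A φsl (s'.v ρsa) ∧
      (∀ j < i, s.A φsl (slot (s.A φsl) (s.v ρu) (s.v ρy) j) ≠ 0 ∧
        s.A φlab (s.A φsl (slot (s.A φsl) (s.v ρu) (s.v ρy) j)) ≠ s.v ρy) ∧
      s'.v ρz = s.v ρy / 2 ^ i ∧
      s'.v ρy = s.v ρy ∧ s'.A φlab 0 = s.v ρy ∧ (∀ v, 1 ≤ v → s'.A φlab v = s.A φlab v) ∧
      s'.A φsl = s.A φsl ∧ s'.A φH = s.A φH ∧ s'.A φB = s.A φB ∧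
      n = 30 * (l - i)) ?_ (n := 30 * l) ?_) ?_
  · rintro n s' ⟨i, hil, h1, h2, h3, h4, h5, h6, h7, h8, h9, h10, rfl⟩
    have hj : s.A φsl (slot (s.A φsl) (s.v ρu) (s.v ρy) i) = s'.v ρq := by rw [h2, h1]
    have hval : s'.v ρq ≠ 0 → ∀ j ≤ i, s.A φsl (slot (s.A φsl) (s.v ρu) (s.v ρy) j) ≠ 0 := by
      intro hq j hji
      rcases hji.lt_or_eq with hji | rfl
      · exact (h3 j hji).1
      · rwa [hj]
    have hqN : s'.v ρq < s.v ρN := by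
      by_cases hq : s'.v ρq = 0
      · omega
      · have := (hd.valid huN i (hval hq)).2.1
        rwa [hj] at this
    have hz : s'.v ρz ≤ E.m := by
      rw [h4]
      exact (Nat.div_le_self _ _).trans (by omega)
    have hbz := h.bit _ hz
    have hb2 := Nat.mod_lt (s'.v ρz) (show 0 < 2 by norm_num)
    simp only [tr_seq, tr_set, Bx.Safe, Bx.Holds, Bx.cost, Ex.Safe, Ex.eval, Ex.cost, St.setV_v,
      St.setV_A, h8, h9, h10]
    norm_num only [if_true, if_false, and_assoc, true_and, and_true]
    refine ⟨by omega, fun hne => ?_⟩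
    have hq0 : s'.v ρq ≠ 0 := by
      intro hq
      rw [hq, h6, h5] at hne
      exact hne rfl
    rw [h7 _ (by omega), h5] at hne
    have hil := hd.lt_of_ne huN htr.lab_lt h.le_pow hy (hval hq0) (by rwa [hj])
    have hsl : s'.v ρq + s'.v ρq + s'.v ρq + 1 + s.A φB (s'.v ρz) =
        slot (s.A φsl) (s.v ρu) (s.v ρy) (i + 1) := by
      rw [slot, hj, hbz, h4]
      ring
    repeat refine And.intro (by omega) ?_
    refine ⟨30 * (l - (i + 1)), ⟨i + 1, by omega, hsl, ?_, ?_, h5, h6, h7, rfl⟩,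
      by omega⟩
    · intro j hji
      rcases Nat.lt_succ_iff_lt_or_eq.1 hji with hji | rfl
      · exact h3 j hji
      · rw [hj]
        exact ⟨hq0, hne⟩
    · rw [h.half _ hz, h4, Nat.div_div_eq_div_mul, pow_succ]
  · refine ⟨0, by omega, ?_, rfl, by simp, by simp [St.setV_v], rfl, ?_, ?_, rfl, rfl, rfl, by simp⟩
    · simp only [St.setV_v, St.setA_v, Ex.eval, slot]
      norm_num only [if_true, if_false, and_assoc, true_and, and_true]
      ring
    · simp [St.setV_A, St.setA_A]
    · intro v hv
      simp [St.setV_A, St.setA_A, Function.update_apply, show v ≠ 0 by omega]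
  · rintro s' t ⟨n', ⟨i, hil, h1, h2, h3, h4, h5, h6, h7, h8, h9, h10, rfl⟩, hx, ht⟩
    simp only [Bx.Holds, Ex.eval, Bx.cost, Ex.cost, not_not] at hx ht
    refine ⟨⟨i, h1, h2, h3, ?_⟩, h7, by omega⟩
    by_cases hq : s'.v ρq = 0
    · exact Or.inl hq
    · right
      rw [← h7 _ (by omega), hx, h5]

theorem lookup_spec {E : Env α} (hE : E.Big) {s : St} {σ l : ℕ} {arm : ℕ → List ℕ}
    (h : TrieInv E σ l arm s) (hN : s.v ρN ≤ 5 * E.m) (hu : 1 ≤ s.v ρu)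
    (huN : s.v ρu < s.v ρN) (hy : s.v ρy < σ) :
    Tr E lookup (fun s' t => (∃ arm', TrieInv E σ l arm' s' ∧ (∀ v < s.v ρN, arm' v = arm v) ∧
      arm' (s'.v ρq) = arm (s.v ρu) ++ [s.v ρy]) ∧
      (s'.v ρN = s.v ρN ∧ s'.v ρq < s.v ρN ∨ s'.v ρN = s.v ρN + 1 ∧ s'.v ρq = s.v ρN) ∧
      t ≤ 40 * l + 80 ∧ (∀ r, r ∉ [ρsa, ρz, ρq, ρN] → s'.v r = s.v r) ∧
      (∀ f, f ∉ [φlab, φsl, φpar, φdep] → s'.A f = s.A f)) s := by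
  have hp := hE.pos
  have hL := hE.len
  have hW := hE.num
  have hm := h.le_m
  have htr := h.trie
  obtain ⟨δ, hd⟩ := h.dst
  have hlt := htr.lt
  have hs := (searchLoop_spec hE h hN hu huN hy).frame
  rw [lookup, tr_seq]
  refine hs.mono ?_
  rintro s₁ t₁ ⟨⟨⟨i, h1, h2, h3, h4⟩, h5, ht⟩, hv, hA⟩
  have hv' : ∀ r, r ∉ [ρsa, ρz, ρq] → s₁.v r = s.v r := fun r hr => hv r (by
    simp only [List.mem_cons, List.not_mem_nil, or_false, not_or] at hr
    simp [searchLoop, Cm.wV, hr])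
  have hA' : ∀ f, f ≠ φlab → s₁.A f = s.A f := fun f hf => hA f (by
    simpa [searchLoop, Cm.wA] using hf)
  have eN : s₁.v ρN = s.v ρN := hv' _ (by simp)
  have eu : s₁.v ρu = s.v ρu := hv' _ (by simp)
  have ey : s₁.v ρy = s.v ρy := hv' _ (by simp)
  have em : s₁.v ρm = s.v ρm := hv' _ (by simp)
  have esl : s₁.A φsl = s.A φsl := hA' _ (by simp)
  have epar : s₁.A φpar = s.A φpar := hA' _ (by simp)
  have edep : s₁.A φdep = s.A φdep := hA' _ (by simp)
  have eH : s₁.A φH = s.A φH := hA' _ (by simp)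
  have eB : s₁.A φB = s.A φB := hA' _ (by simp)
  have hsa : s₁.v ρsa < 3 * s.v ρN := by
    rw [h1]
    exact hd.slot_lt huN i (fun j hj => (h3 j hj).1)
  have hj : s.A φsl (slot (s.A φsl) (s.v ρu) (s.v ρy) i) = s₁.v ρq := by rw [h2, h1]
  simp only [tr_ite, Bx.Safe, Bx.Holds, Bx.cost, Ex.Safe, Ex.eval, Ex.cost, newNode, tr_seq,
    tr_set, tr_put, tr_skip, St.setV_v, St.setV_A, St.setA_v, St.setA_A]
  norm_num only [if_true, if_false, and_assoc, true_and, and_true]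
  have hdep : s₁.A φdep (s₁.v ρu) ≤ s.v ρu := by
    rw [edep, eu]
    exact htr.dep_le huN
  refine ⟨by omega, fun hq => ?_, fun hq => ?_⟩
  · have hnew : ∀ v < s.v ρN, arm v ≠ arm (s.v ρu) ++ [s.v ρy] := by
      intro v hvN he
      have hv1 := htr.one_le_of_arm he
      obtain ⟨k1, k2⟩ := (htr.child_iff huN hv1 hvN).1 he
      have hvσ := htr.gt_of_par hv1 hvN (by omega)
      exact hd.not_found h3 (by rw [hj, hq]) hvσ hvN k1 k2
    repeat refine And.intro (by omega) ?_
    refine ⟨⟨Function.update arm (s.v ρN) (arm (s.v ρu) ++ [s.v ρy]), ⟨?_, ?_, ⟨Function.update δ (s.v ρN) i, ?_⟩, ?_, ?_, hm, h.le_pow⟩, ?_, ?_⟩, ?_, ?_,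
      ?_, ?_⟩
    rotate_left 1
    · simp only [St.setV_v, St.setV_A, St.setA_v, St.setA_A]
      norm_num only [if_true, if_false]
      rw [eN]
      refine htr.insert (y := s.v ρy) huN hy hnew ?_ ?_ ?_ ?_ ?_ ?_
      · intro v hv1 hvN
        simp [hvN.ne, h5 v hv1]
      · simp [ey]
      · intro v hvN
        simp [hvN.ne, edep]
      · simp [edep, eu]
      · intro v hvN
        simp [hvN.ne, epar]
      · simp [eu]
    · simp only [St.setV_v, St.setV_A, St.setA_v, St.setA_A]
      norm_num only [if_true, if_false]
      rw [eN, esl, h1]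
      refine hd.insert hlt (y := s.v ρy) huN (fun j hj => (h3 j hj).1) (by rw [hj, hq]) ?_ ?_ ?_ ?_
      · intro v hv1 hvN
        simp [hvN.ne, h5 v hv1]
      · simp [ey]
      · intro v hvN
        simp [hvN.ne, epar]
      · simp [eu]
    · simpa [St.setV_A, St.setA_A, eH] using h.half
    · simpa [St.setV_A, St.setA_A, eB] using h.bit
    · intro v hvN
      exact Function.update_of_ne hvN.ne _ _
    · simp [St.setV_v, St.setA_v, eN]
    · right
      simp [St.setV_v, St.setA_v, eN]
    · omega
    · intro r hr
      simp only [List.mem_cons, List.not_mem_nil, or_false, not_or] at hr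
      simp [St.setV_v, St.setA_v, hr, hv' r (by simp [hr])]
    · intro f hf
      simp only [List.mem_cons, List.not_mem_nil, or_false, not_or] at hf
      simp [St.setV_A, St.setA_A, hf, hA' f hf.1]
    · simp [St.setV_v, St.setA_v, em, h.hm]
  · have hval : ∀ j ≤ i, s.A φsl (slot (s.A φsl) (s.v ρu) (s.v ρy) j) ≠ 0 := by
      intro j hji
      rcases hji.lt_or_eq with hji | rfl
      · exact (h3 j hji).1
      · rwa [hj]
    obtain ⟨k1, k2, k3, k4, k5⟩ := hd.valid huN i hval
    rw [hj] at k1 k2 k3 k4 k5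
    have hlab : s.A φlab (s₁.v ρq) = s.v ρy := h4.resolve_left hq
    refine ⟨⟨arm, ⟨?_, ?_, ⟨δ, ?_⟩, ?_, ?_, hm, h.le_pow⟩, fun _ _ => rfl, ?_⟩, ?_, ?_, ?_, ?_⟩
    · rw [em, h.hm]
    · rw [eN, edep, epar]
      refine ⟨hlt, htr.root, htr.par_lt, ?_, ?_, htr.dep_eq, htr.inj, htr.single⟩
      · intro v hv1 hvN
        rw [h5 v hv1]
        exact htr.lab_lt v hv1 hvN
      · intro v hv1 hvN
        rw [h5 v hv1]
        exact htr.arm_eq v hv1 hvN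
    · rw [eN, epar, esl]
      have hcongr : ∀ v, σ < v → s₁.A φlab v = s.A φlab v := fun v hv => h5 v (by omega)
      refine ⟨?_, hd.top, ?_, hd.zero⟩
      · intro v hv1 hvN
        rw [hcongr v hv1]
        exact hd.mem v hv1 hvN
      · intro w hw1 hwN b hb hne
        obtain ⟨j1, j2⟩ := hd.down w hw1 hwN b hb hne
        rw [hcongr _ j1, h5 w hw1]
        exact ⟨j1, j2⟩
    · rw [eH]
      exact h.half
    · rw [eB]
      exact h.bit
    · exact (htr.child_iff huN (by omega) k2).2 ⟨k3, hlab⟩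
    · exact Or.inl ⟨eN, k2⟩
    · omega
    · intro r hr
      simp only [List.mem_cons, List.not_mem_nil, or_false, not_or] at hr
      exact hv' r (by simp [hr])
    · intro f hf
      simp only [List.mem_cons, List.not_mem_nil, or_false, not_or] at hf
      exact hA' f hf.1

end Lookup

/-! ### Palindromes of odd length -/

/-- `X` is symmetric around `c` within distance less than `D`. -/
def Pal (X : ℕ → ℕ) (c D : ℕ) : Prop := ∀ d < D, X (c - d) = X (c + d)

/-- The letters of `X` at `c, …, c + D - 1`. -/
def armOf (X : ℕ → ℕ) (c D : ℕ) : List ℕ := (List.range D).map fun d => X (c + d)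

section

variable {X : ℕ → ℕ} {c D : ℕ}

theorem pal_zero : Pal X c 0 := fun _ h => absurd h (Nat.not_lt_zero _)

theorem pal_one : Pal X c 1 := fun d h => by
  obtain rfl : d = 0 := by omega
  rfl

theorem Pal.mono (h : Pal X c D) {D' : ℕ} (hD : D' ≤ D) : Pal X c D' :=
  fun d hd => h d (by omega)

theorem pal_succ : Pal X c (D + 1) ↔ Pal X c D ∧ X (c - D) = X (c + D) := by
  constructor
  · exact fun h => ⟨h.mono (by omega), h D (by omega)⟩
  · rintro ⟨h1, h2⟩ d hd
    rcases Nat.lt_succ_iff_lt_or_eq.1 hd with hd | rfl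
    · exact h1 d hd
    · exact h2

theorem armOf_succ : armOf X c (D + 1) = armOf X c D ++ [X (c + D)] := by
  simp [armOf, List.range_succ]

theorem length_armOf : (armOf X c D).length = D := by simp [armOf]

theorem armOf_one : armOf X c 1 = [X c] := by simp [armOf]

theorem armOf_eq_iff {c' : ℕ} : armOf X c D = armOf X c' D ↔ ∀ d < D, X (c + d) = X (c' + d) := by
  simp [armOf]

theorem Pal.reflect (h : Pal X c D) (hc : D ≤ c) {j : ℕ} (h1 : c < j + D) (h2 : j < c + D) :
    X (2 * c - j) = X j := by
  rcases le_total c j with hj | hj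
  · have := h (j - c) (by omega)
    rwa [show c - (j - c) = 2 * c - j by omega, show c + (j - c) = j by omega] at this
  · have := h (c - j) (by omega)
    rw [show c - (c - j) = j by omega, show c + (c - j) = 2 * c - j by omega] at this
    exact this.symm

/-- Reflection at `c` maps a window inside the palindrome around `c` to another such window and
preserves its symmetry. This is the principle of Manacher's algorithm. -/
theorem Pal.mirror (h : Pal X c D) (hc : D ≤ c) {k r : ℕ} (hk : c < k) (hr : k + r ≤ c + D) :
    Pal X (2 * c - k) r ↔ Pal X k r := by
  refine forall₂_congr fun d hd => ?_
  have h1 := h.reflect hc (j := k + d) (by omega) (by omega)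
  have h2 := h.reflect hc (j := k - d) (by omega) (by omega)
  rw [show 2 * c - k - d = 2 * c - (k + d) by omega, h1,
    show 2 * c - k + d = 2 * c - (k - d) by omega, h2, eq_comm]

theorem Pal.armOf_mirror (h : Pal X c D) (hc : D ≤ c) {k r : ℕ} (hk : c < k)
    (hr : k + r ≤ c + D) (hp : Pal X k r) : armOf X (2 * c - k) r = armOf X k r := by
  rw [armOf_eq_iff]
  intro d hd
  have h2 := h.reflect hc (j := k - d) (by omega) (by omega)
  rw [show 2 * c - k + d = 2 * c - (k - d) by omega, h2, hp d hd]

/-- Palindromic suffixes correspond at two occurrences of a palindrome. -/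
theorem Pal.transfer {c' : ℕ} (h : Pal X c D) (h' : Pal X c' D) (ha : armOf X c D = armOf X c' D)
    (e r : ℕ) (her : e + r ≤ D) : (Pal X (c + e) r ↔ Pal X (c' + e) r) ∧
      armOf X (c + e) r = armOf X (c' + e) r := by
  rw [armOf_eq_iff] at ha
  have hr : ∀ d < r, X (c + e + d) = X (c' + e + d) := fun d hd => by
    rw [add_assoc, add_assoc]
    exact ha _ (by omega)
  refine ⟨?_, armOf_eq_iff.2 hr⟩
  refine forall₂_congr fun d hd => ?_
  have hl : X (c + e - d) = X (c' + e - d) := by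
    rcases le_total d e with hde | hde
    · rw [Nat.add_sub_assoc hde, Nat.add_sub_assoc hde]
      exact ha _ (by omega)
    · rw [show c + e - d = c - (d - e) by omega, show c' + e - d = c' - (d - e) by omega,
        h _ (by omega), h' _ (by omega)]
      exact ha _ (by omega)
  rw [hl, hr d hd]

end

/-- A word `X 1, …, X m` over the alphabet `{0, …, σ - 1}`, between two different marks. -/
structure Text (m σ : ℕ) (X : ℕ → ℕ) : Prop where
  left : X 0 = m
  right : X (m + 1) = m + 1
  lt : ∀ c, 1 ≤ c → c ≤ m → X c < σ
  le : σ ≤ m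
  surj : ∀ r < σ, ∃ c, 1 ≤ c ∧ c ≤ m ∧ X c = r

theorem Text.le_m {m σ : ℕ} {X : ℕ → ℕ} (h : Text m σ X) {c : ℕ} (hc : c ≤ m) : X c ≤ m := by
  rcases Nat.eq_zero_or_pos c with rfl | h1
  · rw [h.left]
  · exact (h.lt c h1 hc).le.trans h.le

/-- The marks differ from each other and from all letters, so no palindrome contains one. Hence the
truncation in `c - d` never matters for palindromes of a text. -/
theorem Text.bound {m σ : ℕ} {X : ℕ → ℕ} (h : Text m σ X) {c D : ℕ} (h1c : 1 ≤ c)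
    (hc : c ≤ m) (hp : Pal X c D) : D ≤ c ∧ c + D ≤ m + 1 := by
  have h2 : c + D ≤ m + 1 := by
    by_contra! hD
    have h1 := hp (m + 1 - c) (by omega)
    rw [show c + (m + 1 - c) = m + 1 by omega, h.right] at h1
    have := h.le_m (c := c - (m + 1 - c)) (by omega)
    omega
  refine ⟨?_, h2⟩
  by_contra! hD
  have h1 := hp c hD
  rw [Nat.sub_self, h.left] at h1
  rcases (show c + c ≤ m ∨ c + c = m + 1 by omega) with h3 | h3
  · have := h.lt (c + c) (by omega) h3
    have := h.le
    omega
  · rw [h3, h.right] at h1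
    omega

/-- The node `u` is a palindrome that ends just before position `P`. -/
structure Suf (X : ℕ → ℕ) (N : ℕ) (dep : ℕ → ℕ) (arm : ℕ → List ℕ) (P u : ℕ) : Prop where
  lt : u < N
  dep_lt : dep u < P
  pal : Pal X (P - dep u) (dep u)
  arm_eq : arm u = armOf X (P - dep u) (dep u)

/-- The node `v` is the maximal palindrome with center `c`. -/
structure MaxNode (X : ℕ → ℕ) (N : ℕ) (dep : ℕ → ℕ) (arm : ℕ → List ℕ) (c v : ℕ) : Prop where
  pos : 1 ≤ v
  lt : v < N
  pal : Pal X c (dep v)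
  max : ¬ Pal X c (dep v + 1)
  arm_eq : arm v = armOf X c (dep v)

theorem Suf.congr {X dep dep' : ℕ → ℕ} {N P u : ℕ} {arm arm' : ℕ → List ℕ}
    (h : Suf X N dep arm P u) (hd : dep' u = dep u) (ha : arm' u = arm u) :
    Suf X N dep' arm' P u :=
  ⟨h.lt, by rw [hd]; exact h.dep_lt, by rw [hd]; exact h.pal, by rw [hd, ha]; exact h.arm_eq⟩

theorem MaxNode.congr {X dep dep' : ℕ → ℕ} {N N' c v : ℕ} {arm arm' : ℕ → List ℕ}
    (h : MaxNode X N dep arm c v) (hN : N ≤ N') (hd : ∀ v < N, dep' v = dep v)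
    (ha : ∀ v < N, arm' v = arm v) : MaxNode X N' dep' arm' c v :=
  ⟨h.pos, h.lt.trans_le hN, by rw [hd v h.lt]; exact h.pal, by rw [hd v h.lt]; exact h.max,
    by rw [hd v h.lt, ha v h.lt]; exact h.arm_eq⟩

/-- The nodes are the palindromes that end before `P`, and the suffix links are correct; `ld v` is
the number of the nonempty palindromic suffixes of the node `v`. -/
structure Links (m σ N P : ℕ) (X dep link : ℕ → ℕ) (arm : ℕ → List ℕ) (ld : ℕ → ℕ) : Prop where
  complete : ∀ k D, 1 ≤ k → 1 ≤ D → k + D ≤ P → Pal X k D → ∃ v < N, arm v = armOf X k D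
  sound : ∀ v, 1 ≤ v → v < N → ∃ k, 1 ≤ k ∧ k ≤ m ∧ Pal X k (dep v) ∧ arm v = armOf X k (dep v)
  link_lt : ∀ v, 1 ≤ v → v < N → link v < N ∧ dep (link v) < dep v
  link_suf : ∀ v, 1 ≤ v → v < N → ∀ k, 1 ≤ k → k ≤ m → Pal X k (dep v) →
    arm v = armOf X k (dep v) → Pal X (k + dep v - dep (link v)) (dep (link v)) ∧
      arm (link v) = armOf X (k + dep v - dep (link v)) (dep (link v)) ∧
      ∀ c, k < c → c < k + dep v - dep (link v) → ¬ Pal X c (k + dep v - c)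
  ld_zero : ld 0 = 0
  ld_link : ∀ v, 1 ≤ v → v < N → ld v = ld (link v) + 1
  ld_child : ∀ u < N, ∀ v < N, ∀ y, arm v = arm u ++ [y] → ld v ≤ ld u + 1

namespace Links

variable {m σ N P : ℕ} {X lab dep par link : ℕ → ℕ} {arm : ℕ → List ℕ} {ld : ℕ → ℕ}

theorem congr (h : Links m σ N P X dep link arm ld) {dep' : ℕ → ℕ} {arm' : ℕ → List ℕ}
    (hd : ∀ v < N, dep' v = dep v) (ha : ∀ v < N, arm' v = arm v) :
    Links m σ N P X dep' link arm' ld := by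
  refine ⟨?_, ?_, ?_, ?_, h.ld_zero, h.ld_link, ?_⟩
  · intro k D hk hD hkD hp
    obtain ⟨v, hv, he⟩ := h.complete k D hk hD hkD hp
    exact ⟨v, hv, by rw [ha v hv, he]⟩
  · intro v h1 hv
    rw [hd v hv, ha v hv]
    exact h.sound v h1 hv
  · intro v h1 hv
    have := h.link_lt v h1 hv
    rw [hd v hv, hd _ this.1]
    exact this
  · intro v h1 hv
    have := h.link_lt v h1 hv
    rw [hd v hv, hd _ this.1, ha v hv, ha _ this.1]
    exact h.link_suf v h1 hv
  · intro u hu v hv y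
    rw [ha u hu, ha v hv]
    exact h.ld_child u hu v hv y

/-- This passes from nodes to positions: at any place where `u` ends, its link is the next shorter
palindromic suffix, with none centered in between. -/
theorem suf_link (h : Links m σ N P X dep link arm ld) {Q u : ℕ} (hQ : Q ≤ m + 1)
    (hu : Suf X N dep arm Q u) (h1 : 1 ≤ u) :
    Suf X N dep arm Q (link u) ∧ dep (link u) < dep u ∧
      ∀ c, Q - dep u < c → c < Q - dep (link u) → ¬ Pal X c (Q - c) := by
  have hlt := hu.dep_lt
  obtain ⟨h2, h3⟩ := h.link_lt u h1 hu.lt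
  obtain ⟨h4, h5, h6⟩ := h.link_suf u h1 hu.lt (Q - dep u) (by omega) (by omega) hu.pal hu.arm_eq
  rw [Nat.sub_add_cancel hlt.le] at h4 h5 h6
  exact ⟨⟨h2, by omega, h4, h5⟩, h3, h6⟩

/-- A palindromic suffix of a palindrome occurs earlier. -/
theorem exists_suffix (h : Links m σ N P X dep link arm ld) (hX : Text m σ X) {c k : ℕ}
    (h1c : 1 ≤ c) (hP : P ≤ m) (hk : c < k) (hkP : k ≤ P) (hc : Pal X c (P + 1 - c))
    (hp : Pal X k (P + 1 - k)) : ∃ v < N, arm v = armOf X k (P + 1 - k) := by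
  obtain ⟨h1, h2⟩ := hX.bound h1c (by omega) hc
  have e := hc.armOf_mirror h1 hk (r := P + 1 - k) (by omega) hp
  have hp' := (hc.mirror h1 hk (r := P + 1 - k) (by omega)).2 hp
  rw [← e]
  exact h.complete _ _ (by omega) (by omega) (by omega) hp'

/-- If the longest palindromic suffix is a node already, nothing is missing: every shorter one is
reflected inside it and so occurs earlier. -/
theorem step (h : Links m σ N P X dep link arm ld) (hX : Text m σ X) {c : ℕ} (hP : P ≤ m)
    (h1c : 1 ≤ c) (hcP : c ≤ P) (hc : Pal X c (P + 1 - c))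
    (hlong : ∀ k, 1 ≤ k → k < c → ¬ Pal X k (P + 1 - k))
    (hv : ∃ v < N, arm v = armOf X c (P + 1 - c)) :
    Links m σ N (P + 1) X dep link arm ld := by
  refine ⟨?_, h.sound, h.link_lt, h.link_suf, h.ld_zero, h.ld_link, h.ld_child⟩
  intro k D hk hD hkD hp
  rcases Nat.lt_succ_iff_lt_or_eq.1 (Nat.lt_succ_of_le hkD) with hlt | heq
  · exact h.complete k D hk hD (by omega) hp
  · obtain rfl : D = P + 1 - k := by omega
    rcases lt_trichotomy k c with hkc | rfl | hkc
    · exact absurd hp (hlong k hk hkc)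
    · exact hv
    · exact h.exists_suffix hX h1c hP hkc (by omega) hc hp

/-- Adding a new longest palindromic suffix. -/
theorem insert (h : Links m σ N P X dep link arm ld) (hX : Text m σ X)
    {lab' dep' par' : ℕ → ℕ} {arm' : ℕ → List ℕ}
    (ht : Trie σ N lab dep par arm) (ht' : Trie σ (N + 1) lab' dep' par' arm')
    (hold : ∀ v < N, arm' v = arm v) {u c k lk : ℕ} (hP : P ≤ m) (hu : u < N)
    (hu' : arm' N = arm u ++ [X P])
    (h1c : 1 ≤ c) (hcP : c < P) (hc : Pal X c (P + 1 - c)) (harm : arm' N = armOf X c (P + 1 - c))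
    (hlong : ∀ k, 1 ≤ k → k < c → ¬ Pal X k (P + 1 - k))
    (hck : c < k) (hkP : k ≤ P) (hk : Pal X k (P + 1 - k))
    (hkc : ∀ j, c < j → j < k → ¬ Pal X j (P + 1 - j))
    (hlk : lk < N) (hlka : arm lk = armOf X k (P + 1 - k)) (hld : ld lk ≤ ld u) :
    Links m σ (N + 1) (P + 1) X dep' (Function.update link N lk) arm'
      (Function.update ld N (ld lk + 1)) := by
  have hdep : ∀ v < N, dep' v = dep v := fun v hv => by
    rw [ht'.dep_eq v (by omega), ht.dep_eq v hv, hold v hv]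
  have hdN : dep' N = P + 1 - c := by rw [ht'.dep_eq N (by omega), harm, length_armOf]
  have hdlk : dep lk = P + 1 - k := by rw [ht.dep_eq lk hlk, hlka, length_armOf]
  have hlink : ∀ v < N, Function.update link N lk v = link v :=
    fun v hv => Function.update_of_ne hv.ne _ _
  have hldu : ∀ v < N, Function.update ld N (ld lk + 1) v = ld v :=
    fun v hv => Function.update_of_ne hv.ne _ _
  have hN : 0 < N := by have := ht.lt; omega
  refine ⟨?_, ?_, ?_, ?_, ?_, ?_, ?_⟩
  · intro k' D hk' hD hkD hp
    rcases Nat.lt_succ_iff_lt_or_eq.1 (Nat.lt_succ_of_le hkD) with hlt | heq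
    · obtain ⟨v, hv, he⟩ := h.complete k' D hk' hD (by omega) hp
      exact ⟨v, by omega, by rw [hold v hv, he]⟩
    · obtain rfl : D = P + 1 - k' := by omega
      rcases lt_trichotomy k' c with hkc | rfl | hkc
      · exact absurd hp (hlong k' hk' hkc)
      · exact ⟨N, by omega, harm⟩
      · obtain ⟨v, hv, he⟩ := h.exists_suffix hX h1c hP hkc (by omega) hc hp
        exact ⟨v, by omega, by rw [hold v hv, he]⟩
  · intro v h1 h2
    rcases Nat.lt_succ_iff_lt_or_eq.1 h2 with hv | rfl
    · rw [hdep v hv, hold v hv]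
      exact h.sound v h1 hv
    · rw [hdN]
      exact ⟨c, h1c, by omega, hc, harm⟩
  · intro v h1 h2
    rcases Nat.lt_succ_iff_lt_or_eq.1 h2 with hv | rfl
    · obtain ⟨k1, k2⟩ := h.link_lt v h1 hv
      rw [hlink v hv, hdep v hv, hdep _ k1]
      exact ⟨by omega, k2⟩
    · rw [Function.update_self, hdep _ hlk, hdN, hdlk]
      exact ⟨by omega, by omega⟩
  · intro v h1 h2 j hj hjm
    rcases Nat.lt_succ_iff_lt_or_eq.1 h2 with hv | rfl
    · obtain ⟨k1, k2⟩ := h.link_lt v h1 hv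
      rw [hlink v hv, hdep v hv, hdep _ k1, hold v hv, hold _ k1]
      exact h.link_suf v h1 hv j hj hjm
    · rw [Function.update_self, hdep _ hlk, hdN, hdlk, hold _ hlk, hlka, harm]
      intro hp ha
      -- A link must be right at every occurrence of the new palindrome. Suffixes are carried over
      -- from the occurrence around `c` to the one around `j`.
      have htr : ∀ i, c ≤ i → i ≤ P + 1 → (Pal X i (P + 1 - i) ↔
          Pal X (j + (i - c)) (P + 1 - i)) ∧
          armOf X i (P + 1 - i) = armOf X (j + (i - c)) (P + 1 - i) := by
        intro i hi hiP
        have := hc.transfer hp ha (i - c) (P + 1 - i) (by omega)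
        rwa [show c + (i - c) = i by omega] at this
      rw [show j + (P + 1 - c) - (P + 1 - k) = j + (k - c) by omega]
      refine ⟨(htr k hck.le (by omega)).1.1 hk, (htr k hck.le (by omega)).2, ?_⟩
      intro i hi hik hpi
      have h3 := (htr (c + (i - j)) (by omega) (by omega)).1
      rw [show c + (i - j) - c = i - j by omega, show j + (i - j) = i by omega] at h3
      refine hkc (c + (i - j)) (by omega) (by omega) (h3.2 ?_)
      rwa [show P + 1 - (c + (i - j)) = j + (P + 1 - c) - i by omega]
  · rw [hldu 0 hN, h.ld_zero]
  · intro v h1 h2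
    rcases Nat.lt_succ_iff_lt_or_eq.1 h2 with hv | rfl
    · obtain ⟨k1, k2⟩ := h.link_lt v h1 hv
      rw [hlink v hv, hldu v hv, hldu _ k1]
      exact h.ld_link v h1 hv
    · rw [Function.update_self, Function.update_self, hldu _ hlk]
  · intro w hw v hv y he
    rcases Nat.lt_succ_iff_lt_or_eq.1 hv with hvN | rfl
    · have h1 := ht'.one_le_of_arm he
      have h3 := ht'.par_lt v h1 hv
      have h4 := ((ht'.child_iff hw h1 hv).1 he).1
      rw [hldu v hvN, hldu w (by omega)]
      refine h.ld_child w (by omega) v hvN y ?_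
      rw [← hold v hvN, ← hold w (by omega), he]
    · rw [hu'] at he
      have h3 := (List.append_inj' he rfl).1
      have hwu : u = w := ht'.inj u (by omega) w hw (by rw [hold u hu, h3])
      rw [Function.update_self, ← hwu, hldu u hu]
      omega

end Links

/-! ### Walking along suffix links and recording maximal palindromes. -/

section Eertree

variable {α : Type u} [LinearOrder α] {E : Env α} {s : St} {σ l : ℕ} {arm : ℕ → List ℕ}
  {ld : ℕ → ℕ}

theorem copyLoop_spec (hE : E.Big) (hcur : s.v ρcur ≤ 5 * E.m) (hp : s.v ρp ≤ E.m + 1)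
    (hcn : s.v ρcn < s.v ρk) (hk : s.v ρk ≤ E.m + 1) :
    Tr E copyLoop (fun s' t =>
      (∀ j, s.v ρk ≤ j → j < s.v ρp - s.A φdep (s.v ρcur) →
        s'.A φM j = s.A φM (2 * s.v ρcn - j)) ∧
      (∀ j, j < s.v ρk → s'.A φM j = s.A φM j) ∧
      t ≤ 24 * (s.v ρp - s.A φdep (s.v ρcur) - s.v ρk) + 8 ∧
      (∀ r, r ≠ ρk → s'.v r = s.v r) ∧ (∀ f, f ≠ φM → s'.A f = s.A f)) s := by
  have hpos := hE.pos
  have hL := hE.len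
  have hW := hE.num
  refine Tr.mono (tr_loop (fun n s' => (s.v ρk ≤ s'.v ρk ∧ s'.v ρk ≤ E.m + 1) ∧
    (∀ j, s.v ρk ≤ j → j < s'.v ρk → s'.A φM j = s.A φM (2 * s.v ρcn - j)) ∧
    (∀ j, j < s.v ρk → s'.A φM j = s.A φM j) ∧
    (∀ r, r ≠ ρk → s'.v r = s.v r) ∧ (∀ f, f ≠ φM → s'.A f = s.A f) ∧
    n = 24 * (s.v ρp - s.A φdep (s.v ρcur) - s'.v ρk)) ?_
    ⟨⟨le_rfl, hk⟩, fun j h1 h2 => by omega, fun _ _ => rfl, fun _ _ => rfl, fun _ _ => rfl,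
      rfl⟩) ?_
  rotate_left 1
  · rintro s' t ⟨n', ⟨⟨h1, h2⟩, h3, h4, h5, h6, rfl⟩, hx, ht⟩
    simp only [Bx.Holds, Ex.eval, Bx.cost, Ex.cost, h5 ρp (by norm_num), h5 ρcur (by norm_num),
      h6 φdep (by norm_num)] at hx ht
    exact ⟨fun j hj hj' => h3 j hj (by omega), h4, by omega, h5, h6⟩
  · rintro n s' ⟨⟨h1, h2⟩, h3, h4, h5, h6, rfl⟩
    have ep := h5 ρp (by norm_num)
    have ec := h5 ρcur (by norm_num)
    have en := h5 ρcn (by norm_num)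
    have ed := h6 φdep (by norm_num)
    simp only [tr_seq, tr_set, tr_put, Bx.Safe, Bx.Holds, Bx.cost, Ex.Safe, Ex.eval, Ex.cost,
      St.setV_v, St.setV_A, St.setA_v, St.setA_A, ep, ec, en, ed]
    norm_num only [if_true, if_false, and_assoc, true_and, and_true]
    repeat refine And.intro (by omega) ?_
    intro hlt
    repeat refine And.intro (by omega) ?_
    refine ⟨24 * (s.v ρp - s.A φdep (s.v ρcur) - (s'.v ρk + 1)), by omega, by omega, ?_, ?_, ?_, ?_, rfl,
      by omega⟩
    · intro j hj hj'
      rcases Nat.lt_succ_iff_lt_or_eq.1 hj' with hjk | rfl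
      · rw [Function.update_of_ne hjk.ne, h3 j hj hjk]
      · rw [Function.update_self, h4 _ (by omega)]
        congr 1
        omega
    · intro j hj
      rw [Function.update_of_ne (by omega), h4 j hj]
    · intro r hr
      simp [hr, h5 r hr]
    · intro f hf
      simp [hf, h6 f hf]

/-- `cur` runs through the palindromic suffixes before `p` until one extends to `p`. A suffix that
does not extend is the maximal palindrome at its center, and the maximal palindromes at the centers
up to the next suffix are reflections of earlier ones. The potential pays `60` for every link, since
links lower `ld` by one, and `24` for every center that is settled. -/
theorem chainLoop_spec (hE : E.Big) (h : TrieInv E σ l arm s) (hN : s.v ρN ≤ 5 * E.m)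
    (hX : Text E.m σ (s.A φX)) {Q : ℕ}
    (hK : Links E.m σ (s.v ρN) Q (s.A φX) (s.A φdep) (s.A φlink) arm ld)
    (hPm : s.v ρp ≤ E.m + 1)
    (hS : Suf (s.A φX) (s.v ρN) (s.A φdep) arm (s.v ρp) (s.v ρcur))
    (hlong : ∀ c, 1 ≤ c → c < s.v ρp - s.A φdep (s.v ρcur) →
      ¬ Pal (s.A φX) c (s.v ρp + 1 - c))
    (hM : ∀ c, 1 ≤ c → c < s.v ρp - s.A φdep (s.v ρcur) →
      MaxNode (s.A φX) (s.v ρN) (s.A φdep) arm c (s.A φM c)) :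
    Tr E chainLoop (fun s' t =>
      Suf (s.A φX) (s.v ρN) (s.A φdep) arm (s.v ρp) (s'.v ρcur) ∧
      (∀ c, 1 ≤ c → c < s.v ρp - s.A φdep (s'.v ρcur) →
        ¬ Pal (s.A φX) c (s.v ρp + 1 - c)) ∧
      (∀ c, 1 ≤ c → c < s.v ρp - s.A φdep (s'.v ρcur) →
        MaxNode (s.A φX) (s.v ρN) (s.A φdep) arm c (s'.A φM c)) ∧
      s.A φX (s.v ρp - (s.A φdep (s'.v ρcur) + s.A φdep (s'.v ρcur))) = s.A φX (s.v ρp) ∧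
      t + (60 * ld (s'.v ρcur) + 24 * (E.m + 1 - (s.v ρp - s.A φdep (s'.v ρcur)))) ≤
        60 * ld (s.v ρcur) + 24 * (E.m + 1 - (s.v ρp - s.A φdep (s.v ρcur))) + 20 ∧
      (∀ r, r ∉ [ρk, ρcn, ρcur] → s'.v r = s.v r) ∧ (∀ f, f ≠ φM → s'.A f = s.A f)) s := by
  have hpos := hE.pos
  have hL := hE.len
  have hW := hE.num
  have htr := h.trie
  have hNpos := htr.lt
  refine Tr.mono (tr_loop (fun n s' =>
    Suf (s.A φX) (s.v ρN) (s.A φdep) arm (s.v ρp) (s'.v ρcur) ∧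
      (∀ c, 1 ≤ c → c < s.v ρp - s.A φdep (s'.v ρcur) →
        ¬ Pal (s.A φX) c (s.v ρp + 1 - c)) ∧
      (∀ c, 1 ≤ c → c < s.v ρp - s.A φdep (s'.v ρcur) →
        MaxNode (s.A φX) (s.v ρN) (s.A φdep) arm c (s'.A φM c)) ∧
      (∀ r, r ∉ [ρk, ρcn, ρcur] → s'.v r = s.v r) ∧ (∀ f, f ≠ φM → s'.A f = s.A f) ∧
      n = 60 * ld (s'.v ρcur) + 24 * (E.m + 1 - (s.v ρp - s.A φdep (s'.v ρcur)))) ?_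
      ⟨hS, hlong, hM, fun _ _ => rfl, fun _ _ => rfl, rfl⟩) ?_
  rotate_left 1
  · rintro s' t ⟨n', ⟨h1, h2, h3, h4, h5, rfl⟩, hx, ht⟩
    simp only [Bx.Holds, Ex.eval, Bx.cost, Ex.cost, h4 ρp (by norm_num),
      h5 φdep (by norm_num), h5 φX (by norm_num), not_not] at hx ht
    exact ⟨h1, h2, h3, hx, by omega, h4, h5⟩
  · rintro n s' ⟨h1, h2, h3, h4, h5, rfl⟩
    have ep := h4 ρp (by norm_num)
    have ed := h5 φdep (by norm_num)
    have eX := h5 φX (by norm_num)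
    have el := h5 φlink (by norm_num)
    have hclt := h1.lt
    have hdlt := h1.dep_lt
    simp only [tr_seq, tr_set, tr_put, Bx.Safe, Bx.Holds, Bx.cost, Ex.Safe, Ex.eval, Ex.cost,
      St.setV_v, St.setV_A, St.setA_v, St.setA_A, ep, ed, eX, el]
    norm_num only [if_true, if_false, and_assoc, true_and, and_true]
    repeat refine And.intro (by omega) ?_
    intro hne
    repeat refine And.intro (by omega) ?_
    -- The root always extends: it has depth `0`, and position `p` is compared with itself.
    have h1c : 1 ≤ s'.v ρcur := by
      by_contra! hc
      have hc0 : s'.v ρcur = 0 := by omega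
      have hd0 : s.A φdep 0 = 0 := by rw [htr.dep_eq 0 (by omega), htr.root]; rfl
      rw [hc0, hd0] at hne
      exact hne rfl
    obtain ⟨k1, k2, k3⟩ := hK.suf_link hPm h1 h1c
    have hb := hX.bound (by omega) (by omega) h1.pal
    have hldl := hK.ld_link _ h1c hclt
    set u := s'.v ρcur with hu
    set w := s.A φlink u with hw
    set P := s.v ρp with hP
    have hnp : ¬ Pal (s.A φX) (P - s.A φdep u) (P + 1 - (P - s.A φdep u)) := by
      rw [show P + 1 - (P - s.A φdep u) = s.A φdep u + 1 by omega, pal_succ]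
      rintro ⟨-, h7⟩
      apply hne
      rw [show P - (s.A φdep u + s.A φdep u) = P - s.A φdep u - s.A φdep u by omega, h7]
      congr 1
      omega
    have k1lt := k1.lt
    refine Tr.mono (copyLoop_spec hE ?_ ?_ ?_ ?_) ?_
    · simp [St.setV_v, St.setA_v]
      omega
    · simp [St.setV_v, St.setA_v]
      omega
    · simp [St.setV_v, St.setA_v]
    · simp [St.setV_v, St.setA_v]
      omega
    · rintro s₂ t₂ ⟨j1, j2, j3, j4, j5⟩
      simp only [St.setV_v, St.setV_A, St.setA_v, St.setA_A] at j1 j2 j3 j4 j5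
      norm_num only [if_true, if_false] at j1 j2 j3 j4 j5
      have ec2 : s₂.v ρcur = w := by
        rw [j4 _ (by norm_num)]
        simp
      rw [ep, ed] at j1 j3
      refine ⟨_, ?_, ?_, ?_, ?_, ?_, rfl, ?_⟩
      · rw [ec2]
        exact k1
      · rw [ec2]
        intro c hc hcw hpal
        rcases lt_trichotomy c (P - s.A φdep u) with hlt | rfl | hgt
        · exact h2 c hc hlt hpal
        · exact hnp hpal
        · exact k3 c hgt hcw (hpal.mono (by omega))
      · rw [ec2]
        intro c hc hcw
        rcases lt_trichotomy c (P - s.A φdep u) with hlt | rfl | hgt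
        · rw [j2 c (by omega), Function.update_of_ne hlt.ne]
          exact h3 c hc hlt
        · rw [j2 _ (by omega), Function.update_self]
          refine ⟨h1c, hclt, h1.pal, ?_, h1.arm_eq⟩
          rwa [show s.A φdep u + 1 = P + 1 - (P - s.A φdep u) by omega]
        · rw [j1 c (by omega) hcw, Function.update_of_ne (by omega)]
          have hold := h3 (2 * (P - s.A φdep u) - c) (by omega) (by omega)
          set v := s'.A φM (2 * (P - s.A φdep u) - c)
          -- Were the mirrored palindrome longer, its reflection would be a palindromic suffix
          -- strictly between `u` and its link.
          have hlt : s.A φdep v < P - c := by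
            by_contra! hge
            refine k3 c hgt hcw ?_
            rw [← h1.pal.mirror hb.1 hgt (by omega)]
            exact hold.pal.mono hge
          have hpal := (h1.pal.mirror hb.1 hgt (r := s.A φdep v) (by omega)).1 hold.pal
          refine ⟨hold.pos, hold.lt, hpal, ?_, ?_⟩
          · rw [← h1.pal.mirror hb.1 hgt (by omega)]
            exact hold.max
          · rw [hold.arm_eq]
            exact h1.pal.armOf_mirror hb.1 hgt (by omega) hpal
      · intro r hr
        simp only [List.mem_cons, List.not_mem_nil, or_false, not_or] at hr
        rw [j4 r hr.1]
        simp [hr, h4 r (by simp [hr])]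
      · intro f hf
        rw [j5 f hf]
        simp [hf, h5 f hf]
      · rw [ec2]
        have := k1.dep_lt
        omega

end Eertree

/-! ### The suffix link of a new palindrome. -/

section Eertree

variable {α : Type u} [LinearOrder α] {E : Env α} {s : St} {σ l : ℕ} {arm : ℕ → List ℕ}
  {ld : ℕ → ℕ}

/-- The same walk as in `chainLoop_spec`, but no centers are settled, so `ld` alone pays for it. The
bound `c` keeps track that everything skipped is centered to the right of the new palindrome's
center. -/
theorem linkLoop_spec (hE : E.Big) {N Q : ℕ} (hN : N ≤ 5 * E.m) (hd0 : s.A φdep 0 = 0)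
    (hK : Links E.m σ N Q (s.A φX) (s.A φdep) (s.A φlink) arm ld)
    (hPm : s.v ρp ≤ E.m + 1)
    (hS : Suf (s.A φX) N (s.A φdep) arm (s.v ρp) (s.v ρw)) {c : ℕ}
    (hc : c < s.v ρp - s.A φdep (s.v ρw))
    (hlong : ∀ k, c < k → k < s.v ρp - s.A φdep (s.v ρw) → ¬ Pal (s.A φX) k (s.v ρp + 1 - k)) :
    Tr E linkLoop (fun s' t =>
      Suf (s.A φX) N (s.A φdep) arm (s.v ρp) (s'.v ρw) ∧
      c < s.v ρp - s.A φdep (s'.v ρw) ∧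
      (∀ k, c < k → k < s.v ρp - s.A φdep (s'.v ρw) → ¬ Pal (s.A φX) k (s.v ρp + 1 - k)) ∧
      s.A φX (s.v ρp - (s.A φdep (s'.v ρw) + s.A φdep (s'.v ρw))) = s.A φX (s.v ρp) ∧
      t + 60 * ld (s'.v ρw) ≤ 60 * ld (s.v ρw) + 20 ∧
      (∀ r, r ≠ ρw → s'.v r = s.v r) ∧ s'.A = s.A) s := by
  have hpos := hE.pos
  have hL := hE.len
  have hW := hE.num
  refine Tr.mono (tr_loop (fun n s' =>
    Suf (s.A φX) N (s.A φdep) arm (s.v ρp) (s'.v ρw) ∧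
      c < s.v ρp - s.A φdep (s'.v ρw) ∧
      (∀ k, c < k → k < s.v ρp - s.A φdep (s'.v ρw) → ¬ Pal (s.A φX) k (s.v ρp + 1 - k)) ∧
      (∀ r, r ≠ ρw → s'.v r = s.v r) ∧ s'.A = s.A ∧ n = 60 * ld (s'.v ρw)) ?_
      ⟨hS, hc, hlong, fun _ _ => rfl, rfl, rfl⟩) ?_
  rotate_left 1
  · rintro s' t ⟨n', ⟨h1, h2, h3, h4, h5, rfl⟩, hx, ht⟩
    simp only [Bx.Holds, Ex.eval, Bx.cost, Ex.cost, h4 ρp (by norm_num), h5, not_not] at hx ht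
    exact ⟨h1, h2, h3, hx, by omega, h4, h5⟩
  · rintro n s' ⟨h1, h2, h3, h4, h5, rfl⟩
    have ep := h4 ρp (by norm_num)
    have hclt := h1.lt
    have hdlt := h1.dep_lt
    simp only [tr_seq, tr_set, tr_put, Bx.Safe, Bx.Holds, Bx.cost, Ex.Safe, Ex.eval, Ex.cost,
      St.setV_v, St.setV_A, St.setA_v, St.setA_A, ep, h5]
    norm_num only [if_true, if_false, and_assoc, true_and, and_true]
    repeat refine And.intro (by omega) ?_
    intro hne
    repeat refine And.intro (by omega) ?_
    have h1c : 1 ≤ s'.v ρw := by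
      by_contra! hc
      have hc0 : s'.v ρw = 0 := by omega
      rw [hc0, hd0] at hne
      exact hne rfl
    obtain ⟨k1, k2, k3⟩ := hK.suf_link hPm h1 h1c
    have hldl := hK.ld_link _ h1c hclt
    set w := s'.v ρw with hw
    set P := s.v ρp with hP
    have hnp : ¬ Pal (s.A φX) (P - s.A φdep w) (P + 1 - (P - s.A φdep w)) := by
      rw [show P + 1 - (P - s.A φdep w) = s.A φdep w + 1 by omega, pal_succ]
      rintro ⟨-, h7⟩
      apply hne
      rw [show P - (s.A φdep w + s.A φdep w) = P - s.A φdep w - s.A φdep w by omega, h7]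
      congr 1
      omega
    refine ⟨_, k1, by omega, ?_, ?_, rfl, by omega⟩
    · intro k hk hkw hpal
      rcases lt_trichotomy k (P - s.A φdep w) with hlt | rfl | hgt
      · exact h3 k hk hlt hpal
      · exact hnp hpal
      · exact k3 k hgt hkw (hpal.mono (by omega))
    · intro r hr
      simp [hr, h4 r hr]

/-- After the new node `q` has been added, its suffix link is set. -/
theorem setLink_spec (hE : E.Big) (h : TrieInv E σ l arm s) {N : ℕ} (hNs : s.v ρN = N + 1)
    (hN : N + 1 ≤ 5 * E.m) (hX : Text E.m σ (s.A φX)) {P u : ℕ} (hP : s.v ρp = P)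
    (hPm : P ≤ E.m) (hy : s.v ρy = s.A φX P)
    (hK : Links E.m σ N P (s.A φX) (s.A φdep) (s.A φlink) arm ld) (hcur : s.v ρcur = u)
    (h1u : 1 ≤ u) (hS : Suf (s.A φX) N (s.A φdep) arm P u)
    (hlong : ∀ c, 1 ≤ c → c < P - s.A φdep u → ¬ Pal (s.A φX) c (P + 1 - c))
    (hmatch : s.A φX (P - (s.A φdep u + s.A φdep u)) = s.A φX P)
    (hq : s.v ρq = N) (hqa : arm N = arm u ++ [s.A φX P])
    {lab₀ dep₀ par₀ : ℕ → ℕ} {arm₀ : ℕ → List ℕ} (ht₀ : Trie σ N lab₀ dep₀ par₀ arm₀)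
    (hold : ∀ v < N, arm v = arm₀ v) :
    Tr E setLink (fun s' t => ∃ arm' ld',
      TrieInv E σ l arm' s' ∧ (∀ v < N + 1, arm' v = arm v) ∧
      Links E.m σ (N + 1) (P + 1) (s.A φX) (s'.A φdep) (s'.A φlink) arm' ld' ∧
      s'.v ρN = N + 1 ∧ s'.v ρq = N ∧
      t + 60 * ld' N ≤ 60 * ld u + 40 * l + 250 ∧
      (∀ r, r ∉ [ρsa, ρz, ρq, ρN, ρw, ρt, ρu] → s'.v r = s.v r) ∧
      (∀ f, f ∉ [φlab, φsl, φpar, φdep, φlink] → s'.A f = s.A f)) s := by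
  have hpos := hE.pos
  have hL := hE.len
  have hW := hE.num
  have htr := h.trie
  rw [hNs] at htr
  have hlt0 := ht₀.lt
  have hcl := hS.lt
  have hdl := hS.dep_lt
  have hd0 : s.A φdep 0 = 0 := by rw [htr.dep_eq 0 (by omega), htr.root]; rfl
  have hyσ : s.v ρy < σ := by rw [hy]; exact hX.lt P (by omega) hPm
  have hσm := h.le_m
  obtain ⟨k1, k2, k3⟩ := hK.suf_link (by omega) hS h1u
  have hldl := hK.ld_link _ h1u hcl
  have k1lt := k1.lt
  have k1d := k1.dep_lt
  rw [setLink]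
  simp only [tr_seq, tr_set, Ex.Safe, Ex.eval, Ex.cost, St.setV_v, St.setV_A, hcur]
  norm_num only [if_true, if_false, and_assoc, true_and, and_true]
  repeat refine And.intro (by omega) ?_
  set c := P - s.A φdep u with hc
  have hw0 := linkLoop_spec (σ := σ) (arm := arm) (ld := ld) (N := N) (Q := P) (c := c)
    (s := (s.setV ρw (s.A φlink u)).setV ρt (s.v ρq)) hE (by omega) hd0 hK
    (by simp [St.setV_v, hP]; omega) (by simp only [St.setV_v, St.setV_A]; norm_num only [if_true, if_false]; rw [hP]; exact k1)
    (by simp only [St.setV_v, St.setV_A]; norm_num only [if_true, if_false]; omega)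
    (by
      simp only [St.setV_v, St.setV_A]
      norm_num only [if_true, if_false]
      rw [hP]
      intro k hk hkw hpal
      exact k3 k hk hkw (hpal.mono (by omega)))
  refine hw0.mono ?_
  rintro s₁ t₁ ⟨w1, w2, w3, w4, w5, w6, w7⟩
  simp only [St.setV_v, St.setV_A] at w1 w2 w3 w4 w5 w6 w7
  norm_num only [if_true, if_false] at w1 w2 w3 w4 w5 w6 w7
  rw [hP] at w1 w2 w3 w4
  have w1lt := w1.lt
  have w1d := w1.dep_lt
  have e1 : ∀ r, r ≠ ρw → r ≠ ρt → s₁.v r = s.v r := fun r hr hr' => by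
    rw [w6 r hr]
    simp [hr, hr']
  have et : s₁.v ρt = N := by rw [w6 _ (by norm_num)]; simp [hq]
  have ey : s₁.v ρy = s.v ρy := e1 _ (by norm_num) (by norm_num)
  have hTI1 : TrieInv E σ l arm s₁ :=
    h.congr (e1 _ (by norm_num) (by norm_num)) (e1 _ (by norm_num) (by norm_num))
      (fun f _ => by rw [w7])
  set w := s₁.v ρw with hw
  set k := P - s.A φdep w with hk
  have hldw : ld w ≤ ld (s.A φlink u) := by omega
  have hpk : Pal (s.A φX) k (P + 1 - k) := by
    rw [show P + 1 - k = s.A φdep w + 1 by omega, pal_succ]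
    refine ⟨w1.pal, ?_⟩
    rw [show k - s.A φdep w = P - (s.A φdep w + s.A φdep w) by omega, w4]
    congr 1
    omega
  have hpc : Pal (s.A φX) c (P + 1 - c) := by
    rw [show P + 1 - c = s.A φdep u + 1 by omega, pal_succ]
    refine ⟨hS.pal, ?_⟩
    rw [show c - s.A φdep u = P - (s.A φdep u + s.A φdep u) by omega, hmatch]
    congr 1
    omega
  have harmN : arm N = armOf (s.A φX) c (P + 1 - c) := by
    rw [show P + 1 - c = s.A φdep u + 1 by omega, armOf_succ, ← hS.arm_eq, hqa]
    congr 3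
    omega
  have harmk : armOf (s.A φX) k (P + 1 - k) = arm w ++ [s.A φX P] := by
    rw [show P + 1 - k = s.A φdep w + 1 by omega, armOf_succ, ← w1.arm_eq]
    congr 3
    omega
  have hcpos : 1 ≤ c := by omega
  have hdu : 1 ≤ s.A φdep u := by omega
  -- Both cases below end with a node for the palindrome around `k`. It is shorter than the new
  -- palindrome, hence an old node, and by `ld_child` its `ld` is at most one more than that of `w`.
  have hkey : ∀ {lab' dep' par' : ℕ → ℕ} {arm' : ℕ → List ℕ} {lk : ℕ},
      Trie σ (N + 1) lab' dep' par' arm' → (∀ v < N + 1, arm' v = arm v) → lk < N + 1 →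
      arm' lk = armOf (s.A φX) k (P + 1 - k) →
      Links E.m σ (N + 1) (P + 1) (s.A φX) dep' (Function.update (s.A φlink) N lk) arm'
      (Function.update ld N (ld lk + 1)) ∧ ld lk ≤ ld w + 1 := by
    intro lab' dep' par' arm' lk ht' ha' hlk hlka
    rw [ha' lk hlk] at hlka
    have hne : lk ≠ N := by
      rintro rfl
      have := congrArg List.length (hlka.symm.trans harmN)
      rw [length_armOf, length_armOf] at this
      omega
    have hlkN : lk < N := by omega
    have hld := hK.ld_child w w1lt lk hlkN (s.A φX P) (by rw [hlka, harmk])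
    refine ⟨(hK.congr (dep' := dep₀) (arm' := arm₀) ?_ ?_).insert hX ht₀ ht' ?_ hPm hcl
      (by rw [ha' N (by omega), hqa, hold u hcl])
      hcpos (by omega) hpc (by rw [ha' N (by omega), harmN]) hlong w2 (by omega) hpk w3 hlkN
      (by rw [← hold lk hlkN, hlka]) (by omega), hld⟩
    · intro v hv
      rw [ht₀.dep_eq v hv, htr.dep_eq v (by omega), hold v hv]
    · intro v hv
      rw [hold v hv]
    · intro v hv
      rw [ha' v (by omega), hold v hv]
  -- The palindrome around `k` is reflected inside the one around `c` and occurred before, so the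
  -- lookup for the link cannot create a node.
  obtain ⟨lk₀, hlk₀, hlka₀⟩ := hK.exists_suffix hX hcpos hPm w2 (by omega) hpc hpk
  rw [tr_ite]
  simp only [tr_seq, tr_set, tr_put, Bx.Safe, Bx.Holds, Bx.cost, Ex.Safe, Ex.eval, Ex.cost,
      St.setV_v, St.setV_A, St.setA_v, St.setA_A, ← hw, ey]
  norm_num only [if_true, if_false, and_assoc, true_and, and_true]
  repeat refine And.intro (by omega) ?_
  refine ⟨fun hw0 => ?_, fun hw0 => ?_⟩
  · repeat refine And.intro (by omega) ?_
    have hd0w : s.A φdep w = 0 := by rw [hw0, hd0]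
    obtain ⟨q1, q2⟩ := hkey (lk := s.v ρy + 1) htr (fun _ _ => rfl) (by omega) (by
      rw [htr.single _ hyσ, harmk, hw0, htr.root, hy]
      rfl)
    refine ⟨arm, Function.update ld N (ld (s.v ρy + 1) + 1), ?_, fun _ _ => rfl, ?_, ?_, ?_, ?_,
      ?_, ?_⟩
    · refine hTI1.congr ?_ ?_ ?_
      · simp [St.setV_v, St.setA_v]
      · simp [St.setV_v, St.setA_v]
      · intro f hf
        have : f ≠ φlink := by
          rintro rfl
          simp at hf
        simp [St.setV_A, St.setA_A, this]
    · rw [w7, et]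
      exact q1
    · rw [e1 _ (by norm_num) (by norm_num), hNs]
    · exact et
    · rw [Function.update_self]
      omega
    · intro r hr
      simp only [List.mem_cons, List.not_mem_nil, or_false, not_or] at hr
      simp [hr, e1 r]
    · intro f hf
      simp only [List.mem_cons, List.not_mem_nil, or_false, not_or] at hf
      simp [hf, w7]
  · have hTI2 : TrieInv E σ l arm (s₁.setV ρu w) :=
      hTI1.congr (by simp [St.setV_v]) (by simp [St.setV_v]) (fun _ _ => rfl)
    have eN : s₁.v ρN = N + 1 := by rw [e1 _ (by norm_num) (by norm_num), hNs]
    refine (lookup_spec hE hTI2 ?_ ?_ ?_ ?_).mono ?_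
    · simp [St.setV_v]
      omega
    · simp [St.setV_v]
      omega
    · simp [St.setV_v]
      omega
    · simp [St.setV_v]
      omega
    rintro s₂ t₂ ⟨⟨arm', r1, r2, r3⟩, r4, r5, r6, r7⟩
    simp only [St.setV_v, St.setV_A] at r2 r3 r4 r5 r6 r7
    norm_num only [if_true, if_false] at r2 r3 r4 r5 r6 r7
    rw [eN] at r2 r4
    rw [ey, hy] at r3
    have et2 : s₂.v ρt = N := by rw [r6 _ (by norm_num)]; simp [et]
    have hq' : s₂.v ρN = N + 1 ∧ s₂.v ρq < N + 1 := by
      rcases r4 with r4 | ⟨r4, r4'⟩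
      · exact r4
      · exfalso
        have := r1.trie.inj (s₂.v ρq) (by omega) lk₀ (by omega)
          (by rw [r3, r2 lk₀ (by omega), hlka₀, harmk])
        omega
    have htr2 := r1.trie
    rw [hq'.1] at htr2
    obtain ⟨q1, q2⟩ := hkey (lk := s₂.v ρq) htr2 r2 hq'.2 (by rw [r3, harmk])
    repeat refine And.intro (by omega) ?_
    refine ⟨arm', Function.update ld N (ld (s₂.v ρq) + 1), ?_, r2, ?_, ?_, ?_, ?_,
      ?_, ?_⟩
    · refine r1.congr ?_ ?_ ?_
      · simp [St.setV_v, St.setA_v]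
      · simp [St.setV_v, St.setA_v]
      · intro f hf
        have : f ≠ φlink := by
          rintro rfl
          simp at hf
        simp [St.setV_A, St.setA_A, this]
    · rw [r7 φlink (by norm_num), w7, et2]
      exact q1
    · exact hq'.1
    · exact et2
    · rw [Function.update_self]
      omega
    · intro r hr
      simp only [List.mem_cons, List.not_mem_nil, or_false, not_or] at hr
      simp [hr, e1 r, r6 r]
    · intro f hf
      simp only [List.mem_cons, List.not_mem_nil, or_false, not_or] at hf
      simp [hf, w7, r7 f]

end Eertree

/-! ### Extension by one letter, and the whole scan of the text. -/

section Eertree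

variable {α : Type u} [LinearOrder α] {E : Env α} {s : St} {σ l : ℕ} {arm : ℕ → List ℕ}
  {ld : ℕ → ℕ}

/-- Attaching a letter at both ends raises the number of palindromic suffixes by at most one. So the
potential grows by at most `60` beyond what the walk for the suffix link consumes, and the two
lookups account for `80 * l`. -/
theorem extend_spec (hE : E.Big) (h : TrieInv E σ l arm s) {N P u : ℕ} (hNs : s.v ρN = N)
    (hN : N + 1 ≤ 5 * E.m) (hX : Text E.m σ (s.A φX)) (hP : s.v ρp = P)
    (hPm : P ≤ E.m) (hcur : s.v ρcur = u)
    (hK : Links E.m σ N P (s.A φX) (s.A φdep) (s.A φlink) arm ld)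
    (hS : Suf (s.A φX) N (s.A φdep) arm P u)
    (hlong : ∀ c, 1 ≤ c → c < P - s.A φdep u → ¬ Pal (s.A φX) c (P + 1 - c))
    (hmatch : s.A φX (P - (s.A φdep u + s.A φdep u)) = s.A φX P) :
    Tr E extend (fun s' t => (∃ arm' ld', TrieInv E σ l arm' s' ∧ (∀ v < N, arm' v = arm v) ∧
      Links E.m σ (s'.v ρN) (P + 1) (s.A φX) (s'.A φdep) (s'.A φlink) arm' ld' ∧
      Suf (s.A φX) (s'.v ρN) (s'.A φdep) arm' (P + 1) (s'.v ρcur) ∧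
      t + 60 * ld' (s'.v ρcur) ≤ 60 * ld u + 80 * l + 450) ∧
      (∀ v < N, s'.A φdep v = s.A φdep v) ∧ s'.A φdep (s'.v ρcur) = s.A φdep u + 1 ∧
      N ≤ s'.v ρN ∧ s'.v ρN ≤ N + 1 ∧
      (∀ r, r ∉ [ρsa, ρz, ρq, ρN, ρw, ρt, ρu, ρy, ρn0, ρcur] → s'.v r = s.v r) ∧
      (∀ f, f ∉ [φlab, φsl, φpar, φdep, φlink] → s'.A f = s.A f)) s := by
  have hpos := hE.pos
  have hL := hE.len
  have hW := hE.num
  have htr := h.trie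
  rw [hNs] at htr
  have hlt0 := htr.lt
  have hcl := hS.lt
  have hdl := hS.dep_lt
  have hd0 : s.A φdep 0 = 0 := by rw [htr.dep_eq 0 (by omega), htr.root]; rfl
  have hyσ : s.A φX P < σ := hX.lt P (by omega) hPm
  have hσm := h.le_m
  set c := P - s.A φdep u with hc
  have hpc : Pal (s.A φX) c (P + 1 - c) := by
    rw [show P + 1 - c = s.A φdep u + 1 by omega, pal_succ]
    refine ⟨hS.pal, ?_⟩
    rw [show c - s.A φdep u = P - (s.A φdep u + s.A φdep u) by omega, hmatch]
    congr 1
    omega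
  have harmc : armOf (s.A φX) c (P + 1 - c) = arm u ++ [s.A φX P] := by
    rw [show P + 1 - c = s.A φdep u + 1 by omega, armOf_succ, ← hS.arm_eq]
    congr 3
    omega
  have hdepc : ∀ {N' : ℕ} {lab' dep' par' : ℕ → ℕ} {arm' : ℕ → List ℕ} {v : ℕ},
      Trie σ N' lab' dep' par' arm' → v < N' → arm' v = armOf (s.A φX) c (P + 1 - c) →
      dep' v = s.A φdep u + 1 := by
    intro N' lab' dep' par' arm' v ht hv ha
    rw [ht.dep_eq v hv, ha, length_armOf]
    omega
  have hsufc : ∀ {N' : ℕ} {lab' dep' par' : ℕ → ℕ} {arm' : ℕ → List ℕ} {v : ℕ},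
      Trie σ N' lab' dep' par' arm' → v < N' → arm' v = armOf (s.A φX) c (P + 1 - c) →
      Suf (s.A φX) N' dep' arm' (P + 1) v := by
    intro N' lab' dep' par' arm' v ht hv ha
    have hd := hdepc ht hv ha
    have e1 : P + 1 - dep' v = c := by omega
    have e2 : dep' v = P + 1 - c := by omega
    refine ⟨hv, by omega, ?_, ?_⟩
    · rw [e1, e2]
      exact hpc
    · rw [e1, e2, ha]
  rw [extend]
  simp only [tr_seq, tr_ite, tr_set, Bx.Safe, Bx.Holds, Bx.cost, Ex.Safe, Ex.eval, Ex.cost,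
    St.setV_v, St.setV_A, hP]
  norm_num only [if_true, if_false, and_assoc, true_and, and_true]
  repeat refine And.intro (by omega) ?_
  refine ⟨fun hu0 => ?_, fun hu0 => ?_⟩
  · rw [hcur] at hu0
    repeat refine And.intro (by omega) ?_
    have ha : arm (s.A φX P + 1) = armOf (s.A φX) c (P + 1 - c) := by
      rw [htr.single _ hyσ, harmc, hu0, htr.root]
      rfl
    have hld := hK.ld_child u hcl (s.A φX P + 1) (by omega) (s.A φX P) (by rw [ha, harmc])
    refine ⟨⟨arm, ld, ?_, fun _ _ => rfl, ?_, ?_, ?_⟩, by simp, ?_, ?_, ?_, ?_, ?_⟩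
    · exact h.congr (by simp [St.setV_v]) (by simp [St.setV_v]) (fun _ _ => rfl)
    · rw [hNs]
      exact hK.step hX hPm (by omega) (by omega) hpc hlong ⟨_, by omega, ha⟩
    · rw [hNs]
      exact hsufc htr (by omega) ha
    · omega
    · exact hdepc htr (by omega) ha
    · omega
    · omega
    · intro r hr
      simp only [List.mem_cons, List.not_mem_nil, or_false, not_or] at hr
      simp [hr]
    · intro f hf
      trivial
  · rw [hcur] at hu0
    refine (lookup_spec hE (h.congr (s' := ((s.setV ρy (s.A φX P)).setV ρu (s.v ρcur)).setV ρn0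
      (s.v ρN)) (by simp [St.setV_v]) (by simp [St.setV_v]) (fun _ _ => rfl)) ?_ ?_ ?_ ?_).mono ?_
    · simp [St.setV_v]
      omega
    · simp [St.setV_v]
      omega
    · simp [St.setV_v]
      omega
    · simpa [St.setV_v] using hyσ
    rintro s₁ t₁ ⟨⟨arm₁, r1, r2, r3⟩, r4, r5, r6, r7⟩
    simp only [St.setV_v, St.setV_A] at r2 r3 r4 r5 r6 r7
    norm_num only [if_true, if_false] at r2 r3 r4 r5 r6 r7
    rw [hNs] at r2 r4
    rw [hcur] at r3
    have en0 : s₁.v ρn0 = N := by rw [r6 _ (by norm_num)]; simp [hNs]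
    have ecur : s₁.v ρcur = u := by rw [r6 _ (by norm_num)]; simp [hcur]
    have ep : s₁.v ρp = P := by rw [r6 _ (by norm_num)]; simp [hP]
    have ey : s₁.v ρy = s.A φX P := by rw [r6 _ (by norm_num)]; simp
    have eX : s₁.A φX = s.A φX := r7 _ (by norm_num)
    have elink : s₁.A φlink = s.A φlink := r7 _ (by norm_num)
    have htr1 := r1.trie
    have hN1 : N ≤ s₁.v ρN := by omega
    have hdep1 : ∀ v < N, s₁.A φdep v = s.A φdep v := fun v hv => by
      rw [htr1.dep_eq v (by omega), htr.dep_eq v hv, r2 v hv]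
    have hK1 := hK.congr hdep1 r2
    have hS1 := hS.congr (hdep1 u hcl) (r2 u hcl)
    have har : arm₁ (s₁.v ρq) = armOf (s.A φX) c (P + 1 - c) := by rw [r3, harmc]
    simp only [tr_seq, tr_ite, tr_set, tr_skip, Bx.Safe, Bx.Holds, Bx.cost, Ex.Safe, Ex.eval,
      Ex.cost, St.setV_v, St.setV_A]
    norm_num only [if_true, if_false, and_assoc, true_and, and_true]
    rw [en0]
    refine ⟨fun hq => ?_, fun hq => ?_⟩
    · have hN' : s₁.v ρN = N + 1 := by omega
      refine (setLink_spec hE r1 hN' hN (by rw [eX]; exact hX) ep hPm (by rw [eX, ey])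
        (by rw [eX, elink]; exact hK1) ecur (by omega) (by rw [eX]; exact hS1)
        (by rw [eX, hdep1 u hcl]; exact hlong) (by rw [eX, hdep1 u hcl]; exact hmatch) hq
        (by rw [eX, ← r2 u hcl] at *; rw [← hq]; rw [r3, r2 u hcl]) htr r2).mono ?_
      rintro s₂ t₂ ⟨arm₂, ld₂, a1, a2, a3, a4, a5, a6, a7, a8⟩
      have htr2 := a1.trie
      have ha2 : arm₂ (s₂.v ρq) = armOf (s.A φX) c (P + 1 - c) := by
        rw [a2 _ (by omega), a5, ← hq, har]
      have hdep2 : ∀ v < N, s₂.A φdep v = s.A φdep v := fun v hv => by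
        rw [htr2.dep_eq v (by omega), htr.dep_eq v hv, a2 v (by omega), r2 v hv]
      refine ⟨⟨arm₂, ld₂, ?_, ?_, ?_, ?_, ?_⟩, hdep2, ?_, ?_, ?_, ?_, ?_⟩
      · exact a1.congr (by simp [St.setV_v]) (by simp [St.setV_v]) (fun _ _ => rfl)
      · intro v hv
        rw [a2 v (by omega), r2 v hv]
      · rw [a4, ← eX]
        exact a3
      · exact hsufc htr2 (by omega) ha2
      · rw [a5]
        omega
      · exact hdepc htr2 (by omega) ha2
      · omega
      · omega
      · intro r hr
        simp only [List.mem_cons, List.not_mem_nil, or_false, not_or] at hr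
        simp [hr, a7 r, r6 r]
      · intro f hf
        simp only [List.mem_cons, List.not_mem_nil, or_false, not_or] at hf
        simp [hf, a8 f, r7 f]
    · have hN' : s₁.v ρN = N := by omega
      have hqN : s₁.v ρq < N := by omega
      rw [hN'] at htr1
      have hld := hK1.ld_child u hcl (s₁.v ρq) hqN (s.A φX P) (by rw [har, harmc, r2 u hcl])
      refine ⟨⟨arm₁, ld, ?_, r2, ?_, ?_, ?_⟩, hdep1, ?_, ?_, ?_, ?_, ?_⟩
      · exact r1.congr (by simp [St.setV_v]) (by simp [St.setV_v]) (fun _ _ => rfl)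
      · rw [hN', elink]
        exact hK1.step hX hPm (by omega) (by omega) hpc hlong ⟨_, hqN, har⟩
      · rw [hN']
        exact hsufc htr1 hqN har
      · omega
      · exact hdepc htr1 hqN har
      · omega
      · omega
      · intro r hr
        simp only [List.mem_cons, List.not_mem_nil, or_false, not_or] at hr
        simp [hr, r6 r]
      · intro f hf
        simp only [List.mem_cons, List.not_mem_nil, or_false, not_or] at hf
        simp [hf, r7 f]

/-- Initially the nodes other than the root are the single letters. Their links are the zeros of a
fresh array, which already denote the root. -/
theorem Links.init {m : ℕ} {X lab dep par link : ℕ → ℕ}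
    (ht : Trie σ (σ + 1) lab dep par arm) (hX : Text m σ X)
    (hl : ∀ v, link v = 0) :
    Links m σ (σ + 1) 1 X dep link arm (fun v => if v = 0 then 0 else 1) := by
  have ha : ∀ v, 1 ≤ v → v < σ + 1 → arm v = [v - 1] := fun v h1 h2 => by
    have := ht.single (v - 1) (by omega)
    rwa [Nat.sub_add_cancel h1] at this
  have hd0 : dep 0 = 0 := by rw [ht.dep_eq 0 (by omega), ht.root]; rfl
  have hd : ∀ v, 1 ≤ v → v < σ + 1 → dep v = 1 := fun v h1 h2 => by
    rw [ht.dep_eq v h2, ha v h1 h2]; rfl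
  refine ⟨?_, ?_, ?_, ?_, rfl, ?_, ?_⟩
  · intro k D h1 h2 h3
    omega
  · intro v h1 h2
    obtain ⟨k, hk1, hkm, hk⟩ := hX.surj (v - 1) (by omega)
    refine ⟨k, hk1, hkm, ?_, ?_⟩
    · rw [hd v h1 h2]
      exact pal_one
    · rw [hd v h1 h2, ha v h1 h2, armOf_one, hk]
  · intro v h1 h2
    rw [hl, hd v h1 h2, hd0]
    omega
  · intro v h1 h2 k hk hkm hp hv
    rw [hl, hd0, hd v h1 h2, ht.root]
    exact ⟨pal_zero, rfl, fun c hc1 hc2 => by omega⟩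
  · intro v h1 h2
    simp [hl, show v ≠ 0 by omega]
  · intro u hu v hv y he
    have := ht.one_le_of_arm he
    simp [show v ≠ 0 by omega]

/-- The costs of the single positions telescope. At most one node is created per position, which
bounds the number of nodes. -/
theorem eertreeLoop_spec (hE : E.Big) (h : TrieInv E σ l arm s) (hNs : s.v ρN = σ + 1)
    (hX : Text E.m σ (s.A φX)) (hl : ∀ v, s.A φlink v = 0) :
    Tr E eertreeLoop (fun s' t => (∃ arm', TrieInv E σ l arm' s' ∧
      (∀ v, 1 ≤ v → v < s'.v ρN → ∃ k, 1 ≤ k ∧ k ≤ E.m ∧ Pal (s.A φX) k (s'.A φdep v) ∧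
        arm' v = armOf (s.A φX) k (s'.A φdep v)) ∧
      (∀ k D, 1 ≤ k → 1 ≤ D → k + D ≤ E.m + 1 → Pal (s.A φX) k D →
        ∃ v < s'.v ρN, arm' v = armOf (s.A φX) k D) ∧
      (∀ c, 1 ≤ c → c ≤ E.m → MaxNode (s.A φX) (s'.v ρN) (s'.A φdep) arm' c (s'.A φM c))) ∧
      s'.v ρN ≤ σ + 1 + E.m ∧ t ≤ (80 * l + 700) * (E.m + 1) ∧
      (∀ r, r ∉ [ρk, ρcn, ρp, ρsa, ρz, ρq, ρN, ρw, ρt, ρu, ρy, ρn0, ρcur] → s'.v r = s.v r) ∧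
      (∀ f, f ∉ [φM, φlab, φsl, φpar, φdep, φlink] → s'.A f = s.A f)) s := by
  have hpos := hE.pos
  have hL := hE.len
  have hW := hE.num
  have htr := h.trie
  rw [hNs] at htr
  have hd0 : s.A φdep 0 = 0 := by rw [htr.dep_eq 0 (by omega), htr.root]; rfl
  have hσm := h.le_m
  have hm := h.hm
  rw [eertreeLoop]
  simp only [tr_seq, tr_set, Ex.Safe, Ex.eval, Ex.cost]
  norm_num only [if_true, if_false, and_assoc, true_and, and_true]
  repeat refine And.intro (by omega) ?_
  refine Tr.mono (tr_loop (fun n s' =>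
    (∀ r, r ∉ [ρk, ρcn, ρp, ρsa, ρz, ρq, ρN, ρw, ρt, ρu, ρy, ρn0, ρcur] → s'.v r = s.v r) ∧
    (∀ f, f ∉ [φM, φlab, φsl, φpar, φdep, φlink] → s'.A f = s.A f) ∧
    1 ≤ s'.v ρp ∧ s'.v ρp ≤ E.m + 1 ∧ s'.v ρN ≤ σ + s'.v ρp ∧
    ∃ arm' ld', TrieInv E σ l arm' s' ∧
      Links E.m σ (s'.v ρN) (s'.v ρp) (s.A φX) (s'.A φdep) (s'.A φlink) arm' ld' ∧
      Suf (s.A φX) (s'.v ρN) (s'.A φdep) arm' (s'.v ρp) (s'.v ρcur) ∧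
      (∀ c, 1 ≤ c → c < s'.v ρp - s'.A φdep (s'.v ρcur) →
        ¬ Pal (s.A φX) c (s'.v ρp - c)) ∧
      (∀ c, 1 ≤ c → c < s'.v ρp - s'.A φdep (s'.v ρcur) →
        MaxNode (s.A φX) (s'.v ρN) (s'.A φdep) arm' c (s'.A φM c)) ∧
      -- A fixed amount for each remaining position, `60` for each palindromic suffix of `cur`, and
      -- `24` for each center that is not settled.
      n = (80 * l + 500) * (E.m + 1 - s'.v ρp) + 60 * ld' (s'.v ρcur) +
        24 * (E.m + 1 - (s'.v ρp - s'.A φdep (s'.v ρcur)))) (n := (80 * l + 500) * E.m +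
          24 * E.m) ?_ ?_) ?_
  · rintro n s₀ ⟨b1, b2, b3, b4, b5, arm₀, ld₀, c1, c2, c3, c4, c5, rfl⟩
    have em : s₀.v ρm = E.m := by rw [b1 _ (by norm_num), hm]
    have eX : s₀.A φX = s.A φX := b2 _ (by norm_num)
    have hcd := c3.dep_lt
    simp only [tr_seq, Bx.Safe, Bx.Holds, Bx.cost, Ex.Safe, Ex.eval, Ex.cost, em]
    norm_num only [if_true, if_false, and_assoc, true_and, and_true]
    repeat refine And.intro (by omega) ?_
    intro hlt
    refine (chainLoop_spec hE c1 (by omega) (by rw [eX]; exact hX) (by rw [eX]; exact c2) b4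
      (by rw [eX]; exact c3) (by
        rw [eX]
        exact fun c hc hcd hp => c4 c hc hcd (hp.mono (by omega)))
      (by rw [eX]; exact c5)).mono ?_
    rintro s₁ t₁ ⟨d1, d2, d3, d4, d5, d6, d7⟩
    have e1N : s₁.v ρN = s₀.v ρN := d6 _ (by norm_num)
    have e1p : s₁.v ρp = s₀.v ρp := d6 _ (by norm_num)
    have e1m : s₁.v ρm = E.m := by rw [d6 _ (by norm_num), em]
    have e1X : s₁.A φX = s.A φX := by rw [d7 _ (by norm_num), eX]
    have e1d : s₁.A φdep = s₀.A φdep := d7 _ (by norm_num)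
    have e1l : s₁.A φlink = s₀.A φlink := d7 _ (by norm_num)
    have hc1 : TrieInv E σ l arm₀ s₁ := c1.congr (by rw [e1m, em]) e1N (fun f hf => d7 f (by
      rintro rfl
      simp at hf))
    rw [eX] at d1 d2 d3 d4
    have hd1 := d1.dep_lt
    refine (extend_spec hE hc1 e1N (by omega) (by rw [e1X]; exact hX) e1p (by omega) rfl
      (by rw [e1X, e1d, e1l]; exact c2) (by rw [e1X, e1d]; exact d1)
      (by rw [e1X, e1d]; exact d2) (by rw [e1X, e1d]; exact d4)).mono ?_
    rintro s₂ t₂ ⟨⟨arm₂, ld₂, f1, f2, f3, f4, f5⟩, f6, f7, f8, f9, f10, f11⟩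
    have e2p : s₂.v ρp = s₀.v ρp := by rw [f10 _ (by norm_num), e1p]
    have e2M : s₂.A φM = s₁.A φM := f11 _ (by norm_num)
    rw [e1X] at f3 f4
    rw [e1d] at f6 f7
    simp only [tr_set, Ex.Safe, Ex.eval, Ex.cost, St.setV_v, St.setV_A, e2p]
    norm_num only [if_true, if_false, and_assoc, true_and, and_true]
    repeat refine And.intro (by omega) ?_
    have hcen : s₀.v ρp + 1 - s₂.A φdep (s₂.v ρcur) = s₀.v ρp - s₀.A φdep (s₁.v ρcur) := by
      omega
    refine ⟨(80 * l + 500) * (E.m + 1 - (s₀.v ρp + 1)) + 60 * ld₂ (s₂.v ρcur) +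
        24 * (E.m + 1 - (s₀.v ρp + 1 - s₂.A φdep (s₂.v ρcur))), ?_, ?_, by omega, by omega,
        by omega, ⟨arm₂, ld₂, ?_, f3, f4, ?_, ?_, rfl⟩, ?_⟩
    · intro r hr
      simp only [List.mem_cons, List.not_mem_nil, or_false, not_or] at hr
      simp [hr, f10 r, d6 r, b1 r]
    · intro f hf
      simp only [List.mem_cons, List.not_mem_nil, or_false, not_or] at hf
      simp [hf, f11 f, d7 f, b2 f]
    · exact f1.congr (by simp [St.setV_v]) (by simp [St.setV_v]) (fun _ _ => rfl)
    · rw [hcen]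
      exact d2
    · rw [hcen, e2M]
      exact fun c hc hcc => (d3 c hc hcc).congr f8 f6 f2
    · rw [hcen]
      have e3 : E.m + 1 - s₀.v ρp = E.m + 1 - (s₀.v ρp + 1) + 1 := by omega
      rw [e3, Nat.mul_add]
      omega
  · refine ⟨?_, fun _ _ => rfl, ?_, ?_, ?_, arm, fun v => if v = 0 then 0 else 1, ?_, ?_, ?_, ?_,
      ?_, ?_⟩
    · intro r hr
      simp only [List.mem_cons, List.not_mem_nil, or_false, not_or] at hr
      simp [St.setV_v, hr]
    · simp [St.setV_v]
    · simp [St.setV_v]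
    · simp [St.setV_v, hNs]
    · exact h.congr (by simp [St.setV_v]) (by simp [St.setV_v]) (fun _ _ => rfl)
    · simp only [St.setV_v, St.setV_A]
      norm_num only [if_true, if_false]
      rw [hNs]
      exact Links.init htr hX hl
    · simp only [St.setV_v, St.setV_A]
      norm_num only [if_true, if_false]
      exact ⟨by omega, by omega, by rw [hd0]; exact pal_zero, by rw [hd0, htr.root]; rfl⟩
    · simp only [St.setV_v, St.setV_A]
      norm_num only [if_true, if_false]
      intro c hc1 hc2
      omega
    · simp only [St.setV_v, St.setV_A]
      norm_num only [if_true, if_false]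
      intro c hc1 hc2
      omega
    · simp [St.setV_v, St.setV_A, hd0]
  · rintro s₀ t₀ ⟨n', ⟨b1, b2, b3, b4, b5, arm₀, ld₀, c1, c2, c3, c4, c5, rfl⟩, hx, ht⟩
    have em : s₀.v ρm = E.m := by rw [b1 _ (by norm_num), hm]
    have eX : s₀.A φX = s.A φX := b2 _ (by norm_num)
    simp only [Bx.Holds, Bx.cost, Ex.eval, Ex.cost, em] at hx ht
    have hp : s₀.v ρp = E.m + 1 := by omega
    refine (chainLoop_spec hE c1 (by omega) (by rw [eX]; exact hX) (by rw [eX]; exact c2) b4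
      (by rw [eX]; exact c3) (by
        rw [eX]
        exact fun c hc hcd hp => c4 c hc hcd (hp.mono (by omega)))
      (by rw [eX]; exact c5)).mono ?_
    rintro s₁ t₁ ⟨d1, d2, d3, d4, d5, d6, d7⟩
    have e1N : s₁.v ρN = s₀.v ρN := d6 _ (by norm_num)
    have e1m : s₁.v ρm = E.m := by rw [d6 _ (by norm_num), em]
    have e1d : s₁.A φdep = s₀.A φdep := d7 _ (by norm_num)
    rw [eX] at d1 d2 d3 d4
    have hd1 := d1.dep_lt
    -- The right mark occurs nowhere else in the text, so only the root extends to it.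
    have hlast : s₀.A φdep (s₁.v ρcur) = 0 := by
      by_contra hne
      rw [hp, hX.right] at d4
      have := hX.le_m (c := E.m + 1 - (s₀.A φdep (s₁.v ρcur) + s₀.A φdep (s₁.v ρcur))) (by omega)
      omega
    refine ⟨⟨arm₀, c1.congr (by rw [e1m, em]) e1N (fun f hf => d7 f (by
      rintro rfl
      simp at hf)), ?_, ?_, ?_⟩, ?_, ?_, ?_, ?_⟩
    · rw [e1N, e1d]
      exact c2.sound
    · rw [e1N]
      rw [hp] at c2
      exact c2.complete
    · rw [e1N, e1d]
      intro c hc hcm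
      exact d3 c hc (by omega)
    · omega
    · have : (80 * l + 700) * (E.m + 1) = (80 * l + 500) * E.m + 80 * l + 200 * E.m + 700 := by
        ring
      omega
    · intro r hr
      simp only [List.mem_cons, List.not_mem_nil, or_false, not_or] at hr
      simp [hr, d6 r, b1 r]
    · intro f hf
      simp only [List.mem_cons, List.not_mem_nil, or_false, not_or] at hf
      simp [hf, d7 f, b2 f]

end Eertree

/-! ### Paths: maximal palindromes extended by a common part of the next two runs. -/

section Partial

variable {α : Type u} [LinearOrder α] {E : Env α} {s : St} {σ l : ℕ} {arm : ℕ → List ℕ}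

/-- The string of runs that is read off outwards from the center `c` up to the first mismatch; the
last run may be a common part of two runs. -/
def pathOf (E : Env α) (X : ℕ → ℕ) (c D : ℕ) : List ℕ :=
  armOf X c D ++ if D < c ∧ c + D ≤ E.m ∧ E.ltr (c - D - 1) = E.ltr (c + D - 1) then
    [min (X (c - D)) (X (c + D))] else []

/-- Replacing a long postcondition by a variable keeps `simp` from rewriting inside it during
symbolic execution. -/
theorem Tr.of_forall {c : Cm} {P : St → ℕ → Prop} {s : St}
    (h : ∀ Q : St → ℕ → Prop, (∀ s' t, P s' t → Q s' t) → Tr E c Q s) : Tr E c P s :=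
  h P fun _ _ h => h

theorem card_filter_Ico_succ {k : ℕ} (hk : 1 ≤ k) (p : ℕ → Prop) [DecidablePred p] :
    ((Finset.Ico 1 (k + 1)).filter p).card =
      ((Finset.Ico 1 k).filter p).card + if p k then 1 else 0 := by
  rw [← Finset.insert_Ico_right_eq_Ico_add_one hk, Finset.filter_insert]
  split_ifs with h
  · rw [Finset.card_insert_of_notMem (by simp)]
  · rfl

theorem partialNode_spec (hE : E.Big) (h : TrieInv E σ l arm s) (hN : s.v ρN ≤ 5 * E.m)
    (hX : Text E.m σ (s.A φX)) {k u : ℕ} (hk : s.v ρk = k) (h1k : 1 ≤ k) (hkm : k ≤ E.m)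
    (hu : s.A φM k = u)
    (hM : MaxNode (s.A φX) (s.v ρN) (s.A φdep) arm k u) :
    Tr E partialNode (fun s' t => (∃ arm', TrieInv E σ l arm' s' ∧
      (∀ v < s.v ρN, arm' v = arm v) ∧
      arm' (s'.v ρq) = pathOf E (s.A φX) k (s.A φdep u)) ∧
      (s'.v ρN = s.v ρN ∧ s'.v ρq < s.v ρN ∨ s'.v ρN = s.v ρN + 1 ∧ s'.v ρq = s.v ρN) ∧
      t ≤ 40 * l + 160 ∧
      (∀ r, r ∉ [ρu, ρw, ρy, ρsa, ρz, ρq, ρN] → s'.v r = s.v r) ∧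
      (∀ f, f ∉ [φlab, φsl, φpar, φdep] → s'.A f = s.A f)) s := by
  have hpos := hE.pos
  have hL := hE.len
  have hW := hE.num
  have htr := h.trie
  have hσm := h.le_m
  have hm := h.hm
  have hMlt := hM.lt
  have hMpos := hM.pos
  obtain ⟨hb1, hb2⟩ := hX.bound h1k hkm hM.pal
  set D := s.A φdep u with hD
  refine Tr.of_forall fun Q hQ => ?_
  -- Whichever of the three tests fails, the path is the maximal palindrome itself.
  have hskip : ∀ t, t ≤ 40 * l + 160 → ¬ (D < k ∧ k + D ≤ E.m ∧
      E.ltr (k - D - 1) = E.ltr (k + D - 1)) →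
      Q (((s.setV ρu u).setV ρq u).setV ρw D) t := by
    intro t ht hn
    refine hQ _ _ ⟨⟨arm, h.congr (by simp [St.setV_v]) (by simp [St.setV_v]) (fun _ _ => rfl),
      fun _ _ => rfl, ?_⟩, ?_, ht, ?_, fun _ _ => rfl⟩
    · rw [pathOf, if_neg hn, List.append_nil, ← hM.arm_eq]
      simp [St.setV_v]
    · left
      simp [St.setV_v, hMlt]
    · intro r hr
      simp only [List.mem_cons, List.not_mem_nil, or_false, not_or] at hr
      simp [St.setV_v, hr]
  simp only [partialNode, tr_seq, tr_ite, tr_set, tr_skip, Bx.Safe, Bx.Holds, Bx.cost, Ex.Safe,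
    Ex.eval, Ex.cost]
  simp only [St.setV_v, St.setV_A, hk, hm]
  norm_num only [if_true, if_false, and_assoc, true_and, and_true, hu, ← hD]
  repeat refine And.intro (by omega) ?_
  refine ⟨fun h1 => ?_, fun h1 => hskip _ (by omega) (by tauto)⟩
  repeat refine And.intro (by omega) ?_
  refine ⟨fun h2 => ?_, fun h2 => hskip _ (by omega) (by omega)⟩
  repeat refine And.intro (by omega) ?_
  refine ⟨fun h3 => ?_, fun h3 => hskip _ (by omega) (by tauto)⟩
  repeat refine And.intro (by omega) ?_
  have hmin : s.A φX (k - D) - (s.A φX (k - D) - s.A φX (k + D)) =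
      min (s.A φX (k - D)) (s.A φX (k + D)) := by omega
  have hyσ : min (s.A φX (k - D)) (s.A φX (k + D)) < σ :=
    lt_of_le_of_lt (min_le_right _ _) (hX.lt _ (by omega) (by omega))
  rw [hmin]
  refine (lookup_spec hE (arm := arm) (σ := σ) (l := l)
    (s := (((s.setV ρu u).setV ρq u).setV ρw D).setV ρy (min (s.A φX (k - D)) (s.A φX (k + D))))
    (h.congr (by simp [St.setV_v]) (by simp [St.setV_v]) (fun _ _ => rfl)) ?_ ?_ ?_ ?_).mono ?_
  · simp [St.setV_v]
    omega
  · simp [St.setV_v]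
    omega
  · simp [St.setV_v]
    omega
  · simp only [St.setV_v]
    norm_num only [if_true, if_false]
    exact hyσ
  rintro s₂ t₂ ⟨⟨arm₂, r1, r2, r3⟩, r4, r5, r6, r7⟩
  simp only [St.setV_v, St.setV_A] at r2 r3 r4 r5 r6 r7
  norm_num only [if_true, if_false] at r2 r3 r4 r5 r6 r7
  refine hQ _ _ ⟨⟨arm₂, r1, r2, ?_⟩, r4, by omega, ?_, r7⟩
  · rw [r3, pathOf, if_pos ⟨h1, by omega, h3⟩, ← hM.arm_eq]
  · intro r hr
    simp only [List.mem_cons, List.not_mem_nil, or_false, not_or] at hr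
    simp [hr, r6 r]

/-- Each center adds at most one node. At this stage a node only counts the centers whose path is
equal to its arm; prefixes are dealt with in `sumLoop_spec`. -/
theorem partialLoop_spec (hE : E.Big) (h : TrieInv E σ l arm s) (hN : s.v ρN ≤ 2 * E.m + 1)
    (hX : Text E.m σ (s.A φX)) (hcnt : ∀ v, s.A φcnt v = 0) {rad : ℕ → ℕ}
    (hrad : ∀ c, rad c = s.A φdep (s.A φM c))
    (hM : ∀ c, 1 ≤ c → c ≤ E.m → MaxNode (s.A φX) (s.v ρN) (s.A φdep) arm c (s.A φM c)) :
    Tr E partialLoop (fun s' t => (∃ arm', TrieInv E σ l arm' s' ∧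
      (∀ v < s.v ρN, arm' v = arm v) ∧
      (∀ c, 1 ≤ c → c ≤ E.m → ∃ v < s'.v ρN, arm' v = pathOf E (s.A φX) c (rad c)) ∧
      (∀ v, s.v ρN ≤ v → v < s'.v ρN →
        ∃ c, 1 ≤ c ∧ c ≤ E.m ∧ arm' v = pathOf E (s.A φX) c (rad c)) ∧
      (∀ v < s'.v ρN, s'.A φcnt v = ((Finset.Ico 1 (E.m + 1)).filter
        (fun c => arm' v = pathOf E (s.A φX) c (rad c))).card)) ∧
      s.v ρN ≤ s'.v ρN ∧ s'.v ρN ≤ s.v ρN + E.m ∧ t ≤ (40 * l + 200) * E.m + 20 ∧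
      (∀ r, r ∉ [ρk, ρu, ρw, ρy, ρsa, ρz, ρq, ρN] → s'.v r = s.v r) ∧
      (∀ f, f ∉ [φcnt, φlab, φsl, φpar, φdep] → s'.A f = s.A f)) s := by
  have hpos := hE.pos
  have hL := hE.len
  have hW := hE.num
  have htr := h.trie
  have hσm := h.le_m
  have hm := h.hm
  rw [partialLoop]
  simp only [tr_seq, tr_set, Ex.Safe, Ex.eval, Ex.cost]
  norm_num only [if_true, if_false, and_assoc, true_and, and_true]
  repeat refine And.intro (by omega) ?_
  refine Tr.mono (tr_loop (fun n s' =>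
    (∀ r, r ∉ [ρk, ρu, ρw, ρy, ρsa, ρz, ρq, ρN] → s'.v r = s.v r) ∧
    (∀ f, f ∉ [φcnt, φlab, φsl, φpar, φdep] → s'.A f = s.A f) ∧
    1 ≤ s'.v ρk ∧ s'.v ρk ≤ E.m + 1 ∧ s.v ρN ≤ s'.v ρN ∧ s'.v ρN + 1 ≤ s.v ρN + s'.v ρk ∧
    (∃ arm', TrieInv E σ l arm' s' ∧ (∀ v < s.v ρN, arm' v = arm v) ∧
      (∀ c, 1 ≤ c → c < s'.v ρk → ∃ v < s'.v ρN, arm' v = pathOf E (s.A φX) c (rad c)) ∧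
      (∀ v, s.v ρN ≤ v → v < s'.v ρN →
        ∃ c, 1 ≤ c ∧ c < s'.v ρk ∧ arm' v = pathOf E (s.A φX) c (rad c)) ∧
      (∀ v, s'.v ρN ≤ v → s'.A φcnt v = 0) ∧
      (∀ v < s'.v ρN, s'.A φcnt v = ((Finset.Ico 1 (s'.v ρk)).filter
        (fun c => arm' v = pathOf E (s.A φX) c (rad c))).card)) ∧
    n = (40 * l + 200) * (E.m + 1 - s'.v ρk)) (n := (40 * l + 200) * E.m) ?_ ?_) ?_
  · rintro n s₀ ⟨b1, b2, b3, b4, b5, b6, ⟨arm₀, c1, c2, c3, c4, c5, c6⟩, rfl⟩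
    have em : s₀.v ρm = E.m := by rw [b1 _ (by norm_num), hm]
    have eX : s₀.A φX = s.A φX := b2 _ (by norm_num)
    have eM : s₀.A φM = s.A φM := b2 _ (by norm_num)
    have htr0 := c1.trie
    simp only [tr_seq, Bx.Safe, Bx.Holds, Bx.cost, Ex.Safe, Ex.eval, Ex.cost, em]
    norm_num only [if_true, if_false, and_assoc, true_and, and_true]
    repeat refine And.intro (by omega) ?_
    intro hlt
    set k := s₀.v ρk with hk
    have hMk := hM k b3 (by omega)
    have hdep0 : ∀ v < s.v ρN, s₀.A φdep v = s.A φdep v := fun v hv => by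
      rw [htr0.dep_eq _ (by omega), c2 _ hv, ← htr.dep_eq _ hv]
    have hMk0 := hMk.congr b5 hdep0 c2
    refine (partialNode_spec (s := s₀) hE c1 (by omega) (by rw [eX]; exact hX) hk.symm b3 (by omega)
      (by rw [eM]) (by rw [eX]; exact hMk0)).mono ?_
    rintro s₁ t₁ ⟨⟨arm₁, r1, r2, r3⟩, r4, r5, r6, r7⟩
    rw [eX, hdep0 _ hMk.lt, ← hrad] at r3
    have htr1 := r1.trie
    have ek : s₁.v ρk = k := r6 _ (by norm_num)
    have ecnt : s₁.A φcnt = s₀.A φcnt := r7 _ (by norm_num)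
    have hqlt : s₁.v ρq < s₁.v ρN := by omega
    have hNle : s₀.v ρN ≤ s₁.v ρN := by omega
    have hcntq : s₁.A φcnt (s₁.v ρq) ≤ k := by
      rw [ecnt]
      rcases r4 with r4 | r4
      · rw [c6 _ r4.2]
        refine (Finset.card_filter_le _ _).trans ?_
        simp
      · rw [c5 _ r4.2.ge]
        omega
    simp only [tr_set, tr_put, Ex.Safe, Ex.eval, Ex.cost, St.setV_v,
      St.setV_A, St.setA_v, St.setA_A, ek]
    norm_num only [if_true, if_false, and_assoc, true_and, and_true]
    repeat refine And.intro (by omega) ?_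
    have hr2 : ∀ v < s.v ρN, arm₁ v = arm v := fun v hv => by rw [r2 v (by omega), c2 v hv]
    refine ⟨(40 * l + 200) * (E.m + 1 - (k + 1)), ?_, ?_, by omega, by omega, by omega, by omega,
      ⟨arm₁, ?_, hr2, ?_, ?_, ?_, ?_⟩, rfl, ?_⟩
    · intro r hr
      simp only [List.mem_cons, List.not_mem_nil, or_false, not_or] at hr
      simp [hr, r6 r, b1 r]
    · intro f hf
      simp only [List.mem_cons, List.not_mem_nil, or_false, not_or] at hf
      simp [hf, r7 f, b2 f]
    · exact r1.congr (by simp [St.setV_v, St.setA_v]) (by simp [St.setV_v, St.setA_v])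
        (fun f hf => by
          have : f ≠ φcnt := by
            rintro rfl
            simp at hf
          simp [St.setV_A, St.setA_A, this])
    · intro c hc hck
      rcases Nat.lt_succ_iff_lt_or_eq.1 hck with hck | rfl
      · obtain ⟨v, hv, he⟩ := c3 c hc hck
        exact ⟨v, by omega, by rw [r2 v hv, he]⟩
      · exact ⟨_, hqlt, r3⟩
    · intro v hv hv'
      rcases lt_or_ge v (s₀.v ρN) with hlt' | hge
      · obtain ⟨c, hc, hck, he⟩ := c4 v hv hlt'
        exact ⟨c, hc, by omega, by rw [r2 v hlt', he]⟩
      · refine ⟨k, b3, by omega, ?_⟩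
        rw [show v = s₁.v ρq by omega, r3]
    · intro v hv
      rw [Function.update_of_ne (by omega), ecnt, c5 v (by omega)]
    · intro v hv
      rw [card_filter_Ico_succ b3]
      have hiff : arm₁ v = pathOf E (s.A φX) k (rad k) ↔ v = s₁.v ρq := by
        rw [← r3]
        exact ⟨htr1.inj v hv _ hqlt, fun h => by rw [h]⟩
      -- A node created just now is not the path of an earlier center, because all earlier paths
      -- belong to old nodes.
      have hbase : s₁.A φcnt v = ((Finset.Ico 1 k).filter
          (fun c => arm₁ v = pathOf E (s.A φX) c (rad c))).card := by
        rw [ecnt]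
        rcases lt_or_ge v (s₀.v ρN) with hlt' | hge
        · rw [c6 v hlt', r2 v hlt']
        · rw [c5 v hge, eq_comm, Finset.card_eq_zero, Finset.filter_eq_empty_iff]
          intro c hc he
          rw [Finset.mem_Ico] at hc
          obtain ⟨w, hw, hwe⟩ := c3 c hc.1 hc.2
          have := htr1.inj v hv w (by omega) (by rw [he, r2 w hw, hwe])
          omega
      rw [← hbase]
      by_cases hvq : v = s₁.v ρq
      · rw [if_pos (hiff.2 hvq), hvq, Function.update_self]
      · rw [if_neg (fun h => hvq (hiff.1 h)), Function.update_of_ne hvq, add_zero]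
    · have hcl : (40 * l + 200) * (E.m + 1 - k) =
          (40 * l + 200) * (E.m + 1 - (k + 1)) + (40 * l + 200) := by
        rw [show E.m + 1 - k = E.m + 1 - (k + 1) + 1 by omega]
        ring
      omega
  · refine ⟨?_, fun _ _ => rfl, ?_, ?_, ?_, ?_, ⟨arm, ?_, fun _ _ => rfl, ?_, ?_, ?_, ?_⟩, ?_⟩
    · intro r hr
      simp only [List.mem_cons, List.not_mem_nil, or_false, not_or] at hr
      simp [St.setV_v, hr]
    · simp [St.setV_v]
    · simp [St.setV_v]
    · simp [St.setV_v]
    · simp [St.setV_v]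
    · exact h.congr (by simp [St.setV_v]) (by simp [St.setV_v]) (fun _ _ => rfl)
    · simp only [St.setV_v]
      norm_num only [if_true, if_false]
      intro c hc hc1
      omega
    · simp only [St.setV_v]
      norm_num only [if_true, if_false]
      intro v hv hv1
      omega
    · intro v hv
      exact hcnt v
    · intro v hv
      simp [St.setV_v, St.setV_A, hcnt]
    · simp [St.setV_v]
  · rintro s₀ t₀ ⟨n', ⟨b1, b2, b3, b4, b5, b6, ⟨arm₀, c1, c2, c3, c4, c5, c6⟩, rfl⟩, hx, ht⟩
    have em : s₀.v ρm = E.m := by rw [b1 _ (by norm_num), hm]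
    simp only [Bx.Holds, Bx.cost, Ex.eval, Ex.cost, em] at hx ht
    have hk : s₀.v ρk = E.m + 1 := by omega
    rw [hk] at c3 c4 c6
    exact ⟨⟨arm₀, c1, c2, fun c hc hcm => c3 c hc (by omega), fun v hv hv' => by
      obtain ⟨c, hc, hcm, he⟩ := c4 v hv hv'
      exact ⟨c, hc, by omega, he⟩, c6⟩, b5, by omega, by omega, b1, b2⟩

end Partial

/-! ### Linked lists -/

/-- The list `l` is stored as a linked list with head `h`, successors `nx`, and end `nil`. -/
def IsList (nil : ℕ) (nx : ℕ → ℕ) : ℕ → List ℕ → Prop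
  | h, [] => h = nil
  | h, a :: l => h = a ∧ a ≠ nil ∧ IsList nil nx (nx a) l

namespace IsList

variable {nil h a : ℕ} {nx nx' : ℕ → ℕ} {l : List ℕ}

theorem congr (hl : IsList nil nx h l) (hn : ∀ a ∈ l, nx' a = nx a) : IsList nil nx' h l := by
  induction l generalizing h with
  | nil => exact hl
  | cons b l ih =>
    obtain ⟨h1, h2, h3⟩ := hl
    exact ⟨h1, h2, by rw [hn b (by simp)]; exact ih h3 fun a ha => hn a (by simp [ha])⟩

theorem update (hl : IsList nil nx h l) (ha : a ∉ l) (x : ℕ) :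
    IsList nil (Function.update nx a x) h l :=
  hl.congr fun b hb => Function.update_of_ne (by rintro rfl; exact ha hb) _ _

theorem push (hl : IsList nil nx h l) (ha : a ∉ l) (hn : a ≠ nil) :
    IsList nil (Function.update nx a h) a (a :: l) :=
  ⟨rfl, hn, by rw [Function.update_self]; exact hl.update ha h⟩

theorem eq_cons (hl : IsList nil nx h l) (hn : h ≠ nil) :
    ∃ l', l = h :: l' ∧ IsList nil nx (nx h) l' := by
  cases l with
  | nil => exact absurd hl hn
  | cons b l =>
    obtain ⟨rfl, _, h3⟩ := hl
    exact ⟨l, rfl, h3⟩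

theorem eq_nil (hl : IsList nil nx h l) (hn : h = nil) : l = [] := by
  cases l with
  | nil => rfl
  | cons b l =>
    obtain ⟨rfl, h2, _⟩ := hl
    exact absurd hn h2

end IsList

/-! ### Numbers of occurrences -/

section Counts

variable {α : Type u} [LinearOrder α] {E : Env α} {s : St} {σ l : ℕ} {arm : ℕ → List ℕ}

theorem Trie.exists_prefix {N : ℕ} {lab dep par : ℕ → ℕ} (h : Trie σ N lab dep par arm) {v : ℕ}
    (hv : v < N) {p : List ℕ} (hp : p <+: arm v) : ∃ w < N, arm w = p := by
  induction v using Nat.strong_induction_on with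
  | _ v ih =>
    rcases Nat.eq_zero_or_pos v with rfl | h1
    · rw [h.root, List.prefix_nil] at hp
      exact ⟨0, hv, by rw [h.root, hp]⟩
    · have := h.par_lt v h1 hv
      rw [h.arm_eq v h1 hv, List.prefix_concat_iff] at hp
      rcases hp with hp | hp
      · exact ⟨v, hv, by rw [hp, h.arm_eq v h1 hv]⟩
      · exact ih _ this (by omega) hp

/-- A path that begins with the arm of `u` either ends there or continues through exactly one child,
since different nodes have different arms. Children have larger numbers than `u`, so the sum may
start at `u + 1`. -/
theorem Trie.count_eq {N : ℕ} {lab dep par : ℕ → ℕ} (h : Trie σ N lab dep par arm)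
    {paths : ℕ → List ℕ} (S : Finset ℕ) (hp : ∀ c ∈ S, ∃ v < N, arm v = paths c) {u : ℕ}
    (hu : u < N) : (S.filter fun c => arm u <+: paths c).card =
      (S.filter fun c => arm u = paths c).card +
      ∑ w ∈ Finset.Ico (u + 1) N, if par w = u then (S.filter fun c => arm w <+: paths c).card
        else 0 := by
  simp only [Finset.card_filter]
  have hswap : ∀ w, (if par w = u then ∑ c ∈ S, (if arm w <+: paths c then 1 else 0) else 0) =
      ∑ c ∈ S, if par w = u then (if arm w <+: paths c then 1 else 0) else 0 := by
    intro w
    split_ifs <;> simp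
  simp only [hswap]
  rw [Finset.sum_comm, ← Finset.sum_add_distrib]
  refine Finset.sum_congr rfl fun c hc => ?_
  obtain ⟨x, hx, hxc⟩ := hp c hc
  have hchild : ∀ w, 1 ≤ w → w < N → par w = u → arm w = arm u ++ [lab w] := fun w h1 h2 h3 => by
    rw [h.arm_eq w h1 h2, h3]
  by_cases hpre : arm u <+: paths c
  · rw [if_pos hpre]
    by_cases heq : arm u = paths c
    · rw [if_pos heq]
      refine (congrArg (1 + ·) (Finset.sum_eq_zero fun w hw => ?_)).symm
      rw [Finset.mem_Ico] at hw
      split_ifs with h1 h2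
      · rw [hchild w (by omega) hw.2 h1, ← heq] at h2
        have := h2.length_le
        simp at this
      · rfl
      · rfl
    · rw [if_neg heq]
      obtain ⟨t, ht⟩ := hpre
      obtain _ | ⟨y, t⟩ := t
      · simp at ht
        exact absurd ht heq
      · have hy : arm u ++ [y] <+: paths c := ⟨t, by simp [← ht]⟩
        obtain ⟨w, hw, hwa⟩ := h.exists_prefix hx (hxc ▸ hy)
        have hw1 := h.one_le_of_arm hwa
        have hwp := (h.child_iff hu hw1 hw).1 hwa
        have := h.par_lt w hw1 hw
        rw [Finset.sum_eq_single_of_mem w (by simp; omega), if_pos hwp.1, hwa, if_pos hy]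
        intro w' hw' hne
        rw [Finset.mem_Ico] at hw'
        split_ifs with h1 h2
        · exfalso
          refine hne (h.inj w' hw'.2 w hw ?_)
          rw [hwa]
          rw [hchild w' (by omega) hw'.2 h1] at h2 ⊢
          exact (List.prefix_of_prefix_length_le h2 hy (by simp)).eq_of_length (by simp)
        · rfl
        · rfl
  · rw [if_neg hpre, if_neg (fun he => hpre (by rw [he]))]
    refine (congrArg (0 + ·) (Finset.sum_eq_zero fun w hw => ?_)).symm
    rw [Finset.mem_Ico] at hw
    split_ifs with h1 h2
    · rw [hchild w (by omega) hw.2 h1] at h2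
      exact absurd ((List.prefix_append _ _).trans h2) hpre
    · rfl
    · rfl

/-- Nodes are visited in decreasing order and parents precede their children, so the count of a node
is final when it is added to its parent's. On the way each node is pushed onto the bucket of its
label. -/
theorem sumLoop_spec (hE : E.Big) (hN : s.v ρN ≤ 3 * E.m + 1)
    (ht : Trie σ (s.v ρN) (s.A φlab) (s.A φdep) (s.A φpar) arm) (hhb : ∀ r, s.A φhb r = 0)
    {paths : ℕ → List ℕ}
    (hp : ∀ c, 1 ≤ c → c ≤ E.m → ∃ v < s.v ρN, arm v = paths c)
    (hcnt : ∀ v < s.v ρN, s.A φcnt v =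
      ((Finset.Ico 1 (E.m + 1)).filter fun c => arm v = paths c).card) :
    Tr E sumLoop (fun s' t => (∀ v < s.v ρN, s'.A φcnt v =
        ((Finset.Ico 1 (E.m + 1)).filter fun c => arm v <+: paths c).card) ∧
      (∀ r, IsList 0 (s'.A φnb) (s'.A φhb r)
        ((List.range' 1 (s.v ρN - 1)).filter fun x => s.A φlab x = r)) ∧
      t ≤ 40 * s.v ρN + 20 ∧
      (∀ r, r ∉ [ρi, ρx] → s'.v r = s.v r) ∧
      (∀ f, f ∉ [φcnt, φnb, φhb] → s'.A f = s.A f)) s := by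
  have hpos := hE.pos
  have hL := hE.len
  have hW := hE.num
  have hσN := ht.lt
  set F : ℕ → ℕ := fun v => ((Finset.Ico 1 (E.m + 1)).filter fun c => arm v <+: paths c).card
    with hF
  have hFle : ∀ v, F v ≤ E.m := fun v => (Finset.card_filter_le _ _).trans (by simp)
  have hrec : ∀ v < s.v ρN, F v = s.A φcnt v +
      ∑ w ∈ Finset.Ico (v + 1) (s.v ρN), if s.A φpar w = v then F w else 0 := fun v hv => by
    rw [hcnt v hv]
    exact ht.count_eq _ (fun c hc => hp c (by simp at hc; omega) (by simp at hc; omega)) hv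
  rw [sumLoop]
  simp only [tr_seq, tr_set, Ex.Safe, Ex.eval, Ex.cost]
  norm_num only [if_true, if_false, and_assoc, true_and, and_true]
  repeat refine And.intro (by omega) ?_
  refine Tr.mono (tr_loop (fun n s' =>
    (∀ r, r ∉ [ρi, ρx] → s'.v r = s.v r) ∧
    (∀ f, f ∉ [φcnt, φnb, φhb] → s'.A f = s.A f) ∧
    s'.v ρi < s.v ρN ∧
    (∀ v < s.v ρN, s'.A φcnt v = s.A φcnt v +
      ∑ w ∈ Finset.Ico (s'.v ρi + 1) (s.v ρN), if s.A φpar w = v then F w else 0) ∧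
    (∀ r, IsList 0 (s'.A φnb) (s'.A φhb r)
        ((List.range' (s'.v ρi + 1) (s.v ρN - 1 - s'.v ρi)).filter fun x => s.A φlab x = r)) ∧
    n = 40 * s'.v ρi) (n := 40 * (s.v ρN - 1)) ?_ ?_) ?_
  · rintro n s₀ ⟨b1, b2, b3, b4, b5, rfl⟩
    have el : s₀.A φlab = s.A φlab := b2 _ (by norm_num)
    have ep : s₀.A φpar = s.A φpar := b2 _ (by norm_num)
    set i := s₀.v ρi with hi
    simp only [tr_seq, tr_set, tr_put, Bx.Safe, Bx.Holds, Bx.cost, Ex.Safe, Ex.eval, Ex.cost,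
      St.setV_v, St.setV_A, St.setA_v, St.setA_A, el, ep, ← hi]
    norm_num only [if_true, if_false, and_assoc, true_and, and_true]
    repeat refine And.intro (by omega) ?_
    intro hi0
    have hpi := ht.par_lt i hi0 b3
    have hli := ht.lab_lt i hi0 b3
    have hci : s₀.A φcnt i = F i := by rw [b4 i b3, hrec i b3]
    have hsum : ∀ v, (∑ w ∈ Finset.Ico i (s.v ρN), if s.A φpar w = v then F w else 0) =
        (if s.A φpar i = v then F i else 0) +
        ∑ w ∈ Finset.Ico (i + 1) (s.v ρN), if s.A φpar w = v then F w else 0 := fun v =>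
      Finset.sum_eq_sum_Ico_succ_bot b3 _
    -- Intermediate sums never exceed the final count, which is at most the number of centers. This
    -- keeps the numbers within the bound of the machine.
    have hcp : s₀.A φcnt (s.A φpar i) + F i ≤ E.m := by
      have h1 := hrec _ (hpi.trans b3)
      have h2 := hFle (s.A φpar i)
      have h3 := hsum (s.A φpar i)
      rw [if_pos rfl] at h3
      have h4 : (∑ w ∈ Finset.Ico i (s.v ρN), if s.A φpar w = s.A φpar i then F w else 0) ≤
          ∑ w ∈ Finset.Ico (s.A φpar i + 1) (s.v ρN), if s.A φpar w = s.A φpar i then F w else 0 :=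
        Finset.sum_le_sum_of_subset (Finset.Ico_subset_Ico_left (by omega))
      rw [b4 _ (hpi.trans b3)]
      omega
    rw [hci]
    repeat refine And.intro (by omega) ?_
    refine ⟨40 * (i - 1), ?_, ?_, by omega, ?_, ?_, rfl, by omega⟩
    · intro r hr
      simp only [List.mem_cons, List.not_mem_nil, or_false, not_or] at hr
      simp [hr, b1 r]
    · intro f hf
      simp only [List.mem_cons, List.not_mem_nil, or_false, not_or] at hf
      simp [hf, b2 f]
    · intro v hv
      rw [Nat.sub_add_cancel hi0, hsum v]
      by_cases hvp : v = s.A φpar i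
      · subst hvp
        rw [Function.update_self, if_pos rfl, b4 _ hv]
        ring
      · rw [Function.update_of_ne hvp, if_neg (Ne.symm hvp), b4 v hv, zero_add]
    · intro r
      have hr' : List.range' (i - 1 + 1) (s.v ρN - 1 - (i - 1)) =
          i :: List.range' (i + 1) (s.v ρN - 1 - i) := by
        rw [Nat.sub_add_cancel hi0, show s.v ρN - 1 - (i - 1) = s.v ρN - 1 - i + 1 by omega,
          List.range'_succ]
      rw [hr', List.filter_cons]
      have hni : ∀ r, i ∉ (List.range' (i + 1) (s.v ρN - 1 - i)).filter
          fun x => s.A φlab x = r := by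
        intro r
        simp
      by_cases hr : r = s.A φlab i
      · subst hr
        simp only [Function.update_self, decide_true, if_true]
        exact (b5 _).push (hni _) (by omega)
      · rw [Function.update_of_ne hr, if_neg (by simpa using Ne.symm hr)]
        exact (b5 r).update (hni r) _
  · refine ⟨?_, fun _ _ => rfl, ?_, ?_, ?_, ?_⟩
    · intro r hr
      simp only [List.mem_cons, List.not_mem_nil, or_false, not_or] at hr
      simp [St.setV_v, hr]
    · simp only [St.setV_v, if_true]
      omega
    · simp only [St.setV_v, St.setV_A, if_true]
      rw [show s.v ρN - 1 + 1 = s.v ρN by omega]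
      simp
    · simp only [St.setV_v, St.setV_A, if_true]
      intro r
      simpa [IsList] using hhb r
    · simp only [St.setV_v, if_true]
  · rintro s₀ t₀ ⟨n', ⟨b1, b2, b3, b4, b5, rfl⟩, hx, ht⟩
    simp only [Bx.Holds, Bx.cost, Ex.eval, Ex.cost] at hx ht
    have hi : s₀.v ρi = 0 := by omega
    rw [hi] at b4 b5
    refine ⟨fun v hv => ?_, ?_, by omega, b1, b2⟩
    · rw [b4 v hv]
      show _ = F v
      rw [hrec v hv]
      congr 1
      refine (Finset.sum_subset (Finset.Ico_subset_Ico_left (by omega)) ?_).symm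
      intro w hw hw'
      rw [Finset.mem_Ico] at hw hw'
      have := ‹Trie _ _ _ _ _ _›.par_lt w (by omega) hw.2
      rw [if_neg (by omega)]
    · simpa using b5

/-- Ranks are sorted first by letter, so the ranks with one letter are consecutive. A running sum
that is reset when the letter changes counts the longer runs with the same letter; each of them
contributes twice. -/
theorem singleLoop_spec (hE : E.Big) (hσ : σ ≤ E.m) (hs : s.v ρσ = σ)
    (hrp : ∀ r < σ, s.A φrp r < E.m)
    (hmono : ∀ r r', r < r' → r' < σ → E.ltr (s.A φrp r) ≤ E.ltr (s.A φrp r'))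
    (hsum : ∑ r ∈ Finset.range σ, s.A φcnt (r + 1) ≤ E.m) :
    Tr E singleLoop (fun s' t => (∀ r < σ, s'.A φcnt (r + 1) = s.A φcnt (r + 1) +
        2 * ∑ r' ∈ Finset.Ico (r + 1) σ,
          if E.ltr (s.A φrp r') = E.ltr (s.A φrp r) then s.A φcnt (r' + 1) else 0) ∧
      (∀ v, v = 0 ∨ σ < v → s'.A φcnt v = s.A φcnt v) ∧
      t ≤ 70 * σ + 20 ∧
      (∀ r, r ∉ [ρr, ρacc, ρold] → s'.v r = s.v r) ∧
      (∀ f, f ∉ [φcnt] → s'.A f = s.A f)) s := by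
  have hpos := hE.pos
  have hL := hE.len
  have hW := hE.num
  set G : ℕ → ℕ := fun r => ∑ r' ∈ Finset.Ico (r + 1) σ,
    if E.ltr (s.A φrp r') = E.ltr (s.A φrp r) then s.A φcnt (r' + 1) else 0 with hG
  have hGle : ∀ r < σ, s.A φcnt (r + 1) + G r ≤ E.m := by
    intro r hr
    refine le_trans ?_ hsum
    rw [Finset.range_eq_Ico, ← Finset.sum_Ico_consecutive _ (Nat.zero_le r) hr.le,
      Finset.sum_eq_sum_Ico_succ_bot hr]
    have : G r ≤ ∑ r' ∈ Finset.Ico (r + 1) σ, s.A φcnt (r' + 1) :=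
      Finset.sum_le_sum fun r' _ => by split_ifs <;> simp
    omega
  have hGeq : ∀ r, r + 1 < σ → E.ltr (s.A φrp r) = E.ltr (s.A φrp (r + 1)) →
      G r = s.A φcnt (r + 1 + 1) + G (r + 1) := by
    intro r hr he
    simp only [hG]
    rw [Finset.sum_eq_sum_Ico_succ_bot hr, if_pos he.symm, he]
  have hGne : ∀ r, r + 1 < σ → E.ltr (s.A φrp r) ≠ E.ltr (s.A φrp (r + 1)) → G r = 0 := by
    intro r hr he
    refine Finset.sum_eq_zero fun r' hr' => if_neg ?_
    rw [Finset.mem_Ico] at hr'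
    have h1 := hmono r (r + 1) (by omega) hr
    have h2 : E.ltr (s.A φrp (r + 1)) ≤ E.ltr (s.A φrp r') := by
      rcases hr'.1.eq_or_lt with h | h
      · rw [h]
      · exact hmono _ _ h hr'.2
    exact ((lt_of_le_of_ne h1 he).trans_le h2).ne'
  rw [singleLoop]
  simp only [tr_seq, tr_set, Ex.Safe, Ex.eval, Ex.cost, St.setV_v, St.setV_A]
  norm_num only [if_true, if_false, and_assoc, true_and, and_true]
  repeat refine And.intro (by omega) ?_
  refine Tr.mono (tr_loop (fun n s' =>
    (∀ r, r ∉ [ρr, ρacc, ρold] → s'.v r = s.v r) ∧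
    (∀ f, f ∉ [φcnt] → s'.A f = s.A f) ∧
    s'.v ρr ≤ σ ∧ (s'.v ρr = σ → s'.v ρacc = 0 ∧ s'.v ρold = 0) ∧
    (s'.v ρr < σ → s'.v ρacc = G (s'.v ρr) ∧ s'.v ρold = s.A φcnt (s'.v ρr + 1)) ∧
    (∀ r < σ, s'.v ρr ≤ r → s'.A φcnt (r + 1) = s.A φcnt (r + 1) + 2 * G r) ∧
    (∀ v, v ≤ s'.v ρr ∨ σ < v → s'.A φcnt v = s.A φcnt v) ∧
    n = 60 * s'.v ρr) (n := 60 * σ) ?_ ?_) ?_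
  · rintro n s₀ ⟨b1, b2, b3, b4, b5, b6, b7, rfl⟩
    have eσ : s₀.v ρσ = σ := by rw [b1 _ (by norm_num), hs]
    have er : s₀.A φrp = s.A φrp := b2 _ (by norm_num)
    refine ⟨by simp only [Bx.Safe, Ex.Safe, and_true]; omega, ?_⟩
    simp only [Bx.Holds, Ex.eval]
    intro hr0
    obtain ⟨r, hr⟩ : ∃ r, s₀.v ρr = r + 1 := ⟨s₀.v ρr - 1, by omega⟩
    rw [hr] at b3 b4 b5 b6 b7
    have hrσ : r < σ := by omega
    have hGr := hGle r hrσ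
    have hacc : Tr E (.ite (.lt (.add (.v ρr) (.c 1)) (.v ρσ))
       (.ite (.leq (.get φrp (.v ρr)) (.get φrp (.add (.v ρr) (.c 1))))
         (.set ρacc (.add (.v ρacc) (.v ρold))) (.set ρacc (.c 0))) .skip)
        (fun s₁ t => t ≤ 30 ∧ s₁.v ρr = r ∧ s₁.v ρacc = G r ∧
          (∀ r, r ∉ [ρr, ρacc, ρold] → s₁.v r = s₀.v r) ∧ s₁.A = s₀.A) (s₀.setV ρr r) := by
      refine Tr.of_forall fun Q hQ => ?_
      simp only [tr_set, tr_ite, tr_skip, Bx.Safe, Bx.Holds, Bx.cost, Ex.Safe, Ex.eval,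
        Ex.cost, St.setV_v, St.setV_A, eσ, er]
      norm_num only [if_true, if_false, and_assoc, true_and, and_true]
      repeat refine And.intro (by omega) ?_
      refine ⟨fun h1 => ?_, fun h1 => ?_⟩
      · have g1 := hrp r hrσ
        have g2 := hrp (r + 1) h1
        obtain ⟨b51, b52⟩ := b5 h1
        have hGr1 := hGle (r + 1) h1
        rw [b51, b52]
        repeat refine And.intro (by omega) ?_
        refine ⟨fun h2 => ?_, fun h2 => ?_⟩
        · refine ⟨by omega, hQ _ _ ⟨by omega, ?_, ?_, ?_, rfl⟩⟩
          · simp [St.setV_v]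
          · simp only [St.setV_v, if_true]
            rw [hGeq r h1 h2]
            ring
          · intro r hr
            simp only [List.mem_cons, List.not_mem_nil, or_false, not_or] at hr
            simp [St.setV_v, hr]
        · refine ⟨by omega, hQ _ _ ⟨by omega, ?_, ?_, ?_, rfl⟩⟩
          · simp [St.setV_v]
          · simp only [St.setV_v, if_true]
            rw [hGne r h1 h2]
          · intro r hr
            simp only [List.mem_cons, List.not_mem_nil, or_false, not_or] at hr
            simp [St.setV_v, hr]
      · refine hQ _ _ ⟨by omega, ?_, ?_, ?_, rfl⟩
        · simp [St.setV_v]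
        · obtain rfl : σ = r + 1 := by omega
          simp only [St.setV_v, hG]
          norm_num only [if_false, Finset.Ico_self, Finset.sum_empty]
          exact (b4 rfl).1
        · intro r hr
          simp only [List.mem_cons, List.not_mem_nil, or_false, not_or] at hr
          simp [St.setV_v, hr]
    rw [tr_seq, tr_set, tr_seq]
    simp only [Ex.Safe, Ex.eval, Ex.cost, hr, Nat.add_sub_cancel]
    refine ⟨⟨trivial, by omega⟩, hacc.mono ?_⟩
    rintro s₁ t₁ ⟨h0, h1, h2, h3, h4⟩
    have hc : s₀.A φcnt (r + 1) = s.A φcnt (r + 1) := b7 _ (Or.inl le_rfl)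
    simp only [tr_seq, tr_set, tr_put, Ex.Safe, Ex.eval, Ex.cost, Bx.cost, St.setV_v, St.setV_A,
      St.setA_v, St.setA_A, h1, h2, h4, hc]
    norm_num only [if_true, if_false, and_assoc, true_and, and_true]
    repeat refine And.intro (by omega) ?_
    refine ⟨60 * r, ?_, ?_, by omega, by omega, fun _ => trivial, ?_, ?_, by omega⟩
    · intro r hr
      have e1 := h3 r hr
      have e2 := b1 r hr
      simp only [List.mem_cons, List.not_mem_nil, or_false, not_or] at hr
      simp [hr, e1, e2]
    · intro f hf
      have := b2 f hf
      simp only [List.mem_cons, List.not_mem_nil, or_false] at hf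
      simp [hf, this]
    · intro r' hr' hle
      rcases hle.eq_or_lt with rfl | hlt
      · rw [Function.update_self]
        ring
      · rw [Function.update_of_ne (by omega), b6 r' hr' hlt]
    · intro v hv
      rw [Function.update_of_ne (by omega), b7 v (by omega)]
  · refine ⟨?_, fun _ _ => rfl, ?_, ?_, ?_, ?_, fun _ _ => rfl, ?_⟩
    · intro r hr
      simp only [List.mem_cons, List.not_mem_nil, or_false, not_or] at hr
      simp [St.setV_v, hr]
    · simp [St.setV_v, hs]
    · simp [St.setV_v, hs]
    · simp [St.setV_v, hs]
    · simp only [St.setV_v]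
      norm_num only [if_true, if_false, hs]
      intro r h1 h2
      omega
    · simp [St.setV_v, hs]
  · rintro s₀ t₀ ⟨n', ⟨b1, b2, b3, b4, b5, b6, b7, rfl⟩, hx, ht⟩
    simp only [Bx.Holds, Bx.cost, Ex.eval, Ex.cost] at hx ht
    exact ⟨fun r hr => b6 r hr (by omega), fun v hv => b7 v (by omega), by omega, b1, b2⟩

end Counts

/-! ### Children and output -/

section Output

variable {α : Type u} [LinearOrder α] {E : Env α} {s : St} {σ l : ℕ} {arm : ℕ → List ℕ}

theorem sum_length_filter_le (f : ℕ → ℕ) (l : List ℕ) (n : ℕ) :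
    ∑ r ∈ Finset.range n, (l.filter fun x => f x = r).length ≤ l.length := by
  induction l with
  | nil => simp
  | cons a l ih =>
    have : ∀ r, ((a :: l).filter fun x => f x = r).length =
        (if f a = r then 1 else 0) + (l.filter fun x => f x = r).length := by
      intro r
      rw [List.filter_cons]
      by_cases h : f a = r
      · simp [h, add_comm]
      · simp [h]
    simp only [this, Finset.sum_add_distrib, List.length_cons]
    have : (∑ r ∈ Finset.range n, if f a = r then 1 else 0) ≤ 1 := by
      rw [Finset.sum_ite_eq]
      split_ifs <;> simp
    omega

/-- A bucket sort for all nodes together: labels are visited in decreasing order and every node is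
pushed to the front of its parent's list, so all these lists become increasing. The potential
charges every label and every bucket element once. -/
theorem childLoop_spec (hE : E.Big) (hN : s.v ρN ≤ 3 * E.m + 1) (hs : s.v ρσ = σ) (hσ : σ ≤ E.m)
    (ht : Trie σ (s.v ρN) (s.A φlab) (s.A φdep) (s.A φpar) arm) (hhc : ∀ r, s.A φhc r = 0)
    (hb : ∀ r, IsList 0 (s.A φnb) (s.A φhb r)
        ((List.range' 1 (s.v ρN - 1)).filter fun x => s.A φlab x = r)) :
    Tr E childLoop (fun s' t => (∃ ch : ℕ → List ℕ, ∀ u,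
        IsList 0 (s'.A φnc) (s'.A φhc u) (ch u) ∧
        (ch u).Pairwise (fun x y => s.A φlab x < s.A φlab y) ∧
        ∀ x, x ∈ ch u ↔ 1 ≤ x ∧ x < s.v ρN ∧ s.A φpar x = u) ∧
      t ≤ 30 * (σ + s.v ρN) + 20 ∧
      (∀ r, r ∉ [ρr, ρx] → s'.v r = s.v r) ∧
      (∀ f, f ∉ [φnc, φhc] → s'.A f = s.A f)) s := by
  have hpos := hE.pos
  have hL := hE.len
  have hW := hE.num
  have hσN := ht.lt
  set bk : ℕ → List ℕ := fun r => (List.range' 1 (s.v ρN - 1)).filter fun x => s.A φlab x = r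
    with hbk
  have hbm : ∀ r x, x ∈ bk r ↔ 1 ≤ x ∧ x < s.v ρN ∧ s.A φlab x = r := by
    intro r x
    simp only [hbk, List.mem_filter, List.mem_range'_1, decide_eq_true_eq, and_assoc]
    omega
  have hbn : ∀ r, (bk r).Nodup := fun r => (List.nodup_range' (step := 1) (by omega)).filter _
  have hlen : ∑ r ∈ Finset.range σ, (bk r).length ≤ s.v ρN - 1 := by
    have := sum_length_filter_le (s.A φlab) (List.range' 1 (s.v ρN - 1)) σ
    simpa using this
  rw [childLoop]
  simp only [tr_seq, tr_set, Ex.Safe, Ex.eval, Ex.cost]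
  norm_num only [if_true, if_false, and_assoc, true_and, and_true]
  refine Tr.mono (tr_loop (fun n s' =>
    (∀ r, r ∉ [ρr, ρx] → s'.v r = s.v r) ∧
    (∀ f, f ∉ [φnc, φhc] → s'.A f = s.A f) ∧
    s'.v ρr ≤ σ ∧
    (∃ ch : ℕ → List ℕ, ∀ u, IsList 0 (s'.A φnc) (s'.A φhc u) (ch u) ∧
        (ch u).Pairwise (fun x y => s.A φlab x < s.A φlab y) ∧
        ∀ x, x ∈ ch u ↔ 1 ≤ x ∧ x < s.v ρN ∧ s.A φpar x = u ∧ s'.v ρr ≤ s.A φlab x) ∧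
    n = 30 * (s'.v ρr + ∑ r ∈ Finset.range (s'.v ρr), (bk r).length))
    (n := 30 * (σ + ∑ r ∈ Finset.range σ, (bk r).length)) ?_ ?_) ?_
  · rintro n s₀ ⟨b1, b2, b3, ⟨ch, b4⟩, rfl⟩
    refine ⟨by simp only [Bx.Safe, Ex.Safe, and_true]; omega, ?_⟩
    simp only [Bx.Holds, Ex.eval]
    intro hr0
    obtain ⟨r, hr⟩ : ∃ r, s₀.v ρr = r + 1 := ⟨s₀.v ρr - 1, by omega⟩
    rw [hr] at b3 b4 ⊢
    have eb : s₀.A φhb = s.A φhb := b2 _ (by norm_num)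
    rw [Finset.sum_range_succ]
    simp only [tr_seq, tr_set, Ex.Safe, Ex.eval, Ex.cost, Bx.cost, St.setV_v, St.setV_A, eb, hr]
    norm_num only [if_true, if_false, and_assoc, true_and, and_true]
    repeat refine And.intro (by omega) ?_
    refine Tr.mono (tr_loop (fun n s' =>
      (∀ r, r ∉ [ρr, ρx] → s'.v r = s.v r) ∧
      (∀ f, f ∉ [φnc, φhc] → s'.A f = s.A f) ∧
      s'.v ρr = r ∧
      (∃ (ch : ℕ → List ℕ) (rem : List ℕ), IsList 0 (s.A φnb) (s'.v ρx) rem ∧ rem.Nodup ∧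
        (∀ x ∈ rem, x ∈ bk r) ∧ n = 30 * rem.length ∧ ∀ u,
          IsList 0 (s'.A φnc) (s'.A φhc u) (ch u) ∧
          (ch u).Pairwise (fun x y => s.A φlab x < s.A φlab y) ∧
          ∀ x, x ∈ ch u ↔ 1 ≤ x ∧ x < s.v ρN ∧ s.A φpar x = u ∧ r ≤ s.A φlab x ∧ x ∉ rem))
      (n := 30 * (bk r).length) ?_ ?_) ?_
    · rintro n s₁ ⟨c1, c2, c3, ch', rem, c4, c5, c6, rfl, c7⟩
      refine ⟨by simp only [Bx.Safe, Ex.Safe, and_true]; omega, ?_⟩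
      simp only [Bx.Holds, Ex.eval]
      intro hx0
      obtain ⟨rem', hrem, c4'⟩ := c4.eq_cons (by omega)
      set x := s₁.v ρx with hx
      subst hrem
      have hxb := (hbm r x).1 (c6 x (by simp))
      have hpx := ht.par_lt x hxb.1 hxb.2.1
      have hN1 : 1 ≤ x ∧ x < s.v ρN := ⟨hxb.1, hxb.2.1⟩
      have ep : s₁.A φpar = s.A φpar := c2 _ (by norm_num)
      have en : s₁.A φnb = s.A φnb := c2 _ (by norm_num)
      have hxr : x ∉ rem' := (List.nodup_cons.1 c5).1
      simp only [tr_seq, tr_set, tr_put, Ex.Safe, Ex.eval, Ex.cost, Bx.cost, St.setV_v, St.setV_A,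
        St.setA_v, St.setA_A, ep, en, ← hx]
      norm_num only [if_true, if_false, and_assoc, true_and, and_true]
      repeat refine And.intro (by omega) ?_
      refine ⟨30 * rem'.length, ?_, ?_, c3, ⟨Function.update ch' (s.A φpar x) (x :: ch' (s.A φpar x)),
        rem', c4', (List.nodup_cons.1 c5).2, fun y hy => c6 y (by simp [hy]), rfl, ?_⟩, ?_⟩
      · intro r hr
        have := c1 r hr
        simp only [List.mem_cons, List.not_mem_nil, or_false, not_or] at hr
        simp [hr, this]
      · intro f hf
        have := c2 f hf
        simp only [List.mem_cons, List.not_mem_nil, or_false, not_or] at hf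
        simp [hf, this]
      · intro u
        obtain ⟨d1, d2, d3⟩ := c7 u
        have hxu : x ∉ ch' u := fun h => ((d3 x).1 h).2.2.2.2 (by simp)
        by_cases hu : u = s.A φpar x
        · subst hu
          simp only [Function.update_self]
          refine ⟨d1.push hxu (by omega), List.pairwise_cons.2 ⟨fun y hy => ?_, d2⟩, fun y => ?_⟩
          · obtain ⟨h1, h2, h3, h4, h5⟩ := (d3 y).1 hy
            rw [hxb.2.2]
            -- A sibling with the same label would be `x` itself, and `x` is still waiting in the
            -- bucket.
            refine lt_of_le_of_ne h4 fun h6 => h5 ?_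
            have : y = x := ht.inj y h2 x hxb.2.1 (by
              rw [ht.arm_eq y h1 h2, ht.arm_eq x hxb.1 hxb.2.1, h3, hxb.2.2, h6])
            simp [this]
          · rw [List.mem_cons, d3 y]
            by_cases hyx : y = x
            · subst hyx
              simp only [true_or, true_iff]
              exact ⟨hxb.1, hxb.2.1, trivial, hxb.2.2.ge, hxr⟩
            · simp [hyx]
        · rw [Function.update_of_ne hu, Function.update_of_ne hu]
          refine ⟨d1.update hxu _, d2, fun y => ?_⟩
          rw [d3 y]
          by_cases hyx : y = x
          · subst hyx
            simp [Ne.symm hu]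
          · simp [hyx]
      · simp only [List.length_cons]
        omega
    · refine ⟨?_, b2, ?_, ch, bk r, ?_, hbn r, fun _ h => h, rfl, ?_⟩
      · intro r hr
        have := b1 r hr
        simp only [List.mem_cons, List.not_mem_nil, or_false, not_or] at hr
        simp [hr, this, St.setV_v]
      · simp [St.setV_v]
      · simp only [St.setV_v, if_true]
        exact hb r
      · intro u
        obtain ⟨d1, d2, d3⟩ := b4 u
        refine ⟨d1, d2, fun x => ?_⟩
        rw [d3 x, hbm]
        omega
    · rintro s₁ t₁ ⟨n', ⟨c1, c2, c3, ch', rem, c4, c5, c6, rfl, c7⟩, hx, ht₁⟩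
      simp only [Bx.Holds, Bx.cost, Ex.eval, Ex.cost] at hx ht₁
      obtain rfl : rem = [] := c4.eq_nil (by omega)
      refine ⟨30 * (r + ∑ r ∈ Finset.range r, (bk r).length), c1, c2, by omega, ⟨ch', ?_⟩,
        by rw [c3], ?_⟩
      · intro u
        obtain ⟨d1, d2, d3⟩ := c7 u
        exact ⟨d1, d2, fun x => by rw [d3 x, c3]; simp⟩
      · omega
  · refine ⟨?_, fun _ _ => rfl, ?_, ⟨fun _ => [], fun u => ?_⟩, ?_⟩
    · intro r hr
      simp only [List.mem_cons, List.not_mem_nil, or_false, not_or] at hr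
      simp [St.setV_v, hr]
    · simp [St.setV_v, hs]
    · refine ⟨hhc u, List.Pairwise.nil, fun x => ?_⟩
      simp only [St.setV_v, if_true, hs, List.not_mem_nil, false_iff]
      intro h
      have := ht.lab_lt x h.1 h.2.1
      omega
    · simp [St.setV_v, hs]
  · rintro s₀ t₀ ⟨n', ⟨b1, b2, b3, ⟨ch, b4⟩, rfl⟩, hx, ht₀⟩
    simp only [Bx.Holds, Bx.cost, Ex.eval, Ex.cost] at hx ht₀
    refine ⟨⟨ch, fun u => ?_⟩, by omega, b1, b2⟩
    obtain ⟨d1, d2, d3⟩ := b4 u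
    refine ⟨d1, d2, fun x => ?_⟩
    rw [d3 x]
    have : s₀.v ρr ≤ s.A φlab x := by omega
    simp [this]

/-- The record in the array of edges for the edge to the node `x`. -/
def EdgeAt (E : Env α) (s s' : St) (p x : ℕ) : Prop :=
  s'.A φed (3 * p) = s.A φrp (s.A φlab x) ∧
  s'.A φed (3 * p + 1) = E.ex (s.A φrp (s.A φlab x)) ∧ s'.A φed (3 * p + 2) = x

/-- The lists of children are written one after another in the order of their parents, so the edges
of node `i` start after all edges of smaller nodes. Every node has only one parent, hence there are
fewer edges than nodes. -/
theorem outLoop_spec (hE : E.Big) (hN : s.v ρN ≤ 3 * E.m + 1) (hσ : σ ≤ E.m)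
    (ht : Trie σ (s.v ρN) (s.A φlab) (s.A φdep) (s.A φpar) arm)
    (hrp : ∀ r < σ, s.A φrp r < E.m) (hcnt : ∀ v < s.v ρN, s.A φcnt v < E.W)
    {ch : ℕ → List ℕ} (hch : ∀ u, IsList 0 (s.A φnc) (s.A φhc u) (ch u))
    (hnd : ∀ u, (ch u).Nodup)
    (hmem : ∀ u x, x ∈ ch u ↔ 1 ≤ x ∧ x < s.v ρN ∧ s.A φpar x = u) :
    Tr E outLoop (fun s' t => s'.v ρm = s.v ρN ∧ s'.v ρe ≤ s.v ρN ∧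
      (∀ p < s'.v ρe, s'.A φed (3 * p) < E.m) ∧
      (∀ i < s.v ρN, ∃ off, off + (ch i).length ≤ s'.v ρe ∧
        s'.A φrec (3 * i) = s.A φcnt i ∧ s'.A φrec (3 * i + 1) = 2 * E.m + φed * E.L + 3 * off ∧
        s'.A φrec (3 * i + 2) = (ch i).length ∧
        ∀ k x, (ch i)[k]? = some x → EdgeAt E s s' (off + k) x) ∧
      t ≤ 130 * s.v ρN + 20) s := by
  have hpos := hE.pos
  have hL := hE.len
  have hW := hE.num
  have hσN := ht.lt
  set fl : ℕ → List ℕ := fun i => (List.range i).flatMap ch with hfl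
  have hfls : ∀ i, fl (i + 1) = fl i ++ ch i := fun i => by
    simp [hfl, List.range_succ, List.flatMap_append]
  have hflN : ∀ i j, i ≤ j → fl i <+: fl j := by
    intro i j hij
    induction j, hij using Nat.le_induction with
    | base => exact List.prefix_rfl
    | succ j _ ih => exact ih.trans (hfls j ▸ List.prefix_append _ _)
  have hfll : ∀ i, (fl i).length ≤ s.v ρN - 1 := by
    intro i
    have hn : (fl i).Nodup := by
      rw [hfl, List.nodup_flatMap]
      refine ⟨fun u _ => hnd u, List.nodup_range.imp fun {a b} hab => ?_⟩
      rw [Function.onFun, List.disjoint_left]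
      intro x hx hx'
      exact hab (by rw [← ((hmem a x).1 hx).2.2, ← ((hmem b x).1 hx').2.2])
    rw [← List.toFinset_card_of_nodup hn]
    refine (Finset.card_le_card (t := Finset.Ico 1 (s.v ρN)) fun x hx => ?_).trans (by simp)
    simp only [hfl, List.mem_toFinset, List.mem_flatMap] at hx
    obtain ⟨u, _, hx⟩ := hx
    have := (hmem u x).1 hx
    simp
    omega
  rw [outLoop]
  simp only [tr_seq, tr_set, Ex.Safe, Ex.eval, Ex.cost, St.setV_v, St.setV_A]
  norm_num only [if_true, if_false, and_assoc, true_and, and_true]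
  repeat refine And.intro (by omega) ?_
  refine Tr.mono (tr_loop (fun n s' =>
    (∀ r, r ∉ [ρe, ρi, ρx, ρc0] → s'.v r = s.v r) ∧
    (∀ f, f ∉ [φrec, φed] → s'.A f = s.A f) ∧
    s'.v ρi ≤ s.v ρN ∧ s'.v ρe = (fl (s'.v ρi)).length ∧
    (∀ p x, (fl (s'.v ρi))[p]? = some x → EdgeAt E s s' p x) ∧
    (∀ i < s'.v ρi, s'.A φrec (3 * i) = s.A φcnt i ∧
      s'.A φrec (3 * i + 1) = 2 * E.m + φed * E.L + 3 * (fl i).length ∧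
      s'.A φrec (3 * i + 2) = (ch i).length) ∧
    n = 60 * (s.v ρN - s'.v ρi) + 60 * (s.v ρN - (fl (s'.v ρi)).length))
    (n := 60 * s.v ρN + 60 * s.v ρN) ?_ ?_) ?_
  · rintro n s₀ ⟨b1, b2, b3, b4, b5, b6, rfl⟩
    have eN : s₀.v ρN = s.v ρN := b1 _ (by norm_num)
    have ec : s₀.A φcnt = s.A φcnt := b2 _ (by norm_num)
    have eh : s₀.A φhc = s.A φhc := b2 _ (by norm_num)
    set i := s₀.v ρi with hi
    have hci := hcnt i
    have hl1 := hfll i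
    have hl2 := hfll (i + 1)
    rw [hfls i, List.length_append] at hl2
    simp only [tr_seq, tr_set, tr_put, Bx.Safe, Bx.Holds, Bx.cost, Ex.Safe, Ex.eval, Ex.cost,
      St.setV_v, St.setV_A, St.setA_v, St.setA_A, eN, ec, eh, ← hi]
    norm_num only [if_true, if_false, and_assoc, true_and, and_true, b4]
    intro hlt
    repeat refine And.intro (by omega) ?_
    refine Tr.mono (tr_loop (fun n s' =>
      (∀ r, r ∉ [ρe, ρi, ρx, ρc0] → s'.v r = s.v r) ∧
      (∀ f, f ∉ [φrec, φed] → s'.A f = s.A f) ∧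
      s'.v ρi = i ∧ s'.v ρc0 = (fl i).length ∧
      (∃ cur rem, cur ++ rem = fl (i + 1) ∧ (fl i).length ≤ cur.length ∧ s'.v ρe = cur.length ∧
        IsList 0 (s.A φnc) (s'.v ρx) rem ∧
        (∀ p x, cur[p]? = some x → EdgeAt E s s' p x) ∧
        n = 60 * rem.length) ∧
      (∀ j < i, s'.A φrec (3 * j) = s.A φcnt j ∧
        s'.A φrec (3 * j + 1) = 2 * E.m + φed * E.L + 3 * (fl j).length ∧
        s'.A φrec (3 * j + 2) = (ch j).length) ∧
      s'.A φrec (3 * i) = s.A φcnt i ∧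
      s'.A φrec (3 * i + 1) = 2 * E.m + φed * E.L + 3 * (fl i).length)
      (n := 60 * (ch i).length) ?_ ?_) ?_
    · rintro n s₁ ⟨c1, c2, c3, c4, ⟨cur, rem, c5, c6, c7, c8, c9, rfl⟩, c10, c11, c12⟩
      refine ⟨by simp only [Bx.Safe, Ex.Safe, and_true]; omega, ?_⟩
      simp only [Bx.Holds, Ex.eval]
      intro hx0
      obtain ⟨rem', hrem, c8'⟩ := c8.eq_cons (by omega)
      set x := s₁.v ρx with hx
      subst hrem
      have hl3 := congrArg List.length c5
      rw [List.length_append, List.length_cons] at hl3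
      have hl4 := hfll (i + 1)
      have hxm : x ∈ fl (i + 1) := by rw [← c5]; simp
      simp only [hfl, List.mem_flatMap] at hxm
      obtain ⟨u, _, hxu⟩ := hxm
      have hxN := (hmem u x).1 hxu
      have hlx := ht.lab_lt x hxN.1 hxN.2.1
      have hrx := hrp _ hlx
      have hN1 := hxN.2.1
      have el : s₁.A φlab = s.A φlab := c2 _ (by norm_num)
      have er : s₁.A φrp = s.A φrp := c2 _ (by norm_num)
      have en : s₁.A φnc = s.A φnc := c2 _ (by norm_num)
      simp only [tr_seq, tr_set, tr_put, Ex.Safe, Ex.eval, Ex.cost, Bx.cost, St.setV_v, St.setV_A,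
        St.setA_v, St.setA_A, el, er, en, ← hx, c7]
      norm_num only [if_true, if_false, and_assoc, true_and, and_true]
      repeat refine And.intro (by omega) ?_
      refine ⟨60 * rem'.length, ?_, ?_, c3, c4, ⟨cur ++ [x], rem', by rw [← c5]; simp, ?_, ?_, c8', ?_,
        rfl⟩, c10, c11, c12, ?_⟩
      · intro r hr
        have := c1 r hr
        simp only [List.mem_cons, List.not_mem_nil, or_false, not_or] at hr
        simp [hr, this]
      · intro f hf
        have := c2 f hf
        simp only [List.mem_cons, List.not_mem_nil, or_false, not_or] at hf
        simp [hf, this]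
      · rw [List.length_append]
        omega
      · simp
      · intro p y hp
        rcases lt_or_ge p cur.length with hlt' | hge
        · rw [List.getElem?_append_left hlt'] at hp
          obtain ⟨g1, g2, g3⟩ := c9 p y hp
          simp only [EdgeAt, St.setV_A, St.setA_A, if_true]
          rw [Function.update_of_ne (by omega), Function.update_of_ne (by omega),
            Function.update_of_ne (by omega), Function.update_of_ne (by omega),
            Function.update_of_ne (by omega), Function.update_of_ne (by omega),
            Function.update_of_ne (by omega), Function.update_of_ne (by omega),
            Function.update_of_ne (by omega)]
          exact ⟨g1, g2, g3⟩
        · rw [List.getElem?_append_right hge, List.getElem?_singleton] at hp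
          split_ifs at hp with hp0
          obtain rfl : x = y := by simpa using hp
          obtain rfl : p = cur.length := by omega
          simp only [EdgeAt, St.setV_A, St.setA_A, if_true]
          rw [show cur.length + cur.length + cur.length = 3 * cur.length by omega]
          simp [Function.update_apply]
      · simp only [List.length_cons]
        omega
    · refine ⟨?_, ?_, ?_, ?_, ⟨fl i, ch i, (hfls i).symm, le_rfl, ?_, ?_, ?_, rfl⟩, ?_, ?_, ?_⟩
      · intro r hr
        have := b1 r hr
        simp only [List.mem_cons, List.not_mem_nil, or_false, not_or] at hr
        simp [hr, this, St.setV_v, St.setA_v]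
      · intro f hf
        have := b2 f hf
        simp only [List.mem_cons, List.not_mem_nil, or_false, not_or] at hf
        simp [hf, this, St.setV_A, St.setA_A]
      · simp [St.setV_v, St.setA_v, hi]
      · simp [St.setV_v, St.setA_v, b4]
      · simp [St.setV_v, St.setA_v, b4]
      · simp only [St.setV_v, St.setA_v, if_true]
        exact hch i
      · intro p x hp
        exact b5 p x hp
      · intro j hj
        simp only [St.setV_A, St.setA_A, if_true]
        rw [Function.update_of_ne (by omega), Function.update_of_ne (by omega),
          Function.update_of_ne (by omega), Function.update_of_ne (by omega),
          Function.update_of_ne (by omega), Function.update_of_ne (by omega)]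
        exact b6 j hj
      · simp only [St.setV_A, St.setA_A, if_true]
        rw [Function.update_of_ne (by omega), show i + i + i = 3 * i by omega,
          Function.update_self]
      · simp only [St.setV_A, St.setA_A, if_true]
        rw [show i + i + i + 1 = 3 * i + 1 by omega, Function.update_self]
        omega
    · rintro s₁ t₁ ⟨n', ⟨c1, c2, c3, c4, ⟨cur, rem, c5, c6, c7, c8, c9, rfl⟩, c10, c11, c12⟩, hx,
        ht₁⟩
      simp only [Bx.Holds, Bx.cost, Ex.eval, Ex.cost] at hx ht₁
      obtain rfl : rem = [] := c8.eq_nil (by omega)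
      rw [List.append_nil] at c5
      subst c5
      have hl4 := hfll (i + 1)
      have hl5 : (fl (i + 1)).length = (fl i).length + (ch i).length := by
        rw [hfls, List.length_append]
      simp only [Ex.Safe, Ex.eval, Ex.cost, St.setV_v, St.setV_A,
        St.setA_v, St.setA_A, c3, c4, c7]
      norm_num only [if_true, if_false, and_assoc, true_and, and_true]
      repeat refine And.intro (by omega) ?_
      refine ⟨60 * (s.v ρN - (i + 1)) + 60 * (s.v ρN - (fl (i + 1)).length), ?_, ?_, by omega, ?_,
        ?_, rfl, by omega⟩
      · intro r hr
        have := c1 r hr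
        simp only [List.mem_cons, List.not_mem_nil, or_false, not_or] at hr
        simp [hr, this]
      · intro f hf
        have := c2 f hf
        simp only [List.mem_cons, List.not_mem_nil, or_false, not_or] at hf
        simp [hf, this]
      · intro p x hp
        exact c9 p x hp
      · intro j hj
        rcases Nat.lt_succ_iff_lt_or_eq.1 hj with hj | rfl
        · rw [Function.update_of_ne (by omega), Function.update_of_ne (by omega),
            Function.update_of_ne (by omega)]
          exact c10 j hj
        · rw [Function.update_of_ne (by omega), Function.update_of_ne (by omega)]
          refine ⟨c11, c12, ?_⟩
          rw [show i + i + i + 2 = 3 * i + 2 by omega, Function.update_self]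
          omega
  · refine ⟨?_, fun _ _ => rfl, ?_, ?_, ?_, ?_, ?_⟩
    · intro r hr
      simp only [List.mem_cons, List.not_mem_nil, or_false, not_or] at hr
      simp [St.setV_v, hr]
    · simp [St.setV_v]
    · simp [St.setV_v, hfl]
    · simp [St.setV_v, hfl]
    · simp [St.setV_v]
    · simp [St.setV_v, hfl]
  · rintro s₀ t₀ ⟨n', ⟨b1, b2, b3, b4, b5, b6, rfl⟩, hx, ht₀⟩
    have eN : s₀.v ρN = s.v ρN := b1 _ (by norm_num)
    simp only [Bx.Holds, Bx.cost, Ex.eval, Ex.cost, eN] at hx ht₀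
    have hi : s₀.v ρi = s.v ρN := by omega
    rw [hi] at b4 b5 b6
    simp only [tr_set, Ex.Safe, Ex.eval, Ex.cost, St.setV_v, St.setV_A, eN]
    norm_num only [if_true, if_false, and_assoc, true_and, and_true]
    have hlN := hfll (s.v ρN)
    refine ⟨by omega, ?_, ?_, by omega⟩
    · intro p hp
      rw [b4] at hp
      obtain ⟨g1, g2, g3⟩ := b5 p _ (List.getElem?_eq_getElem hp)
      rw [g1]
      have hxm := List.getElem_mem hp
      simp only [hfl, List.mem_flatMap] at hxm
      obtain ⟨u, _, hxu⟩ := hxm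
      have hxN := (hmem u _).1 hxu
      exact hrp _ (ht.lab_lt _ hxN.1 hxN.2.1)
    · intro i hiN
      obtain ⟨g1, g2, g3⟩ := b6 i hiN
      have hpre := hflN (i + 1) (s.v ρN) hiN
      have hle := hpre.length_le
      rw [hfls, List.length_append] at hle
      refine ⟨(fl i).length, by omega, g1, g2, g3, fun k x hk => b5 _ x ?_⟩
      have hk' : k < (ch i).length := by
        by_contra hk'
        rw [List.getElem?_eq_none (by omega)] at hk
        simp at hk
      obtain ⟨rest, hrest⟩ := hpre
      rw [← hrest, hfls, List.append_assoc, List.getElem?_append_right (by omega),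
        Nat.add_sub_cancel_left, List.getElem?_append_left hk', hk]

end Output

/-! ### Merging -/

/-- Following `nx` from `h` one visits the elements of the list, and ends at `t`. -/
def IsSeg (nx : ℕ → ℕ) : ℕ → List ℕ → ℕ → Prop
  | h, [], t => h = t
  | h, a :: l, t => nx h = a ∧ IsSeg nx a l t

namespace IsSeg

variable {nil h t a : ℕ} {nx : ℕ → ℕ} {l r : List ℕ}

theorem mem (hs : IsSeg nx h l t) : t ∈ h :: l := by
  induction l generalizing h with
  | nil =>
    have : h = t := hs
    simp [this]
  | cons b l ih => exact List.mem_cons_of_mem _ (ih hs.2)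

theorem push (hs : IsSeg nx h l t) (hn : (h :: l).Nodup) :
    IsSeg (Function.update nx t a) h (l ++ [a]) a := by
  induction l generalizing h with
  | nil =>
    obtain rfl : h = t := hs
    exact ⟨Function.update_self _ _ _, rfl⟩
  | cons b l ih =>
    obtain ⟨h1, h2⟩ := hs
    have hne : h ≠ t := by
      rintro rfl
      exact (List.nodup_cons.1 hn).1 h2.mem
    exact ⟨by rw [Function.update_of_ne hne, h1], ih h2 (List.nodup_cons.1 hn).2⟩

theorem isList (hs : IsSeg nx h l t) (hl : ∀ a ∈ l, a ≠ nil) (hr : IsList nil nx (nx t) r) :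
    IsList nil nx (nx h) (l ++ r) := by
  induction l generalizing h with
  | nil =>
    obtain rfl : h = t := hs
    exact hr
  | cons b l ih =>
    obtain ⟨h1, h2⟩ := hs
    refine ⟨h1, hl b (by simp), ih h2 fun a ha => hl a (by simp [ha])⟩

end IsSeg

section Merge

variable {α : Type u} [LinearOrder α] {E : Env α} {s : St} {σ l : ℕ}

/-- A run as an element of the lexicographic order. -/
def Env.key (E : Env α) (i : ℕ) : α ×ₗ ℕ := toLex (E.ltr i, E.ex i)

theorem Env.key_lt {i j : ℕ} : E.key i < E.key j ↔
    E.ltr i < E.ltr j ∨ E.ltr i = E.ltr j ∧ E.ex i < E.ex j := Prod.Lex.toLex_lt_toLex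

/-- The runs of the list are in increasing order. -/
def Inc (E : Env α) (l : List ℕ) : Prop := l.Pairwise fun i j => E.key i < E.key j

theorem Inc.insert {out x y : List ℕ} {a b : ℕ} (hx : Inc E (out ++ a :: x))
    (hy : Inc E (out ++ b :: y)) (hab : E.key a < E.key b) : Inc E (out ++ [a] ++ b :: y) := by
  simp only [Inc, List.pairwise_append, List.pairwise_cons] at hx hy ⊢
  obtain ⟨h1, ⟨h2, h3⟩, h4⟩ := hx
  obtain ⟨k1, ⟨k2, k3⟩, k4⟩ := hy
  refine ⟨⟨h1, ⟨by simp, List.Pairwise.nil⟩, fun i hi j hj => ?_⟩, ⟨k2, k3⟩, fun i hi j hj => ?_⟩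
  · obtain rfl : j = a := by simpa using hj
    exact h4 i hi j (by simp)
  · rcases List.mem_append.1 hi with hi | hi
    · exact k4 i hi j hj
    · obtain rfl : i = a := by simpa using hi
      rcases List.mem_cons.1 hj with rfl | hj
      · exact hab
      · exact hab.trans (k2 j hj)

theorem mergeStep_spec (hE : E.Big) (ha : s.v ρa < E.m) (hb : s.v ρb < E.m)
    (htl : s.v ρtl ≤ E.m + 1) (hnd : s.v ρnd < E.m) {Q : St → ℕ → Prop}
    (h1 : E.key (s.v ρa) < E.key (s.v ρb) → ∀ t ≤ 52,
      Q (((s.setA φnx (s.v ρtl) (s.v ρa)).setV ρtl (s.v ρa)).setV ρa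
        (Function.update (s.A φnx) (s.v ρtl) (s.v ρa) (s.v ρa))) t)
    (h2 : E.key (s.v ρb) < E.key (s.v ρa) → ∀ t ≤ 52,
      Q (((s.setA φnx (s.v ρtl) (s.v ρb)).setV ρtl (s.v ρb)).setV ρb
        (Function.update (s.A φnx) (s.v ρtl) (s.v ρb) (s.v ρb))) t)
    (h3 : E.key (s.v ρa) = E.key (s.v ρb) → ∀ t ≤ 52,
      Q ((((s.setA φrd (s.v ρb) (s.v ρa)).setA φdr (s.v ρnd) (s.v ρb)).setV ρnd
        (s.v ρnd + 1)).setV ρb (s.A φnx (s.v ρb))) t) :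
    Tr E mergeStep Q s := by
  have hpos := hE.pos
  have hL := hE.len
  have hW := hE.num
  have hA : E.key (s.v ρa) < E.key (s.v ρb) → ∀ k ≤ 40, Tr E takeA (fun s' t => Q s' (k + t)) s := by
    intro hk k hk'
    simp only [takeA, tr_seq, tr_set, tr_put, Ex.Safe, Ex.eval, Ex.cost, St.setV_v, St.setV_A,
      St.setA_v, St.setA_A]
    norm_num only [if_true, if_false, and_assoc, true_and, and_true]
    repeat refine And.intro (by omega) ?_
    exact h1 hk _ (by omega)
  have hB : E.key (s.v ρb) < E.key (s.v ρa) → ∀ k ≤ 40, Tr E takeB (fun s' t => Q s' (k + t)) s := by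
    intro hk k hk'
    simp only [takeB, tr_seq, tr_set, tr_put, Ex.Safe, Ex.eval, Ex.cost, St.setV_v, St.setV_A,
      St.setA_v, St.setA_A]
    norm_num only [if_true, if_false, and_assoc, true_and, and_true]
    repeat refine And.intro (by omega) ?_
    exact h2 hk _ (by omega)
  have hD : E.key (s.v ρa) = E.key (s.v ρb) → ∀ k ≤ 36, Tr E dropB (fun s' t => Q s' (k + t)) s := by
    intro hk k hk'
    simp only [dropB, tr_seq, tr_set, tr_put, Ex.Safe, Ex.eval, Ex.cost, St.setV_v, St.setV_A,
      St.setA_v, St.setA_A]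
    norm_num only [if_true, if_false, and_assoc, true_and, and_true]
    repeat refine And.intro (by omega) ?_
    exact h3 hk _ (by omega)
  simp only [Env.key_lt] at hA hB
  simp only [mergeStep, tr_ite, Bx.Safe, Bx.Holds, Bx.cost, Ex.Safe, Ex.eval, Ex.cost]
  norm_num only [and_assoc, true_and, and_true]
  repeat refine And.intro (by omega) ?_
  refine ⟨fun g1 => (hA (Or.inl g1) 7 (by omega)).mono fun s' t h => ?_, fun g1 => ?_⟩
  · convert h using 1
    omega
  repeat refine And.intro (by omega) ?_
  refine ⟨fun g2 => (hB (Or.inl g2) 14 (by omega)).mono fun s' t h => ?_, fun g2 => ?_⟩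
  · convert h using 1
    omega
  have heq : E.ltr (s.v ρa) = E.ltr (s.v ρb) := le_antisymm (not_lt.1 g2) (not_lt.1 g1)
  repeat refine And.intro (by omega) ?_
  refine ⟨fun g3 => (hA (Or.inr ⟨heq, g3⟩) 25 (by omega)).mono fun s' t h => ?_, fun g3 => ?_⟩
  · convert h using 1
    omega
  repeat refine And.intro (by omega) ?_
  refine ⟨fun g4 => (hB (Or.inr ⟨heq.symm, g4⟩) 36 (by omega)).mono fun s' t h => ?_,
    fun g4 => (hD ?_ 36 (by omega)).mono fun s' t h => ?_⟩
  · convert h using 1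
    omega
  · rw [Env.key, Env.key, heq, show E.ex (s.v ρa) = E.ex (s.v ρb) by omega]
  · convert h using 1
    omega

/-- The finished part followed by either of the two rests is strictly increasing throughout. A run
is dropped from `y` only when an equal run heads the rest of `x`, so the run that replaces it is not
dropped in this merge. -/
theorem mergeLoop_spec (hE : E.Big) (hm : s.v ρm = E.m) {x y : List ℕ}
    (hx : IsList E.m (s.A φnx) (s.v ρa) x) (hy : IsList E.m (s.A φnx) (s.v ρb) y)
    (hlt : ∀ i ∈ x ++ y, i < E.m) (hxy : (x ++ y).Nodup) (hsx : Inc E x) (hsy : Inc E y)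
    (htl : s.v ρtl = E.m + 1) (hnd : s.v ρnd + (x ++ y).length ≤ E.m) :
    Tr E mergeLoop (fun s' t => (∃ out rest Dn, IsSeg (s'.A φnx) (E.m + 1) out (s'.v ρtl) ∧
      IsList E.m (s'.A φnx) (min (s'.v ρa) (s'.v ρb)) rest ∧ Inc E (out ++ rest) ∧
      (out ++ rest ++ Dn).Perm (x ++ y) ∧ Dn ⊆ y ∧ s'.v ρnd = s.v ρnd + Dn.length ∧
      (∀ j b, Dn[j]? = some b → s'.A φdr (s.v ρnd + j) = b) ∧
      (∀ b ∈ Dn, s'.A φrd b ∈ x ∧ E.key (s'.A φrd b) = E.key b)) ∧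
      (∀ j < s.v ρnd, s'.A φdr j = s.A φdr j) ∧
      (∀ j, j ∉ x ++ y → j ≠ E.m + 1 → s'.A φnx j = s.A φnx j) ∧
      (∀ j, j ∉ x ++ y → s'.A φrd j = s.A φrd j) ∧
      t ≤ 60 * (x ++ y).length + 10 ∧
      (∀ r, r ∉ [ρa, ρb, ρtl, ρnd] → s'.v r = s.v r) ∧
      (∀ f, f ∉ [φnx, φrd, φdr] → s'.A f = s.A f)) s := by
  have hpos := hE.pos
  have hL := hE.len
  have hW := hE.num
  have hdisj := List.disjoint_of_nodup_append hxy
  rw [mergeLoop]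
  refine Tr.mono (tr_loop (fun n s' =>
    (∀ r, r ∉ [ρa, ρb, ρtl, ρnd] → s'.v r = s.v r) ∧
    (∀ f, f ∉ [φnx, φrd, φdr] → s'.A f = s.A f) ∧
    (∀ j < s.v ρnd, s'.A φdr j = s.A φdr j) ∧
    (∀ j, j ∉ x ++ y → j ≠ E.m + 1 → s'.A φnx j = s.A φnx j) ∧
    (∀ j, j ∉ x ++ y → s'.A φrd j = s.A φrd j) ∧
    ∃ out xr yr Dn, IsSeg (s'.A φnx) (E.m + 1) out (s'.v ρtl) ∧
      IsList E.m (s'.A φnx) (s'.v ρa) xr ∧ IsList E.m (s'.A φnx) (s'.v ρb) yr ∧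
      Inc E (out ++ xr) ∧ Inc E (out ++ yr) ∧ (out ++ xr ++ yr ++ Dn).Perm (x ++ y) ∧
      xr ⊆ x ∧ yr ⊆ y ∧ Dn ⊆ y ∧ s'.v ρnd = s.v ρnd + Dn.length ∧
      (∀ j b, Dn[j]? = some b → s'.A φdr (s.v ρnd + j) = b) ∧
      (∀ b ∈ Dn, s'.A φrd b ∈ x ∧ E.key (s'.A φrd b) = E.key b) ∧
      n = 60 * (xr.length + yr.length)) (n := 60 * (x.length + y.length)) ?_ ?_) ?_
  · rintro n s₀ ⟨b1, b2, b3, b4, b5, out, xr, yr, Dn, c1, c2, c3, c4, c5, c6, c7, c8, c9, c10, c11,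
      c12, rfl⟩
    have em : s₀.v ρm = E.m := by rw [b1 _ (by norm_num), hm]
    have hbd : ∀ h l, IsList E.m (s₀.A φnx) h l → l ⊆ x ++ y → h ≤ E.m := by
      intro h l hl hs
      cases l with
      | nil => exact le_of_eq hl
      | cons a l =>
        obtain ⟨rfl, _, _⟩ := hl
        exact (hlt _ (hs (by simp))).le
    have ha := hbd _ _ c2 fun a ha => List.mem_append_left _ (c7 ha)
    have hb := hbd _ _ c3 fun a ha => List.mem_append_right _ (c8 ha)
    refine ⟨by simp only [Bx.Safe, Ex.Safe, Ex.eval, and_true, true_and]; omega, ?_⟩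
    simp only [Bx.Holds, Bx.cost, Ex.eval, Ex.cost, em]
    intro hab
    obtain ⟨xr', rfl, c2'⟩ := c2.eq_cons (by omega)
    obtain ⟨yr', rfl, c3'⟩ := c3.eq_cons (by omega)
    set a := s₀.v ρa with hva
    set b := s₀.v ρb with hvb
    set q := s₀.v ρtl with hq
    have hnod : (out ++ a :: xr' ++ b :: yr' ++ Dn).Nodup := c6.nodup_iff.2 hxy
    have hlen := c6.length_eq
    have hmem : ∀ i, i ∈ out ++ a :: xr' ++ b :: yr' ++ Dn → i < E.m := fun i hi =>
      hlt i (c6.subset hi)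
    have hqm := c1.mem
    have hql : q ≤ E.m + 1 := by
      rcases List.mem_cons.1 hqm with h | h
      · omega
      · have := hmem q (by simp [h])
        omega
    have hqx : q ∉ a :: xr' ++ b :: yr' := by
      intro hq'
      rcases List.mem_cons.1 hqm with h | h
      · have := hmem q (by simp at hq' ⊢; tauto)
        omega
      · rw [List.append_assoc, List.append_assoc] at hnod
        refine List.disjoint_of_nodup_append hnod h ?_
        simp at hq' ⊢
        tauto
    have houtn : ((E.m + 1) :: out).Nodup := by
      rw [List.nodup_cons]
      refine ⟨fun h => ?_, ?_⟩
      · have := hmem (E.m + 1) (by simp [h])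
        omega
      · simp only [List.append_assoc] at hnod
        exact hnod.of_append_left
    have hqy : ∀ j, j ∉ x ++ y → j ≠ E.m + 1 → j ≠ q := by
      rintro j hj hj' rfl
      rcases List.mem_cons.1 hqm with h | h
      · exact hj' h
      · exact hj (c6.subset (by simp [h]))
    have hqa : q ∉ a :: xr' := fun h => hqx (List.mem_append_left _ h)
    have hqb : q ∉ b :: yr' := fun h => hqx (List.mem_append_right _ h)
    have haq : a ≠ q := fun h => hqa (by rw [← h]; simp)
    have hbq : b ≠ q := fun h => hqb (by rw [← h]; simp)
    have hax : a ∈ x := c7 (by simp)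
    have hby : b ∈ y := c8 (by simp)
    simp only [List.length_append, List.length_cons] at hlen hnd ⊢
    refine mergeStep_spec hE (by omega) (by omega) hql (by omega) ?_ ?_ ?_
    · intro hk t ht
      refine ⟨60 * (xr'.length + (yr'.length + 1)), ⟨?_, ?_, b3, ?_, b5, out ++ [a], xr', b :: yr', Dn,
        ?_, ?_, ?_, ?_, ?_, ?_, ?_, c8, c9, c10, c11, c12, ?_⟩, ?_⟩
      · intro r hr
        have := b1 r hr
        simp only [List.mem_cons, List.not_mem_nil, or_false, not_or] at hr
        simp [hr, this, St.setV_v, St.setA_v]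
      · intro f hf
        have := b2 f hf
        simp only [List.mem_cons, List.not_mem_nil, or_false, not_or] at hf
        simp [hf, this, St.setV_A, St.setA_A]
      · intro j hj hj'
        simp only [St.setV_A, St.setA_A, if_true]
        rw [Function.update_of_ne (hqy j hj hj'), b4 j hj hj']
      · exact c1.push houtn
      · simp only [St.setV_v, St.setV_A, St.setA_A, if_true]
        rw [Function.update_of_ne haq]
        exact c2'.update (fun h => hqa (List.mem_cons_of_mem _ h)) _
      · exact c3.update hqb _
      · simpa using c4
      · exact c4.insert c5 hk
      · simpa using c6
      · exact fun i hi => c7 (by simp [hi])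
      · simp
      · omega
    · intro hk t ht
      refine ⟨60 * (xr'.length + 1 + yr'.length), ⟨?_, ?_, b3, ?_, b5, out ++ [b], a :: xr', yr', Dn,
        ?_, ?_, ?_, ?_, ?_, ?_, c7, ?_, c9, c10, c11, c12, ?_⟩, ?_⟩
      · intro r hr
        have := b1 r hr
        simp only [List.mem_cons, List.not_mem_nil, or_false, not_or] at hr
        simp [hr, this, St.setV_v, St.setA_v]
      · intro f hf
        have := b2 f hf
        simp only [List.mem_cons, List.not_mem_nil, or_false, not_or] at hf
        simp [hf, this, St.setV_A, St.setA_A]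
      · intro j hj hj'
        simp only [St.setV_A, St.setA_A, if_true]
        rw [Function.update_of_ne (hqy j hj hj'), b4 j hj hj']
      · exact c1.push houtn
      · exact c2.update hqa _
      · simp only [St.setV_v, St.setV_A, St.setA_A, if_true]
        rw [Function.update_of_ne hbq]
        exact c3'.update (fun h => hqb (List.mem_cons_of_mem _ h)) _
      · exact c5.insert c4 hk
      · simpa using c5
      · refine List.Perm.trans ?_ c6
        simp only [List.append_assoc]
        refine List.Perm.append_left _ ?_
        refine (List.perm_append_comm_assoc _ _ _).trans ?_
        simp only [List.cons_append, List.nil_append]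
        exact List.Perm.refl _
      · exact fun i hi => c8 (by simp [hi])
      · simp
      · omega
    · intro hk t ht
      have hbx : b ∉ x := fun h => hdisj h hby
      have hbD : b ∉ Dn := by
        intro h
        simp only [List.append_assoc] at hnod
        have h1 := hnod.of_append_right.of_append_right
        exact List.disjoint_of_nodup_append h1 (List.mem_cons_self ..) h
      refine ⟨60 * (xr'.length + 1 + yr'.length), ⟨?_, ?_, ?_, b4, ?_, out, a :: xr', yr', Dn ++ [b],
        c1, c2, c3', c4, ?_, ?_, c7, ?_, ?_, ?_, ?_, ?_, ?_⟩, ?_⟩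
      · intro r hr
        have := b1 r hr
        simp only [List.mem_cons, List.not_mem_nil, or_false, not_or] at hr
        simp [hr, this, St.setV_v, St.setA_v]
      · intro f hf
        have := b2 f hf
        simp only [List.mem_cons, List.not_mem_nil, or_false, not_or] at hf
        simp [hf, this, St.setV_A, St.setA_A]
      · intro j hj
        simp only [St.setV_A, St.setA_A]
        norm_num only [if_true, if_false]
        rw [Function.update_of_ne (by omega), b3 j hj]
      · intro j hj
        simp only [St.setV_A, St.setA_A]
        norm_num only [if_true, if_false]
        rw [Function.update_of_ne (by
          rintro rfl
          exact hj (List.mem_append_right _ hby)), b5 j hj]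
      · exact c5.sublist (by simp)
      · refine List.Perm.trans ?_ c6
        simp only [List.append_assoc]
        refine List.Perm.append_left _ (List.Perm.append_left _ ?_)
        rw [← List.append_assoc]
        refine (List.perm_append_comm).trans ?_
        simp
      · exact fun i hi => c8 (by simp [hi])
      · intro i hi
        rcases List.mem_append.1 hi with hi | hi
        · exact c9 hi
        · obtain rfl : i = b := by simpa using hi
          exact hby
      · simp only [St.setV_v, if_true, List.length_append, List.length_singleton]
        norm_num only [if_true, if_false]
        omega
      · intro j i hj
        simp only [St.setV_A, St.setA_A]
        norm_num only [if_true, if_false]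
        rcases lt_or_ge j Dn.length with hlt' | hge
        · rw [List.getElem?_append_left hlt'] at hj
          rw [Function.update_of_ne (by omega), c11 j i hj]
        · rw [List.getElem?_append_right hge, List.getElem?_singleton] at hj
          split_ifs at hj with hj0
          obtain rfl : b = i := by simpa using hj
          rw [show s.v ρnd + j = s₀.v ρnd by omega, Function.update_self]
      · intro i hi
        simp only [St.setV_A, St.setA_A]
        norm_num only [if_true, if_false]
        rcases List.mem_append.1 hi with hi | hi
        · rw [Function.update_of_ne (fun h => hbD (by rwa [h] at hi))]
          exact c12 i hi
        · obtain rfl : i = b := by simpa using hi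
          rw [Function.update_self]
          exact ⟨hax, hk⟩
      · simp
      · omega
  · exact ⟨fun _ _ => rfl, fun _ _ => rfl, fun _ _ => rfl, fun _ _ _ => rfl, fun _ _ => rfl,
      [], x, y, [], htl.symm, hx, hy, hsx, hsy, by simp, List.Subset.refl _, List.Subset.refl _,
      by simp, by simp, by simp, by simp, rfl⟩
  · rintro s₀ t₀ ⟨n', ⟨b1, b2, b3, b4, b5, out, xr, yr, Dn, c1, c2, c3, c4, c5, c6, c7, c8, c9, c10,
      c11, c12, rfl⟩, hab, ht₀⟩
    have em : s₀.v ρm = E.m := by rw [b1 _ (by norm_num), hm]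
    simp only [Bx.Holds, Bx.cost, Ex.eval, Ex.cost, em] at hab ht₀
    have hbd : ∀ h l, IsList E.m (s₀.A φnx) h l → l ⊆ x ++ y → h ≤ E.m := by
      intro h l hl hs
      cases l with
      | nil => exact le_of_eq hl
      | cons a l =>
        obtain ⟨rfl, _, _⟩ := hl
        exact (hlt _ (hs (by simp))).le
    have ha := hbd _ _ c2 fun a ha => List.mem_append_left _ (c7 ha)
    have hb := hbd _ _ c3 fun a ha => List.mem_append_right _ (c8 ha)
    refine ⟨?_, b3, b4, b5, by rw [List.length_append]; omega, b1, b2⟩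
    -- One list has ended, and its end mark is at least the other head; the minimum is therefore the
    -- head of what remains.
    rcases (show s₀.v ρa = E.m ∨ s₀.v ρb = E.m by omega) with h | h
    · obtain rfl := c2.eq_nil h
      exact ⟨out, yr, Dn, c1, by rwa [h, min_eq_right hb], c5, by simpa using c6, c9, c10, c11, c12⟩
    · obtain rfl := c3.eq_nil h
      exact ⟨out, xr, Dn, c1, by rwa [h, min_eq_left ha], c4, by simpa using c6, c9, c10, c11, c12⟩

end Merge

/-! ### Sorting the runs -/

theorem IsSeg.update_end {h t a : ℕ} {nx : ℕ → ℕ} {l : List ℕ} (hs : IsSeg nx h l t)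
    (hn : (h :: l).Nodup) : IsSeg (Function.update nx t a) h l t := by
  induction l generalizing h with
  | nil => exact hs
  | cons b l ih =>
    obtain ⟨h1, h2⟩ := hs
    have hne : h ≠ t := by
      rintro rfl
      exact (List.nodup_cons.1 hn).1 h2.mem
    exact ⟨by rw [Function.update_of_ne hne, h1], ih h2 (List.nodup_cons.1 hn).2⟩

/-- The potential of a sorted list that was made from `w` runs, if there are at most `2 ^ l` distinct
runs. -/
def sortPot (l w : ℕ) : ℕ := w * (2 * l + 2 - Nat.log 2 (w ^ 2)) + 2 * min w (2 ^ l)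

/-- As long as `w₂ < 2 ^ (l + 1)`, the merge raises the logarithm of the squared weight by at least
one for all `w₁ + w₂` runs, which pays for the at most `w₁ + w₂` elements. The square is needed
because the weight is only known to grow by the factor `3 / 2`, and `(3 / 2) ^ 2 ≥ 2`. For larger
weights both minima equal `2 ^ l`, and the one that disappears releases `2 * 2 ^ l ≥ a + b`. -/
theorem sortPot_add {l w₁ w₂ a b : ℕ} (h1 : 1 ≤ w₁) (h12 : w₁ ≤ w₂) (h2 : w₂ ≤ 2 * w₁)
    (ha : a ≤ w₁) (hb : b ≤ w₂) (ha' : a ≤ 2 ^ l) (hb' : b ≤ 2 ^ l) :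
    a + b + sortPot l (w₁ + w₂) ≤ sortPot l w₁ + sortPot l w₂ := by
  have hl1 : Nat.log 2 (w₁ ^ 2) ≤ Nat.log 2 (w₂ ^ 2) :=
    Nat.log_mono_right (Nat.pow_le_pow_left h12 2)
  have hl2 : Nat.log 2 (w₂ ^ 2) + 1 ≤ Nat.log 2 ((w₁ + w₂) ^ 2) := by
    rw [← Nat.log_mul_base (by norm_num) (pow_ne_zero _ (by omega))]
    exact Nat.log_mono_right (by nlinarith)
  have hmin : min (w₁ + w₂) (2 ^ l) ≤ min w₁ (2 ^ l) + min w₂ (2 ^ l) := by omega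
  unfold sortPot
  by_cases hw : w₂ < 2 ^ (l + 1)
  · have h3 : Nat.log 2 (w₂ ^ 2) < 2 * l + 2 := by
      refine Nat.log_lt_of_lt_pow (pow_ne_zero _ (by omega)) ?_
      rw [show 2 * l + 2 = (l + 1) * 2 by ring, pow_mul]
      exact Nat.pow_lt_pow_left hw (by norm_num)
    have h4 : 1 + (2 * l + 2 - Nat.log 2 ((w₁ + w₂) ^ 2)) ≤ 2 * l + 2 - Nat.log 2 (w₁ ^ 2) := by
      omega
    have h5 : 1 + (2 * l + 2 - Nat.log 2 ((w₁ + w₂) ^ 2)) ≤ 2 * l + 2 - Nat.log 2 (w₂ ^ 2) := by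
      omega
    have h6 := Nat.mul_le_mul_left w₁ h4
    have h7 := Nat.mul_le_mul_left w₂ h5
    rw [Nat.mul_add] at h6 h7
    rw [Nat.add_mul]
    omega
  · have h3 : 2 * l + 2 ≤ Nat.log 2 (w₂ ^ 2) := by
      refine Nat.le_log_of_pow_le (by norm_num) ?_
      rw [show 2 * l + 2 = (l + 1) * 2 by ring, pow_mul]
      exact Nat.pow_le_pow_left (by omega) 2
    rw [Nat.sub_eq_zero_of_le (show 2 * l + 2 ≤ Nat.log 2 ((w₁ + w₂) ^ 2) by omega),
      Nat.sub_eq_zero_of_le h3]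
    rw [pow_succ] at hw
    have h4 : 2 ^ l ≤ w₁ := by omega
    rw [min_eq_right h4, min_eq_right (h4.trans h12), min_eq_right (by omega)]
    omega

section Sorting

variable {α : Type u} [LinearOrder α] {E : Env α} {s : St} {σ l : ℕ}

/-- The queue holds sorted lists of runs, with their weights; the runs in `D` were dropped. -/
structure Queue (E : Env α) (s : St) (q : List (ℕ × List ℕ)) (D : List ℕ) : Prop where
  hm : s.v ρm = E.m
  qt : s.v ρqt = s.v ρqh + q.length
  cap : s.v ρqh + 2 * q.length ≤ 2 * E.m
  lists : ∀ j p, q[j]? = some p → IsList E.m (s.A φnx) (s.A φQ (s.v ρqh + j)) p.2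
  inc : ∀ p ∈ q, Inc E p.2 ∧ p.2.length ≤ p.1 ∧ 1 ≤ p.1
  sorted : q.Pairwise fun p p' => p.1 ≤ p'.1
  double : ∀ p ∈ q, ∀ p' ∈ q, p.1 ≤ 2 * p'.1
  perm : ((q.map Prod.snd).flatten ++ D).Perm (List.range E.m)
  nd : s.v ρnd = D.length
  dr : ∀ j b, D[j]? = some b → s.A φdr j = b
  drop : ∀ b ∈ D, s.A φrd b < E.m ∧ s.A φrd b ≠ b ∧ E.key (s.A φrd b) = E.key b
  order : D.Pairwise fun b' b => s.A φrd b ≠ b'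

/-- The potential of a queue. -/
def queuePot (l : ℕ) (q : List (ℕ × List ℕ)) : ℕ :=
  60 * (q.map fun p => sortPot l p.1).sum + 100 * q.length

/-- A strictly increasing list has no two equal runs. This is the gain from dropping duplicates
early. -/
theorem Inc.length_le {x : List ℕ} (h : Inc E x) (hx : ∀ i ∈ x, i < E.m)
    (hσ : ((Finset.range E.m).image E.key).card ≤ σ) : x.length ≤ σ := by
  refine le_trans ?_ hσ
  have hn : (x.map E.key).Nodup := by
    rw [List.Nodup, List.pairwise_map]
    exact h.imp fun h => h.ne
  rw [← List.length_map (f := E.key), ← List.toFinset_card_of_nodup hn]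
  refine Finset.card_le_card fun k hk => ?_
  simp only [List.mem_toFinset, List.mem_map] at hk
  obtain ⟨i, hi, rfl⟩ := hk
  exact Finset.mem_image_of_mem _ (Finset.mem_range.2 (hx i hi))

/-- The weights in the queue are nondecreasing and differ by a factor of at most two. Merging the
two lightest lists and appending the result preserves this, so that `sortPot_add` applies in every
step. -/
theorem sortStep_spec (hE : E.Big) {p₁ p₂ : ℕ × List ℕ} {q : List (ℕ × List ℕ)} {D : List ℕ}
    (h : Queue E s (p₁ :: p₂ :: q) D)
    (hσ : ((Finset.range E.m).image E.key).card ≤ 2 ^ l) :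
    Tr E sortStep (fun s' t => (∃ p D', Queue E s' (q ++ [p]) D' ∧
      t + 10 + queuePot l (q ++ [p]) ≤ queuePot l (p₁ :: p₂ :: q)) ∧
      (∀ r, r ∉ [ρqh, ρqt, ρa, ρb, ρtl, ρnd] → s'.v r = s.v r) ∧
      (∀ f, f ∉ [φQ, φnx, φrd, φdr] → s'.A f = s.A f)) s := by
  have hpos := hE.pos
  have hL := hE.len
  have hW := hE.num
  have hm := h.hm
  have hqt := h.qt
  have hcap := h.cap
  obtain ⟨w₁, x⟩ := p₁
  obtain ⟨w₂, y⟩ := p₂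
  simp only [List.length_cons] at hqt hcap
  have hperm := h.perm
  simp only [List.map_cons, List.flatten_cons] at hperm
  have hnod := hperm.nodup_iff.2 List.nodup_range
  have hlt : ∀ i, i ∈ x ++ (y ++ (q.map Prod.snd).flatten) ++ D → i < E.m := fun i hi =>
    List.mem_range.1 (hperm.subset hi)
  have hplen := hperm.length_eq
  simp only [List.length_append, List.length_range] at hplen
  have hxy : (x ++ y).Nodup := by
    rw [← List.append_assoc] at hnod
    exact hnod.of_append_left.of_append_left
  have hxyo : ∀ i ∈ x ++ y, i ∉ (q.map Prod.snd).flatten ∧ i ∉ D := by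
    rw [← List.append_assoc, List.append_assoc] at hnod
    intro i hi
    have := List.disjoint_of_nodup_append hnod hi
    rw [List.mem_append] at this
    exact not_or.1 this
  obtain ⟨hi1, hi2, hi3⟩ := h.inc (w₁, x) (by simp)
  obtain ⟨hj1, hj2, hj3⟩ := h.inc (w₂, y) (by simp)
  dsimp only at hi1 hi2 hi3 hj1 hj2 hj3
  have hw12 : w₁ ≤ w₂ := (List.pairwise_cons.1 h.sorted).1 (w₂, y) (by simp)
  have hw21 : w₂ ≤ 2 * w₁ := h.double (w₂, y) (by simp) (w₁, x) (by simp)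
  have hnd := h.nd
  simp only [sortStep, tr_seq, tr_set, Ex.Safe, Ex.eval, Ex.cost, St.setV_v, St.setV_A, hm]
  norm_num only [if_true, if_false, and_assoc, true_and, and_true]
  repeat refine And.intro (by omega) ?_
  refine (mergeLoop_spec hE (x := x) (y := y)
    (s := (((s.setV ρa (s.A φQ (s.v ρqh))).setV ρb (s.A φQ (s.v ρqh + 1))).setV ρqh
      (s.v ρqh + 2)).setV ρtl (E.m + 1)) (by simp [St.setV_v, hm])
    (by simpa [St.setV_v, St.setV_A] using h.lists 0 (w₁, x) (by simp))
    (by simpa [St.setV_v, St.setV_A] using h.lists 1 (w₂, y) (by simp))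
    (fun i hi => hlt i (by simp at hi ⊢; tauto)) hxy hi1 hj1 (by simp [St.setV_v])
    (by simp [St.setV_v]; omega)).mono ?_
  rintro s₁ t₁ ⟨⟨out, rest, Dn, c1, c2, c3, c4, c5, c6, c7, c8⟩, c9, c10, c11, c12, c13, c14⟩
  simp only [St.setV_v, St.setV_A] at c6 c7 c9 c10 c11 c13 c14
  norm_num only [if_true, if_false] at c6 c7 c9 c10 c11 c13 c14
  have em : s₁.v ρm = E.m := by rw [c13 _ (by norm_num)]; simp [hm]
  have eqt : s₁.v ρqt = s.v ρqt := by rw [c13 _ (by norm_num)]; simp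
  have eqh : s₁.v ρqh = s.v ρqh + 2 := by rw [c13 _ (by norm_num)]; simp
  have eQ : s₁.A φQ = s.A φQ := c14 _ (by norm_num)
  have hclen := c4.length_eq
  simp only [List.length_append] at hclen
  have hcmem : ∀ i, i ∈ out ++ rest ++ Dn → i ∈ x ++ y := fun i hi => c4.subset hi
  have hcnod := c4.nodup_iff.2 hxy
  have hmn : s₁.v ρa - (s₁.v ρa - s₁.v ρb) = min (s₁.v ρa) (s₁.v ρb) := by omega
  set v := min (s₁.v ρa) (s₁.v ρb) with hv
  set z := s₁.v ρtl with hz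
  have hzm := c1.mem
  have hout : ∀ i ∈ out, i < E.m := fun i hi => hlt i (by
    have := hcmem i (by simp [hi])
    simp at this ⊢
    tauto)
  have hzl : z ≤ E.m + 1 := by
    rcases List.mem_cons.1 hzm with h | h
    · omega
    · have := hout _ h
      omega
  have hzr : z ∉ rest := by
    intro hzr
    rcases List.mem_cons.1 hzm with h | h
    · have := hlt z (by
        have := hcmem z (by simp [hzr])
        simp at this ⊢
        tauto)
      omega
    · exact List.disjoint_of_nodup_append hcnod.of_append_left h hzr
  have houtn : ((E.m + 1) :: out).Nodup := by
    refine List.nodup_cons.2 ⟨fun h => ?_, hcnod.of_append_left.of_append_left⟩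
    have := hout _ h
    omega
  have hzo : ∀ j, j ∉ x ++ y → j ≠ E.m + 1 → j ≠ z := by
    rintro j hj hj' rfl
    rcases List.mem_cons.1 hzm with h | h
    · exact hj' h
    · exact hj (hcmem _ (by simp [h]))
  have hnew : IsList E.m (Function.update (s₁.A φnx) z v) (Function.update (s₁.A φnx) z v (E.m + 1))
      (out ++ rest) := by
    refine (c1.update_end houtn).isList (fun i hi => (hout i hi).ne) ?_
    rw [Function.update_self]
    exact c2.update hzr v
  simp only [tr_seq, tr_set, tr_put, Ex.Safe, Ex.eval, Ex.cost, St.setV_v, St.setV_A, St.setA_v,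
    St.setA_A, em, eqt, hmn]
  norm_num only [if_true, if_false, and_assoc, true_and, and_true]
  repeat refine And.intro (by omega) ?_
  have hinc := c3
  have hpot : x.length + y.length + sortPot l (w₁ + w₂) ≤ sortPot l w₁ + sortPot l w₂ :=
    sortPot_add hi3 hw12 hw21 hi2 hj2
      (hi1.length_le (fun i hi => hlt i (by simp [hi])) hσ)
      (hj1.length_le (fun i hi => hlt i (by simp [hi])) hσ)
  refine ⟨⟨(w₁ + w₂, out ++ rest), D ++ Dn, ?_, ?_⟩, ?_, ?_⟩
  · have hQold : ∀ j < q.length, Function.update (s₁.A φQ) (s.v ρqt)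
        (Function.update (s₁.A φnx) z v (E.m + 1)) (s.v ρqh + 2 + j) = s.A φQ (s.v ρqh + (j + 2)) := by
      intro j hj
      rw [Function.update_of_ne (by omega), eQ, add_assoc, add_comm 2 j]
    have hrdD : ∀ b ∈ D, s₁.A φrd b = s.A φrd b := fun b hb =>
      c11 b fun hxy => (hxyo b hxy).2 hb
    constructor
    · simp [St.setV_v, St.setA_v, em]
    · simp [St.setV_v, St.setA_v, eqh, hqt]
      omega
    · simp [St.setV_v, St.setA_v, eqh]
      omega
    · intro j p hp
      simp only [St.setV_v, St.setV_A, St.setA_v, St.setA_A]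
      norm_num only [if_true, if_false]
      rw [eqh]
      rcases lt_or_ge j q.length with hj | hj
      · rw [List.getElem?_append_left hj] at hp
        rw [hQold j hj]
        have hold := h.lists (j + 2) p (by simpa using hp)
        refine hold.congr fun i hi => ?_
        have hiq : i ∈ (q.map Prod.snd).flatten :=
          List.mem_flatten.2 ⟨p.2, List.mem_map_of_mem (List.mem_of_getElem? hp), hi⟩
        have hixy : i ∉ x ++ y := fun hh => (hxyo i hh).1 hiq
        have him := hlt i (by simp only [List.mem_append]; tauto)
        rw [Function.update_of_ne (hzo i hixy (by omega)), c10 i hixy (by omega)]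
      · rw [List.getElem?_append_right hj, List.getElem?_singleton] at hp
        split_ifs at hp with hj0
        obtain rfl : (w₁ + w₂, out ++ rest) = p := by simpa using hp
        rw [show s.v ρqh + 2 + j = s.v ρqt by omega, Function.update_self]
        exact hnew
    · intro p hp
      rcases List.mem_append.1 hp with hp | hp
      · exact h.inc p (by simp [hp])
      · obtain rfl : p = (w₁ + w₂, out ++ rest) := by simpa using hp
        refine ⟨c3, ?_, ?_⟩
        · simp only [List.length_append]
          omega
        · show 1 ≤ w₁ + w₂
          omega
    · have hs := h.sorted
      simp only [List.pairwise_cons] at hs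
      refine List.pairwise_append.2 ⟨hs.2.2, List.pairwise_singleton _ _, fun p hp p' hp' => ?_⟩
      obtain rfl : p' = (w₁ + w₂, out ++ rest) := by simpa using hp'
      -- Every weight is at most twice the smallest one, hence at most the sum of the two smallest.
      have := h.double p (by simp [hp]) (w₁, x) (by simp)
      simp only at this ⊢
      omega
    · intro p hp p' hp'
      have hs := h.sorted
      simp only [List.pairwise_cons] at hs
      rcases List.mem_append.1 hp with hp | hp <;> rcases List.mem_append.1 hp' with hp' | hp'
      · exact h.double p (by simp [hp]) p' (by simp [hp'])
      · obtain rfl : p' = (w₁ + w₂, out ++ rest) := by simpa using hp'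
        have := h.double p (by simp [hp]) (w₁, x) (by simp)
        simp only at this ⊢
        omega
      · obtain rfl : p = (w₁ + w₂, out ++ rest) := by simpa using hp
        have h1 := hs.1 p' (by simp [hp'])
        have h2 := hs.2.1 p' hp'
        simp only at h1 h2 ⊢
        omega
      · obtain rfl : p' = (w₁ + w₂, out ++ rest) := by simpa using hp'
        obtain rfl : p = (w₁ + w₂, out ++ rest) := by simpa using hp
        simp only
        omega
    · refine List.Perm.trans ?_ hperm
      simp only [List.map_append, List.map_cons, List.map_nil, List.flatten_append,
        List.flatten_cons, List.flatten_nil, List.append_nil]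
      rw [← List.append_assoc x y]
      refine List.Perm.trans ?_ ((c4.append_right _).append_right _)
      simp only [← Multiset.coe_eq_coe, ← Multiset.coe_add]
      abel
    · simp only [St.setV_v, St.setA_v]
      norm_num only [if_true, if_false]
      rw [c6, hnd, List.length_append]
    · intro j b hj
      simp only [St.setV_A, St.setA_A]
      norm_num only [if_true, if_false]
      rcases lt_or_ge j D.length with hlt' | hge
      · rw [List.getElem?_append_left hlt'] at hj
        rw [c9 j (by omega), h.dr j b hj]
      · rw [List.getElem?_append_right hge] at hj
        have := c7 _ b hj
        rwa [hnd, Nat.add_sub_cancel' hge] at this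
    · intro b hb
      simp only [St.setV_A, St.setA_A]
      norm_num only [if_true, if_false]
      rcases List.mem_append.1 hb with hb | hb
      · rw [hrdD b hb]
        exact h.drop b hb
      · obtain ⟨g1, g2⟩ := c8 b hb
        refine ⟨hlt _ (by simp [g1]), ?_, g2⟩
        intro he
        rw [he] at g1
        exact List.disjoint_of_nodup_append hxy g1 (c5 hb)
    · simp only [St.setV_A, St.setA_A]
      norm_num only [if_true, if_false]
      refine List.pairwise_append.2 ⟨?_, ?_, ?_⟩
      · refine h.order.imp_of_mem fun {b' b} _ hb hne => ?_
        rwa [hrdD b hb]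
      -- Runs dropped in this merge lie in `y`, but the runs that replace them lie in `x`, where
      -- nothing has been dropped so far.
      · refine List.pairwise_of_forall_mem_list fun b' hb' b hb he => ?_
        have g1 := (c8 b hb).1
        rw [he] at g1
        exact List.disjoint_of_nodup_append hxy g1 (c5 hb')
      · intro b' hb' b hb he
        have g1 := (c8 b hb).1
        rw [he] at g1
        exact (hxyo b' (by simp [g1])).2 hb'
  · simp only [queuePot, List.map_append, List.map_cons, List.map_nil, List.sum_append,
      List.sum_cons, List.sum_nil, List.length_append, List.length_cons, List.length_nil]
    simp only [List.length_append] at c12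
    omega
  · intro r hr
    have := c13 r
    simp only [List.mem_cons, List.not_mem_nil, or_false, not_or] at hr this
    simp [hr, this]
  · intro f hf
    have := c14 f
    simp only [List.mem_cons, List.not_mem_nil, or_false, not_or] at hf this
    simp [hf, this]

end Sorting

/-! ### From the sorted list to the ranks of all runs. -/

section Ranks

variable {α : Type u} [LinearOrder α] {E : Env α} {s : St} {σ l : ℕ}

theorem initLoop_spec (hE : E.Big) (hm : s.v ρm = E.m) (hH : s.A φH 0 = 0) (hB : s.A φB 0 = 0) :
    Tr E initLoop (fun s' t => (∀ j < E.m, s'.A φQ j = j ∧ s'.A φnx j = E.m) ∧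
      (∀ j ≤ E.m, s'.A φH j = j / 2 ∧ s'.A φB j = j % 2) ∧ t ≤ 40 * E.m + 10 ∧
      (∀ r, r ∉ [ρi] → s'.v r = s.v r) ∧
      (∀ f, f ∉ [φQ, φnx, φB, φH] → s'.A f = s.A f)) s := by
  have hpos := hE.pos
  have hL := hE.len
  have hW := hE.num
  rw [initLoop]
  simp only [tr_seq, tr_set, Ex.Safe, Ex.eval, Ex.cost]
  norm_num only [if_true, if_false, and_assoc, true_and, and_true]
  repeat refine And.intro (by omega) ?_
  refine Tr.mono (tr_loop (fun n s' =>
    (∀ r, r ∉ [ρi] → s'.v r = s.v r) ∧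
    (∀ f, f ∉ [φQ, φnx, φB, φH] → s'.A f = s.A f) ∧ s'.v ρi ≤ E.m ∧
    (∀ j < s'.v ρi, s'.A φQ j = j ∧ s'.A φnx j = E.m) ∧
    (∀ j ≤ s'.v ρi, s'.A φH j = j / 2 ∧ s'.A φB j = j % 2) ∧ n = 40 * (E.m - s'.v ρi))
    (n := 40 * E.m) ?_ ?_) ?_
  · rintro n s₀ ⟨b1, b2, b3, b4, b5, rfl⟩
    have em : s₀.v ρm = E.m := by rw [b1 _ (by norm_num), hm]
    set i := s₀.v ρi with hi
    obtain ⟨hHi, hBi⟩ := b5 i le_rfl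
    have hBi1 : 1 - i % 2 = (i + 1) % 2 := by omega
    simp only [tr_seq, tr_set, tr_put, Bx.Safe, Bx.Holds, Bx.cost, Ex.Safe, Ex.eval, Ex.cost,
      St.setV_v, St.setV_A, St.setA_v, St.setA_A, em, ← hi]
    norm_num only [if_true, if_false, and_assoc, true_and, and_true, hHi, hBi, Function.update_of_ne,
      ne_eq, Nat.lt_irrefl, (Nat.lt_succ_self i).ne, not_false_eq_true, hBi1]
    intro hlt
    repeat refine And.intro (by omega) ?_
    refine ⟨40 * (E.m - (i + 1)), ?_, ?_, by omega, ?_, ?_, rfl, by omega⟩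
    · intro r hr
      have := b1 r hr
      simp only [List.mem_cons, List.not_mem_nil, or_false, not_or] at hr
      simp [hr, this]
    · intro f hf
      have := b2 f hf
      simp only [List.mem_cons, List.not_mem_nil, or_false, not_or] at hf
      simp [hf, this]
    · intro j hj
      by_cases hji : j = i
      · simp [hji]
      · rw [Function.update_of_ne hji, Function.update_of_ne hji]
        exact b4 j (by omega)
    · intro j hj
      by_cases hji : j = i + 1
      · subst hji
        rw [Function.update_self, Function.update_self]
        omega
      · rw [Function.update_of_ne hji, Function.update_of_ne hji]
        exact b5 j (by omega)
  · refine ⟨?_, fun _ _ => rfl, ?_, ?_, ?_, ?_⟩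
    · intro r hr
      simp only [List.mem_cons, List.not_mem_nil, or_false, not_or] at hr
      simp [St.setV_v, hr]
    · simp [St.setV_v]
    · simp [St.setV_v]
    · simp [St.setV_v, St.setV_A, hH, hB]
    · simp [St.setV_v]
  · rintro s₀ t₀ ⟨n', ⟨b1, b2, b3, b4, b5, rfl⟩, hx, ht⟩
    have em : s₀.v ρm = E.m := by rw [b1 _ (by norm_num), hm]
    simp only [Bx.Holds, Bx.cost, Ex.eval, Ex.cost, em] at hx ht
    have hi : s₀.v ρi = E.m := by omega
    rw [hi] at b4 b5
    exact ⟨b4, b5, by omega, b1, b2⟩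

theorem Queue.init {s' : St} (hm : s'.v ρm = E.m) (hh : s'.v ρqh = 0) (ht : s'.v ρqt = E.m)
    (hn : s'.v ρnd = 0) (hQ : ∀ j < E.m, s'.A φQ j = j ∧ s'.A φnx j = E.m) :
    Queue E s' ((List.range E.m).map fun i => (1, [i])) [] := by
  constructor
  · exact hm
  · simp [hh, ht]
  · simp [hh]
  · intro j p hp
    simp only [List.getElem?_map, Option.map_eq_some_iff] at hp
    obtain ⟨i, hi, rfl⟩ := hp
    obtain ⟨hj, rfl⟩ := List.getElem?_eq_some_iff.1 hi
    simp only [List.length_range] at hj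
    simp only [List.getElem_range, hh, zero_add]
    exact ⟨(hQ j hj).1, hj.ne, (hQ j hj).2⟩
  · simp only [List.mem_map]
    rintro p ⟨i, _, rfl⟩
    exact ⟨List.pairwise_singleton _ _, le_rfl, le_rfl⟩
  · rw [List.pairwise_map]
    exact List.pairwise_of_forall_mem_list fun _ _ _ _ => le_rfl
  · simp only [List.mem_map]
    rintro p ⟨i, _, rfl⟩ p' ⟨i', _, rfl⟩
    norm_num
  · rw [List.map_map, List.append_nil]
    have : (List.map (Prod.snd ∘ fun i => (1, [i])) (List.range E.m)).flatten = List.range E.m := by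
      induction List.range E.m with
      | nil => rfl
      | cons a x ih => simpa using ih
    rw [this]
  · simpa using hn
  · simp
  · simp
  · exact List.Pairwise.nil

theorem sortLoop_spec (hE : E.Big) (hm : s.v ρm = E.m)
    (hQ : ∀ j < E.m, s.A φQ j = j ∧ s.A φnx j = E.m)
    (hσ : ((Finset.range E.m).image E.key).card ≤ 2 ^ l) :
    Tr E sortLoop (fun s' t => (∃ w F D, Queue E s' [(w, F)] D) ∧
      t ≤ 60 * (E.m * (2 * l + 4)) + 100 * E.m + 20 ∧
      (∀ r, r ∉ [ρqh, ρqt, ρa, ρb, ρtl, ρnd] → s'.v r = s.v r) ∧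
      (∀ f, f ∉ [φQ, φnx, φrd, φdr] → s'.A f = s.A f)) s := by
  have hpos := hE.pos
  have hL := hE.len
  have hW := hE.num
  rw [sortLoop]
  simp only [tr_seq, tr_set, Ex.Safe, Ex.eval, Ex.cost, St.setV_v, hm]
  norm_num only [if_true, if_false, and_assoc, true_and, and_true]
  repeat refine And.intro (by omega) ?_
  refine Tr.mono (tr_loop (fun n s' =>
    (∀ r, r ∉ [ρqh, ρqt, ρa, ρb, ρtl, ρnd] → s'.v r = s.v r) ∧
    (∀ f, f ∉ [φQ, φnx, φrd, φdr] → s'.A f = s.A f) ∧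
    ∃ q D, Queue E s' q D ∧ q ≠ [] ∧ n = queuePot l q)
    (n := 60 * (E.m * (2 * l + 4)) + 100 * E.m) ?_ ?_) ?_
  · rintro n s₀ ⟨b1, b2, q, D, b3, b4, rfl⟩
    have hqt := b3.qt
    have hcap := b3.cap
    simp only [Bx.Safe, Bx.Holds, Bx.cost, Ex.Safe, Ex.eval, Ex.cost]
    norm_num only [and_assoc, true_and, and_true]
    have hql : 1 ≤ q.length := List.length_pos_iff.2 b4
    repeat refine And.intro (by omega) ?_
    intro hlt
    match q, b3 with
    | [], _ => simp at hql
    | [_], _ =>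
      simp only [List.length_singleton] at hqt
      omega
    | p₁ :: p₂ :: q', b3 =>
      refine (sortStep_spec hE b3 hσ).mono ?_
      rintro s₁ t₁ ⟨⟨p, D', c1, c2⟩, c3, c4⟩
      refine ⟨queuePot l (q' ++ [p]), fun r hr => by rw [c3 r hr, b1 r hr],
        fun f hf => by rw [c4 f hf, b2 f hf], ⟨q' ++ [p], D', c1, by simp, rfl⟩, by omega⟩
  · refine ⟨?_, fun _ _ => rfl, (List.range E.m).map fun i => (1, [i]), [], ?_, ?_, ?_⟩
    · intro r hr
      simp only [List.mem_cons, List.not_mem_nil, or_false, not_or] at hr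
      simp [St.setV_v, hr]
    · exact Queue.init (by simp [St.setV_v, hm]) (by simp [St.setV_v]) (by simp [St.setV_v])
        (by simp [St.setV_v]) hQ
    · simp
      omega
    -- The queue starts with `m` lists of weight `1`.
    · have h1 : sortPot l 1 = 2 * l + 4 := by
        have : 1 ≤ 2 ^ l := Nat.one_le_two_pow
        simp [sortPot, this]
      simp only [queuePot, List.map_map, Function.comp_def, h1, List.map_const', List.sum_replicate,
        List.length_map, List.length_range, smul_eq_mul]
  · rintro s₀ t₀ ⟨n', ⟨b1, b2, q, D, b3, b4, rfl⟩, hx, ht⟩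
    simp only [Bx.Holds, Bx.cost, Ex.eval, Ex.cost] at hx ht
    have hqt := b3.qt
    refine ⟨?_, by omega, b1, b2⟩
    match q, b3 with
    | [], _ => exact absurd rfl b4
    | [(w, F)], b3 => exact ⟨w, F, D, b3⟩
    | _ :: _ :: _, _ =>
      simp only [List.length_cons] at hqt
      omega

theorem rankLoop_spec (hE : E.Big) (hm : s.v ρm = E.m) {w : ℕ} {F D : List ℕ}
    (h : Queue E s [(w, F)] D) :
    Tr E rankLoop (fun s' t => (∀ j b, F[j]? = some b → s'.A φrp j = b ∧ s'.A φX (b + 1) = j) ∧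
      (∀ r < F.length, s'.A φlab (r + 1) = r ∧ s'.A φdep (r + 1) = 1) ∧
      s'.v ρσ = F.length ∧ s'.v ρN = F.length + 1 ∧ t ≤ 40 * E.m + 30 ∧ s'.A φdep 0 = s.A φdep 0 ∧
      (∀ r, r ∉ [ρa, ρr, ρσ, ρN] → s'.v r = s.v r) ∧
      (∀ f, f ∉ [φrp, φX, φlab, φdep] → s'.A f = s.A f)) s := by
  have hpos := hE.pos
  have hL := hE.len
  have hW := hE.num
  have hperm := h.perm
  simp only [List.map_cons, List.map_nil, List.flatten_cons, List.flatten_nil,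
    List.append_nil] at hperm
  have hnod := (hperm.nodup_iff.2 List.nodup_range).of_append_left
  have hlt : ∀ i ∈ F, i < E.m := fun i hi =>
    List.mem_range.1 (hperm.subset (List.mem_append_left _ hi))
  have hplen := hperm.length_eq
  simp only [List.length_append, List.length_range] at hplen
  have hcap := h.cap
  have hlist := h.lists 0 (w, F) rfl
  simp only [List.length_singleton, add_zero] at hcap hlist
  rw [rankLoop]
  simp only [tr_seq, tr_set, Ex.Safe, Ex.eval, Ex.cost, St.setV_v, St.setV_A]
  norm_num only [if_true, if_false, and_assoc, true_and, and_true]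
  repeat refine And.intro (by omega) ?_
  refine Tr.mono (tr_loop (fun n s' =>
    (∀ r, r ∉ [ρa, ρr, ρσ, ρN] → s'.v r = s.v r) ∧
    (∀ f, f ∉ [φrp, φX, φlab, φdep] → s'.A f = s.A f) ∧ s'.A φdep 0 = s.A φdep 0 ∧
    ∃ x y, x ++ y = F ∧ s'.v ρr = x.length ∧ IsList E.m (s.A φnx) (s'.v ρa) y ∧
      (∀ j b, x[j]? = some b → s'.A φrp j = b ∧ s'.A φX (b + 1) = j) ∧
      (∀ r < x.length, s'.A φlab (r + 1) = r ∧ s'.A φdep (r + 1) = 1) ∧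
      n = 40 * y.length) (n := 40 * F.length) ?_ ?_) ?_
  · rintro n s₀ ⟨b1, b2, b2', x, y, b3, b4, b5, b6, b7, rfl⟩
    have em : s₀.v ρm = E.m := by rw [b1 _ (by norm_num), hm]
    have en : s₀.A φnx = s.A φnx := b2 _ (by norm_num)
    refine ⟨by simp only [Bx.Safe, Ex.Safe, and_true], ?_⟩
    simp only [Bx.Holds, Bx.cost, Ex.eval, Ex.cost, em]
    intro ha
    obtain ⟨y', rfl, b5'⟩ := b5.eq_cons ha.ne
    set a := s₀.v ρa with hva
    have hlen := congrArg List.length b3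
    simp only [List.length_append, List.length_cons] at hlen
    have hax : a ∉ x := by
      rw [← b3] at hnod
      intro hax
      exact List.disjoint_of_nodup_append hnod hax (by simp)
    simp only [tr_seq, tr_set, tr_put, Ex.Safe, Ex.eval, Ex.cost, St.setV_v, St.setV_A, St.setA_v,
      St.setA_A, en, b4, ← hva]
    norm_num only [if_true, if_false, and_assoc, true_and, and_true]
    repeat refine And.intro (by omega) ?_
    refine ⟨40 * y'.length, ?_, ?_, ?_, ⟨x ++ [a], y', by rw [← b3]; simp, by simp, b5', ?_, ?_, rfl⟩,
      ?_⟩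
    · intro r hr
      have := b1 r hr
      simp only [List.mem_cons, List.not_mem_nil, or_false, not_or] at hr
      simp [hr, this]
    · intro f hf
      have := b2 f hf
      simp only [List.mem_cons, List.not_mem_nil, or_false, not_or] at hf
      simp [hf, this]
    · rw [Function.update_of_ne (by omega), b2']
    · intro j b hj
      rcases lt_or_ge j x.length with hlt' | hge
      · rw [List.getElem?_append_left hlt'] at hj
        have hbx : b ∈ x := List.mem_of_getElem? hj
        rw [Function.update_of_ne hlt'.ne, Function.update_of_ne fun hba => hax (by
          obtain rfl : b = a := by omega
          exact hbx)]
        exact b6 j b hj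
      · rw [List.getElem?_append_right hge, List.getElem?_singleton] at hj
        split_ifs at hj with hj0
        obtain rfl : a = b := by simpa using hj
        obtain rfl : j = x.length := by omega
        simp
    · intro r hr
      rw [List.length_append, List.length_singleton] at hr
      rcases Nat.lt_succ_iff_lt_or_eq.1 hr with hr | rfl
      · rw [Function.update_of_ne (by omega), Function.update_of_ne (by omega)]
        exact b7 r hr
      · simp
    · simp only [List.length_cons]
      omega
  · refine ⟨?_, fun _ _ => rfl, rfl, [], F, rfl, ?_, ?_, ?_, ?_, rfl⟩
    · intro r hr
      simp only [List.mem_cons, List.not_mem_nil, or_false, not_or] at hr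
      simp [St.setV_v, hr]
    · simp [St.setV_v]
    · simpa [St.setV_v] using hlist
    · simp
    · simp
  · rintro s₀ t₀ ⟨n', ⟨b1, b2, b2', x, y, b3, b4, b5, b6, b7, rfl⟩, hx, ht⟩
    have em : s₀.v ρm = E.m := by rw [b1 _ (by norm_num), hm]
    simp only [Bx.Holds, Bx.cost, Ex.eval, Ex.cost, em] at hx ht
    have hy : y = [] := by
      by_contra hy
      obtain ⟨b, y', rfl⟩ := List.exists_cons_of_ne_nil hy
      obtain ⟨rfl, _, _⟩ := b5
      exact hx (hlt _ (by rw [← b3]; simp))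
    subst hy
    rw [List.append_nil] at b3
    subst b3
    simp only [Ex.Safe, Ex.eval, Ex.cost, St.setV_v, St.setV_A, b4]
    norm_num only [if_true, if_false, and_assoc, true_and, and_true]
    repeat refine And.intro (by omega) ?_
    refine ⟨?_, b2⟩
    intro r hr
    have := b1 r hr
    simp only [List.mem_cons, List.not_mem_nil, or_false, not_or] at hr
    simp [hr, this]

/-- By `hord`, the run that replaces a dropped run was not dropped before it. Going backwards, it
therefore has its rank when the dropped run asks for it. -/
theorem dropLoop_spec (hE : E.Big) (hm : s.v ρm = E.m) {F D : List ℕ}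
    (hperm : (F ++ D).Perm (List.range E.m)) (hnd : s.v ρnd = D.length)
    (hdr : ∀ j b, D[j]? = some b → s.A φdr j = b)
    (hdrop : ∀ b ∈ D, s.A φrd b < E.m ∧ s.A φrd b ≠ b ∧ E.key (s.A φrd b) = E.key b)
    (hord : D.Pairwise fun b' b => s.A φrd b ≠ b')
    (hF : ∀ j b, F[j]? = some b → s.A φrp j = b ∧ s.A φX (b + 1) = j) :
    Tr E dropLoop (fun s' t => s'.A φX 0 = E.m ∧ s'.A φX (E.m + 1) = E.m + 1 ∧
      (∀ i < E.m, s'.A φX (i + 1) < F.length ∧ E.key (s.A φrp (s'.A φX (i + 1))) = E.key i) ∧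
      (∀ j b, F[j]? = some b → s'.A φX (b + 1) = j) ∧ t ≤ 40 * E.m + 30 ∧
      (∀ r, r ∉ [ρnd, ρb] → s'.v r = s.v r) ∧
      (∀ f, f ∉ [φX] → s'.A f = s.A f)) s := by
  have hpos := hE.pos
  have hL := hE.len
  have hW := hE.num
  have hnod := hperm.nodup_iff.2 List.nodup_range
  have hlt : ∀ i ∈ F ++ D, i < E.m := fun i hi => List.mem_range.1 (hperm.subset hi)
  have hplen := hperm.length_eq
  simp only [List.length_append, List.length_range] at hplen
  rw [dropLoop]
  simp only [tr_seq]
  refine Tr.mono (tr_loop (fun n s' =>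
    (∀ r, r ∉ [ρnd, ρb] → s'.v r = s.v r) ∧
    (∀ f, f ∉ [φX] → s'.A f = s.A f) ∧
    ∃ x y, x ++ y = D ∧ s'.v ρnd = x.length ∧
      (∀ i < E.m, i ∉ x → s'.A φX (i + 1) < F.length ∧
        E.key (s.A φrp (s'.A φX (i + 1))) = E.key i) ∧
      (∀ j b, F[j]? = some b → s'.A φX (b + 1) = j) ∧
      n = 40 * x.length) (n := 40 * D.length) ?_ ?_) ?_
  · rintro n s₀ ⟨b1, b2, x, y, b3, b4, b5, b6, rfl⟩
    have ed : s₀.A φdr = s.A φdr := b2 _ (by norm_num)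
    have er : s₀.A φrd = s.A φrd := b2 _ (by norm_num)
    simp only [Bx.Safe, Bx.Holds, Bx.cost, Ex.Safe, Ex.eval, Ex.cost]
    refine ⟨⟨by omega, trivial⟩, ?_⟩
    intro hn
    obtain ⟨x', b, rfl⟩ : ∃ x' b, x = x' ++ [b] := by
      refine ⟨x.dropLast, x.getLast (by rintro rfl; simp at b4; omega), ?_⟩
      rw [List.dropLast_append_getLast]
    rw [List.length_append, List.length_singleton] at b4
    have hlen := congrArg List.length b3
    simp only [List.length_append, List.length_singleton] at hlen
    have hDb : s.A φdr x'.length = b := hdr _ b (by rw [← b3]; simp)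
    have hbD : b ∈ D := by rw [← b3]; simp
    obtain ⟨h1, h2, h3⟩ := hdrop b hbD
    have hbm := hlt b (List.mem_append_right _ hbD)
    have hrx : s.A φrd b ∉ x' ++ [b] := by
      intro hmem
      rcases List.mem_append.1 hmem with hmem | hmem
      · rw [← b3, List.append_assoc] at hord
        exact (List.pairwise_append.1 hord).2.2 _ hmem b (by simp) rfl
      · exact h2 (by simpa using hmem)
    obtain ⟨h4, h5⟩ := b5 _ h1 hrx
    simp only [tr_seq, tr_set, tr_put, Ex.Safe, Ex.eval, Ex.cost, St.setV_v, St.setV_A, St.setA_v,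
      St.setA_A, ed, er, b4]
    norm_num only [if_true, if_false, and_assoc, true_and, and_true, Nat.add_sub_cancel, hDb]
    repeat refine And.intro (by omega) ?_
    refine ⟨40 * x'.length, ?_, ?_, ⟨x', b :: y, by rw [← b3]; simp, rfl, ?_, ?_, rfl⟩, ?_⟩
    · intro r hr
      have := b1 r hr
      simp only [List.mem_cons, List.not_mem_nil, or_false, not_or] at hr
      simp [hr, this]
    · intro f hf
      have := b2 f hf
      simp only [List.mem_cons, List.not_mem_nil, or_false] at hf
      simp [hf, this]
    · intro i him hix
      by_cases hib : i = b
      · subst hib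
        rw [Function.update_self]
        exact ⟨h4, h5.trans h3⟩
      · rw [Function.update_of_ne (by omega)]
        exact b5 i him (by simp [hix, hib])
    · intro j c hc
      have hcF : c ∈ F := List.mem_of_getElem? hc
      have hcb : c ≠ b := by
        rintro rfl
        exact List.disjoint_of_nodup_append hnod hcF hbD
      rw [Function.update_of_ne (by omega)]
      exact b6 j c hc
    · simp only [List.length_append, List.length_singleton]
      omega
  · refine ⟨fun _ _ => rfl, fun _ _ => rfl, D, [], by simp, hnd, ?_, fun j b hj => (hF j b hj).2, rfl⟩
    intro i him hiD
    have hiF : i ∈ F := by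
      have := hperm.symm.subset (List.mem_range.2 him)
      simpa [hiD] using this
    obtain ⟨j, hj⟩ := List.mem_iff_getElem?.1 hiF
    obtain ⟨h1, h2⟩ := hF j i hj
    rw [h2, h1]
    exact ⟨(List.getElem?_eq_some_iff.1 hj).1, rfl⟩
  · rintro s₀ t₀ ⟨n', ⟨b1, b2, x, y, b3, b4, b5, b6, rfl⟩, hx, ht⟩
    simp only [Bx.Holds, Bx.cost, Ex.eval, Ex.cost] at hx ht
    have em : s₀.v ρm = E.m := by rw [b1 _ (by norm_num), hm]
    obtain rfl : x = [] := List.length_eq_zero_iff.1 (by omega)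
    simp only [tr_put, Ex.Safe, Ex.eval, Ex.cost, St.setA_v, St.setA_A, em]
    norm_num only [if_true, if_false, and_assoc, true_and, and_true]
    repeat refine And.intro (by omega) ?_
    refine ⟨?_, ?_, ?_, ?_, by omega, b1, ?_⟩
    · rw [Function.update_of_ne (by omega), Function.update_self]
    · rw [Function.update_self]
    · intro i hi
      rw [Function.update_of_ne (by omega), Function.update_of_ne (by omega)]
      exact b5 i hi (by simp)
    · intro j b hj
      have := hlt b (List.mem_append_left _ (List.mem_of_getElem? hj))
      rw [Function.update_of_ne (by omega), Function.update_of_ne (by omega)]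
      exact b6 j b hj
    · intro f hf
      have := b2 f hf
      simp only [List.mem_cons, List.not_mem_nil, or_false] at hf
      simp [hf, this]

end Ranks

/-! ### The whole computation in the array language. -/

section Main

variable {α : Type u} [LinearOrder α] {E : Env α} {s : St} {σ l : ℕ}

/-- The runs `rp 0, …, rp (σ - 1)` represent the distinct runs in increasing order. -/
structure Ranks (E : Env α) (σ : ℕ) (rp : ℕ → ℕ) (X : ℕ → ℕ) : Prop where
  text : Text E.m σ X
  lt : ∀ r < σ, rp r < E.m
  mono : ∀ r r', r < r' → r' < σ → E.key (rp r) < E.key (rp r')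
  key : ∀ i < E.m, E.key (rp (X (i + 1))) = E.key i

theorem Trie.init {σ : ℕ} {lab dep par : ℕ → ℕ} (hl : ∀ r < σ, lab (r + 1) = r ∧ dep (r + 1) = 1)
    (hd : dep 0 = 0) (hp : ∀ v, par v = 0) :
    Trie σ (σ + 1) lab dep par fun v => if v = 0 then [] else [v - 1] := by
  have hl' : ∀ v, 1 ≤ v → v < σ + 1 → lab v = v - 1 ∧ dep v = 1 := fun v h1 h2 => by
    have := hl (v - 1) (by omega)
    rwa [Nat.sub_add_cancel h1] at this
  refine ⟨by omega, by simp, ?_, ?_, ?_, ?_, ?_, ?_⟩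
  · intro v h1 h2
    rw [hp]
    omega
  · intro v h1 h2
    rw [(hl' v h1 h2).1]
    omega
  · intro v h1 h2
    rw [hp, (hl' v h1 h2).1, if_neg (by omega)]
    simp
  · intro v hv
    rcases Nat.eq_zero_or_pos v with rfl | h1
    · simp [hd]
    · rw [(hl' v h1 hv).2, if_neg (by omega)]
      simp
  · intro v hv w hw he
    by_cases h1 : v = 0 <;> by_cases h2 : w = 0
    · omega
    · simp [h1, h2] at he
    · simp [h1, h2] at he
    · simp only [h1, h2, if_false, List.cons.injEq, and_true] at he
      omega
  · intro r hr
    simp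

theorem Dst.init {σ : ℕ} {lab par sl : ℕ → ℕ} (hs : ∀ a, sl a = 0) :
    Dst σ (σ + 1) lab par sl fun _ => 0 := by
  refine ⟨fun v h1 h2 => by omega, fun w _ h => absurd (hs _) h, fun w _ _ b _ h => absurd (hs _) h,
    fun a _ => hs a⟩

theorem rankRuns_spec (hE : E.Big) (hm : s.v ρm = E.m) (hA : ∀ f i, s.A f i = 0)
    (hσ : ((Finset.range E.m).image E.key).card = σ) (hl : σ ≤ 2 ^ l) :
    Tr E rankRuns (fun s' t => Ranks E σ (s'.A φrp) (s'.A φX) ∧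
      TrieInv E σ l (fun v => if v = 0 then [] else [v - 1]) s' ∧ s'.v ρσ = σ ∧ s'.v ρN = σ + 1 ∧
      t ≤ 120 * (E.m * l) + 700 * E.m ∧
      (∀ f, f ∉ [φQ, φnx, φB, φH, φrd, φdr, φrp, φX, φlab, φdep] → ∀ i, s'.A f i = 0)) s := by
  have hpos := hE.pos
  simp only [rankRuns, tr_seq]
  refine (initLoop_spec hE hm (hA _ _) (hA _ _)).mono ?_
  rintro s₁ t₁ ⟨a1, a2, a3, a4, a5⟩
  refine (sortLoop_spec hE (l := l) (by rw [a4 _ (by norm_num), hm]) a1 (by omega)).mono ?_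
  rintro s₂ t₂ ⟨⟨w, F, D, b1⟩, b2, b3, b4⟩
  refine (rankLoop_spec hE b1.hm b1).mono ?_
  rintro s₃ t₃ ⟨c1, c2, c3, c4, c5, c6, c7, c8⟩
  have hperm := b1.perm
  simp only [List.map_cons, List.map_nil, List.flatten_cons, List.flatten_nil,
    List.append_nil] at hperm
  have e3m : s₃.v ρm = E.m := by rw [c7 _ (by norm_num), b1.hm]
  refine (dropLoop_spec hE e3m hperm (by rw [c7 _ (by norm_num), b1.nd])
    (by rw [c8 _ (by norm_num)]; exact b1.dr) (by rw [c8 _ (by norm_num)]; exact b1.drop)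
    (by rw [c8 _ (by norm_num)]; exact b1.order) c1).mono ?_
  rintro s₄ t₄ ⟨d1, d2, d3, d4, d5, d6, d7⟩
  have er : s₄.A φrp = s₃.A φrp := d7 _ (by norm_num)
  have hinc : Inc E F := (b1.inc (w, F) (by simp)).1
  have hFlt : ∀ i ∈ F, i < E.m := fun i hi =>
    List.mem_range.1 (hperm.subset (List.mem_append_left _ hi))
  have hrp : ∀ r (hr : r < F.length), s₃.A φrp r = F[r] := fun r hr =>
    (c1 r _ (List.getElem?_eq_getElem hr)).1
  -- The final list has no duplicates, and each run is equal to one of its members, so it contains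
  -- every distinct run exactly once.
  have hFσ : F.length = σ := by
    refine le_antisymm (hinc.length_le hFlt hσ.le) ?_
    have hsub : (Finset.range E.m).image E.key ⊆ (F.map E.key).toFinset := by
      intro k hk
      simp only [Finset.mem_image, Finset.mem_range] at hk
      obtain ⟨i, hi, rfl⟩ := hk
      obtain ⟨h1, h2⟩ := d3 i hi
      simp only [List.mem_toFinset, List.mem_map]
      exact ⟨_, List.getElem_mem h1, by rw [← hrp _ h1, h2]⟩
    have := (Finset.card_le_card hsub).trans (List.toFinset_card_le _)
    rw [List.length_map] at this
    omega
  have hz : ∀ f, f ∉ [φQ, φnx, φB, φH, φrd, φdr, φrp, φX, φlab, φdep] → ∀ i, s₄.A f i = 0 := by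
    intro f hf i
    simp only [List.mem_cons, List.not_mem_nil, or_false, not_or] at hf
    rw [d7 f (by simp [hf]), c8 f (by simp [hf]), b4 f (by simp [hf]), a5 f (by simp [hf]), hA]
  have hσm : σ ≤ E.m := by
    rw [← hσ]
    exact Finset.card_image_le.trans (by simp)
  have eN : s₄.v ρN = σ + 1 := by rw [d6 _ (by norm_num), c4, hFσ]
  have eHB : ∀ f, f = φH ∨ f = φB → s₄.A f = s₁.A f := by
    rintro f (rfl | rfl) <;> rw [d7 _ (by norm_num), c8 _ (by norm_num), b4 _ (by norm_num)]
  refine ⟨⟨⟨d1, d2, ?_, hσm, ?_⟩, ?_, ?_, ?_⟩, ⟨?_, ?_, ?_, ?_, ?_, hσm, hl⟩, ?_, eN, ?_, hz⟩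
  · intro c h1 h2
    have := (d3 (c - 1) (by omega)).1
    rw [Nat.sub_add_cancel h1] at this
    omega
  · intro r hr
    have hr' : r < F.length := by omega
    exact ⟨F[r] + 1, by omega, hFlt _ (List.getElem_mem hr'), d4 r _ (List.getElem?_eq_getElem hr')⟩
  · intro r hr
    rw [er, hrp r (by omega)]
    exact hFlt _ (List.getElem_mem _)
  · intro r r' h1 h2
    rw [er, hrp r (by omega), hrp r' (by omega)]
    exact List.pairwise_iff_getElem.1 hinc _ _ (by omega) (by omega) h1
  · intro i hi
    rw [er]
    exact (d3 i hi).2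
  · rw [d6 _ (by norm_num), e3m]
  · rw [eN]
    refine Trie.init ?_ ?_ (hz _ (by norm_num))
    · rw [d7 φlab (by norm_num), d7 φdep (by norm_num), ← hFσ]
      exact c2
    · rw [d7 φdep (by norm_num), c6, b4 _ (by norm_num), a5 _ (by norm_num), hA]
  · rw [eN]
    exact ⟨_, Dst.init (hz _ (by norm_num))⟩
  · rw [eHB _ (Or.inl rfl)]
    exact fun j hj => (a2 j hj).1
  · rw [eHB _ (Or.inr rfl)]
    exact fun j hj => (a2 j hj).2
  · rw [d6 _ (by norm_num), c3, hFσ]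
  · have : E.m * (2 * l + 4) = 2 * (E.m * l) + 4 * E.m := by ring
    omega

/-- The tree that the program builds: the nodes are the prefixes of the strings `pathOf`. -/
structure Result (E : Env α) (σ N : ℕ) (X rp lab dep par rad : ℕ → ℕ) (arm ch : ℕ → List ℕ) :
    Prop where
  ranks : Ranks E σ rp X
  trie : Trie σ N lab dep par arm
  le : N ≤ 3 * E.m + 1
  rad_pos : ∀ c, 1 ≤ c → c ≤ E.m → 1 ≤ rad c
  pal : ∀ c, 1 ≤ c → c ≤ E.m → Pal X c (rad c)
  max : ∀ c, 1 ≤ c → c ≤ E.m → ¬ Pal X c (rad c + 1)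
  sound : ∀ v, 1 ≤ v → v < N → ∃ c, 1 ≤ c ∧ c ≤ E.m ∧ arm v <+: pathOf E X c (rad c)
  complete : ∀ c, 1 ≤ c → c ≤ E.m → ∃ v < N, arm v = pathOf E X c (rad c)
  sorted : ∀ u, (ch u).Pairwise fun x y => lab x < lab y
  mem : ∀ u x, x ∈ ch u ↔ 1 ≤ x ∧ x < N ∧ par x = u

/-- The number of centers from which the string `a` can be read off. -/
def countOf (E : Env α) (X rad : ℕ → ℕ) (a : List ℕ) : ℕ :=
  ((Finset.Ico 1 (E.m + 1)).filter fun c => a <+: pathOf E X c (rad c)).card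

/-- The number of occurrences of the node `v`. -/
def totalOf (E : Env α) (σ : ℕ) (X rp rad : ℕ → ℕ) (arm : ℕ → List ℕ) (v : ℕ) : ℕ :=
  -- A node `v ≤ σ` other than the root is the single run of rank `v - 1`, so that `Finset.Ico v σ`
  -- consists of the larger ranks. Each longer run with the same letter contributes its two ends.
  countOf E X rad (arm v) + if v ≤ σ then 2 * ∑ r ∈ Finset.Ico v σ,
    if E.ltr (rp r) = E.ltr (rp (v - 1)) then countOf E X rad [r] else 0 else 0

theorem pathOf_eq_cons {X : ℕ → ℕ} {c D : ℕ} (hD : 1 ≤ D) : ∃ p, pathOf E X c D = X c :: p := by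
  obtain ⟨D, rfl⟩ : ∃ d, D = d + 1 := ⟨D - 1, by omega⟩
  rw [pathOf, armOf, List.range_succ_eq_map]
  exact ⟨_, rfl⟩

theorem countOf_single {X rad : ℕ → ℕ} (hrad : ∀ c, 1 ≤ c → c ≤ E.m → 1 ≤ rad c) (r : ℕ) :
    countOf E X rad [r] = ((Finset.Ico 1 (E.m + 1)).filter fun c => X c = r).card := by
  rw [countOf]
  congr 1
  refine Finset.filter_congr fun c hc => ?_
  rw [Finset.mem_Ico] at hc
  obtain ⟨p, hp⟩ := pathOf_eq_cons (E := E) (X := X) (c := c) (hrad c hc.1 (by omega))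
  rw [hp, List.cons_prefix_cons]
  simp [eq_comm]

theorem sum_countOf_le {X rad : ℕ → ℕ} (hrad : ∀ c, 1 ≤ c → c ≤ E.m → 1 ≤ rad c) (σ : ℕ) :
    ∑ r ∈ Finset.range σ, countOf E X rad [r] ≤ E.m := by
  simp only [countOf_single hrad, Finset.card_filter]
  rw [Finset.sum_comm]
  refine (Finset.sum_le_sum (g := fun _ => 1) fun c _ => ?_).trans (by simp)
  rw [Finset.sum_ite_eq]
  split_ifs <;> simp

theorem mainCm_spec (hE : E.Big) (hm : s.v ρm = E.m) (hA : ∀ f i, s.A f i = 0)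
    (hσ : ((Finset.range E.m).image E.key).card = σ) (hl : σ ≤ 2 ^ l) :
    Tr E mainCm (fun s' t => (∃ (X rp lab dep par rad : ℕ → ℕ) (arm ch : ℕ → List ℕ),
      Result E σ (s'.v ρm) X rp lab dep par rad arm ch ∧ s'.v ρe ≤ s'.v ρm ∧
      (∀ p < s'.v ρe, s'.A φed (3 * p) < E.m) ∧
      (∀ i < s'.v ρm, ∃ off, off + (ch i).length ≤ s'.v ρe ∧
        (1 ≤ i → s'.A φrec (3 * i) = totalOf E σ X rp rad arm i) ∧
        s'.A φrec (3 * i + 1) = 2 * E.m + φed * E.L + 3 * off ∧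
        s'.A φrec (3 * i + 2) = (ch i).length ∧
        ∀ k x, (ch i)[k]? = some x → s'.A φed (3 * (off + k)) = rp (lab x) ∧
          s'.A φed (3 * (off + k) + 1) = E.ex (rp (lab x)) ∧
          s'.A φed (3 * (off + k) + 2) = x)) ∧
      t ≤ 4000 * (E.m * (l + 1))) s := by
  have hpos := hE.pos
  have hW := hE.num
  rw [mainCm, tr_seq]
  refine (rankRuns_spec hE hm hA hσ hl).mono ?_
  rintro s₁ t₁ ⟨a1, a2, a3, a4, a5, a6⟩
  have hσm := a1.text.le
  rw [tr_seq]
  refine (eertreeLoop_spec hE a2 a4 a1.text (a6 _ (by norm_num))).mono ?_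
  rintro s₂ t₂ ⟨⟨arm₂, b1, b2, b3, b4⟩, b5, b6, b7, b8⟩
  have e2X : s₂.A φX = s₁.A φX := b8 _ (by norm_num)
  have e2r : s₂.A φrp = s₁.A φrp := b8 _ (by norm_num)
  have e2z : ∀ f, f ∈ [φcnt, φhb, φhc] → ∀ i, s₂.A f i = 0 := by
    intro f hf i
    simp only [List.mem_cons, List.not_mem_nil, or_false] at hf
    rcases hf with rfl | rfl | rfl <;> rw [b8 _ (by norm_num), a6 _ (by norm_num)]
  rw [tr_seq]
  refine (partialLoop_spec hE b1 (by omega) (by rw [e2X]; exact a1.text) (e2z _ (by simp))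
    (fun _ => rfl) (by rw [e2X]; exact b4)).mono ?_
  rw [e2X]
  set X := s₁.A φX with hX
  set rad : ℕ → ℕ := fun c => s₂.A φdep (s₂.A φM c) with hrad
  rintro s₃ t₃ ⟨⟨arm, c1, c2, c3, c4, c5⟩, c6, c7, c8, c9, c10⟩
  have htr₂ := b1.trie
  have htr := c1.trie
  have hpos' : ∀ c, 1 ≤ c → c ≤ E.m → 1 ≤ rad c := fun c h1 h2 => by
    have := b4 c h1 h2
    exact htr₂.dep_pos this.pos this.lt
  have e3z : ∀ f, f ∈ [φhb, φhc] → ∀ i, s₃.A f i = 0 := by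
    intro f hf i
    simp only [List.mem_cons, List.not_mem_nil, or_false] at hf
    rcases hf with rfl | rfl <;> rw [c10 _ (by norm_num), e2z _ (by norm_num)]
  have e3r : s₃.A φrp = s₁.A φrp := by rw [c10 _ (by norm_num), e2r]
  have hN3 : s₃.v ρN ≤ 3 * E.m + 1 := by omega
  rw [tr_seq]
  refine (sumLoop_spec hE hN3 htr (e3z _ (by simp)) c3 c5).mono ?_
  rintro s₄ t₄ ⟨d1, d2, d3, d4, d5⟩
  have e4σ : s₄.v ρσ = σ := by
    rw [d4 _ (by norm_num), c9 _ (by norm_num), b7 _ (by norm_num), a3]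
  have e4N : s₄.v ρN = s₃.v ρN := d4 _ (by norm_num)
  have e4 : ∀ f, f ∉ [φcnt, φnb, φhb] → s₄.A f = s₃.A f := d5
  have hσN := htr.lt
  have hcnt : ∀ v < s₃.v ρN, s₄.A φcnt v = countOf E X rad (arm v) := d1
  have hcnt1 : ∀ r < σ, s₄.A φcnt (r + 1) = countOf E X rad [r] := fun r hr => by
    rw [hcnt _ (by omega), htr.single r hr]
  have hsum : ∑ r ∈ Finset.range σ, s₄.A φcnt (r + 1) ≤ E.m := by
    rw [Finset.sum_congr rfl fun r hr => hcnt1 r (Finset.mem_range.1 hr)]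
    exact sum_countOf_le hpos' σ
  rw [tr_seq]
  refine (singleLoop_spec hE hσm e4σ (by rw [e4 _ (by norm_num), e3r]; exact a1.lt) (by
    rw [e4 _ (by norm_num), e3r]
    intro r r' h1 h2
    rcases E.key_lt.1 (a1.mono r r' h1 h2) with h | h
    · exact h.le
    · exact h.1.le) hsum).mono ?_
  rintro s₅ t₅ ⟨f1, f2, f3, f4, f5⟩
  rw [e4 φrp (by norm_num), e3r] at f1
  have e5N : s₅.v ρN = s₃.v ρN := by rw [f4 _ (by norm_num), e4N]
  have e5 : ∀ f, f ∉ [φcnt, φnb, φhb] → s₅.A f = s₃.A f := by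
    intro f hf
    have hf' := hf
    simp only [List.mem_cons, List.not_mem_nil, or_false, not_or] at hf'
    rw [f5 f (by simp [hf']), e4 f hf]
  rw [tr_seq]
  refine (childLoop_spec (arm := arm) hE (by omega) (by rw [f4 _ (by norm_num), e4σ]) hσm
    (by rw [e5N, e5 _ (by norm_num), e5 _ (by norm_num), e5 _ (by norm_num)]; exact htr)
    (by rw [e5 _ (by norm_num)]; exact e3z _ (by simp))
    (by
      rw [f5 φnb (by norm_num), f5 φhb (by norm_num), e5N, e5 φlab (by norm_num)]
      exact d2)).mono ?_
  rintro s₆ t₆ ⟨⟨ch, g1⟩, g2, g3, g4⟩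
  rw [e5N, e5 φlab (by norm_num), e5 φpar (by norm_num)] at g1
  have e6N : s₆.v ρN = s₃.v ρN := by rw [g3 _ (by norm_num), e5N]
  have e6 : ∀ f, f ∈ [φlab, φdep, φpar, φrp] → s₆.A f = s₃.A f := by
    intro f hf
    simp only [List.mem_cons, List.not_mem_nil, or_false] at hf
    rcases hf with rfl | rfl | rfl | rfl <;> rw [g4 _ (by norm_num), e5 _ (by norm_num)]
  have e6l : s₆.A φlab = s₃.A φlab := e6 _ (by simp)
  have e6p : s₆.A φpar = s₃.A φpar := e6 _ (by simp)
  have e6r : s₆.A φrp = s₁.A φrp := by rw [e6 _ (by simp), e3r]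
  have e6c : s₆.A φcnt = s₅.A φcnt := g4 _ (by norm_num)
  have htot : ∀ v, 1 ≤ v → v < s₃.v ρN →
      s₅.A φcnt v = totalOf E σ X (s₁.A φrp) rad arm v := by
    intro v h1 h2
    rw [totalOf]
    by_cases hv : v ≤ σ
    · obtain ⟨r, rfl⟩ : ∃ r, v = r + 1 := ⟨v - 1, by omega⟩
      rw [if_pos hv, f1 r (by omega), hcnt _ h2, Nat.add_sub_cancel]
      congr 2
      refine Finset.sum_congr rfl fun r' hr' => ?_
      rw [hcnt1 r' (Finset.mem_Ico.1 hr').2]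
    · rw [if_neg hv, f2 v (Or.inr (by omega)), hcnt v h2, add_zero]
  -- At most `m` centers, and twice at most `m` longer runs: the corrected counts stay below `600 *
  -- m`.
  have hle : ∀ v < s₃.v ρN, s₅.A φcnt v < E.W := by
    intro v hv
    have h0 : ∀ a, countOf E X rad a ≤ E.m := fun a =>
      (Finset.card_filter_le _ _).trans (by simp)
    rcases Nat.eq_zero_or_pos v with rfl | h1
    · rw [f2 0 (Or.inl rfl), hcnt 0 hv]
      have := h0 (arm 0)
      omega
    · rw [htot v h1 hv, totalOf]
      have h2 := h0 (arm v)
      have h3 : (∑ r ∈ Finset.Ico v σ, if E.ltr (s₁.A φrp r) = E.ltr (s₁.A φrp (v - 1)) then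
          countOf E X rad [r] else 0) ≤ E.m := by
        refine le_trans (Finset.sum_le_sum fun r _ => ?_) ((Finset.sum_le_sum_of_subset
          (t := Finset.range σ) fun r hr => ?_).trans (sum_countOf_le (X := X) hpos' σ))
        · split_ifs <;> simp
        · simp at hr ⊢
          omega
      split_ifs <;> omega
  refine (outLoop_spec (arm := arm) hE (by omega) hσm
    (by rw [e6N, e6 _ (by simp), e6 _ (by simp), e6 _ (by simp)]; exact htr)
    (by rw [e6r]; exact a1.lt) (by rw [e6N, e6c]; exact hle)
    (fun u => (g1 u).1) (fun u => (g1 u).2.1.imp fun {a b} h => by rintro rfl; omega)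
    (by rw [e6N, e6p]; exact fun u => (g1 u).2.2)).mono ?_
  rintro s₇ t₇ ⟨k1, k2, k3, k4, k5⟩
  rw [e6N] at k1 k4
  rw [e6c] at k4
  simp only [EdgeAt, e6l, e6r] at k4
  refine ⟨⟨X, s₁.A φrp, s₃.A φlab, s₃.A φdep, s₃.A φpar, rad, arm, ch, ⟨a1, ?_, ?_, hpos', ?_, ?_, ?_,
    ?_, fun u => (g1 u).2.1, ?_⟩, ?_, k3, ?_⟩, ?_⟩
  · rw [k1]
    exact htr
  · omega
  · exact fun c h1 h2 => (b4 c h1 h2).pal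
  · exact fun c h1 h2 => (b4 c h1 h2).max
  · rw [k1]
    intro v h1 h2
    -- A node from the scan of the text is a palindrome of `X`, and the maximal palindrome at its
    -- center continues it. A later node was created as a complete path.
    rcases lt_or_ge v (s₂.v ρN) with hv | hv
    · obtain ⟨c, hc1, hc2, hp, ha⟩ := b2 v h1 hv
      refine ⟨c, hc1, hc2, ?_⟩
      rw [c2 v hv, ha, pathOf]
      refine List.IsPrefix.trans ?_ (List.prefix_append _ _)
      have hd : s₂.A φdep v ≤ rad c := by
        by_contra! hd
        exact (b4 c hc1 hc2).max (hp.mono hd)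
      obtain ⟨e, he⟩ := Nat.exists_eq_add_of_le hd
      rw [he, armOf, armOf, List.range_add, List.map_append]
      exact List.prefix_append _ _
    · obtain ⟨c, hc1, hc2, ha⟩ := c4 v hv h2
      exact ⟨c, hc1, hc2, by rw [ha]⟩
  · rw [k1]
    exact c3
  · rw [k1]
    exact fun u => (g1 u).2.2
  · omega
  · rw [k1]
    intro i hi
    obtain ⟨off, h1, h2, h3, h4, h5⟩ := k4 i hi
    exact ⟨off, h1, fun hi1 => by rw [h2, htot i hi1 hi], h3, h4, h5⟩
  · have h1 : (80 * l + 700) * (E.m + 1) = 80 * (E.m * l) + 80 * l + 700 * E.m + 700 := by ring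
    have h2 : (40 * l + 200) * E.m = 40 * (E.m * l) + 200 * E.m := by ring
    have h3 : E.m * (l + 1) = E.m * l + E.m := by ring
    have h4 : l ≤ E.m * l := Nat.le_mul_of_pos_left l hpos
    omega

end Main

/-! ### Run-length encodings -/

section Runs

variable {α : Type u}

/-- The string with the given runs. -/
def expand (R : List (α × ℕ)) : List α := R.flatMap fun p => List.replicate p.2 p.1

/-- The exponents are positive, and the letters of adjacent runs are different. -/
def IsRuns (R : List (α × ℕ)) : Prop :=
  (∀ p ∈ R, 1 ≤ p.2) ∧ R.IsChain fun p q => p.1 ≠ q.1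

theorem expand_cons (p : α × ℕ) (R : List (α × ℕ)) :
    expand (p :: R) = List.replicate p.2 p.1 ++ expand R := by
  simp [expand]

theorem expand_append (R R' : List (α × ℕ)) : expand (R ++ R') = expand R ++ expand R' := by
  simp [expand]

theorem expand_reverse (R : List (α × ℕ)) : expand R.reverse = (expand R).reverse := by
  induction R with
  | nil => rfl
  | cons p R ih =>
    rw [List.reverse_cons, expand_append, ih, expand_cons p R, List.reverse_append]
    simp [expand]

theorem length_expand (R : List (α × ℕ)) : (expand R).length = (R.map Prod.snd).sum := by
  induction R with
  | nil => rfl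
  | cons p R ih => simp [expand_cons, ih]

theorem IsRuns.tail {p : α × ℕ} {R : List (α × ℕ)} (h : IsRuns (p :: R)) : IsRuns R :=
  ⟨fun q hq => h.1 q (by simp [hq]), h.2.tail⟩

theorem IsRuns.reverse {R : List (α × ℕ)} (h : IsRuns R) : IsRuns R.reverse :=
  ⟨fun q hq => h.1 q (by simpa using hq), List.isChain_reverse.2 (h.2.imp fun _ _ h => h.symm)⟩

theorem IsRuns.of_getElem {R : List (α × ℕ)} (h1 : ∀ p ∈ R, 1 ≤ p.2)
    (h2 : ∀ i (hi : i + 1 < R.length), R[i].1 ≠ R[i + 1].1) : IsRuns R :=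
  ⟨h1, List.isChain_iff_getElem.2 fun i hi => h2 i hi⟩

theorem IsRuns.ne {R : List (α × ℕ)} (h : IsRuns R) (i : ℕ) (hi : i + 1 < R.length) :
    R[i].1 ≠ R[i + 1].1 := List.isChain_iff_getElem.1 h.2 i hi

/-- Comparison of a string with a prefix, run by run. -/
def PrefRuns (Q T : List (α × ℕ)) : Prop :=
  ∀ j q, Q[j]? = some q → ∃ e, T[j]? = some (q.1, e) ∧ q.2 ≤ e ∧ (j + 1 < Q.length → q.2 = e)

theorem prefRuns_cons {b a : α} {f e : ℕ} {Q T : List (α × ℕ)} :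
    PrefRuns ((b, f) :: Q) ((a, e) :: T) ↔
      b = a ∧ f ≤ e ∧ (Q ≠ [] → f = e) ∧ PrefRuns Q T := by
  constructor
  · intro h
    obtain ⟨e', h1, h2, h3⟩ := h 0 (b, f) rfl
    simp only [List.getElem?_cons_zero, Option.some.injEq, Prod.mk.injEq] at h1
    obtain ⟨rfl, rfl⟩ := h1
    refine ⟨rfl, h2, fun hQ => h3 ?_, fun j q hj => ?_⟩
    · have := List.length_pos_iff.2 hQ
      simp only [List.length_cons]
      omega
    · obtain ⟨e', k1, k2, k3⟩ := h (j + 1) q (by simpa using hj)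
      refine ⟨e', by simpa using k1, k2, fun hjQ => k3 ?_⟩
      simp only [List.length_cons]
      omega
  · rintro ⟨rfl, h1, h2, h3⟩ j q hj
    cases j with
    | zero =>
      simp only [List.getElem?_cons_zero, Option.some.injEq] at hj
      subst hj
      refine ⟨e, rfl, h1, fun hQ => h2 ?_⟩
      rintro rfl
      simp at hQ
    | succ j =>
      obtain ⟨e', k1, k2, k3⟩ := h3 j q (by simpa using hj)
      refine ⟨e', by simpa using k1, k2, fun hjQ => k3 ?_⟩
      simp only [List.length_cons] at hjQ
      omega

theorem expand_eq_cons {p : α × ℕ} {R : List (α × ℕ)} (hp : 1 ≤ p.2) :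
    expand (p :: R) = p.1 :: (List.replicate (p.2 - 1) p.1 ++ expand R) := by
  rw [expand_cons]
  obtain ⟨n, hn⟩ : ∃ n, p.2 = n + 1 := ⟨p.2 - 1, by omega⟩
  simp [hn, List.replicate_succ]

theorem expand_eq_nil {R : List (α × ℕ)} (h : IsRuns R) : expand R = [] ↔ R = [] := by
  cases R with
  | nil => simp [expand]
  | cons p R => rw [expand_eq_cons (h.1 p (by simp))]; simp

/-- Compare the first runs. If the exponents differ, the shorter run must be followed by the same
letter, which is impossible unless it is the last run of `Q`. -/
theorem expand_prefix_iff {Q T : List (α × ℕ)} (hQ : IsRuns Q) (hT : IsRuns T) :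
    expand Q <+: expand T ↔ PrefRuns Q T := by
  induction Q generalizing T with
  | nil => simp [expand, PrefRuns]
  | cons p Q ih =>
    obtain ⟨b, f⟩ := p
    have hf : 1 ≤ f := hQ.1 (b, f) (by simp)
    cases T with
    | nil =>
      rw [expand_eq_cons hf]
      simp only [expand, List.flatMap_nil, List.prefix_nil, reduceCtorEq, false_iff]
      intro h
      obtain ⟨e, h1, _⟩ := h 0 (b, f) rfl
      simp at h1
    | cons q T =>
      obtain ⟨a, e⟩ := q
      have he : 1 ≤ e := hT.1 (a, e) (by simp)
      rw [prefRuns_cons, ← ih hQ.tail hT.tail]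
      by_cases hab : b = a
      swap
      · rw [expand_eq_cons hf, expand_eq_cons he, List.cons_prefix_cons]
        simp [hab]
      subst hab
      simp only [true_and]
      rw [expand_cons, expand_cons]
      simp only
      rcases lt_trichotomy f e with hfe | rfl | hfe
      · obtain ⟨g, rfl⟩ := Nat.exists_eq_add_of_lt hfe
        rw [show f + g + 1 = f + (g + 1) by ring, List.replicate_add, List.append_assoc,
          List.prefix_append_right_inj]
        cases Q with
        | nil => simp [expand]
        | cons q Q =>
          have hq := hQ.tail.1 q (by simp)
          have hne : b ≠ q.1 := hQ.ne 0 (by simp)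
          rw [expand_eq_cons hq, List.replicate_succ, List.cons_append, List.cons_prefix_cons]
          simp [hne.symm]
      · rw [List.prefix_append_right_inj]
        simp
      · obtain ⟨g, rfl⟩ := Nat.exists_eq_add_of_lt hfe
        rw [show e + g + 1 = e + (g + 1) by ring, List.replicate_add, List.append_assoc,
          List.prefix_append_right_inj]
        constructor
        · intro h
          exfalso
          cases T with
          | nil => simp [expand, List.replicate_succ] at h
          | cons q T =>
            have hq := hT.tail.1 q (by simp)
            have hne : b ≠ q.1 := hT.ne 0 (by simp)
            rw [expand_eq_cons hq, List.replicate_succ, List.cons_append,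
              List.cons_prefix_cons] at h
            exact hne h.1
        · rintro ⟨h, _⟩
          omega

variable [DecidableEq α]

theorem isRuns_rle (S : List α) : IsRuns (rle S) := by
  induction S with
  | nil => exact ⟨by simp [rle], by simp [rle]⟩
  | cons a S ih =>
    rw [rle]
    rcases hS : rle S with _ | ⟨⟨b, e⟩, R⟩
    · exact ⟨by simp, by simp⟩
    · rw [hS] at ih
      simp only
      split_ifs with hab
      · refine ⟨fun p hp => ?_, ?_⟩
        · rcases List.mem_cons.1 hp with rfl | hp
          · simp
          · exact ih.1 p (by simp [hp])
        · have := ih.2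
          rw [List.isChain_cons] at this ⊢
          exact this
      · refine ⟨fun p hp => ?_, ?_⟩
        · rcases List.mem_cons.1 hp with rfl | hp
          · simp
          · exact ih.1 p hp
        · exact List.isChain_cons_cons.2 ⟨hab, ih.2⟩

theorem expand_rle (S : List α) : expand (rle S) = S := by
  induction S with
  | nil => rfl
  | cons a S ih =>
    rw [rle]
    rcases hS : rle S with _ | ⟨⟨b, e⟩, R⟩
    · rw [hS] at ih
      rw [← ih]
      rfl
    · rw [hS] at ih
      simp only
      split_ifs with hab
      · rw [← ih, expand_cons, expand_cons, hab]
        simp [List.replicate_succ]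
      · rw [expand_cons, ih]
        simp

theorem rle_replicate_append {a : α} {T : List α} (h : ∀ p ∈ (rle T).head?, p.1 ≠ a) (e : ℕ) :
    rle (List.replicate (e + 1) a ++ T) = (a, e + 1) :: rle T := by
  induction e with
  | zero =>
    rw [List.replicate_succ, List.cons_append, rle]
    rcases hT : rle T with _ | ⟨⟨b, f⟩, R⟩
    · simp [hT]
    · rw [hT] at h
      have : a ≠ b := fun hab => h (b, f) (by simp) hab.symm
      simp [hT, this]
  | succ e ih =>
    rw [List.replicate_succ, List.cons_append, rle, ih]
    simp

/-- Together with `expand_rle` and `isRuns_rle` this makes `rle` a bijection onto the valid lists of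
runs: any valid list that spells a string is its encoding. -/
theorem rle_expand {R : List (α × ℕ)} (h : IsRuns R) : rle (expand R) = R := by
  induction R with
  | nil => rfl
  | cons p R ih =>
    obtain ⟨a, e⟩ := p
    have he : 1 ≤ e := h.1 (a, e) (by simp)
    have hR := ih h.tail
    rw [expand_cons]
    obtain ⟨e, rfl⟩ : ∃ n, e = n + 1 := ⟨e - 1, by omega⟩
    rw [rle_replicate_append, hR]
    rw [hR]
    intro q hq
    cases R with
    | nil => simp at hq
    | cons q' R =>
      obtain rfl : q' = q := by simpa using hq
      exact (h.ne 0 (by simp)).symm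

theorem rle_reverse (S : List α) : rle S.reverse = (rle S).reverse := by
  conv_lhs => rw [← expand_rle S, ← expand_reverse]
  exact rle_expand (isRuns_rle S).reverse

end Runs

/-! ### Occurrences -/

section Occurrences

variable {α : Type u}

/-- The position at which run number `k` begins. -/
def bnd (ex : ℕ → ℕ) (k : ℕ) : ℕ := ∑ j ∈ Finset.range k, ex j

theorem bnd_succ (ex : ℕ → ℕ) (k : ℕ) : bnd ex (k + 1) = bnd ex k + ex k :=
  Finset.sum_range_succ _ _

theorem bnd_eq_sum (ex : ℕ → ℕ) (k : ℕ) : bnd ex k = ((List.range k).map ex).sum := by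
  induction k with
  | zero => rfl
  | succ k ih => rw [bnd_succ, ih, List.range_succ]; simp

theorem bnd_mono (ex : ℕ → ℕ) {k k' : ℕ} (h : k ≤ k') : bnd ex k ≤ bnd ex k' :=
  Finset.sum_le_sum_of_subset (Finset.range_subset_range.2 h)

theorem bnd_unique {ex : ℕ → ℕ} {i k k' : ℕ} (h1 : bnd ex k ≤ i) (h2 : i < bnd ex (k + 1))
    (h1' : bnd ex k' ≤ i) (h2' : i < bnd ex (k' + 1)) : k = k' := by
  rcases lt_trichotomy k k' with hlt | heq | hlt
  · have := bnd_mono ex (show k + 1 ≤ k' from hlt)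
    omega
  · exact heq
  · have := bnd_mono ex (show k' + 1 ≤ k from hlt)
    omega

/-- The runs of a suffix. -/
def tailRuns (m : ℕ) (ltr : ℕ → α) (ex : ℕ → ℕ) (k i : ℕ) : List (α × ℕ) :=
  (ltr k, bnd ex (k + 1) - i) ::
    (List.range (m - k - 1)).map fun j => (ltr (k + 1 + j), ex (k + 1 + j))

theorem tailRuns_getElem? {m : ℕ} {ltr : ℕ → α} {ex : ℕ → ℕ} {i k j : ℕ} (hk : k < m) : (tailRuns m ltr ex k i)[j]? =
    if k + j < m then some (ltr (k + j), if j = 0 then bnd ex (k + 1) - i else ex (k + j)) else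
      none := by
  cases j with
  | zero => simp [tailRuns, hk]
  | succ j =>
    simp only [tailRuns, List.getElem?_cons_succ, List.getElem?_map]
    rw [show k + (j + 1) = k + 1 + j by omega]
    rw [if_neg (Nat.succ_ne_zero j)]
    by_cases hj : k + 1 + j < m
    · rw [List.getElem?_range (by omega), if_pos hj, Option.map_some]
    · rw [List.getElem?_eq_none (by simp; omega), if_neg hj, Option.map_none]

variable [DecidableEq α]

/-- The runs of `S` are `(ltr k, ex k)` for `k < m`. -/
def HasRuns (S : List α) (m : ℕ) (ltr : ℕ → α) (ex : ℕ → ℕ) : Prop :=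
  rle S = (List.range m).map fun k => (ltr k, ex k)

namespace HasRuns

variable {S : List α} {m : ℕ} {ltr : ℕ → α} {ex : ℕ → ℕ}

theorem length_rle (h : HasRuns S m ltr ex) : (rle S).length = m := by
  rw [h]
  simp

theorem pos (h : HasRuns S m ltr ex) {k : ℕ} (hk : k < m) : 1 ≤ ex k :=
  (isRuns_rle S).1 (ltr k, ex k) (by rw [h]; simp; exact ⟨k, hk, rfl, rfl⟩)

theorem ne (h : HasRuns S m ltr ex) {k : ℕ} (hk : k + 1 < m) : ltr k ≠ ltr (k + 1) := by
  have h' := isRuns_rle S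
  rw [h] at h'
  have h1 := h'.ne k (by simpa using hk)
  simp only [List.getElem_map, List.getElem_range] at h1
  exact h1

theorem bnd_lt (h : HasRuns S m ltr ex) {k k' : ℕ} (hk : k < k') (hk' : k' ≤ m) :
    bnd ex k < bnd ex k' := by
  have h1 := bnd_mono ex (show k + 1 ≤ k' from hk)
  have h2 := h.pos (k := k) (by omega)
  rw [bnd_succ] at h1
  omega

theorem runBegin_eq (h : HasRuns S m ltr ex) {k : ℕ} (hk : k ≤ m) :
    runBegin S k = bnd ex k := by
  rw [runBegin, h, bnd_eq_sum, ← List.map_take, List.take_range, min_eq_left hk, List.map_map]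
  rfl

theorem runEnd_eq (h : HasRuns S m ltr ex) {k : ℕ} (hk : k < m) :
    runEnd S k = bnd ex (k + 1) := h.runBegin_eq hk

theorem length_eq (h : HasRuns S m ltr ex) : S.length = bnd ex m := by
  rw [← expand_rle S, length_expand, h, bnd_eq_sum, List.map_map]
  rfl

theorem exists_run (h : HasRuns S m ltr ex) {i : ℕ} (hi : i < S.length) :
    ∃ k < m, bnd ex k ≤ i ∧ i < bnd ex (k + 1) := by
  rw [h.length_eq] at hi
  clear h
  induction m with
  | zero => simp [bnd] at hi
  | succ m ih =>
    rcases lt_or_ge i (bnd ex m) with him | him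
    · obtain ⟨k, hk, h1, h2⟩ := ih him
      exact ⟨k, by omega, h1, h2⟩
    · exact ⟨m, by omega, him, hi⟩

theorem drop_eq (h : HasRuns S m ltr ex) {i k : ℕ} (hk : k < m) (h1 : bnd ex k ≤ i)
    (h2 : i < bnd ex (k + 1)) : S.drop i = expand (tailRuns m ltr ex k i) := by
  have hS : S = expand ((List.range k).map fun k => (ltr k, ex k)) ++
      (List.replicate (ex k) (ltr k) ++
        expand ((List.range (m - k - 1)).map fun j => (ltr (k + 1 + j), ex (k + 1 + j)))) := by
    conv_lhs => rw [← expand_rle S, h]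
    rw [show m = k + (m - k - 1 + 1) by omega, List.range_add, List.range_succ_eq_map]
    simp only [List.map_append, List.map_cons, List.map_map, expand_append, expand_cons, add_zero]
    rw [show k + (m - k - 1 + 1) - k - 1 = m - k - 1 by omega]
    congr 4
    funext j
    simp only [Function.comp_apply, Nat.succ_eq_add_one]
    rw [show k + (j + 1) = k + 1 + j by omega]
  have hl : (expand ((List.range k).map fun k => (ltr k, ex k))).length = bnd ex k := by
    rw [length_expand, bnd_eq_sum, List.map_map]
    rfl
  rw [bnd_succ] at h2
  rw [hS, tailRuns, expand_cons, List.drop_append, hl, List.drop_eq_nil_of_le (by omega),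
    List.nil_append, List.drop_append, List.drop_replicate, List.length_replicate,
    show i - bnd ex k - ex k = 0 by omega, List.drop_zero, bnd_succ]
  congr 2
  omega

theorem isRuns_tailRuns (h : HasRuns S m ltr ex) {i k : ℕ} (hk : k < m)
    (h2 : i < bnd ex (k + 1)) : IsRuns (tailRuns m ltr ex k i) := by
  refine IsRuns.of_getElem ?_ ?_
  · intro p hp
    rcases List.mem_cons.1 hp with rfl | hp
    · show 1 ≤ bnd ex (k + 1) - i
      omega
    · simp only [List.mem_map, List.mem_range] at hp
      obtain ⟨j, hj, rfl⟩ := hp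
      exact h.pos (by omega)
  · intro j hj
    simp only [tailRuns, List.length_cons, List.length_map, List.length_range] at hj
    cases j with
    | zero =>
      simp only [tailRuns, List.getElem_cons_zero, List.getElem_cons_succ, List.getElem_map,
        List.getElem_range, add_zero]
      exact h.ne (by omega)
    | succ j =>
      simp only [tailRuns, List.getElem_cons_succ, List.getElem_map, List.getElem_range]
      exact h.ne (by omega)

theorem getElem? (h : HasRuns S m ltr ex) {p k : ℕ} (hk : k < m) (h1 : bnd ex k ≤ p)
    (h2 : p < bnd ex (k + 1)) : S[p]? = some (ltr k) := by
  have := congrArg (fun l => l[0]?) (h.drop_eq hk h1 h2)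
  simp only [List.getElem?_drop, add_zero] at this
  rw [this, tailRuns, expand_eq_cons (by show 1 ≤ bnd ex (k + 1) - p; omega)]
  rfl

/-- The occurrences of a string, in terms of runs. -/
theorem occursAt_iff (h : HasRuns S m ltr ex) {Q : List (α × ℕ)} (hQ : IsRuns Q) (hne : Q ≠ [])
    {i : ℕ} : OccursAt S (expand Q) i ↔ ∃ k < m, bnd ex k ≤ i ∧ i < bnd ex (k + 1) ∧
      ∀ j q, Q[j]? = some q → k + j < m ∧ q.1 = ltr (k + j) ∧
        (j = 0 → i + q.2 ≤ bnd ex (k + 1)) ∧ (0 < j → q.2 ≤ ex (k + j)) ∧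
        (j + 1 < Q.length → (j = 0 → i + q.2 = bnd ex (k + 1)) ∧
          (0 < j → q.2 = ex (k + j))) := by
  have hmain : ∀ k < m, i < bnd ex (k + 1) → (PrefRuns Q (tailRuns m ltr ex k i) ↔
      ∀ j q, Q[j]? = some q → k + j < m ∧ q.1 = ltr (k + j) ∧
        (j = 0 → i + q.2 ≤ bnd ex (k + 1)) ∧ (0 < j → q.2 ≤ ex (k + j)) ∧
        (j + 1 < Q.length → (j = 0 → i + q.2 = bnd ex (k + 1)) ∧
          (0 < j → q.2 = ex (k + j)))) := by
    intro k hk hi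
    refine forall₃_congr fun j q hj => ?_
    rw [tailRuns_getElem? hk]
    by_cases hkm : k + j < m
    · simp only [hkm, if_true, Option.some.injEq, Prod.mk.injEq, true_and]
      constructor
      · rintro ⟨e, ⟨h1, h2⟩, h3, h4⟩
        refine ⟨h1.symm, fun h0 => ?_, fun h0 => ?_, fun hl => ⟨fun h0 => ?_, fun h0 => ?_⟩⟩
        · rw [if_pos h0] at h2
          omega
        · rw [if_neg h0.ne'] at h2
          omega
        · rw [if_pos h0] at h2
          have := h4 hl
          omega
        · rw [if_neg h0.ne'] at h2
          have := h4 hl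
          omega
      · rintro ⟨h1, h2, h3, h4⟩
        refine ⟨_, ⟨h1.symm, rfl⟩, ?_, fun hl => ?_⟩
        · split_ifs with h0
          · have := h2 h0
            omega
          · exact h3 (Nat.pos_of_ne_zero h0)
        · split_ifs with h0
          · have := (h4 hl).1 h0
            omega
          · exact (h4 hl).2 (Nat.pos_of_ne_zero h0)
    · simp [hkm]
  constructor
  · intro hocc
    have hlen : i < S.length := by
      have h1 := hocc.length_le
      have h2 : 0 < (expand Q).length := List.length_pos_iff.2 fun h0 => hne ((expand_eq_nil hQ).1 h0)
      rw [List.length_drop] at h1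
      omega
    obtain ⟨k, hk, h1, h2⟩ := h.exists_run hlen
    refine ⟨k, hk, h1, h2, (hmain k hk h2).1 ?_⟩
    rw [OccursAt, h.drop_eq hk h1 h2, expand_prefix_iff hQ (h.isRuns_tailRuns hk h2)] at hocc
    exact hocc
  · rintro ⟨k, hk, h1, h2, h3⟩
    rw [OccursAt, h.drop_eq hk h1 h2, expand_prefix_iff hQ (h.isRuns_tailRuns hk h2)]
    exact (hmain k hk h2).2 h3

/-- An occurrence of a palindrome whose ends are in the runs `kL` and `kR` is RLE-bounded or
maximal if and only if one of its ends is the end of a run. -/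
theorem bounded_or_maximal_iff (h : HasRuns S m ltr ex) {i j kL kR : ℕ} (hL : kL ≤ kR)
    (hR : kR < m) (hlr : ltr kL = ltr kR) (h1 : bnd ex kL ≤ i) (h2 : i < bnd ex (kL + 1))
    (h3 : bnd ex kR < j) (h4 : j ≤ bnd ex (kR + 1)) :
    (RLEBounded S i j ∨ MaximalAt S i j) ↔ i = bnd ex kL ∨ j = bnd ex (kR + 1) := by
  have hLm : kL < m := by omega
  have hpre : bnd ex kL < i → S[i - 1]? = some (ltr kL) := fun hi =>
    h.getElem? hLm (by omega) (by omega)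
  have hpost : j < bnd ex (kR + 1) → S[j]? = some (ltr kR) := fun hj =>
    h.getElem? hR (by omega) hj
  constructor
  · rintro (⟨k, k', hkk, hk', hi, hj⟩ | hmax | hmax | hmax)
    · left
      rw [h.length_rle] at hk'
      rw [h.runBegin_eq (by omega)] at hi
      have := h.bnd_lt (show k < k + 1 by omega) (by omega)
      rw [bnd_unique (k := kL) (k' := k) h1 h2 (by omega) (by omega)]
      exact hi
    · left
      omega
    · right
      rw [h.length_eq] at hmax
      have := bnd_mono ex (show kR + 1 ≤ m from hR)
      omega
    -- If neither end is the end of a run, the letters next to the occurrence continue its end runs,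
    -- and these have equal letters.
    · by_contra! hc
      refine hmax ?_
      rw [hpre (by omega), hpost (by omega), hlr]
  · intro hends
    by_cases hi : i = bnd ex kL <;> by_cases hj : j = bnd ex (kR + 1)
    · left
      exact ⟨kL, kR, hL, by rw [h.length_rle]; exact hR, by rw [h.runBegin_eq hLm.le, hi],
        by rw [h.runEnd_eq hR, hj]⟩
    · right
      -- Only the left end is the end of a run. The letter before it belongs to another run, while
      -- the letter after the right end continues the run `kR`; so they differ unless the text
      -- begins here.
      rcases Nat.eq_zero_or_pos kL with h0 | h0
      · left
        rw [hi, h0]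
        simp [bnd]
      · right
        right
        have hlt := h.bnd_lt (show kL - 1 < kL by omega) hLm.le
        have hprev : S[i - 1]? = some (ltr (kL - 1)) :=
          h.getElem? (by omega) (by omega) (by rw [Nat.sub_add_cancel h0]; omega)
        have hne := h.ne (k := kL - 1) (by omega)
        rw [Nat.sub_add_cancel h0] at hne
        rw [hprev, hpost (by omega), ← hlr]
        simpa using hne
    · right
      rcases Nat.lt_or_ge (kR + 1) m with h0 | h0
      · right
        right
        have hlt := h.bnd_lt (show kR + 1 < kR + 1 + 1 by omega) h0
        rw [hpre (by omega), h.getElem? h0 (by omega) (by omega), hlr]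
        simpa using h.ne h0
      · right
        left
        rw [hj, h.length_eq, show m = kR + 1 by omega]
    · omega

end HasRuns

end Occurrences

/-! ### Palindromes as strings of runs -/

section Palindromes

variable {α : Type u}

/-- The palindrome of odd length whose right half, including the center, is `w`. -/
def mirror (w : List (α × ℕ)) : List (α × ℕ) := w.tail.reverse ++ w

theorem mirror_ne_nil {w : List (α × ℕ)} (hw : w ≠ []) : mirror w ≠ [] := by
  simp [mirror, hw]

theorem length_mirror {w : List (α × ℕ)} {d : ℕ} (hw : w.length = d + 1) :
    (mirror w).length = 2 * d + 1 := by
  simp [mirror, hw]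
  omega

theorem mirror_reverse (w : List (α × ℕ)) : (mirror w).reverse = mirror w := by
  cases w <;> simp [mirror]

theorem mirror_getElem? {w : List (α × ℕ)} {d : ℕ} (hw : w.length = d + 1) (i : ℕ) :
    (mirror w)[i]? = w[(d - i) + (i - d)]? := by
  have hl : w.tail.reverse.length = d := by simp [hw]
  rw [mirror]
  rcases lt_or_ge i d with hi | hi
  · rw [List.getElem?_append_left (by omega), List.getElem?_reverse (by simpa using by omega),
      List.getElem?_tail]
    congr 1
    simp [hw]
    omega
  · rw [List.getElem?_append_right (by omega), hl]
    congr 1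
    omega

theorem mirror_append {w : List (α × ℕ)} (hw : w ≠ []) (l : α × ℕ) :
    mirror (w ++ [l]) = l :: (mirror w ++ [l]) := by
  cases w with
  | nil => exact absurd rfl hw
  | cons a w => simp [mirror]

theorem mirror_inj {w w' : List (α × ℕ)} (h : mirror w = mirror w') : w = w' := by
  have hl := congrArg List.length h
  simp only [mirror, List.length_append, List.length_reverse, List.length_tail] at hl
  exact (List.append_inj' h (by omega)).2

/-- With an even number of runs the two middle runs would be equal, but adjacent runs have different
letters. -/
theorem exists_mirror {Q : List (α × ℕ)} (hQ : IsRuns Q) (hne : Q ≠ []) (hrev : Q.reverse = Q) :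
    ∃ w, w ≠ [] ∧ mirror w = Q := by
  have hpos := List.length_pos_iff.2 hne
  have hsymm : ∀ i, i < Q.length → Q[Q.length - 1 - i]? = Q[i]? := fun i hi => by
    rw [← List.getElem?_reverse hi, hrev]
  obtain ⟨d, hd | hd⟩ := Nat.even_or_odd' Q.length
  · exfalso
    have h1 := hsymm d (by omega)
    have h2 := hQ.ne (d - 1) (by omega)
    rw [show Q.length - 1 - d = d - 1 by omega, List.getElem?_eq_getElem (by omega),
      List.getElem?_eq_getElem (by omega)] at h1
    simp only [show d - 1 + 1 = d by omega] at h2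
    exact h2 (congrArg Prod.fst (Option.some.inj h1))
  · have hl : (Q.drop d).length = d + 1 := by
      rw [List.length_drop]
      omega
    refine ⟨Q.drop d, List.length_pos_iff.1 (by omega), List.ext_getElem? fun i => ?_⟩
    rw [mirror_getElem? hl, List.getElem?_drop]
    rcases lt_or_ge i d with hi | hi
    · rw [← hsymm i (by omega)]
      congr 1
      omega
    · congr 1
      omega

/-- The maximal extension of the arm `w` around run `c`: all runs of `w` but the last one are
read off on both sides of `c`, and the last one is the common part of the next two runs. -/
def Cen (m : ℕ) (ltr : ℕ → α) (ex : ℕ → ℕ) (c : ℕ) (w : List (α × ℕ)) : Prop :=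
  ∀ j p, w[j]? = some p → j ≤ c ∧ c + j < m ∧ p.1 = ltr (c - j) ∧ p.1 = ltr (c + j) ∧
    (j + 1 < w.length → p.2 = ex (c - j) ∧ p.2 = ex (c + j)) ∧
    (j + 1 = w.length → p.2 = min (ex (c - j)) (ex (c + j)))

theorem occurrence_end {ex : ℕ → ℕ} {Q : List (α × ℕ)} {i k n : ℕ} (hn : 1 ≤ n)
    (hnQ : n ≤ Q.length) (h0 : ∀ q, Q[0]? = some q → i + q.2 = bnd ex (k + 1))
    (h : ∀ j q, 0 < j → j < n → Q[j]? = some q → q.2 = ex (k + j)) :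
    i + ((Q.take n).map Prod.snd).sum = bnd ex (k + n) := by
  induction n, hn using Nat.le_induction with
  | base =>
    rw [List.take_add_one, List.getElem?_eq_getElem (by omega)]
    simpa using h0 _ (List.getElem?_eq_getElem (by omega))
  | succ n hn ih =>
    have hg : Q[n]? = some Q[n] := List.getElem?_eq_getElem (by omega)
    rw [List.take_add_one, hg, List.map_append, List.sum_append, ← add_assoc,
      ih (by omega) fun j q h1 h2 => h j q h1 (by omega), ← add_assoc, bnd_succ,
      ← h n _ (by omega) (by omega) hg]
    simp

/-- The first run ends where run `k` ends and the inner runs are complete, so the palindrome ends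
`f` letters into run `k + 2 * d`. -/
theorem expand_mirror_end {ex : ℕ → ℕ} {w : List (α × ℕ)} {d i k : ℕ} {b : α} {f : ℕ}
    (hd : 1 ≤ d) (hw : w.length = d + 1) (hf : w[d]? = some (b, f))
    (h1 : i + f = bnd ex (k + 1)) (h2 : ∀ j q, 0 < j → j < 2 * d →
      (mirror w)[j]? = some q → q.2 = ex (k + j)) :
    i + (expand (mirror w)).length = bnd ex (k + 2 * d) + f := by
  have hlen := length_mirror hw
  have hQ0 : (mirror w)[0]? = some (b, f) := by
    rw [mirror_getElem? hw, ← hf]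
    congr 1
    omega
  have hQ2 : (mirror w)[2 * d]? = some (b, f) := by
    rw [mirror_getElem? hw, ← hf]
    congr 1
    omega
  rw [← occurrence_end (Q := mirror w) (i := i) (n := 2 * d) (by omega) (by omega)
    (fun q hq => by rw [hQ0] at hq; cases hq; exact h1) h2, length_expand]
  conv_lhs => rw [← List.take_length (l := mirror w), hlen, List.take_add_one, hQ2]
  simp
  omega

theorem Cen.mirror {m : ℕ} {ltr : ℕ → α} {ex : ℕ → ℕ} {w : List (α × ℕ)} {d k : ℕ}
    (hw : w.length = d + 1) (hc : Cen m ltr ex (k + d) w) (j : ℕ) (q : α × ℕ)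
    (hj : (mirror w)[j]? = some q) : k + j < m ∧ q.1 = ltr (k + j) ∧
      (0 < j → j < 2 * d → q.2 = ex (k + j)) := by
  rw [mirror_getElem? hw] at hj
  have hl := (List.getElem?_eq_some_iff.1 hj).1
  obtain ⟨k1, k2, k3, k4, k5, -⟩ := hc _ _ hj
  rcases lt_or_ge j d with hjd | hjd
  · rw [show k + d - (d - j + (j - d)) = k + j by omega] at k3 k5
    exact ⟨by omega, k3, fun _ _ => (k5 (by omega)).1⟩
  · rw [show k + d + (d - j + (j - d)) = k + j by omega] at k4 k5
    exact ⟨by omega, k4, fun _ _ => (k5 (by omega)).2⟩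

variable [DecidableEq α] {S : List α} {m : ℕ} {ltr : ℕ → α} {ex : ℕ → ℕ}

namespace HasRuns

theorem isRuns_mirror (h : HasRuns S m ltr ex) {c : ℕ} {w : List (α × ℕ)}
    (hc : Cen m ltr ex c w) : IsRuns (mirror w) := by
  rcases hw : w with _ | ⟨a, w'⟩
  · exact ⟨by simp [mirror], by simp [mirror]⟩
  rw [← hw]
  obtain ⟨d, hd⟩ : ∃ d, w.length = d + 1 := ⟨w'.length, by rw [hw]; rfl⟩
  have hcd := hc d w[d] (List.getElem?_eq_getElem (by omega))
  have key : ∀ i q, (mirror w)[i]? = some q → 1 ≤ q.2 ∧ q.1 = ltr (c - d + i) := by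
    intro i q hi
    rw [mirror_getElem? hd] at hi
    obtain ⟨h1, h2, h3, h4, h5, h6⟩ := hc _ _ hi
    have h7 := h.pos (k := c - (d - i + (i - d))) (by omega)
    have h8 := h.pos (k := c + (d - i + (i - d))) (by omega)
    refine ⟨?_, ?_⟩
    · rcases lt_or_ge (d - i + (i - d) + 1) w.length with hl | hl
      · have := h5 hl
        omega
      · have := (List.getElem?_eq_some_iff.1 hi).1
        have := h6 (by omega)
        omega
    · rcases lt_or_ge i d with hid | hid
      · rw [h3]
        congr 1
        omega
      · rw [h4]
        congr 1
        omega
  refine IsRuns.of_getElem ?_ ?_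
  · intro q hq
    obtain ⟨i, hi⟩ := List.mem_iff_getElem?.1 hq
    exact (key i q hi).1
  · intro i hi
    rw [(key i _ (List.getElem?_eq_getElem (by omega))).2,
      (key (i + 1) _ (List.getElem?_eq_getElem hi)).2]
    rw [length_mirror hd] at hi
    exact h.ne (by omega)

theorem rle_mirror (h : HasRuns S m ltr ex) {c : ℕ} {w : List (α × ℕ)}
    (hc : Cen m ltr ex c w) : rle (expand (mirror w)) = mirror w :=
  rle_expand (h.isRuns_mirror hc)

/-- With at least three runs, the inner runs of an occurrence are complete runs of `S`, which fixes
the center. The outermost run has at most the length of each of the two end runs, and it exhausts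
one of them exactly if the occurrence is RLE-bounded or maximal, which makes its length the minimum.
-/
theorem occurs_mirror_iff (h : HasRuns S m ltr ex) {w : List (α × ℕ)} (hR : IsRuns (mirror w))
    {d : ℕ} (hd : 1 ≤ d) (hw : w.length = d + 1) {b : α} {f : ℕ} (hf : w[d]? = some (b, f))
    {i : ℕ} :
    (OccursAt S (expand (mirror w)) i ∧ (RLEBounded S i (i + (expand (mirror w)).length) ∨
      MaximalAt S i (i + (expand (mirror w)).length))) ↔
      ∃ c, Cen m ltr ex c w ∧ i + f = bnd ex (c - d + 1) := by
  have hne : w ≠ [] := List.length_pos_iff.1 (by omega)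
  have hlen := length_mirror hw
  have hQ0 : (mirror w)[0]? = some (b, f) := by
    rw [mirror_getElem? hw, ← hf]
    congr 1
    omega
  have hQ2 : (mirror w)[2 * d]? = some (b, f) := by
    rw [mirror_getElem? hw, ← hf]
    congr 1
    omega
  have hfpos : 1 ≤ f := hR.1 (b, f) (List.mem_of_getElem? hQ0)
  have hend := fun k => expand_mirror_end (ex := ex) (i := i) (k := k) hd hw hf
  rw [h.occursAt_iff hR (mirror_ne_nil hne)]
  constructor
  · rintro ⟨⟨k, hk, h1, h2, h3⟩, h4⟩
    have h5 := h3 0 _ hQ0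
    have h6 := h3 (2 * d) _ hQ2
    rw [hlen] at h5
    have e1 := (h5.2.2.2.2 (by omega)).1 rfl
    have e2 := h6.2.2.2.1 (by omega)
    have e3 := hend k e1 fun j q hj1 hj2 hj => ((h3 j q hj).2.2.2.2 (by omega)).2 hj1
    have hs1 := bnd_succ ex k
    have hs2 := bnd_succ ex (k + 2 * d)
    rw [add_zero] at h5
    simp only at e1 e2
    rw [e3, h.bounded_or_maximal_iff (kL := k) (kR := k + 2 * d) (by omega) (by omega)
      (h5.2.1.symm.trans h6.2.1) h1 h2 (by omega) (by omega)] at h4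
    refine ⟨k + d, ?_, ?_⟩
    swap
    · rw [Nat.add_sub_cancel]
      exact e1
    intro j p hj
    have hjl := (List.getElem?_eq_some_iff.1 hj).1
    have g1 := h3 (d - j) p (by
      rw [mirror_getElem? hw, ← hj]
      congr 1
      omega)
    have g2 := h3 (d + j) p (by
      rw [mirror_getElem? hw, ← hj]
      congr 1
      omega)
    rw [show k + d - j = k + (d - j) by omega, show k + d + j = k + (d + j) by omega]
    refine ⟨by omega, by omega, g1.2.1, g2.2.1, fun hl => ⟨?_, ?_⟩, fun hl => ?_⟩
    · exact (g1.2.2.2.2 (by omega)).2 (by omega)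
    · exact (g2.2.2.2.2 (by omega)).2 (by omega)
    · obtain rfl : j = d := by omega
      rw [hf] at hj
      cases hj
      rw [Nat.sub_self, add_zero, ← two_mul]
      simp only
      omega
  · rintro ⟨c, hc, hi⟩
    have hcd := hc d _ hf
    obtain ⟨k, rfl⟩ : ∃ k, c = k + d := ⟨c - d, by omega⟩
    rw [Nat.add_sub_cancel] at hi
    obtain ⟨-, g2, g3, g4, -, g6⟩ := hcd
    have g7 := g6 hw.symm
    rw [show k + d + d = k + 2 * d by omega] at g2 g4 g7
    rw [Nat.add_sub_cancel] at g3 g7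
    simp only at g3 g4 g7
    have hs1 := bnd_succ ex k
    have hs2 := bnd_succ ex (k + 2 * d)
    have hin := hc.mirror hw
    have e3 := hend k hi fun j q h1 h2 hj => (hin j q hj).2.2 h1 h2
    refine ⟨⟨k, by omega, by omega, by omega, ?_⟩, ?_⟩
    · intro j q hj
      obtain ⟨h1, h2, h3⟩ := hin j q hj
      have hl := (List.getElem?_eq_some_iff.1 hj).1
      refine ⟨h1, h2, ?_, ?_, fun hjl => ⟨?_, fun h0 => h3 h0 (by omega)⟩⟩
      · rintro rfl
        rw [hQ0] at hj
        cases hj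
        exact hi.le
      · intro h0
        rcases lt_or_ge j (2 * d) with hj2 | hj2
        · exact (h3 h0 hj2).le
        · obtain rfl : j = 2 * d := by omega
          rw [hQ2] at hj
          cases hj
          simp only
          omega
      · rintro rfl
        rw [hQ0] at hj
        cases hj
        exact hi
    · rw [e3, h.bounded_or_maximal_iff (kL := k) (kR := k + 2 * d) (by omega) (by omega)
        (g3.symm.trans g4) (by omega) (by omega) (by omega) (by omega)]
      omega

-- The occurrence with center `c` starts at `bnd ex (c - d + 1) - f`, which strictly increases with
-- `c`. So counting occurrences is counting centers.
open Classical in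
theorem occCount_mirror (h : HasRuns S m ltr ex) {w : List (α × ℕ)} (hR : IsRuns (mirror w))
    (hw : 2 ≤ w.length) : occCount S (expand (mirror w)) =
      ((Finset.range m).filter fun c => Cen m ltr ex c w).card := by
  obtain ⟨d, hd⟩ : ∃ d, w.length = d + 1 := ⟨w.length - 1, by omega⟩
  obtain ⟨⟨b, f⟩, hf⟩ : ∃ p, w[d]? = some p := ⟨_, List.getElem?_eq_getElem (by omega)⟩
  have hcen : ∀ c, Cen m ltr ex c w → d ≤ c ∧ c + d < m ∧ f ≤ bnd ex (c - d + 1) := by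
    intro c hc
    obtain ⟨h1, h2, -, -, -, h6⟩ := hc d _ hf
    have := h6 hd.symm
    have := bnd_succ ex (c - d)
    simp only at *
    omega
  have hset : {i | OccursAt S (expand (mirror w)) i ∧
      (RLEBounded S i (i + (expand (mirror w)).length) ∨
        MaximalAt S i (i + (expand (mirror w)).length))} =
      ((((Finset.range m).filter fun c => Cen m ltr ex c w).image fun c =>
        bnd ex (c - d + 1) - f : Finset ℕ) : Set ℕ) := by
    ext i
    rw [Set.mem_ofPred_eq, h.occurs_mirror_iff hR (by omega) hd hf]
    simp only [Finset.coe_image, Set.mem_image, Finset.mem_coe, Finset.mem_filter,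
      Finset.mem_range]
    constructor
    · rintro ⟨c, hc, hi⟩
      exact ⟨c, ⟨by have := hcen c hc; omega, hc⟩, by omega⟩
    · rintro ⟨c, ⟨-, hc⟩, hi⟩
      exact ⟨c, hc, by have := hcen c hc; omega⟩
  rw [occCount, hset, Set.ncard_coe_finset, Finset.card_image_of_injOn]
  intro c hc c' hc' he
  simp only [Finset.mem_coe, Finset.mem_filter] at hc hc' he
  have h1 := hcen c hc.2
  have h2 := hcen c' hc'.2
  rcases lt_trichotomy c c' with hlt | heq | hlt
  · have := h.bnd_lt (show c - d + 1 < c' - d + 1 by omega) (by omega)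
    omega
  · exact heq
  · have := h.bnd_lt (show c' - d + 1 < c - d + 1 by omega) (by omega)
    omega

/-- Such an occurrence lies inside one run, and RLE-bounded or maximal means that it touches an end
of this run. It need not have the same center as the run. -/
theorem occurs_single_iff (h : HasRuns S m ltr ex) {a : α} {e i : ℕ} (he : 1 ≤ e) :
    (OccursAt S (List.replicate e a) i ∧ (RLEBounded S i (i + e) ∨ MaximalAt S i (i + e))) ↔
      ∃ k < m, a = ltr k ∧ e ≤ ex k ∧ (i = bnd ex k ∨ i + e = bnd ex (k + 1)) := by
  have hexp : List.replicate e a = expand [(a, e)] := by simp [expand]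
  have hR : IsRuns [(a, e)] := ⟨by simpa using he, by simp⟩
  rw [hexp, h.occursAt_iff hR (by simp)]
  constructor
  · rintro ⟨⟨k, hk, h1, h2, h3⟩, h4⟩
    obtain ⟨-, g1, g2, -⟩ := h3 0 _ rfl
    have g3 := g2 rfl
    simp only [add_zero] at g1 g3
    rw [h.bounded_or_maximal_iff le_rfl hk rfl h1 h2 (by omega) g3] at h4
    rw [bnd_succ] at g3
    exact ⟨k, hk, g1, by omega, h4⟩
  · rintro ⟨k, hk, rfl, h1, h2⟩
    have hs := bnd_succ ex k
    refine ⟨⟨k, hk, by omega, by omega, fun j q hj => ?_⟩, ?_⟩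
    · cases j with
      | zero =>
        cases hj
        exact ⟨hk, rfl, fun _ => by simp only; omega, by omega, by simp⟩
      | succ j => simp at hj
    · rw [h.bounded_or_maximal_iff le_rfl hk rfl (by omega) (by omega) (by omega) (by omega)]
      exact h2

/-- In a run of length exactly `e` the occurrences at both ends coincide; in a longer run they are
different. -/
theorem occCount_single (h : HasRuns S m ltr ex) {a : α} {e : ℕ} (he : 1 ≤ e) :
    occCount S (List.replicate e a) =
      ((Finset.range m).filter fun k => ltr k = a ∧ ex k = e).card +
        2 * ((Finset.range m).filter fun k => ltr k = a ∧ e < ex k).card := by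
  set F := (Finset.range m).filter fun k => ltr k = a ∧ ex k = e with hF
  set G := (Finset.range m).filter fun k => ltr k = a ∧ e < ex k with hG
  have hFm : ∀ k ∈ F, k < m ∧ ltr k = a ∧ ex k = e := fun k hk => by simpa [hF] using hk
  have hGm : ∀ k ∈ G, k < m ∧ ltr k = a ∧ e < ex k := fun k hk => by simpa [hG] using hk
  have hFG : Disjoint F G := Finset.disjoint_left.2 fun k h1 h2 => by
    have := hFm k h1
    have := hGm k h2
    omega
  have hlt : ∀ k ∈ F ∪ G, k < m ∧ e ≤ ex k := by
    intro k hk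
    rcases Finset.mem_union.1 hk with hk | hk
    · have := hFm k hk
      omega
    · have := hGm k hk
      omega
  have hset : {i | OccursAt S (List.replicate e a) i ∧
      (RLEBounded S i (i + (List.replicate e a).length) ∨
        MaximalAt S i (i + (List.replicate e a).length))} =
      (((F ∪ G).image (bnd ex) ∪ G.image fun k => bnd ex (k + 1) - e : Finset ℕ) : Set ℕ) := by
    ext i
    rw [List.length_replicate, Set.mem_ofPred_eq, h.occurs_single_iff he]
    simp only [Finset.coe_union, Finset.coe_image, Set.mem_union, Set.mem_image, Finset.mem_coe]
    constructor
    · rintro ⟨k, hk, ha, hek, hi⟩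
      rcases eq_or_lt_of_le hek with heq | hlt'
      · left
        refine ⟨k, Or.inl ?_, ?_⟩
        · simp [hF, hk, ha, heq]
        · have := bnd_succ ex k
          omega
      · have hkG : k ∈ G := by simp [hG, hk, ha, hlt']
        rcases hi with hi | hi
        · exact Or.inl ⟨k, Or.inr hkG, hi.symm⟩
        · exact Or.inr ⟨k, hkG, by omega⟩
    · rintro (⟨k, hk | hk, rfl⟩ | ⟨k, hk, rfl⟩)
      · have := hFm k hk
        exact ⟨k, this.1, this.2.1.symm, this.2.2.ge, Or.inl rfl⟩
      · have := hGm k hk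
        exact ⟨k, this.1, this.2.1.symm, this.2.2.le, Or.inl rfl⟩
      · have := hGm k hk
        have hs := bnd_succ ex k
        exact ⟨k, this.1, this.2.1.symm, this.2.2.le, Or.inr (by omega)⟩
  have hinj1 : ∀ k k', k < m → k' < m → bnd ex k = bnd ex k' → k = k' := by
    intro k k' h1 h2 he
    have g1 := h.bnd_lt (show k < k + 1 by omega) h1
    have g2 := h.bnd_lt (show k' < k' + 1 by omega) h2
    exact bnd_unique (ex := ex) (i := bnd ex k) le_rfl g1 he.ge (by omega)
  rw [occCount, hset, Set.ncard_coe_finset, Finset.card_union_of_disjoint,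
    Finset.card_image_of_injOn, Finset.card_image_of_injOn, Finset.card_union_of_disjoint hFG]
  · ring
  · intro k hk k' hk' he'
    simp only at he'
    have g1 := hGm k hk
    have g2 := hGm k' hk'
    have s1 := bnd_succ ex k
    have s2 := bnd_succ ex k'
    exact bnd_unique (ex := ex) (i := bnd ex (k + 1) - e) (by omega) (by omega) (by omega) (by omega)
  · intro k hk k' hk' he'
    exact hinj1 k k' (hlt k hk).1 (hlt k' hk').1 he'
  · refine Finset.disjoint_left.2 fun i h1 h2 => ?_
    simp only [Finset.mem_image] at h1 h2
    obtain ⟨k, hk, rfl⟩ := h1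
    obtain ⟨k', hk', he'⟩ := h2
    have g1 := hlt k hk
    have g2 := hGm k' hk'
    have s1 := bnd_succ ex k
    have s2 := bnd_succ ex k'
    obtain rfl : k = k' := bnd_unique (ex := ex) (i := bnd ex k) le_rfl (by omega) (by omega) (by omega)
    omega

/-- Runs at equal distances from run `c` have equal lengths, so the runs between are centered at the
center of run `c`. This is why the occurrences of mirrored arms are run-centered. -/
theorem bnd_symm {c d : ℕ} (hd : d ≤ c)
    (hs : ∀ j, 1 ≤ j → j < d → ex (c - j) = ex (c + j)) (h1 : 1 ≤ d) :
    bnd ex (c - d + 1) + bnd ex (c + d) = bnd ex c + bnd ex (c + 1) := by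
  induction d, h1 using Nat.le_induction with
  | base => rw [Nat.sub_add_cancel hd]
  | succ d h1 ih =>
    have h2 := ih (by omega) fun j g1 g2 => hs j g1 (by omega)
    have h3 := hs d h1 (by omega)
    have s1 := bnd_succ ex (c + d)
    have s2 := bnd_succ ex (c - d)
    rw [show c - (d + 1) + 1 = c - d by omega, ← add_assoc]
    omega

/-- Only for a single run does being run-centered matter: an occurrence that touches an end of its
run and has the same center fills the run. -/
theorem mem_eertreeNodes_iff (h : HasRuns S m ltr ex) {P : List α} : P ∈ eertreeNodes S ↔
    P = [] ∨ ∃ c w, w ≠ [] ∧ Cen m ltr ex c w ∧ P = expand (mirror w) := by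
  rw [eertreeNodes, Set.mem_ofPred_eq]
  refine or_congr_right ⟨?_, ?_⟩
  · rintro ⟨hne, hrev, i, hocc, ⟨c, hcm, hcen⟩, hbm⟩
    have hQ := isRuns_rle P
    obtain ⟨w, hw, hmw⟩ := exists_mirror hQ (by
      intro h0
      exact hne (by rw [← expand_rle P, h0]; rfl)) (by rw [← rle_reverse, hrev])
    have hP : P = expand (mirror w) := by rw [hmw, expand_rle]
    rw [← hmw] at hQ
    rcases Nat.lt_or_ge w.length 2 with hl | hl
    · obtain ⟨⟨a, e⟩, rfl⟩ : ∃ p, w = [p] := List.length_eq_one_iff.1 (by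
        have := List.length_pos_iff.2 hw
        omega)
      have he : 1 ≤ e := hQ.1 (a, e) (by simp [mirror])
      have hP' : P = List.replicate e a := by rw [hP]; simp [mirror, expand]
      rw [hP', List.length_replicate] at hcen hbm
      rw [hP'] at hocc
      obtain ⟨k, hk, hak, hek, hi⟩ := (h.occurs_single_iff he).1 ⟨hocc, hbm⟩
      rw [h.length_rle] at hcm
      rw [h.runBegin_eq (by omega), h.runEnd_eq hcm] at hcen
      have s1 := bnd_succ ex k
      have s2 := bnd_succ ex c
      have p1 := h.pos hk
      have p2 := h.pos hcm
      -- The midpoint of the occurrence lies in the run that contains the occurrence, and in the run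
      -- with the same center.
      obtain rfl : k = c := bnd_unique (ex := ex) (i := (i + (i + e)) / 2) (by omega) (by omega)
        (by omega) (by omega)
      refine ⟨k, [(a, e)], by simp, ?_, hP⟩
      intro j p hj
      cases j with
      | zero =>
        cases hj
        refine ⟨by omega, by omega, hak, hak, by simp, fun _ => ?_⟩
        simp
        omega
      | succ j => simp at hj
    · obtain ⟨d, hd⟩ : ∃ d, w.length = d + 1 := ⟨w.length - 1, by omega⟩
      obtain ⟨⟨b, f⟩, hf⟩ : ∃ p, w[d]? = some p := ⟨_, List.getElem?_eq_getElem (by omega)⟩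
      rw [hP] at hocc hbm
      obtain ⟨c', hc', -⟩ := (h.occurs_mirror_iff hQ (by omega) hd hf).1 ⟨hocc, hbm⟩
      exact ⟨c', w, hw, hc', hP⟩
  · rintro ⟨c, w, hw, hc, rfl⟩
    have hQ := h.isRuns_mirror hc
    refine ⟨fun h0 => mirror_ne_nil hw ((expand_eq_nil hQ).1 h0), by
      rw [← expand_reverse, mirror_reverse], ?_⟩
    rcases Nat.lt_or_ge w.length 2 with hl | hl
    · obtain ⟨⟨a, e⟩, rfl⟩ : ∃ p, w = [p] := List.length_eq_one_iff.1 (by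
        have := List.length_pos_iff.2 hw
        omega)
      obtain ⟨-, h2, h3, -, -, h6⟩ := hc 0 _ rfl
      have h7 := h6 rfl
      simp only [tsub_zero, add_zero, min_self] at h2 h3 h7
      have he : 1 ≤ e := by rw [h7]; exact h.pos h2
      have hP' : expand (mirror [(a, e)]) = List.replicate e a := by simp [mirror, expand]
      rw [hP', List.length_replicate]
      obtain ⟨g1, g2⟩ := (h.occurs_single_iff he (i := bnd ex c)).2 ⟨c, h2, h3, h7.le, Or.inl rfl⟩
      refine ⟨_, g1, ⟨c, by rw [h.length_rle]; exact h2, ?_⟩, g2⟩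
      rw [h.runBegin_eq h2.le, h.runEnd_eq h2, bnd_succ, h7]
    · obtain ⟨d, hd⟩ : ∃ d, w.length = d + 1 := ⟨w.length - 1, by omega⟩
      obtain ⟨⟨b, f⟩, hf⟩ : ∃ p, w[d]? = some p := ⟨_, List.getElem?_eq_getElem (by omega)⟩
      obtain ⟨k1, k2, -, -, -, k6⟩ := hc d _ hf
      have k7 := k6 hd.symm
      have s1 := bnd_succ ex (c - d)
      simp only at k7
      have hi : bnd ex (c - d + 1) - f + f = bnd ex (c - d + 1) := by omega
      obtain ⟨g1, g2⟩ := (h.occurs_mirror_iff hQ (by omega) hd hf).2 ⟨c, hc, hi⟩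
      refine ⟨_, g1, ⟨c, by rw [h.length_rle]; omega, ?_⟩, g2⟩
      rw [h.runBegin_eq (by omega), h.runEnd_eq (by omega)]
      obtain ⟨k, rfl⟩ : ∃ k, c = k + d := ⟨c - d, by omega⟩
      have hsym := bnd_symm (ex := ex) (c := k + d) (d := d) (by omega) (fun j h1 h2 => by
        obtain ⟨-, -, -, -, h5, -⟩ := hc j _ (List.getElem?_eq_getElem (by omega))
        have := h5 (by omega)
        omega) (by omega)
      rw [Nat.add_sub_cancel] at hi hsym ⊢
      rw [expand_mirror_end (by omega) hd hf hi fun j q h1 h2 h3 =>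
        (hc.mirror hd j q h3).2.2 h1 h2, show k + 2 * d = k + d + d by omega]
      omega

end HasRuns

end Palindromes

/-! ### The computed tree is the RLE-eertree -/

section Correct

variable {α : Type u} [LinearOrder α] {E : Env α} {S : List α} {σ N : ℕ}
  {X rp lab dep par rad : ℕ → ℕ} {arm ch : ℕ → List ℕ}

/-- The run with rank `r`. -/
def runOf (E : Env α) (rp : ℕ → ℕ) (r : ℕ) : α × ℕ := (E.ltr (rp r), E.ex (rp r))

/-- The palindrome that is represented by a string of ranks. -/
def nodeOf (E : Env α) (rp : ℕ → ℕ) (a : List ℕ) : List α := expand (mirror (a.map (runOf E rp)))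

theorem map_inj_on {β : Type*} {f : ℕ → β} {σ : ℕ}
    (hf : ∀ r r', r < σ → r' < σ → f r = f r' → r = r') {a a' : List ℕ} (ha : ∀ r ∈ a, r < σ)
    (ha' : ∀ r ∈ a', r < σ) (h : a.map f = a'.map f) : a = a' := by
  induction a generalizing a' with
  | nil =>
    rw [List.map_nil, eq_comm, List.map_eq_nil_iff] at h
    exact h.symm
  | cons r a ih =>
    cases a' with
    | nil => simp at h
    | cons r' a' =>
      simp only [List.map_cons, List.cons.injEq] at h
      rw [hf r r' (ha r (by simp)) (ha' r' (by simp)) h.1,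
        ih (fun r hr => ha r (by simp [hr])) (fun r hr => ha' r (by simp [hr])) h.2]

namespace Ranks

theorem runOf_text (h : Ranks E σ rp X) {i : ℕ} (hi : i < E.m) :
    runOf E rp (X (i + 1)) = (E.ltr i, E.ex i) := h.key i hi

theorem runOf_lt (h : Ranks E σ rp X) {r r' : ℕ} (hr : r < r') (hr' : r' < σ) :
    RunLT (runOf E rp r) (runOf E rp r') := E.key_lt.1 (h.mono r r' hr hr')

theorem runOf_inj (h : Ranks E σ rp X) (r r' : ℕ) (hr : r < σ) (hr' : r' < σ)
    (he : runOf E rp r = runOf E rp r') : r = r' := by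
  rcases lt_trichotomy r r' with hlt | heq | hlt
  · exact absurd he (h.mono r r' hlt hr').ne
  · exact heq
  · exact absurd he.symm (h.mono r' r hlt hr).ne

theorem ex_lt (h : Ranks E σ rp X) {r r' : ℕ} (hr : r < r') (hr' : r' < σ)
    (hl : E.ltr (rp r) = E.ltr (rp r')) : E.ex (rp r) < E.ex (rp r') := by
  rcases h.runOf_lt hr hr' with hlt | hlt
  · exact absurd hl hlt.ne
  · exact hlt.2

/-- Among runs with the same letter ranks increase with exponents, so the smaller rank denotes the
common part of the two runs. This justifies the minimum in `pathOf`. -/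
theorem runOf_min (h : Ranks E σ rp X) {r r' : ℕ} (hr : r < σ) (hr' : r' < σ)
    (hl : E.ltr (rp r) = E.ltr (rp r')) :
    runOf E rp (min r r') = (E.ltr (rp r), min (E.ex (rp r)) (E.ex (rp r'))) := by
  rcases lt_trichotomy r r' with hlt | rfl | hlt
  · have := h.ex_lt hlt hr' hl
    rw [min_eq_left hlt.le, min_eq_left this.le, runOf]
  · simp [runOf]
  · have := h.ex_lt hlt hr hl.symm
    rw [min_eq_right hlt.le, min_eq_right this.le, runOf, hl]

theorem rp_text (h : Ranks E σ rp X) {c : ℕ} (h1 : 1 ≤ c) (h2 : c ≤ E.m) :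
    X c < σ ∧ E.ltr (rp (X c)) = E.ltr (c - 1) ∧ E.ex (rp (X c)) = E.ex (c - 1) := by
  have := h.runOf_text (i := c - 1) (by omega)
  rw [Nat.sub_add_cancel h1, runOf, Prod.mk.injEq] at this
  exact ⟨h.text.lt c h1 h2, this⟩

end Ranks

theorem pathOf_getElem?_lt {c D j : ℕ} (hj : j < D) : (pathOf E X c D)[j]? = some (X (c + j)) := by
  rw [pathOf, armOf, List.getElem?_append_left (by simpa using hj), List.getElem?_map,
    List.getElem?_range hj]
  rfl

theorem pathOf_getElem?_ge {c D j : ℕ} (hj : D ≤ j) : (pathOf E X c D)[j]? =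
    if j = D ∧ D < c ∧ c + D ≤ E.m ∧ E.ltr (c - D - 1) = E.ltr (c + D - 1) then
      some (min (X (c - D)) (X (c + D))) else none := by
  rw [pathOf, armOf, List.getElem?_append_right (by simpa using hj), List.length_map,
    List.length_range]
  obtain ⟨i, rfl⟩ := Nat.exists_eq_add_of_le hj
  rw [Nat.add_sub_cancel_left]
  split_ifs with h1 h2 h2
  · rw [show i = 0 by omega]
    rfl
  · rw [List.getElem?_eq_none]
    simp only [List.length_cons, List.length_nil]
    have : D + i ≠ D := fun h => h2 ⟨h, h1⟩
    omega
  · exact absurd h2.2 h1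
  · simp

theorem card_filter_Ico_one (m : ℕ) (p : ℕ → Prop) [DecidablePred p] :
    ((Finset.Ico 1 (m + 1)).filter p).card =
      ((Finset.range m).filter fun c => p (c + 1)).card := by
  rw [Finset.card_filter, Finset.card_filter, Finset.sum_Ico_eq_sum_range]
  simp [add_comm 1]

namespace Result

/-- The ranks of the runs of the arm of length `d + 1` around run `c`. -/
def ranksOf (X : ℕ → ℕ) (c d : ℕ) : List ℕ :=
  (List.range (d + 1)).map fun j => min (X (c + 1 - j)) (X (c + 1 + j))

/-- Center and length determine the arm: each of its runs is the smaller of the two runs at that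
distance. All pairs but the outermost agree, so the arm stays within the maximal palindrome,
possibly extended by one common part. -/
theorem cen_ranksOf (h : Result E σ N X rp lab dep par rad arm ch) {c d : ℕ} {w : List (α × ℕ)}
    (hw : w.length = d + 1) (hc : Cen E.m E.ltr E.ex c w) :
    w = (ranksOf X c d).map (runOf E rp) ∧ (∀ r ∈ ranksOf X c d, r < σ) ∧
      ranksOf X c d <+: pathOf E X (c + 1) (rad (c + 1)) := by
  have hr := h.ranks
  have hin : ∀ j ≤ d, j ≤ c ∧ c + j < E.m := fun j hj => by
    obtain ⟨h1, h2, -⟩ := hc j _ (List.getElem?_eq_getElem (by omega))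
    exact ⟨h1, h2⟩
  have hL : ∀ j ≤ d, X (c + 1 - j) < σ ∧ E.ltr (rp (X (c + 1 - j))) = E.ltr (c - j) ∧
      E.ex (rp (X (c + 1 - j))) = E.ex (c - j) := fun j hj => by
    have := hin j hj
    rw [show c - j = c + 1 - j - 1 by omega]
    exact hr.rp_text (by omega) (by omega)
  have hR : ∀ j ≤ d, X (c + 1 + j) < σ ∧ E.ltr (rp (X (c + 1 + j))) = E.ltr (c + j) ∧
      E.ex (rp (X (c + 1 + j))) = E.ex (c + j) := fun j hj => by
    have := hin j hj
    rw [show c + j = c + 1 + j - 1 by omega]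
    exact hr.rp_text (by omega) (by omega)
  have hltr : ∀ j ≤ d, E.ltr (c - j) = E.ltr (c + j) := fun j hj => by
    obtain ⟨-, -, h3, h4, -⟩ := hc j _ (List.getElem?_eq_getElem (by omega))
    exact h3.symm.trans h4
  have hpal : Pal X (c + 1) d := fun j hj => by
    obtain ⟨-, -, -, -, h5, -⟩ := hc j _ (List.getElem?_eq_getElem (by omega))
    have h6 := h5 (by omega)
    have h7 := hL j hj.le
    have h8 := hR j hj.le
    refine hr.runOf_inj _ _ h7.1 h8.1 ?_
    rw [runOf, runOf, h7.2.1, h7.2.2, h8.2.1, h8.2.2, hltr j hj.le, ← h6.1, ← h6.2]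
  have hcm : c + 1 ≤ E.m := by
    have := hin 0 (by omega)
    omega
  have hdr : d ≤ rad (c + 1) := by
    by_contra! hlt
    exact h.max (c + 1) (by omega) hcm (hpal.mono hlt)
  have hget : ∀ j ≤ d, (ranksOf X c d)[j]? = some (min (X (c + 1 - j)) (X (c + 1 + j))) := by
    intro j hj
    rw [ranksOf, List.getElem?_map, List.getElem?_range (by omega)]
    rfl
  have hlen : (ranksOf X c d).length = d + 1 := by simp [ranksOf]
  refine ⟨?_, ?_, ?_⟩
  · refine List.ext_getElem? fun j => ?_
    rcases lt_or_ge d j with hj | hj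
    · rw [List.getElem?_eq_none (by omega), List.getElem?_eq_none (by
        rw [List.length_map, hlen]
        omega)]
    · have h7 := hL j hj
      have h8 := hR j hj
      obtain ⟨-, -, h3, h4, h5, h6⟩ := hc j _ (List.getElem?_eq_getElem (by omega))
      rw [List.getElem?_map, hget j hj, Option.map_some, hr.runOf_min h7.1 h8.1
        (by rw [h7.2.1, h8.2.1, hltr j hj]), h7.2.1, h7.2.2, h8.2.2,
        List.getElem?_eq_getElem (by omega), ← h3]
      congr 1
      refine Prod.ext rfl ?_
      simp only
      rcases Nat.lt_or_ge (j + 1) w.length with hl | hl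
      · have := h5 hl
        omega
      · exact h6 (by omega)
  · intro r hr'
    simp only [ranksOf, List.mem_map, List.mem_range] at hr'
    obtain ⟨j, hj, rfl⟩ := hr'
    exact (min_le_left _ _).trans_lt (hL j (by omega)).1
  · rw [List.prefix_iff_getElem?]
    intro j hj
    rw [hlen] at hj
    rw [← List.getElem?_eq_getElem (by omega), hget j (by omega)]
    rcases Nat.lt_or_ge j (rad (c + 1)) with hjr | hjr
    · rw [pathOf_getElem?_lt hjr, h.pal (c + 1) (by omega) hcm j hjr, min_self]
    · obtain rfl : j = d := by omega
      have hjd : j = rad (c + 1) := by omega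
      have h1 := hin j le_rfl
      have h2 := hltr j le_rfl
      have h3 := h.rad_pos (c + 1) (by omega) hcm
      rw [pathOf_getElem?_ge hjr, ← hjd, if_pos]
      refine ⟨rfl, by omega, by omega, ?_⟩
      rw [show c + 1 - j - 1 = c - j by omega, show c + 1 + j - 1 = c + j by omega]
      exact h2

/-- This connects runs of `S` with the computed ranks. The index shifts by one because position `0`
of the text carries a mark. Beyond the maximal palindrome the path has at most one more entry, so
this entry can only be the last of the arm, where the minimum is allowed. -/
theorem cen_iff (h : Result E σ N X rp lab dep par rad arm ch) {c : ℕ} (hc : c < E.m)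
    {a : List ℕ} (ha : a ≠ []) (hσ : ∀ r ∈ a, r < σ) :
    Cen E.m E.ltr E.ex c (a.map (runOf E rp)) ↔ a <+: pathOf E X (c + 1) (rad (c + 1)) := by
  have hr := h.ranks
  constructor
  · intro hcen
    have := List.length_pos_iff.2 ha
    obtain ⟨h1, h2, h3⟩ := h.cen_ranksOf (d := a.length - 1)
      (by rw [List.length_map]; omega) hcen
    rwa [map_inj_on hr.runOf_inj hσ h2 h1]
  · intro hp j p hj
    rw [List.getElem?_map, Option.map_eq_some_iff] at hj
    obtain ⟨r, hjr, rfl⟩ := hj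
    have hjl := (List.getElem?_eq_some_iff.1 hjr).1
    have hpj : (pathOf E X (c + 1) (rad (c + 1)))[j]? = some r := by
      rw [List.prefix_iff_getElem?.1 hp j hjl, ← hjr, List.getElem?_eq_getElem hjl]
    have hb := hr.text.bound (by omega) hc (h.pal (c + 1) (by omega) hc)
    have hplus : c + j < E.m → X (c + 1 + j) < σ ∧ E.ltr (rp (X (c + 1 + j))) = E.ltr (c + j) ∧
        E.ex (rp (X (c + 1 + j))) = E.ex (c + j) := fun hcj => by
      rw [show c + j = c + 1 + j - 1 by omega]
      exact hr.rp_text (by omega) (by omega)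
    have hminus : j ≤ c → X (c + 1 - j) < σ ∧ E.ltr (rp (X (c + 1 - j))) = E.ltr (c - j) ∧
        E.ex (rp (X (c + 1 - j))) = E.ex (c - j) := fun hcj => by
      rw [show c - j = c + 1 - j - 1 by omega]
      exact hr.rp_text (by omega) (by omega)
    rw [List.length_map]
    rcases Nat.lt_or_ge j (rad (c + 1)) with hjD | hjD
    · rw [pathOf_getElem?_lt hjD, Option.some.injEq] at hpj
      have h1 := hplus (by omega)
      have h2 := hminus (by omega)
      rw [h.pal (c + 1) (by omega) hc j hjD] at h2
      subst hpj
      simp only [runOf]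
      refine ⟨by omega, by omega, h2.2.1, h1.2.1, fun _ => ⟨h2.2.2, h1.2.2⟩, fun _ => ?_⟩
      rw [← h2.2.2, ← h1.2.2, min_self]
    · rw [pathOf_getElem?_ge hjD] at hpj
      split_ifs at hpj with hcond
      obtain ⟨hjd, h3, h4, h5⟩ := hcond
      rw [← hjd] at h3 h4 h5 hpj
      rw [Option.some.injEq] at hpj
      rw [show c + 1 - j - 1 = c - j by omega, show c + 1 + j - 1 = c + j by omega] at h5
      have h1 := hplus (by omega)
      have h2 := hminus (by omega)
      have h6 : ¬ j + 1 < a.length := fun hl => by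
        have h7 := List.prefix_iff_getElem?.1 hp (j + 1) hl
        rw [pathOf_getElem?_ge (by omega), if_neg (by omega)] at h7
        simp at h7
      rw [← hpj, hr.runOf_min h2.1 h1.1 (by rw [h1.2.1, h2.2.1, h5])]
      simp only
      refine ⟨by omega, by omega, h2.2.1, by rw [h2.2.1, h5], fun hl => absurd hl h6, fun _ => ?_⟩
      rw [h1.2.2, h2.2.2]

theorem lt_of_mem_arm (h : Result E σ N X rp lab dep par rad arm ch) {v : ℕ} (hv : v < N) :
    ∀ r ∈ arm v, r < σ := by
  induction v using Nat.strong_induction_on with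
  | _ v ih =>
    intro r hr
    rcases Nat.eq_zero_or_pos v with rfl | h1
    · rw [h.trie.root] at hr
      simp at hr
    · have hp := h.trie.par_lt v h1 hv
      rw [h.trie.arm_eq v h1 hv, List.mem_append, List.mem_singleton] at hr
      rcases hr with hr | rfl
      · exact ih _ hp (by omega) r hr
      · exact h.trie.lab_lt v h1 hv

theorem exists_cen (h : Result E σ N X rp lab dep par rad arm ch) {v : ℕ} (h1 : 1 ≤ v)
    (hv : v < N) : ∃ c, Cen E.m E.ltr E.ex c ((arm v).map (runOf E rp)) := by
  obtain ⟨c, hc1, hc2, hp⟩ := h.sound v h1 hv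
  obtain ⟨c, rfl⟩ : ∃ k, c = k + 1 := ⟨c - 1, by omega⟩
  exact ⟨c, (h.cen_iff hc2 (h.trie.arm_ne_nil h1 hv) (h.lt_of_mem_arm hv)).2 hp⟩

theorem rle_nodeOf (h : Result E σ N X rp lab dep par rad arm ch)
    (hS : HasRuns S E.m E.ltr E.ex) {v : ℕ} (hv : v < N) :
    rle (nodeOf E rp (arm v)) = mirror ((arm v).map (runOf E rp)) := by
  rcases Nat.eq_zero_or_pos v with rfl | h1
  · rw [nodeOf, h.trie.root]
    rfl
  · obtain ⟨c, hc⟩ := h.exists_cen h1 hv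
    exact hS.rle_mirror hc

theorem map_arm_inj (h : Result E σ N X rp lab dep par rad arm ch) {v w : ℕ} (hv : v < N) (hw : w < N)
    (he : (arm v).map (runOf E rp) = (arm w).map (runOf E rp)) : v = w :=
  h.trie.inj v hv w hw
    (map_inj_on h.ranks.runOf_inj (h.lt_of_mem_arm hv) (h.lt_of_mem_arm hw) he)

theorem bijOn (h : Result E σ N X rp lab dep par rad arm ch) (hS : HasRuns S E.m E.ltr E.ex) :
    Set.BijOn (fun v => nodeOf E rp (arm v)) (Set.Iio N) (eertreeNodes S) := by
  have h0 : nodeOf E rp (arm 0) = [] := by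
    rw [nodeOf, h.trie.root]
    rfl
  refine ⟨fun v hv => ?_, fun v hv w hw he => ?_, fun P hP => ?_⟩
  · rw [hS.mem_eertreeNodes_iff]
    rcases Nat.eq_zero_or_pos v with rfl | h1
    · exact Or.inl h0
    · obtain ⟨c, hc⟩ := h.exists_cen h1 hv
      exact Or.inr ⟨c, _, by simpa using h.trie.arm_ne_nil h1 hv, hc, rfl⟩
  · refine h.map_arm_inj hv hw (mirror_inj ?_)
    rw [← h.rle_nodeOf hS hv, ← h.rle_nodeOf hS hw]
    exact congrArg rle he
  · have hN : 0 < N := lt_of_le_of_lt (Nat.zero_le _) h.trie.lt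
    rcases hS.mem_eertreeNodes_iff.1 hP with rfl | ⟨c, w, hw, hc, rfl⟩
    · exact ⟨0, hN, h0⟩
    · have := List.length_pos_iff.2 hw
      obtain ⟨h1, -, h3⟩ := h.cen_ranksOf (d := w.length - 1) (by omega) hc
      obtain ⟨-, h4, -⟩ := hc 0 _ (List.getElem?_eq_getElem this)
      obtain ⟨v, hv, hva⟩ := h.complete (c + 1) (by omega) (by omega)
      rw [← hva] at h3
      obtain ⟨u, hu, hua⟩ := h.trie.exists_prefix hv h3
      refine ⟨u, hu, ?_⟩
      simp only
      rw [nodeOf, hua, ← h1]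

open Classical in
theorem countOf_eq (h : Result E σ N X rp lab dep par rad arm ch) {a : List ℕ} (ha : a ≠ [])
    (hσ : ∀ r ∈ a, r < σ) : countOf E X rad a =
      ((Finset.range E.m).filter fun c => Cen E.m E.ltr E.ex c (a.map (runOf E rp))).card := by
  rw [countOf, card_filter_Ico_one]
  refine congrArg Finset.card (Finset.filter_congr fun c hc => ?_)
  exact (h.cen_iff (Finset.mem_range.1 hc) ha hσ).symm

theorem countOf_rank (h : Result E σ N X rp lab dep par rad arm ch) (r : ℕ) :
    countOf E X rad [r] = ((Finset.range E.m).filter fun k => X (k + 1) = r).card := by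
  rw [countOf_single h.rad_pos, card_filter_Ico_one]

/-- For longer arms both sides count centers. For a single run, longer runs with the same letter are
exactly the runs of larger rank with the same letter; exchanging sums over ranks and over runs gives
`totalOf`. -/
theorem occCount_nodeOf (h : Result E σ N X rp lab dep par rad arm ch)
    (hS : HasRuns S E.m E.ltr E.ex) {v : ℕ} (h1 : 1 ≤ v) (hv : v < N) :
    occCount S (nodeOf E rp (arm v)) = totalOf E σ X rp rad arm v := by
  have hr := h.ranks
  have hne := h.trie.arm_ne_nil h1 hv
  obtain ⟨c, hc⟩ := h.exists_cen h1 hv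
  rw [totalOf]
  by_cases hvσ : v ≤ σ
  · obtain ⟨r, rfl⟩ : ∃ r, v = r + 1 := ⟨v - 1, by omega⟩
    have hrσ : r < σ := by omega
    have ha := h.trie.single r hrσ
    have hexp : nodeOf E rp (arm (r + 1)) = List.replicate (E.ex (rp r)) (E.ltr (rp r)) := by
      rw [ha]
      simp [nodeOf, mirror, expand, runOf]
    rw [hexp, hS.occCount_single (hS.pos (hr.lt r hrσ)), if_pos hvσ, Nat.add_sub_cancel, ha]
    simp only [h.countOf_rank]
    have hk : ∀ k ∈ Finset.range E.m, X (k + 1) < σ ∧ E.ltr (rp (X (k + 1))) = E.ltr k ∧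
        E.ex (rp (X (k + 1))) = E.ex k := fun k hk => by
      rw [Finset.mem_range] at hk
      exact hr.rp_text (c := k + 1) (by omega) (by omega)
    refine congrArg₂ (· + ·) (congrArg Finset.card (Finset.filter_congr fun k hkm => ?_))
      (congrArg (2 * ·) ?_)
    · obtain ⟨k1, k2, k3⟩ := hk k hkm
      rw [← k2, ← k3]
      constructor
      · rintro ⟨g1, g2⟩
        exact hr.runOf_inj _ _ k1 hrσ (Prod.ext g1 g2)
      · rintro rfl
        exact ⟨rfl, rfl⟩
    · have hsum : ∀ r' ∈ Finset.Ico (r + 1) σ, (if E.ltr (rp r') = E.ltr (rp r) then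
          ((Finset.range E.m).filter fun k => X (k + 1) = r').card else 0) =
          ∑ k ∈ Finset.range E.m, if X (k + 1) = r' then
            (if E.ltr (rp r') = E.ltr (rp r) then 1 else 0) else 0 := by
        intro r' _
        split_ifs with hif
        · rw [Finset.card_filter]
        · simp
      rw [Finset.sum_congr rfl hsum, Finset.sum_comm, Finset.card_filter]
      refine Finset.sum_congr rfl fun k hkm => ?_
      obtain ⟨k1, k2, k3⟩ := hk k hkm
      rw [Finset.sum_ite_eq, ← ite_and, ← k2, ← k3]
      refine if_congr ?_ rfl rfl
      constructor
      · rintro ⟨g1, g2⟩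
        refine ⟨Finset.mem_Ico.2 ⟨?_, k1⟩, g1⟩
        by_contra! hlt
        rcases (show X (k + 1) ≤ r by omega).eq_or_lt with rfl | hlt'
        · omega
        · have := hr.ex_lt hlt' hrσ g1
          omega
      · rintro ⟨g1, g2⟩
        exact ⟨g2, hr.ex_lt (Finset.mem_Ico.1 g1).1 k1 g2.symm⟩
  · rw [if_neg hvσ, add_zero, h.countOf_eq hne (h.lt_of_mem_arm hv), nodeOf,
      hS.occCount_mirror (hS.isRuns_mirror hc)]
    rw [List.length_map]
    by_contra! hl
    obtain ⟨r, hr'⟩ : ∃ r, arm v = [r] := List.length_eq_one_iff.1 (by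
      have := List.length_pos_iff.2 hne
      omega)
    have hrσ := h.lt_of_mem_arm hv r (by simp [hr'])
    have hlt := h.trie.lt
    have := h.trie.inj v hv (r + 1) (by omega) (by rw [hr', h.trie.single r hrσ])
    omega

/-- Putting a run at both ends of a mirrored arm amounts to appending it to the arm, by
`mirror_append`, and mirroring is injective. The root is special because its arm has no center yet.
-/
theorem edge_iff (h : Result E σ N X rp lab dep par rad arm ch)
    (hS : HasRuns S E.m E.ltr E.ex) {i j : ℕ} (hi : i < N) (hj : j < N) {l : α × ℕ} :
    EertreeEdge S (nodeOf E rp (arm i)) l (nodeOf E rp (arm j)) ↔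
      1 ≤ j ∧ par j = i ∧ runOf E rp (lab j) = l := by
  have hb := h.bijOn hS
  have hchild : (arm j).map (runOf E rp) = (arm i).map (runOf E rp) ++ [l] ↔
      1 ≤ j ∧ par j = i ∧ runOf E rp (lab j) = l := by
    constructor
    · intro he
      have h1 : 1 ≤ j := by
        by_contra! h0
        obtain rfl : j = 0 := by omega
        rw [h.trie.root] at he
        simp at he
      rw [h.trie.arm_eq j h1 hj, List.map_append] at he
      obtain ⟨h2, h3⟩ := List.append_inj' he rfl
      have hp := h.trie.par_lt j h1 hj
      exact ⟨h1, h.map_arm_inj (by omega) hi h2, by simpa using h3⟩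
    · rintro ⟨h1, rfl, rfl⟩
      rw [h.trie.arm_eq j h1 hj, List.map_append]
      rfl
  have hi0 : nodeOf E rp (arm i) = [] ↔ arm i = [] := by
    constructor
    · intro h0
      have := h.rle_nodeOf hS hi
      rw [h0] at this
      by_contra hne
      exact mirror_ne_nil (by simpa using hne) this.symm
    · intro h0
      rw [h0]
      rfl
  rw [EertreeEdge, h.rle_nodeOf hS hi, h.rle_nodeOf hS hj, Ne, hi0, ← hchild]
  refine (and_iff_right (hb.1 hi)).trans ((and_iff_right (hb.1 hj)).trans ?_)
  by_cases ha : arm i = []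
  · simp only [ha, List.map_nil, List.nil_append, true_and, ne_eq, not_true_eq_false, false_and,
      or_false]
    exact ⟨fun he => mirror_inj he, fun he => by rw [he]; rfl⟩
  · simp only [ha, false_and, ne_eq, not_false_eq_true, true_and, false_or]
    rw [← mirror_append (by simpa using ha)]
    exact ⟨fun he => mirror_inj he, fun he => by rw [he]⟩

end Result

end Correct

/-! ### The complete program -/

section Complete

variable {α : Type u} [LinearOrder α]

/-- Compute the addresses of the arrays. -/
def setBases : ℕ → Prog
  | 0 => .move 1 2
  | f + 1 => .seq (setBases f) (.add (3 * f + 4) (3 * f + 1) 5)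

/-- Registers `2` and `5` receive `2 m` and `16 m`. Since the machine cannot multiply, the length of
the arrays is obtained by repeated doubling. -/
def setup : Prog :=
  .seq (.add 2 0 0) (.seq (.add 5 2 2) (.seq (.add 5 5 5) (.seq (.add 5 5 5) (setBases 31))))

/-- Replace the run numbers in the array of edges by letters. -/
def relabelLoop : Prog :=
  .loop (.lt 2 5) (.seq (.load 11 2) (.seq (.add 11 11 11) (.seq (.load 11 11)
    (.seq (.store 2 11) (.add 2 2 8)))))

/-- The array language stores numbers only, so up to here the edges contain run numbers. Register
`4` holds the address of the edges, and register `75` is the variable `ρe`. -/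
def relabel : Prog :=
  .seq (.move 2 4) (.seq (.add 5 75 75) (.seq (.add 5 5 75) (.seq (.add 5 5 2)
    (.seq (.const 8 3) relabelLoop))))

def program : Prog := .seq setup (.seq mainCm.comp relabel)

theorem setBases_exec {B W x L : ℕ} (n : ℕ) (hW : x + n * L < W) {s : State α}
    (h2 : s.reg 2 = .num x) (h5 : s.reg 5 = .num L) :
    ∃ s', Exec B W (setBases n) s (n + 1) s' ∧ s'.mem = s.mem ∧
      (∀ f ≤ n, s'.reg (3 * f + 1) = .num (x + f * L)) ∧
      ∀ r, (∀ f, r ≠ 3 * f + 1) → s'.reg r = s.reg r := by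
  induction n with
  | zero =>
    refine ⟨_, .move, rfl, fun f hf => ?_, fun r hr => ?_⟩
    · obtain rfl : f = 0 := by omega
      simp [State.setReg_reg, h2]
    · rw [State.setReg_reg, if_neg (hr 0)]
  | succ n ih =>
    have hn : (n + 1) * L = n * L + L := by ring
    obtain ⟨s₁, h3, h4, h6, h7⟩ := ih (by omega)
    refine ⟨_, .seq h3 (.add (h6 n le_rfl) ((h7 5 fun f => by omega).trans h5) (by omega)), h4,
      fun f hf => ?_, fun r hr => ?_⟩
    · rw [State.setReg_reg]
      rcases Nat.lt_or_ge n f with hnf | hnf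
      · obtain rfl : f = n + 1 := by omega
        rw [if_pos (by omega), hn, add_assoc]
      · rw [if_neg (by omega), h6 f hnf]
    · rw [State.setReg_reg, if_neg (by have := hr (n + 1); omega), h7 r hr]

/-- The initial values of the variables and arrays. -/
def St.init (m : ℕ) : St := ⟨fun r => if r = ρm then m else 0, fun _ _ => 0⟩

theorem setup_exec {E : Env α} {B : ℕ} (hE : E.Fits B) (hb : E.Big) {R : List (α × ℕ)}
    (hR : R = (List.range E.m).map fun k => (E.ltr k, E.ex k)) :
    ∃ σ, Exec B E.W setup (initState R) 36 σ ∧ Sim E (St.init E.m) σ := by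
  have hmem := hE.mem
  have hnum := hE.num
  have hL := hb.len
  have hpos := hb.pos
  have hlen : R.length = E.m := by simp [hR]
  have hW : 2 * E.m + 31 * E.L < E.W := by omega
  have h0 : (initState R).reg 0 = .num E.m := by simp [initState, hlen]
  let s₁ := (initState R).setReg 2 (.num (E.m + E.m))
  let s₂ := s₁.setReg 5 (.num (E.m + E.m + (E.m + E.m)))
  let s₃ := s₂.setReg 5 (.num (E.m + E.m + (E.m + E.m) + (E.m + E.m + (E.m + E.m))))
  let s₄ := s₃.setReg 5 (.num (E.m + E.m + (E.m + E.m) + (E.m + E.m + (E.m + E.m)) +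
    (E.m + E.m + (E.m + E.m) + (E.m + E.m + (E.m + E.m)))))
  have e1 : Exec B E.W (.add 2 0 0) (initState R) 1 s₁ := .add h0 h0 (by omega)
  have e2 : Exec B E.W (.add 5 2 2) s₁ 1 s₂ := .add (by simp [s₁, State.setReg_reg])
    (by simp [s₁, State.setReg_reg]) (by omega)
  have e3 : Exec B E.W (.add 5 5 5) s₂ 1 s₃ := .add (by simp [s₂, State.setReg_reg])
    (by simp [s₂, State.setReg_reg]) (by omega)
  have e4 : Exec B E.W (.add 5 5 5) s₃ 1 s₄ := .add (by simp [s₃, State.setReg_reg])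
    (by simp [s₃, State.setReg_reg]) (by omega)
  have r4 : ∀ r, r ≠ 2 → r ≠ 5 → s₄.reg r = (initState R).reg r := fun r h1 h2 => by
    simp [s₄, s₃, s₂, s₁, State.setReg_reg, h1, h2]
  obtain ⟨σ, e5, h1, h2, h3⟩ := setBases_exec (B := B) 31 hW (s := s₄)
    (by simp [s₄, s₃, s₂, s₁, State.setReg_reg]; omega)
    (by simp [s₄, State.setReg_reg]; omega)
  have hm : ∀ a, σ.mem a = (initState R).mem a := fun a => by rw [h1]; rfl
  refine ⟨σ, .seq e1 (.seq e2 (.seq e3 (.seq e4 e5))), ?_, fun f hf => h2 f (by omega), ?_, ?_, ?_⟩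
  · intro r
    rw [h3 _ fun f => by omega, r4 _ (by omega) (by omega)]
    simp only [initState, St.init, hlen]
    rcases Nat.eq_zero_or_pos r with rfl | hr
    · rfl
    · rw [if_neg (by omega), if_neg (by omega)]
  · intro f hf i hi
    rw [hm]
    simp only [initState]
    rw [List.getElem?_eq_none (by omega)]
    rfl
  · intro k hk
    have : R[2 * k / 2]? = some (E.ltr k, E.ex k) := by
      rw [Nat.mul_div_cancel_left k two_pos, hR, List.getElem?_map, List.getElem?_range hk]
      rfl
    rw [hm]
    simp only [initState, this]
    simp
  · intro k hk
    have : R[(2 * k + 1) / 2]? = some (E.ltr k, E.ex k) := by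
      rw [show (2 * k + 1) / 2 = k by omega, hR, List.getElem?_map, List.getElem?_range hk]
      rfl
    rw [hm]
    simp only [initState, this]
    simp

theorem relabelLoop_exec {B W m x n : ℕ} {ltr : ℕ → α} {j : ℕ → ℕ} (hm : 2 * m ≤ x)
    (hB : x + 3 * n ≤ B) (hW : x + 3 * n < W) (hj : ∀ p < n, j p < m) (q : ℕ) :
    ∀ p, p + q = n → ∀ s : State α, s.reg 2 = .num (x + 3 * p) → s.reg 5 = .num (x + 3 * n) →
      s.reg 8 = .num 3 → (∀ k < m, s.mem (2 * k) = .sym (ltr k)) →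
      (∀ k, p ≤ k → k < n → s.mem (x + 3 * k) = .num (j k)) →
      ∃ s', Exec B W relabelLoop s (6 * q + 1) s' ∧
        (∀ r, r ≠ 2 → r ≠ 11 → s'.reg r = s.reg r) ∧
        (∀ k, p ≤ k → k < n → s'.mem (x + 3 * k) = .sym (ltr (j k))) ∧
        ∀ a, (∀ k, p ≤ k → k < n → a ≠ x + 3 * k) → s'.mem a = s.mem a := by
  induction q with
  | zero =>
    intro p hp s h2 h5 h8 hl hmem
    refine ⟨s, .loopDone ?_, fun _ _ _ => rfl, fun k h1 h2 => by omega, fun _ _ => rfl⟩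
    simp only [Test.Holds, h2, h5, Word.LT]
    omega
  | succ q ih =>
    intro p hp s h2 h5 h8 hl hmem
    have hjp := hj p (by omega)
    let s₁ := s.setReg 11 (.num (j p))
    let s₂ := s₁.setReg 11 (.num (j p + j p))
    let s₃ := s₂.setReg 11 (.sym (ltr (j p)))
    let s₄ := s₃.setMem (x + 3 * p) (.sym (ltr (j p)))
    let s₅ := s₄.setReg 2 (.num (x + 3 * p + 3))
    have e1 : Exec B W (.load 11 2) s 1 s₁ := by
      have := Exec.load (B := B) (W := W) (r := 11) h2 (by omega)
      rwa [hmem p le_rfl (by omega)] at this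
    have e2 : Exec B W (.add 11 11 11) s₁ 1 s₂ := .add (by simp [s₁, State.setReg_reg])
      (by simp [s₁, State.setReg_reg]) (by omega)
    have e3 : Exec B W (.load 11 11) s₂ 1 s₃ := by
      have := Exec.load (B := B) (W := W) (s := s₂) (r := 11) (x := 11) (a := 2 * j p)
        (by simp [s₂, State.setReg_reg]; omega) (by omega)
      rwa [show s₂.mem (2 * j p) = .sym (ltr (j p)) from hl _ hjp] at this
    have e4 : Exec B W (.store 2 11) s₃ 1 s₄ := by
      have := Exec.store (B := B) (W := W) (s := s₃) (x := 2) (y := 11) (a := x + 3 * p)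
        (by simp [s₃, s₂, s₁, State.setReg_reg, h2]) (by omega)
      rwa [show s₃.reg 11 = .sym (ltr (j p)) by simp [s₃, State.setReg_reg]] at this
    have r4 : ∀ r, r ≠ 11 → s₄.reg r = s.reg r := fun r hr => by
      simp [s₄, s₃, s₂, s₁, State.setReg_reg, hr, State.setMem_reg]
    have e5 : Exec B W (.add 2 2 8) s₄ 1 s₅ := .add (by rw [r4 2 (by norm_num), h2])
      (by rw [r4 8 (by norm_num), h8]) (by omega)
    have m5 : ∀ a, s₅.mem a = if a = x + 3 * p then .sym (ltr (j p)) else s.mem a :=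
      State.setMem_mem _ _ _
    have r5 : ∀ r, r ≠ 2 → r ≠ 11 → s₅.reg r = s.reg r := fun r h1 h2 => by
      rw [← r4 r h2]
      simp [s₅, State.setReg_reg, h1]
    obtain ⟨s', e6, g1, g2, g3⟩ := ih (p + 1) (by omega) s₅
      (by simp [s₅, State.setReg_reg]; omega) (by rw [r5 5 (by norm_num) (by norm_num), h5])
      (by rw [r5 8 (by norm_num) (by norm_num), h8])
      (fun k hk => by rw [m5, if_neg (by omega), hl k hk])
      (fun k h1 h2 => by rw [m5, if_neg (by omega), hmem k (by omega) h2])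
    refine ⟨s', ?_, fun r h1 h2 => by rw [g1 r h1 h2, r5 r h1 h2], fun k h1 h3 => ?_,
      fun a ha => ?_⟩
    · have ht : (Test.lt 2 5).Holds s := by
        simp only [Test.Holds, h2, h5, Word.LT]
        omega
      have := Exec.loopStep ht (.seq e1 (.seq e2 (.seq e3 (.seq e4 e5)))) e6
      rwa [show 1 + (1 + (1 + (1 + 1))) + (6 * q + 1) + 1 = 6 * (q + 1) + 1 by ring] at this
    · rcases h1.eq_or_lt with rfl | h1
      · rw [g3 _ fun k h1 _ => by omega, m5, if_pos rfl]
      · exact g2 k h1 h3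
    · rw [g3 a fun k h1 h2 => ha k (by omega) h2, m5, if_neg (ha p le_rfl (by omega))]

theorem relabel_exec {E : Env α} {B : ℕ} (hE : E.Fits B) (hb : E.Big) {s : St} {σ : State α}
    (hs : Sim E s σ) (hn : 3 * s.v ρe ≤ E.L) (hj : ∀ p < s.v ρe, s.A φed (3 * p) < E.m) :
    ∃ σ', Exec B E.W relabel σ (6 * s.v ρe + 6) σ' ∧ σ'.reg 0 = σ.reg 0 ∧ σ'.reg 1 = σ.reg 1 ∧
      (∀ p < s.v ρe, σ'.mem (2 * E.m + φed * E.L + 3 * p) = .sym (E.ltr (s.A φed (3 * p)))) ∧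
      ∀ a, (∀ p < s.v ρe, a ≠ 2 * E.m + φed * E.L + 3 * p) → σ'.mem a = σ.mem a := by
  set n := s.v ρe with hne
  set x := 2 * E.m + φed * E.L with hx
  have hmem := hE.mem
  have hnum := hE.num
  have hL := hb.len
  have hpos := hb.pos
  have h4 : σ.reg 4 = .num x := hs.base 1 (by norm_num)
  have h75 : σ.reg 75 = .num n := hs.var 25
  let s₁ := σ.setReg 2 (.num x)
  let s₂ := s₁.setReg 5 (.num (n + n))
  let s₃ := s₂.setReg 5 (.num (n + n + n))
  let s₄ := s₃.setReg 5 (.num (n + n + n + x))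
  let s₅ := s₄.setReg 8 (.num 3)
  have e1 : Exec B E.W (.move 2 4) σ 1 s₁ := by
    have := Exec.move (B := B) (W := E.W) (s := σ) (r := 2) (x := 4)
    rwa [h4] at this
  have e2 : Exec B E.W (.add 5 75 75) s₁ 1 s₂ := .add (by simp [s₁, State.setReg_reg, h75])
    (by simp [s₁, State.setReg_reg, h75]) (by omega)
  have e3 : Exec B E.W (.add 5 5 75) s₂ 1 s₃ := .add (by simp [s₂, State.setReg_reg])
    (by simp [s₂, s₁, State.setReg_reg, h75]) (by omega)
  have e4 : Exec B E.W (.add 5 5 2) s₃ 1 s₄ := .add (by simp [s₃, State.setReg_reg])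
    (by simp [s₃, s₂, s₁, State.setReg_reg]) (by omega)
  have e5 : Exec B E.W (.const 8 3) s₄ 1 s₅ := .const (by omega)
  have r5 : ∀ r, r ≠ 2 → r ≠ 5 → r ≠ 8 → s₅.reg r = σ.reg r := fun r h1 h2 h3 => by
    simp [s₅, s₄, s₃, s₂, s₁, State.setReg_reg, h1, h2, h3]
  obtain ⟨σ', e6, h1, h2, h3⟩ := relabelLoop_exec (B := B) (W := E.W) (m := E.m) (x := x) (n := n)
    (ltr := E.ltr) (j := fun p => s.A φed (3 * p)) (by omega) (by omega) (by omega) hj n 0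
    (by omega) s₅ (by simp [s₅, s₄, s₃, s₂, s₁, State.setReg_reg])
    (by simp [s₅, s₄, State.setReg_reg]; omega) (by simp [s₅, State.setReg_reg]) hs.ltr
    (fun k _ hk => hs.arr 1 (by norm_num) (3 * k) (by omega))
  refine ⟨σ', ?_, ?_, ?_, fun p hp => h2 p (Nat.zero_le _) hp,
    fun a ha => h3 a fun k _ hk => ha k hk⟩
  · have := Exec.seq e1 (.seq e2 (.seq e3 (.seq e4 (.seq e5 e6))))
    rwa [show 1 + (1 + (1 + (1 + (1 + (6 * n + 1))))) = 6 * n + 6 by ring] at this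
  · rw [h1 0 (by norm_num) (by norm_num), r5 0 (by norm_num) (by norm_num) (by norm_num)]
  · rw [h1 1 (by norm_num) (by norm_num), r5 1 (by norm_num) (by norm_num) (by norm_num)]

/-- The data structure that is in memory at the end is the RLE-eertree. -/
theorem storesEertree {E : Env α} {B σ : ℕ} {S : List α} {s : St} {τ τ' : State α}
    (hE : E.Fits B) (hb : E.Big) (hS : HasRuns S E.m E.ltr E.ex) (hs : Sim E s τ)
    {X rp lab dep par rad : ℕ → ℕ} {arm ch : ℕ → List ℕ}
    (hr : Result E σ (s.v ρm) X rp lab dep par rad arm ch) (he : s.v ρe ≤ s.v ρm)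
    (hrec : ∀ i < s.v ρm, ∃ off, off + (ch i).length ≤ s.v ρe ∧
      (1 ≤ i → s.A φrec (3 * i) = totalOf E σ X rp rad arm i) ∧
      s.A φrec (3 * i + 1) = 2 * E.m + φed * E.L + 3 * off ∧
      s.A φrec (3 * i + 2) = (ch i).length ∧
      ∀ k x, (ch i)[k]? = some x → s.A φed (3 * (off + k)) = rp (lab x) ∧
        s.A φed (3 * (off + k) + 1) = E.ex (rp (lab x)) ∧
        s.A φed (3 * (off + k) + 2) = x)
    (h0 : τ'.reg 0 = τ.reg 0) (h1 : τ'.reg 1 = τ.reg 1)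
    (h2 : ∀ p < s.v ρe,
      τ'.mem (2 * E.m + φed * E.L + 3 * p) = .sym (E.ltr (s.A φed (3 * p))))
    (h3 : ∀ a, (∀ p < s.v ρe, a ≠ 2 * E.m + φed * E.L + 3 * p) → τ'.mem a = τ.mem a) :
    StoresEertree B S τ' := by
  have hmem := hE.mem
  have hL := hb.len
  have hpos := hb.pos
  have hN := hr.le
  have hmrec : ∀ i < E.L, τ'.mem (2 * E.m + i) = .num (s.A φrec i) := fun i hi => by
    rw [h3 _ fun p hp => by omega]
    simpa using hs.arr 0 (by norm_num) i hi
  have hmed : ∀ p < s.v ρe, ∀ q, 1 ≤ q → q ≤ 2 →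
      τ'.mem (2 * E.m + φed * E.L + 3 * p + q) = .num (s.A φed (3 * p + q)) :=
    fun p hp q hq1 hq2 => by
      rw [h3 _ fun p' hp' => by omega, add_assoc (2 * E.m + φed * E.L)]
      exact hs.arr 1 (by norm_num) _ (by omega)
  refine ⟨s.v ρm, 2 * E.m, fun v => nodeOf E rp (arm v), by rw [h0]; exact hs.var 0, ?_,
    by omega, hr.bijOn hS, by simp [nodeOf, hr.trie.root, mirror, expand], fun i hi => ?_⟩
  · rw [h1]
    simpa using hs.base 0 (by norm_num)
  obtain ⟨off, g1, g2, g3, g4, g5⟩ := hrec i hi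
  refine ⟨2 * E.m + φed * E.L + 3 * off, (ch i).map fun x => (runOf E rp (lab x), x),
    fun hi0 => ?_, ?_, ?_, ?_, ?_, ?_, fun l j => ?_⟩
  · rw [hmrec _ (by omega), g2 (by omega), hr.occCount_nodeOf hS (by omega) hi]
  · rw [add_assoc, hmrec _ (by omega), g3]
  · rw [add_assoc, hmrec _ (by omega), g4, List.length_map]
  · rw [List.length_map]
    omega
  · intro k c e x hk
    rw [List.getElem?_map, Option.map_eq_some_iff] at hk
    obtain ⟨y, hy, hye⟩ := hk
    simp only [runOf, Prod.mk.injEq] at hye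
    obtain ⟨⟨rfl, rfl⟩, rfl⟩ := hye
    have hkl := (List.getElem?_eq_some_iff.1 hy).1
    obtain ⟨k1, k2, k3⟩ := g5 k y hy
    rw [show 2 * E.m + φed * E.L + 3 * off + 3 * k = 2 * E.m + φed * E.L + 3 * (off + k) by ring]
    refine ⟨?_, ?_, ?_⟩
    · rw [h2 _ (by omega), k1]
    · rw [hmed _ (by omega) 1 le_rfl (by norm_num), k2]
    · rw [hmed _ (by omega) 2 (by norm_num) le_rfl, k3]
  · rw [List.pairwise_map]
    refine (hr.sorted i).imp_of_mem fun {x y} hx hy hxy => ?_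
    obtain ⟨m1, m2, -⟩ := (hr.mem i y).1 hy
    exact hr.ranks.runOf_lt hxy (hr.trie.lab_lt y m1 m2)
  · simp only [List.mem_map, Prod.mk.injEq]
    constructor
    · rintro ⟨x, hx, rfl, rfl⟩
      obtain ⟨m1, m2, m3⟩ := (hr.mem i x).1 hx
      exact ⟨m2, (hr.edge_iff hS hi m2).2 ⟨m1, m3, rfl⟩⟩
    · rintro ⟨hj, hedge⟩
      obtain ⟨m1, m2, m3⟩ := (hr.edge_iff hS hi hj).1 hedge
      exact ⟨j, (hr.mem i j).2 ⟨m1, hj, m2⟩, m3, rfl⟩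

/-- Rounding up costs less than one, and with the extra `1` this is at most twice the maximum, which
is at least one. -/
theorem clog_le (σ : ℕ) : (Nat.clog 2 σ : ℝ) + 1 ≤ 3 * max 1 (Real.logb 2 σ) := by
  have h1 := le_max_left 1 (Real.logb 2 σ)
  have h2 := le_max_right 1 (Real.logb 2 σ)
  have h3 : (Nat.clog 2 σ : ℝ) < max 1 (Real.logb 2 σ) + 1 := by
    have h4 := Real.natCeil_logb_natCast 2 σ
    rw [Nat.cast_ofNat] at h4
    rw [← h4]
    exact (Nat.cast_le.2 (Nat.ceil_mono h2)).trans_lt (Nat.ceil_lt_add_one (by linarith))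
  linarith

theorem card_rleAlphabet {E : Env α} {S : List α} (hS : HasRuns S E.m E.ltr E.ex) :
    ((Finset.range E.m).image E.key).card = (rleAlphabet S).card := by
  have h1 : rleAlphabet S = (Finset.range E.m).image fun k => (E.ltr k, E.ex k) := by
    ext p
    rw [rleAlphabet, hS]
    simp
  have h2 : (Finset.range E.m).image E.key =
      ((Finset.range E.m).image fun k => (E.ltr k, E.ex k)).image toLex := by
    rw [Finset.image_image]
    rfl
  rw [h1, h2, Finset.card_image_of_injective _ toLex.injective]

theorem exists_hasRuns {S : List α} (hS : S ≠ []) :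
    ∃ ltr ex, HasRuns S (rle S).length ltr ex := by
  -- A letter is needed as a default value for indices beyond the last run; it plays no role below
  -- `m`.
  obtain ⟨a, -⟩ := List.exists_mem_of_ne_nil S hS
  refine ⟨fun k => ((rle S).getD k (a, 0)).1, fun k => ((rle S).getD k (a, 0)).2, ?_⟩
  refine List.ext_getElem (by simp) fun k h1 h2 => ?_
  simp [List.getD_eq_getElem?_getD, h1]

theorem length_rle_le (S : List α) : (rle S).length ≤ S.length := by
  conv_rhs => rw [← expand_rle S, length_expand]
  have := List.length_le_sum_of_one_le ((rle S).map Prod.snd) fun e he => by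
    obtain ⟨p, hp, rfl⟩ := List.mem_map.1 he
    exact (isRuns_rle S).1 p hp
  rwa [List.length_map] at this

end Complete

end RLEString

theorem mainTheorem5 :
    ∃ (P : RLEString.Prog) (C : ℕ), ∀ (α : Type u) [LinearOrder α] (S : List α), S ≠ [] →
      ∃ (t : ℕ) (s : RLEString.State α),
        RLEString.Exec (C * (RLEString.rle S).length) (C * S.length) P
          (RLEString.initState (RLEString.rle S)) t s ∧
        (t : ℝ) ≤ C * ((RLEString.rle S).length *
          max 1 (Real.logb 2 ((RLEString.rleAlphabet S).card : ℝ))) ∧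
        RLEString.StoresEertree (C * (RLEString.rle S).length) S s := by
  -- The time needs `3 * 4000 + 66`, where the factor `3` comes from `clog_le`. Memory needs only `2
  -- + 32 * 16 = 514` cells per run.
  refine ⟨RLEString.program, 13000, fun α _ S hne => ?_⟩
  obtain ⟨ltr, ex, hS⟩ := RLEString.exists_hasRuns hne
  have hmn := RLEString.length_rle_le S
  have hpos : 1 ≤ (RLEString.rle S).length := by
    refine List.length_pos_iff.2 fun h => hne ?_
    rw [← RLEString.expand_rle S, h]
    rfl
  generalize hm : (RLEString.rle S).length = m at *
  let E : RLEString.Env α := ⟨m, 16 * m, 13000 * S.length, ltr, ex⟩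
  have hb : E.Big := ⟨hpos, rfl, by simp only [E]; omega⟩
  have hE : E.Fits (13000 * m) :=
    ⟨by simp only [E]; omega, by simp only [E]; omega, by simp only [E]; omega⟩
  obtain ⟨σ₁, e1, s1⟩ := RLEString.setup_exec hE hb (R := RLEString.rle S) hS
  set k := (RLEString.rleAlphabet S).card with hk
  obtain ⟨t, s, hrun, ⟨X, rp, lab, dep, par, rad, arm, ch, hr, he, hj, hrec⟩, ht⟩ :=
    RLEString.mainCm_spec (s := RLEString.St.init m) (l := Nat.clog 2 k) hb rfl (fun _ _ => rfl)
      (RLEString.card_rleAlphabet (E := E) hS) (Nat.le_pow_clog (by norm_num) k)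
  obtain ⟨σ₂, e2, s2⟩ := hrun.exec hE s1
  have hN := hr.le
  have hEm : E.m = m := rfl
  have hEL : E.L = 16 * m := rfl
  obtain ⟨σ₃, e3, h0, h1, h2, h3⟩ := RLEString.relabel_exec hE hb s2 (by omega) hj
  refine ⟨_, σ₃, .seq e1 (.seq e2 e3), ?_,
    RLEString.storesEertree hE hb hS s2 hr he hrec h0 h1 h2 h3⟩
  have hl := RLEString.clog_le k
  -- Setup takes `36` steps and relabeling `6` per edge and `6` more. There are at most `3 * m + 1`
  -- edges and `m` is positive, so this is at most `66 * m`.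
  have h4 : 36 + (t + (6 * s.v 25 + 6)) ≤ 4000 * (m * (Nat.clog 2 k + 1)) + 66 * m := by
    rw [hEm] at ht
    omega
  have h5 : ((36 + (t + (6 * s.v 25 + 6)) : ℕ) : ℝ) ≤
      4000 * (m * ((Nat.clog 2 k : ℝ) + 1)) + 66 * m := by exact_mod_cast h4
  refine h5.trans ?_
  have h6 : (m : ℝ) * ((Nat.clog 2 k : ℝ) + 1) ≤ m * (3 * max 1 (Real.logb 2 k)) :=
    mul_le_mul_of_nonneg_left hl (Nat.cast_nonneg m)
  have h7 : (m : ℝ) * 1 ≤ m * max 1 (Real.logb 2 k) :=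
    mul_le_mul_of_nonneg_left (le_max_left _ _) (Nat.cast_nonneg m)
  push_cast
  linarith
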